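/- **Setting.** Let $d\ge 2$, $M\ge 1$, $N\ge M+1$ and $0<\epsilon_2<\dots<\epsilon_{M+1}$. For positions $x_1,\dots,x_k\in\mathbb R^d$ put $d_k(x_1,\dots,x_k)=\big(\sum_{i<j}|x_i-x_j|^2\big)^{1/2}$. The phase space $\mathcal D_m\subset\mathbb R^{2dm}$ of $m$ particles is the set of all $Z_m=(X_m,V_m)$ with $d_k(x_{i_1},\dots,x_{i_k})\ge\epsilon_k$ for all $2\le k\le M+1$ and $i_1<\dots<i_k$. The particles move freely until $d_k=\epsilon_k$ for some $k$ particles; then the velocities of these particles change according to $v_i\mapsto v_i^*=v_i+c\sum_j\frac{x_j-x_i}{\epsilon_k}$, where $c=\frac2k\sum_{i<j}\langle v_i-v_j,\frac{x_i-x_j}{\epsilon_k}\rangle$. For almost every $Z_m\in\mathcal D_m$ all collisions met in the past and in the future are simple (only one tuple of one order collides), non-grazing, and without accumulation in time; $\Psi^t_m$ denotes the resulting flow (at the collision time itself it takes the incoming state), and $T^t_mg=g\circ\Psi^{-t}_m$ on $\mathcal D_m$, $T^t_mg=0$ outside. For $1\le\ell\le M$ let $\mathbb E=\{\omega\in\mathbb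 R^{\ell d}:\sum_i|\omega_i|^2+\sum_{i<j}|\omega_i-\omega_j|^2=1\}$, with surface measure $d\omega$, let $b(\omega,\nu)=\sum_i\langle\omega_i,\nu_i\rangle+\sum_{i<j}\langle\omega_i-\omega_j,\nu_i-\nu_j\rangle$ and $b_+=\max(b,0)$, and define $$\mathcal C^N_{s,s+\ell}g(Z_s)=\epsilon_{\ell+1}^{\ell d-1}\binom{N-s}{\ell}\sum_{i=1}^s\int_{\mathbb E\times\mathbb R^{\ell d}}b_+(\omega,v_{s+1}-v_i,\dots,v_{s+\ell}-v_i)\,\big[g(Z^{i,*})-g(Z^{i})\big]\,d\omega\,dv_{s+1}\cdots dv_{s+\ell},$$ with factor $0$ if $s+\ell>N$. Here $Z^i$ arises from $Z_s$ by adding $\ell$ particles at $x_i-\epsilon_{\ell+1}\omega_j$ with velocities $v_{s+j}$, and $Z^{i,*}$ by adding them at $x_i+\epsilon_{\ell+1}\omega_j$ and replacing $v_i,v_{s+1},\dots,v_{s+\ell}$ by the velocities after the collision of these $\ell+1$ particles. Put $\mathcal T^tG=(T^t_sg_s)_{s\ge1}$, $\mathcal C_N^{\ell+1}G=(\mathcal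 C^N_{s,s+\ell}g_{s+\ell})_{s\ge1}$ and $\mathcal C_N=\sum_{\ell=1}^M\mathcal C_N^{\ell+1}$. For $\beta>0$, $\mu\in\mathbb R$ let $X_{N,\beta,\mu}$ be the space of sequences $G=(g_s)_{s\ge1}$ of $g_s\in L^\infty(\mathbb R^{2ds})$ that vanish outside $\mathcal D_s$, with $g_s=0$ for $s>N$ and $$\|G\|_{N,\beta,\mu}=\sup_{s\ge 1}e^{\mu s}\,\operatorname*{ess\,sup}_{Z_s}|g_s(Z_s)|\,e^{\frac\beta2\sum_i|v_i|^2}<\infty .$$ For decreasing $\boldsymbol\beta,\boldsymbol\mu:[0,T]\to\mathbb R$ with $\boldsymbol\beta(T)>0$, let $\boldsymbol X_{N,\boldsymbol\beta,\boldsymbol\mu}$ be the space of $\boldsymbol G$ with $\boldsymbol G(t)\in X_{N,\boldsymbol\beta(t),\boldsymbol\mu(t)}$ for $t\in[0,T]$, with $|||\boldsymbol G|||=\sup_{t\in[0,T]}\|\boldsymbol G(t)\|_{N,\boldsymbol\beta(t),\boldsymbol\mu(t)}<\infty$, and such that $t\mapsto\mathcal T^{-t}\boldsymbol G(t)$ is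 continuous, i.e. $\|\mathcal T^{-t}\boldsymbol G(t)-\mathcal T^{-t_0}\boldsymbol G(t_0)\|_{N,\boldsymbol\beta(t\vee t_0),\boldsymbol\mu(t\vee t_0)}\to0$ as $t\to t_0$, for every $t_0\in[0,T]$. Such a $\boldsymbol G$ has a representative that is zero everywhere outside $\mathcal D_s$ and continuous in $t$ along $(t,\Psi_s^tZ_s)$ for almost every $Z_s\in\mathcal D_s$; the values that enter $\mathcal C^N_{s,s+\ell}\boldsymbol G(\tau)$ are those of such a representative. A mild solution of the BBGKY hierarchy on $[0,T]$ with initial datum $F_{N,0}$ is a $\boldsymbol G\in\boldsymbol X_{N,\boldsymbol\beta,\boldsymbol\mu}$ with $\boldsymbol G(t)=\mathcal T^tF_{N,0}+\int_0^t\mathcal T^{t-\tau}\mathcal C_N\boldsymbol G(\tau)\,d\tau$ for all $t\in[0,T]$. **Theorem.** Let $d\ge2$, $\beta_0>0$ and $K>0$. There is a constant $C=C(d,\beta_0,K)>0$ such that for every $\mu_0\in\mathbb R$ the following holds with the time $$T=\frac{1}{2\tilde C}>0,\qquad \tilde C=(e-1)\,C\,\max\big\{2^\ell\ell^3e^{\ell(|\mu_0|+\beta_0/2)}:\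 \ell\in\mathbb N,\ 2^\ell\ell^3e^{\ell(|\mu_0|+\beta_0/2)}>\ell!\big\},$$ and the weights $\boldsymbol\beta(t)=\beta_0-\frac{\beta_0}{2T}t$, $\boldsymbol\mu(t)=\mu_0-\frac{\beta_0}{2T}t$, for all $M\ge1$, $N\ge M+1$ and $0<\epsilon_2<\dots<\epsilon_{M+1}$ with $N\epsilon_{\ell+1}^{d-1/\ell}\le K$ for $1\le\ell\le M$. 1. For every $F_{N,0}\in X_{N,\beta_0,\mu_0}$ there is a unique mild solution $\boldsymbol F_N\in\boldsymbol X_{N,\boldsymbol\beta,\boldsymbol\mu}$ of the BBGKY hierarchy on $[0,T]$ with initial datum $F_{N,0}$, and $|||\boldsymbol F_N|||_{N,\boldsymbol\beta,\boldsymbol\mu}\le2\,\|F_{N,0}\|_{N,\beta_0,\mu_0}$. 2. For every $1\le\ell\le M$ and $\boldsymbol G_N\in\boldsymbol X_{N,\boldsymbol\beta,\boldsymbol\mu}$ the integrals that define $\int_0^t\mathcal T^{t-\tau}\mathcal C_N^{\ell+1}\boldsymbol G_N(\tau)\,d\tau$ converge absolutely almost everywhere, and for all measurable sets $\mathcal F(t)\subseteq[0,t]$,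 $t\in[0,T]$, $$\Big|\Big|\Big|\int_{\mathcal F(t)}\mathcal T^{t-\tau}\mathcal C_N^{\ell+1}\boldsymbol G_N(\tau)\,d\tau\Big|\Big|\Big|_{N,\boldsymbol\beta,\boldsymbol\mu}\le\frac{1}{2(e-1)\,\ell!}\,|||\boldsymbol G_N|||_{N,\boldsymbol\beta,\boldsymbol\mu}.$$ -/

import Mathlib

open MeasureTheory Set Filter Topology
open scoped ENNReal Nat

namespace BBGKY

noncomputable section

/-! ### Configurations, interaction zones and the collisional law

Throughout, `d` is the space dimension, `M + 1` is the highest order of a collision, and `ε k` is the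
interaction zone of the collisions of order `k`, for `2 ≤ k ≤ M + 1` (the other values of `ε` are
never used). A tuple `i₁ < ⋯ < i_k` of particles is a finite set `I` of `k` indices. -/

/-- The physical space `ℝ^d`, with its Euclidean norm. -/
abbrev Space (d : ℕ) : Type := EuclideanSpace ℝ (Fin d)

/-- States `Z = (X, V)` of `m` particles: positions and velocities. -/
abbrev Phase (d m : ℕ) : Type := (Fin m → Space d) × (Fin m → Space d)

/-- Kinetic energy `E_m(Z) = ½ ∑ |v_i|²`. -/
def kineticEnergy {d m : ℕ} (Z : Phase d m) : ℝ := (1 / 2) * ∑ i, ‖Z.2 i‖ ^ 2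

/-- `∑_{i < j} ⟨x_i - x_j, v_i - v_j⟩`. -/
def pairing {d : ℕ} {κ : Type} [Fintype κ] [LinearOrder κ] (x v : κ → Space d) : ℝ :=
  ∑ i, ∑ j, if i < j then inner ℝ (x i - x j) (v i - v j) else 0

/-- The symmetric collisional law for particles with scaled positions `u` (that is, positions divided
by the interaction zone) and velocities `v`:
`v_i* = v_i + C ∑_j (u_j - u_i)`, with `C = 2 / (number of particles) ∑_{i<j} ⟨v_i - v_j, u_i - u_j⟩`. -/
def scatter {d : ℕ} {κ : Type} [Fintype κ] [LinearOrder κ] (u v : κ → Space d) : κ → Space d :=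
  fun i => v i + ((2 / (Fintype.card κ : ℝ)) * pairing u v) • ∑ j, (u j - u i)

/-- The symmetric distance `(∑_{i < j} |x_i - x_j|²)^{1/2}` of the particles in `I`. -/
def tupleDist {d m : ℕ} (X : Fin m → Space d) (I : Finset (Fin m)) : ℝ :=
  √(∑ i : I, ∑ j : I, if i < j then ‖X i - X j‖ ^ 2 else 0)

/-- `I` is a set of particles that can collide: it has between `2` and `M + 1` elements. -/
def Collidable (M : ℕ) {m : ℕ} (I : Finset (Fin m)) : Prop := 2 ≤ I.card ∧ I.card ≤ M + 1

/-- The phase space `𝒟_m`: all symmetric distances are at least the interaction zone. -/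
def phaseSpace (M : ℕ) (ε : ℕ → ℝ) (d m : ℕ) : Set (Phase d m) :=
  {Z | ∀ I : Finset (Fin m), Collidable M I → ε I.card ≤ tupleDist Z.1 I}

/-- The interior of the phase space: no collision takes place. -/
def phaseInterior (M : ℕ) (ε : ℕ → ℝ) (d m : ℕ) : Set (Phase d m) :=
  {Z | ∀ I : Finset (Fin m), Collidable M I → ε I.card < tupleDist Z.1 I}

/-- `Z` is a simple collision of the particles in `I`: these collide, and no other tuple of any
order does. -/
def SimpleCollision (M : ℕ) (ε : ℕ → ℝ) {d m : ℕ} (Z : Phase d m) (I : Finset (Fin m)) : Prop :=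
  Z ∈ phaseSpace M ε d m ∧ Collidable M I ∧ tupleDist Z.1 I = ε I.card ∧
    ∀ J : Finset (Fin m), Collidable M J → J ≠ I → tupleDist Z.1 J ≠ ε J.card

/-- The velocities of the particles in `I` are incoming, `b < 0`. (The positive factor `1 / ε` of the
scaled positions does not change the sign.) -/
def Precollisional {d m : ℕ} (Z : Phase d m) (I : Finset (Fin m)) : Prop :=
  pairing (fun i : I => Z.1 i) (fun i : I => Z.2 i) < 0

open Classical in
/-- The state `Z*` after the collision of the particles in `I`. -/
def collide (ε : ℕ → ℝ) {d m : ℕ} (I : Finset (Fin m)) (Z : Phase d m) : Phase d m :=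
  (Z.1, fun i =>
    if h : i ∈ I then
      scatter (fun j : I => (ε I.card)⁻¹ • Z.1 j) (fun j : I => Z.2 j) ⟨i, h⟩
    else Z.2 i)

/-! ### The interaction flow -/

/-- Free transport `Φ^t (X, V) = (X + t V, V)`. -/
def freeFlow {d m : ℕ} (t : ℝ) (Z : Phase d m) : Phase d m := (fun i => Z.1 i + t • Z.2 i, Z.2)

/-- `Z'` is the state from which the particles move on freely, when they have arrived at the state `Z`:
`Z' = Z` in the interior, and `Z' = Z*` at a simple precollisional `Z`. There is no such `Z'` at a
multiple or a grazing collision. -/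
def Outgoing (M : ℕ) (ε : ℕ → ℝ) {d m : ℕ} (Z Z' : Phase d m) : Prop :=
  (Z ∈ phaseInterior M ε d m ∧ Z' = Z) ∨
    ∃ I : Finset (Fin m), SimpleCollision M ε Z I ∧ Precollisional Z I ∧ Z' = collide ε I Z

/-- Global trajectories of the particle system. Around each time the motion is free before and free
after that time, with the collisional law between. All collisions are simple and non-grazing, and they
cannot accumulate, since each time has a punctured neighbourhood on which the motion is free. At a
collision time, `γ` takes the incoming value. -/
def IsTrajectory (M : ℕ) (ε : ℕ → ℝ) {d m : ℕ} (γ : ℝ → Phase d m) : Prop :=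
  ∀ t : ℝ, ∃ Z' : Phase d m, Outgoing M ε (γ t) Z' ∧ ∃ δ > 0, ∀ h ∈ Ioc (0 : ℝ) δ,
    γ (t - h) = freeFlow (-h) (γ t) ∧ γ (t + h) = freeFlow h Z'

open Classical in
/-- The interaction flow `Ψ^t_m`: follow the trajectory that passes through `Z` at time `0`, with `Z` as
incoming or as outgoing state. States without a global trajectory (a null set of the phase space)
are left where they are. -/
def flow (M : ℕ) (ε : ℕ → ℝ) {d m : ℕ} (t : ℝ) (Z : Phase d m) : Phase d m :=
  if h : ∃ γ : ℝ → Phase d m, IsTrajectory M ε γ ∧ (γ 0 = Z ∨ Outgoing M ε (γ 0) Z)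
  then h.choose t else Z

/-- The flow operator `T^t_m g = g ∘ Ψ^{-t}_m` on the phase space, and `0` outside. -/
def flowOp (M : ℕ) (ε : ℕ → ℝ) {d m : ℕ} (t : ℝ) (g : Phase d m → ℝ) : Phase d m → ℝ :=
  (phaseSpace M ε d m).indicator fun Z => g (flow M ε (-t) Z)

/-! ### Collision operators -/

/-- `ℝ^{ℓ d}` with its Euclidean norm, as the space of `ℓ` impact parameters in `ℝ^d`. -/
abbrev Impact (d ℓ : ℕ) : Type := PiLp 2 fun _ : Fin ℓ => Space d

/-- The cross-section
`b_{ℓ+1}(ω, ν) = ∑_i ⟨ω_i, ν_i⟩ + ∑_{i<j} ⟨ω_i - ω_j, ν_i - ν_j⟩`. -/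
def crossSection {d ℓ : ℕ} (ω ν : Fin ℓ → Space d) : ℝ :=
  ∑ i, inner ℝ (ω i) (ν i) + pairing ω ν

/-- The ellipsoid `{ω | ∑_i |ω_i|² + ∑_{i<j} |ω_i - ω_j|² = 1}` in `ℝ^{ℓ d}`. -/
def ellipsoid (d ℓ : ℕ) : Set (Impact d ℓ) :=
  {ω | ∑ i, ‖ω i‖ ^ 2 + ∑ i, ∑ j, (if i < j then ‖ω i - ω j‖ ^ 2 else 0) = 1}

/-- The surface measure `dω` of the ellipsoid: the `(ℓ d - 1)`-dimensional Hausdorff measure, in the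
normalization that agrees with Lebesgue measure on Euclidean spaces. -/
def surfaceMeasure (d ℓ : ℕ) : Measure (Impact d ℓ) :=
  (Measure.euclideanHausdorffMeasure (ℓ * d - 1) : Measure (Impact d ℓ)).restrict (ellipsoid d ℓ)

/-- The collisional transformation `T_ω` of `ℓ + 1` velocities: particle `0` has scaled relative
position `0`, and particle `j + 1` has scaled relative position `ω_j`. -/
def transformVel {d ℓ : ℕ} (ω : Fin ℓ → Space d) (v : Fin (ℓ + 1) → Space d) :
    Fin (ℓ + 1) → Space d :=
  scatter (Fin.cons 0 ω : Fin (ℓ + 1) → Space d) v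

/-- In `T_ω`, the coefficient `∑_{i<j} ⟨·, ·⟩` is the cross-section at the relative velocities. -/
theorem pairing_cons {d ℓ : ℕ} (ω v : Fin ℓ → Space d) (w : Space d) :
    pairing (Fin.cons 0 ω : Fin (ℓ + 1) → Space d) (Fin.cons w v) =
      crossSection ω fun j => v j - w := by
  simp only [pairing, crossSection, Fin.sum_univ_succ, Fin.cons_zero, Fin.cons_succ,
    if_false, Fin.succ_pos, if_true, Fin.succ_lt_succ_iff, Fin.not_lt_zero, zero_add, sub_sub_sub_cancel_right]
  congr 1
  refine Finset.sum_congr rfl fun i _ => ?_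
  rw [zero_sub, inner_neg_left, ← inner_neg_right, neg_sub]

/-- The state `Z^{i}_{s+ℓ,ε}`: `ℓ` particles with velocities `v` are added at `x_i - ε ω_j`. -/
def adjoinPre {d s ℓ : ℕ} (ε : ℝ) (i : Fin s) (ω v : Fin ℓ → Space d) (Z : Phase d s) :
    Phase d (s + ℓ) :=
  (Fin.append Z.1 fun j => Z.1 i - ε • ω j, Fin.append Z.2 v)

/-- The state `Z^{i,*}_{s+ℓ,ε}`: `ℓ` particles are added at `x_i + ε ω_j`, and the velocities of
particle `i` and of the added particles are transformed by `T_ω`. -/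
def adjoinPost {d s ℓ : ℕ} (ε : ℝ) (i : Fin s) (ω v : Fin ℓ → Space d) (Z : Phase d s) :
    Phase d (s + ℓ) :=
  let w : Fin (ℓ + 1) → Space d := transformVel ω (Fin.cons (Z.2 i) v)
  (Fin.append Z.1 fun j => Z.1 i + ε • ω j,
    Fin.append (Function.update Z.2 i (w 0)) fun j => w j.succ)

/-- Integrand `b_+(ω, v - v_i) g(Z^{i,*})` of the gain term. -/
def gainIntegrand (ε : ℕ → ℝ) {d s : ℕ} (ℓ : ℕ) (i : Fin s) (g : Phase d (s + ℓ) → ℝ) (Z : Phase d s)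
    (p : Impact d ℓ × (Fin ℓ → Space d)) : ℝ :=
  max (crossSection p.1 fun j => p.2 j - Z.2 i) 0 * g (adjoinPost (ε (ℓ + 1)) i p.1 p.2 Z)

/-- Integrand `b_+(ω, v - v_i) g(Z^{i})` of the loss term. -/
def lossIntegrand (ε : ℕ → ℝ) {d s : ℕ} (ℓ : ℕ) (i : Fin s) (g : Phase d (s + ℓ) → ℝ) (Z : Phase d s)
    (p : Impact d ℓ × (Fin ℓ → Space d)) : ℝ :=
  max (crossSection p.1 fun j => p.2 j - Z.2 i) 0 * g (adjoinPre (ε (ℓ + 1)) i p.1 p.2 Z)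

/-- The measure `dω dv` on `𝔼^{ℓ d - 1} × ℝ^{ℓ d}`. -/
def collisionMeasure (d ℓ : ℕ) : Measure (Impact d ℓ × (Fin ℓ → Space d)) :=
  (surfaceMeasure d ℓ).prod volume

/-- The collision operator `𝒞^N_{s,s+ℓ}` of order `ℓ + 1`, with the factor
`A = ε_{ℓ+1}^{ℓ d - 1} binom(N - s, ℓ)` (which is `0` for `s + ℓ > N`). -/
def collisionOp (ε : ℕ → ℝ) (N : ℕ) {d : ℕ} (ℓ s : ℕ) (g : Phase d (s + ℓ) → ℝ) (Z : Phase d s) : ℝ :=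
  ε (ℓ + 1) ^ (ℓ * d - 1) * ((N - s).choose ℓ : ℝ) *
    ∑ i : Fin s, (∫ p, gainIntegrand ε ℓ i g Z p ∂collisionMeasure d ℓ -
      ∫ p, lossIntegrand ε ℓ i g Z p ∂collisionMeasure d ℓ)

/-! ### The weighted spaces -/

/-- Sequences `(g_s)` of `s`-particle functions. The component `s = 0` plays no role. -/
abbrev Hier (d : ℕ) : Type := ∀ s : ℕ, Phase d s → ℝ

/-- `|g|_{N,β,s}`, the (essential) supremum of `|g(Z)| e^{β E_s(Z)}`. -/
def normS {d s : ℕ} (β : ℝ) (g : Phase d s → ℝ) : ℝ≥0∞ :=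
  essSup (fun Z => ENNReal.ofReal (|g Z| * Real.exp (β * kineticEnergy Z))) volume

/-- `‖G‖_{N,β,μ} = sup_{s ≥ 1} e^{μ s} |g_s|_{N,β,s}`. -/
def normH {d : ℕ} (β μ : ℝ) (G : Hier d) : ℝ≥0∞ :=
  ⨆ (s : ℕ) (_ : 1 ≤ s), ENNReal.ofReal (Real.exp (μ * s)) * normS β (G s)

/-- `|||G|||_{N,β,μ} = sup_{t ∈ [0,T]} ‖G(t)‖_{N,β(t),μ(t)}`. -/
def normT {d : ℕ} (T : ℝ) (β μ : ℝ → ℝ) (G : ℝ → Hier d) : ℝ≥0∞ :=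
  ⨆ t ∈ Icc 0 T, normH (β t) (μ t) (G t)

/-- `G` represents an element of `X_{N,β,μ}`; components are `L^∞` functions, supported in the phase
space, zero for `s > N`, and determined up to null sets. -/
structure MemX (M : ℕ) (ε : ℕ → ℝ) (N : ℕ) {d : ℕ} (β μ : ℝ) (G : Hier d) : Prop where
  measurable : ∀ s, 1 ≤ s → AEStronglyMeasurable (G s) volume
  support : ∀ s, 1 ≤ s → ∀ᵐ Z : Phase d s, Z ∉ phaseSpace M ε d s → G s Z = 0
  vanish : ∀ s, N < s → G s =ᵐ[volume] 0
  norm_lt_top : normH β μ G < ⊤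

/-- `G` represents an element of `C⁰([0,T], X_{N,β(t),μ(t)})`, where `β`, `μ` are decreasing.

Continuity is that of the filtered function `t ↦ 𝒯^{-t} G(t)`; as the spaces increase with `t`, the
difference of its values at `t` and `t₀` is measured in the smallest space that has both. Traces on
hypersurfaces, as in the collision operators, are those of the representative that is continuous along
the trajectories: `G(t, ·)` is `0` everywhere outside the phase space, and `t ↦ G(t, Ψ^t Z)` is continuous
for almost every `Z` in the phase space. Every filtered-continuous `G` has such a representative. -/
structure MemXT (M : ℕ) (ε : ℕ → ℝ) (N : ℕ) {d : ℕ} (T : ℝ) (β μ : ℝ → ℝ) (G : ℝ → Hier d) : Prop where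
  mem : ∀ t ∈ Icc 0 T, MemX M ε N (β t) (μ t) (G t)
  norm_lt_top : normT T β μ G < ⊤
  continuous : ∀ t₀ ∈ Icc 0 T,
    Tendsto (fun t => normH (β (max t t₀)) (μ (max t t₀))
      (fun s Z => flowOp M ε (-t) (G t s) Z - flowOp M ε (-t₀) (G t₀ s) Z))
      (𝓝[Icc 0 T] t₀) (𝓝 0)
  zero_outside : ∀ t ∈ Icc 0 T, ∀ s, 1 ≤ s → ∀ Z ∉ phaseSpace M ε d s, G t s Z = 0
  continuous_along : ∀ s, 1 ≤ s → ∀ᵐ Z : Phase d s, Z ∈ phaseSpace M ε d s →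
    ContinuousOn (fun t => G t s (flow M ε t Z)) (Icc 0 T)

/-! ### Mild solutions -/

/-- The `s`-particle component of `∫_A 𝒯^{t-τ} 𝒞_N^{ℓ+1} G(τ) dτ`. -/
def duhamel (M : ℕ) (ε : ℕ → ℝ) (N : ℕ) {d : ℕ} (ℓ : ℕ) (A : Set ℝ) (t : ℝ) (G : ℝ → Hier d) : Hier d :=
  fun s Z => ∫ τ in A, flowOp M ε (t - τ) (collisionOp ε N ℓ s (G τ (s + ℓ))) Z

/-- All integrals in `∫_0^t 𝒯^{t-τ} 𝒞_N^{ℓ+1} G(τ) dτ` converge absolutely, almost everywhere. -/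
def CollisionConverges (M : ℕ) (ε : ℕ → ℝ) (N : ℕ) {d : ℕ} (ℓ : ℕ) (T : ℝ) (G : ℝ → Hier d) : Prop :=
  ∀ t ∈ Icc 0 T, ∀ s, 1 ≤ s → ∀ᵐ Z : Phase d s, Z ∈ phaseSpace M ε d s →
    (∀ᵐ τ ∂volume.restrict (Icc 0 t), ∀ i : Fin s,
      Integrable (gainIntegrand ε ℓ i (G τ (s + ℓ)) (flow M ε (-(t - τ)) Z)) (collisionMeasure d ℓ) ∧
      Integrable (lossIntegrand ε ℓ i (G τ (s + ℓ)) (flow M ε (-(t - τ)) Z)) (collisionMeasure d ℓ)) ∧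
    IntegrableOn (fun τ => flowOp M ε (t - τ) (collisionOp ε N ℓ s (G τ (s + ℓ))) Z) (Icc 0 t)

/-- Mild solutions of the BBGKY hierarchy on `[0,T]` with initial datum `F₀`:
`G(t) = 𝒯^t F₀ + ∫_0^t 𝒯^{t-τ} 𝒞_N G(τ) dτ`, with `𝒞_N = 𝒞_N^2 + ⋯ + 𝒞_N^{M+1}`. -/
structure IsMildSolution (M : ℕ) (ε : ℕ → ℝ) (N : ℕ) {d : ℕ} (T : ℝ) (β μ : ℝ → ℝ) (F₀ : Hier d)
    (G : ℝ → Hier d) : Prop where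
  mem : MemXT M ε N T β μ G
  eqn : ∀ t ∈ Icc 0 T, ∀ s, 1 ≤ s → ∀ᵐ Z : Phase d s,
    G t s Z = flowOp M ε t (F₀ s) Z +
      ∫ τ in Icc 0 t, flowOp M ε (t - τ)
        (fun Z' => ∑ ℓ ∈ Finset.Icc 1 M, collisionOp ε N ℓ s (G τ (s + ℓ)) Z') Z

/-! ### The time of existence -/

/-- The numbers `2^ℓ ℓ³ e^{ℓ (|μ₀| + β₀ / 2)}` that exceed `ℓ!`. -/
def peakSet (β₀ μ₀ : ℝ) : Set ℝ :=
  {x | ∃ ℓ : ℕ, x = 2 ^ ℓ * (ℓ : ℝ) ^ 3 * Real.exp (ℓ * (|μ₀| + β₀ / 2)) ∧ (ℓ ! : ℝ) < x}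

/-- The maximum of `peakSet`. -/
def peak (β₀ μ₀ : ℝ) : ℝ := sSup (peakSet β₀ μ₀)

/-- The time of existence `T = 1 / (2 C̃)`, where `C̃ = (e - 1) C max(peakSet)`. -/
def existenceTime (C β₀ μ₀ : ℝ) : ℝ := 1 / (2 * ((Real.exp 1 - 1) * (C * peak β₀ μ₀)))

/-- The linearly decreasing weights `t ↦ c - (β₀ / (2 T)) t`. -/
def linearWeight (β₀ T c : ℝ) (t : ℝ) : ℝ := c - β₀ / (2 * T) * t

theorem peakSet_finite (β₀ μ₀ : ℝ) : (peakSet β₀ μ₀).Finite := by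
  set c : ℝ := Real.exp (|μ₀| + β₀ / 2) with hc
  have hlim := FloorSemiring.tendsto_pow_div_factorial_atTop (16 * c)
  have hev := hlim.eventually (gt_mem_nhds (show (0 : ℝ) < 1 by norm_num))
  obtain ⟨n, hn⟩ := eventually_atTop.1 hev
  refine ((Set.finite_Iio n).image
    fun ℓ : ℕ => 2 ^ ℓ * (ℓ : ℝ) ^ 3 * Real.exp (ℓ * (|μ₀| + β₀ / 2))).subset ?_
  rintro x ⟨ℓ, rfl, hx⟩
  refine ⟨ℓ, ?_, rfl⟩
  by_contra hℓ
  have h1 := hn ℓ (not_lt.1 hℓ)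
  have hfac : (0 : ℝ) < (ℓ ! : ℝ) := by positivity
  rw [div_lt_one hfac] at h1
  have h2 : (ℓ : ℝ) ^ 3 ≤ 8 ^ ℓ := by
    have : (ℓ : ℝ) ≤ 2 ^ ℓ := by exact_mod_cast Nat.lt_two_pow_self.le
    calc (ℓ : ℝ) ^ 3 ≤ (2 ^ ℓ) ^ 3 := by gcongr
      _ = 8 ^ ℓ := by rw [← pow_mul, mul_comm, pow_mul]; norm_num
  have h3 : Real.exp (ℓ * (|μ₀| + β₀ / 2)) = c ^ ℓ := Real.exp_nat_mul _ _
  have h4 : (2 : ℝ) ^ ℓ * (ℓ : ℝ) ^ 3 * c ^ ℓ ≤ (16 * c) ^ ℓ := by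
    rw [mul_pow, show (16 : ℝ) = 2 * 8 by norm_num, mul_pow]
    gcongr
  rw [h3] at hx
  linarith

theorem peakSet_nonempty {β₀ : ℝ} (hβ₀ : 0 < β₀) (μ₀ : ℝ) : (peakSet β₀ μ₀).Nonempty := by
  refine ⟨_, 1, rfl, ?_⟩
  have h : (1 : ℝ) ≤ Real.exp (((1 : ℕ) : ℝ) * (|μ₀| + β₀ / 2)) :=
    Real.one_le_exp (by positivity)
  simp only [Nat.factorial_one, Nat.cast_one, one_pow, pow_one, mul_one] at h ⊢
  linarith

theorem peak_isGreatest {β₀ : ℝ} (hβ₀ : 0 < β₀) (μ₀ : ℝ) :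
    IsGreatest (peakSet β₀ μ₀) (peak β₀ μ₀) :=
  ⟨(peakSet_nonempty hβ₀ μ₀).csSup_mem (peakSet_finite β₀ μ₀),
    fun _ hx => le_csSup (peakSet_finite β₀ μ₀).bddAbove hx⟩

end

end BBGKY

open BBGKY

set_option linter.unusedSectionVars false

namespace BBGKY

/-! ### Billiards outside finitely many cylinders -/

/-! The hierarchy is linear, and the solution is a Neumann series in weighted spaces that shrink in
time, as in the Cauchy–Kovalevskaya theorem. Most of the work lies in giving its integrals a
meaning.

Estimate. The collision operator grows linearly in `s + E`, with `E` the kinetic energy. The weight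
at time `τ` is the weight at time `t` multiplied by `exp(-(β₀/(2T)) (t - τ) (s + E))`, and
integration over `τ` gains a factor `1/(s + E)` that pays for this growth (`weight_linearWeight`,
`integrableOn_and_abs_setIntegral_le`). The constants carry two factorials: the scaling bounds the
prefactor by `K^ℓ/ℓ!` (`pow_mul_choose_le`), and the ellipsoid has mass `O(1/(c^ℓ ℓ!))` for every
`c` (`exists_surfaceMeasure_le`). One factorial is spent on `exp(ℓ(|μ₀| + β₀/2))` through `peak`,
and the other one stays (`exists_existenceTime`). Since the `1/ℓ!` with `ℓ ≥ 1` sum to `e - 1`, the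
whole collision term halves the norm (`abs_collisionTerm_le`); this gives existence with the factor
`2` (`exists_mildSolution`) and uniqueness (`IsMildSolution.ae_eq`).

Flow. The particles form a billiard outside cylinders in configuration space. A bounce is regarded
as a map of lines; it has a differentiable inverse where it acts, so words in the bounces and the
time reversal pull null sets back to null sets. Hence almost no line ever grazes a cylinder or meets
two at once, and collision times cannot accumulate (`tendsto_atTop_of_collisions`). At a fixed time
the flow is a drift after one of countably many words, so it does not lead a set of positive measure
into a null set (`ae_flow_notMem`).

Traces. Collision integrals evaluate `G τ` on collision states, which form a null set. Continuity
along trajectories gives `G τ (Ψ^τ Z) = K (τ, Z)` for almost every `Z` and all `τ`, with `K` jointly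
measurable (`MemXT.exists_represents`). For almost all times, states, impact parameters and
velocities with `b > 0`, an adjoined state in the phase space flows back to time zero outside a
given null set (`ae_adjoin`): the points `ε ω + τ ν` sweep out full dimension where `b(ω, ν) ≠ 0`
(`ae_surfaceMeasure_line_notMem`). -/

/-- Finitely many cylinders `{x | ⟨A_a x, x⟩ < r_a²}`, where `A_a` is a positive multiple of an
orthogonal projection for the inner product `ip`. -/
structure CylinderFamily (ι X : Type) [NormedAddCommGroup X] [NormedSpace ℝ X] where
  ip : X →L[ℝ] X →L[ℝ] ℝ
  ip_comm : ∀ x y, ip x y = ip y x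
  -- Domination is enough, and it is all there is: configuration spaces carry a sup norm, while `ip`
  -- is Euclidean.
  norm_sq_le : ∀ x, ‖x‖ ^ 2 ≤ ip x x
  A : ι → X →L[ℝ] X
  κ : ι → ℝ
  r : ι → ℝ
  κ_pos : ∀ a, 0 < κ a
  r_pos : ∀ a, 0 < r a
  A_symm : ∀ a x y, ip (A a x) y = ip x (A a y)
  A_sq : ∀ a x, A a (A a x) = κ a • A a x

namespace CylinderFamily

variable {ι X : Type} [NormedAddCommGroup X] [NormedSpace ℝ X] (B : CylinderFamily ι X)

/-- The bilinear form `⟨A_a x, y⟩`. -/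
noncomputable def q (a : ι) : X →L[ℝ] X →L[ℝ] ℝ := B.ip.comp (B.A a)

theorem q_apply (a : ι) (x y : X) : B.q a x y = B.ip (B.A a x) y := rfl

theorem q_comm (a : ι) (x y : X) : B.q a x y = B.q a y x := by
  rw [q_apply, q_apply, A_symm, ip_comm]

theorem q_A (a : ι) (x y : X) : B.q a x (B.A a y) = B.κ a * B.q a x y := by
  rw [q_apply, A_symm, A_sq, map_smul, smul_eq_mul, ← A_symm, q_apply]

theorem ip_nonneg (x : X) : 0 ≤ B.ip x x := (sq_nonneg _).trans (B.norm_sq_le x)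

/-- `A_a` is `κ_a` times a projection, so `κ_a q(x, x)` is the squared length of `A_a x`. -/
theorem q_nonneg (a : ι) (x : X) : 0 ≤ B.q a x x := by
  have h : B.κ a * B.q a x x = B.ip (B.A a x) (B.A a x) := by
    rw [← q_A, q_apply]
  have := B.ip_nonneg (B.A a x)
  rw [← h] at this
  exact nonneg_of_mul_nonneg_right this (B.κ_pos a)

/-- Specular reflection of the velocity at a point of the cylinder. -/
noncomputable def reflect (a : ι) (Z : X × X) : X × X :=
  (Z.1, Z.2 - (2 / (B.κ a * B.r a ^ 2) * B.q a Z.1 Z.2) • B.A a Z.1)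

theorem reflect_fst (a : ι) (Z : X × X) : (B.reflect a Z).1 = Z.1 := rfl

theorem reflect_snd (a : ι) (Z : X × X) : (B.reflect a Z).2 =
    Z.2 - (2 / (B.κ a * B.r a ^ 2) * B.q a Z.1 Z.2) • B.A a Z.1 := rfl

theorem q_reflect {a : ι} {Z : X × X} (h : B.q a Z.1 Z.1 = B.r a ^ 2) :
    B.q a Z.1 (B.reflect a Z).2 = - B.q a Z.1 Z.2 := by
  have := B.κ_pos a; have := B.r_pos a
  rw [reflect_snd, map_sub, map_smul, smul_eq_mul, q_A, h]
  field_simp; ring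

theorem ip_reflect_self {a : ι} {Z : X × X} (h : B.q a Z.1 Z.1 = B.r a ^ 2) :
    B.ip (B.reflect a Z).2 (B.reflect a Z).2 = B.ip Z.2 Z.2 := by
  have := B.κ_pos a; have := B.r_pos a
  have h1 : B.ip (B.A a Z.1) (B.A a Z.1) = B.κ a * B.r a ^ 2 := by
    rw [← q_apply, q_A, h]
  have h2 : B.ip Z.2 (B.A a Z.1) = B.q a Z.1 Z.2 := by rw [ip_comm, q_apply]
  have h3 : B.ip (B.A a Z.1) Z.2 = B.q a Z.1 Z.2 := rfl
  simp only [reflect_snd, map_sub, map_smul, smul_eq_mul, sub_apply,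
    smul_apply, h1, h2, h3]
  field_simp; ring

theorem reflect_reflect {a : ι} {Z : X × X} (h : B.q a Z.1 Z.1 = B.r a ^ 2) :
    B.reflect a (B.reflect a Z) = Z := by
  refine Prod.ext rfl ?_
  rw [reflect_snd, reflect_fst, B.q_reflect h, reflect_snd, mul_neg, neg_smul, sub_neg_eq_add,
    sub_add_cancel]

/-! ### No accumulation of collisions -/

section NonAccumulation

set_option maxHeartbeats 1000000 in
/-- Collision times do not accumulate. The sequence consists of positions `p n` at times `t n`, and the
velocities `v n` after these times; each step is a collision, or a step of length one without
collision. -/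
theorem tendsto_atTop_of_collisions [Finite ι] [CompleteSpace X] {t : ℕ → ℝ} {p v : ℕ → X}
    (ht : ∀ n, t n < t (n + 1)) (hp : ∀ n, p (n + 1) = p n + (t (n + 1) - t n) • v n)
    (hv : ∀ n, (v (n + 1) = v n ∧ t (n + 1) = t n + 1) ∨
      ∃ a, B.q a (p (n + 1)) (p (n + 1)) = B.r a ^ 2 ∧ B.q a (p (n + 1)) (v n) < 0 ∧
        v (n + 1) = (B.reflect a (p (n + 1), v n)).2) :
    Tendsto t atTop atTop := by
  have htm : Monotone t := monotone_nat_of_le_succ fun n => (ht n).le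
  rcases tendsto_atTop_of_monotone htm with h | ⟨T, hT⟩
  · exact h
  -- Let the times increase to `T`. Energy conservation bounds the speeds, so the positions converge
  -- to `p'`; the virial `⟨p, v⟩` bounds the sum of the impulses `c n`, so the velocities converge
  -- to `v'`. Let `D = v' - v n` and let `S n` be the tail of the impulses. Tested against `p'`,
  -- `‖D‖` is at least of order `S n`; but `‖D‖²` is at most of order `(T - t n) S n²`. So `S n`
  -- vanishes eventually.
  exfalso
  have htT : ∀ n, t n ≤ T := fun n => htm.ge_of_tendsto hT n
  -- impulses
  have hex : ∀ n, ∃ c : ℝ, 0 ≤ c ∧ ((c = 0 ∧ v (n + 1) = v n ∧ t (n + 1) = t n + 1) ∨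
      ∃ a, B.q a (p (n + 1)) (p (n + 1)) = B.r a ^ 2 ∧
        B.q a (p (n + 1)) (v n) = -(c * (B.κ a * B.r a ^ 2) / 2) ∧
        v (n + 1) = v n + c • B.A a (p (n + 1)) ∧ 0 < c) := by
    intro n
    rcases hv n with h | ⟨a, h1, h2, h3⟩
    · exact ⟨0, le_rfl, Or.inl ⟨rfl, h⟩⟩
    · have := B.κ_pos a; have := B.r_pos a
      have hc : 0 < -(2 / (B.κ a * B.r a ^ 2) * B.q a (p (n + 1)) (v n)) := by
        rw [← mul_neg]; exact mul_pos (by positivity) (by linarith)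
      refine ⟨_, hc.le, Or.inr ⟨a, h1, ?_, ?_, hc⟩⟩
      · field_simp
      · rw [h3, reflect_snd, neg_smul, sub_eq_add_neg]
  choose c hc0 hc using hex
  have hin : ∀ n, ip B (v n) (v n) = ip B (v 0) (v 0) := by
    intro n
    induction n with
    | zero => rfl
    | succ n ih =>
      rcases hv n with h | ⟨a, h1, h2, h3⟩
      · rw [h.1, ih]
      · rw [h3, B.ip_reflect_self (Z := (p (n + 1), v n)) h1, ih]
  set V : ℝ := √(ip B (v 0) (v 0)) with hV
  have hvV : ∀ n, ‖v n‖ ≤ V := fun n => by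
    rw [hV, ← hin n]; exact Real.le_sqrt_of_sq_le (B.norm_sq_le _)
  have hV0 : 0 ≤ V := Real.sqrt_nonneg _
  have hpd : ∀ n, dist (p n) (p (n + 1)) ≤ (t (n + 1) - t n) * V := by
    intro n
    rw [dist_eq_norm, hp n, sub_add_cancel_left, norm_neg, norm_smul, Real.norm_eq_abs,
      abs_of_pos (sub_pos.2 (ht n))]
    gcongr
    · exact (sub_pos.2 (ht n)).le
    · exact hvV n
  have hts : Summable fun n => (t (n + 1) - t n) * V := by
    refine Summable.mul_right _ (summable_of_sum_range_le (c := T - t 0)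
      (fun n => (sub_pos.2 (ht n)).le) fun n => ?_)
    rw [Finset.sum_range_sub]; linarith [htT n]
  obtain ⟨p', hp'⟩ := cauchySeq_tendsto_of_complete (cauchySeq_of_dist_le_of_summable _ hpd hts)
  obtain ⟨Q, hQ⟩ : ∃ Q, ∀ n, ‖p n‖ ≤ Q := by
    obtain ⟨Q, hQ⟩ := (hp'.norm).bddAbove_range
    exact ⟨Q, fun n => hQ ⟨n, rfl⟩⟩
  have hQ0 : 0 ≤ Q := (norm_nonneg _).trans (hQ 0)
  obtain ⟨α, hα⟩ : ∃ α, ∀ a, ‖B.A a‖ ≤ α := by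
    obtain ⟨α, hα⟩ := (Set.finite_range fun a => ‖B.A a‖).bddAbove
    exact ⟨α, fun a => hα ⟨a, rfl⟩⟩
  obtain ⟨η, hη0, hη⟩ : ∃ η, 0 ≤ η ∧ ∀ a, ‖B.q a‖ ≤ η := by
    obtain ⟨α, hα⟩ := (Set.finite_range fun a => ‖B.q a‖).bddAbove
    exact ⟨max α 0, le_max_right _ _, fun a => (hα ⟨a, rfl⟩).trans (le_max_left _ _)⟩
  have hq : ∀ a x y, |B.q a x y| ≤ η * ‖x‖ * ‖y‖ := fun a x y => by
    refine ((B.q a).le_opNorm₂ x y).trans ?_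
    gcongr; exact hη a
  obtain ⟨ρ, hρ0, hρ⟩ : ∃ ρ, 0 < ρ ∧ ∀ a, ρ ≤ B.r a ^ 2 := by
    cases isEmpty_or_nonempty ι
    · exact ⟨1, one_pos, fun a => (IsEmpty.false a).elim⟩
    · obtain ⟨a, ha⟩ := Finite.exists_min fun a => B.r a ^ 2
      exact ⟨_, pow_pos (B.r_pos a) 2, ha⟩
  -- the virial identity bounds the total impulse
  have hg : ∀ n, ρ * c n ≤ ip B (p (n + 1)) (v (n + 1)) - ip B (p n) (v n) := by
    intro n
    have h1 : ip B (p (n + 1)) (v n) = ip B (p n) (v n) + (t (n + 1) - t n) * ip B (v n) (v n) := by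
      rw [hp n, map_add, map_smul]; rfl
    have h2 : 0 ≤ (t (n + 1) - t n) * ip B (v n) (v n) :=
      mul_nonneg (sub_pos.2 (ht n)).le (B.ip_nonneg _)
    rcases hc n with ⟨h, h', -⟩ | ⟨a, h3, -, h4, -⟩
    · rw [h, h', h1]; linarith
    · have h5 : ip B (p (n + 1)) (v (n + 1)) = ip B (p (n + 1)) (v n) + c n * B.r a ^ 2 := by
        rw [h4, map_add, map_smul, smul_eq_mul, ← h3, q_apply, A_symm]
      have h6 := mul_le_mul_of_nonneg_right (hρ a) (hc0 n)
      rw [h5, h1]; linarith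
  have hcs : Summable c := by
    refine summable_of_sum_range_le (c := (2 * (‖B.ip‖ * Q * V)) / ρ) hc0 fun n => ?_
    rw [le_div_iff₀ hρ0, mul_comm, Finset.mul_sum]
    refine (Finset.sum_le_sum fun k _ => hg k).trans ?_
    rw [Finset.sum_range_sub (fun k => ip B (p k) (v k))]
    have : ∀ k, |ip B (p k) (v k)| ≤ ‖B.ip‖ * Q * V := fun k => by
      refine (B.ip.le_opNorm₂ _ _).trans ?_
      gcongr
      · exact hQ k
      · exact hvV k
    have h1 := abs_le.1 (this n); have h2 := abs_le.1 (this 0); linarith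
  set L : ℝ := α * Q with hL
  have hα0 : ∀ a : ι, 0 ≤ α := fun a => (norm_nonneg _).trans (hα a)
  have hu : ∀ n, dist (v n) (v (n + 1)) ≤ L * c n := by
    intro n
    rcases hc n with ⟨h, h', -⟩ | ⟨a, -, -, h4, -⟩
    · rw [h', h]; simp
    · rw [h4, dist_self_add_right, norm_smul, Real.norm_eq_abs, abs_of_nonneg (hc0 n), mul_comm, hL]
      refine mul_le_mul_of_nonneg_right (((B.A a).le_opNorm _).trans ?_) (hc0 n)
      exact mul_le_mul (hα a) (hQ _) (norm_nonneg _) (hα0 a)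
  have hus : Summable fun n => L * c n := hcs.mul_left _
  obtain ⟨v', hv'⟩ := cauchySeq_tendsto_of_complete (cauchySeq_of_dist_le_of_summable _ hu hus)
  set S : ℕ → ℝ := fun n => ∑' k, c (n + k) with hS
  have hcsn : ∀ n, Summable fun k => c (n + k) := fun n => by
    simpa [add_comm] using (summable_nat_add_iff n).2 hcs
  have hS0 : ∀ n, 0 ≤ S n := fun n => tsum_nonneg fun k => hc0 _
  have hSs : ∀ n, S n = c n + S (n + 1) := fun n => by
    have := (hcsn n).tsum_eq_zero_add
    simp only [hS]
    rw [this, add_zero]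
    congr 2
    ext k
    congr 1
    omega
  have hSa : Antitone S := antitone_nat_of_succ_le fun n => by linarith [hSs n, hc0 n]
  have hvS : ∀ n, dist (v n) v' ≤ L * S n := fun n => by
    have := dist_le_tsum_of_dist_le_of_tendsto _ hu hus hv' n
    rwa [tsum_mul_left] at this
  have hsum : ∀ n, HasSum (fun k => v (n + k + 1) - v (n + k)) (v' - v n) := by
    intro n
    have h1 : Summable fun k => ‖v (n + k + 1) - v (n + k)‖ := by
      refine Summable.of_nonneg_of_le (fun _ => norm_nonneg _) (fun k => ?_) ((hcsn n).mul_left L)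
      rw [← dist_eq_norm, dist_comm]; exact hu _
    rw [hasSum_iff_tendsto_nat_of_summable_norm h1]
    have : ∀ m, ∑ k ∈ Finset.range m, (v (n + k + 1) - v (n + k)) = v (n + m) - v n := fun m => by
      exact Finset.sum_range_sub (fun k => v (n + k)) m
    simp_rw [this]
    exact ((tendsto_add_atTop_iff_nat n).2 hv' |>.congr fun m => by rw [add_comm]).sub_const _
  -- the active cylinders
  have hfreq : ∀ᶠ k in atTop, ∀ a, (B.q a (p (k + 1)) (p (k + 1)) = B.r a ^ 2 ∧
      B.q a (p (k + 1)) (v k) = -(c k * (B.κ a * B.r a ^ 2) / 2)) → B.q a p' v' = 0 := by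
    rw [eventually_all]
    intro a
    by_cases hf : ∃ᶠ k in atTop, (B.q a (p (k + 1)) (p (k + 1)) = B.r a ^ 2 ∧
      B.q a (p (k + 1)) (v k) = -(c k * (B.κ a * B.r a ^ 2) / 2))
    · refine Eventually.of_forall fun _ _ => ?_
      have h1 : Tendsto (fun k => B.q a (p (k + 1)) (v k)) atTop (𝓝 (B.q a p' v')) :=
        ((B.q a).continuous₂.tendsto (p', v')).comp
          (((tendsto_add_atTop_iff_nat 1).2 hp').prodMk_nhds hv')
      have h2 : Tendsto (fun k => -(c k * (B.κ a * B.r a ^ 2) / 2)) atTop (𝓝 0) := by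
        simpa using ((hcs.tendsto_atTop_zero.mul_const (B.κ a * B.r a ^ 2)).div_const 2).neg
      exact tendsto_nhds_unique_of_frequently_eq h1 h2 (hf.mono fun k hk => hk.2)
    · exact (not_frequently.1 hf).mono fun k hk h => (hk h).elim
  -- Every impulse points along `A_a p`, and `⟨A_a p, p'⟩` is close to `r_a² ≥ ρ`.
  have hlow : ∀ᶠ k in atTop, ρ / 2 * c k ≤ ip B (v (k + 1) - v k) p' := by
    have h0 : Tendsto (fun k => η * Q * ‖p' - p (k + 1)‖) atTop (𝓝 0) := by
      have := ((tendsto_const_nhds (x := p')).sub ((tendsto_add_atTop_iff_nat 1).2 hp')).norm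
      simpa using this.const_mul (η * Q)
    filter_upwards [h0.eventually_lt_const (half_pos hρ0)] with k hk
    rcases hc k with ⟨h, h', -⟩ | ⟨a, h3, -, h4, -⟩
    · rw [h, h']; simp
    · rw [h4, add_sub_cancel_left, map_smul, smul_apply, smul_eq_mul, mul_comm]
      refine mul_le_mul_of_nonneg_left ?_ (hc0 k)
      have h5 : ip B (B.A a (p (k + 1))) p' =
          B.r a ^ 2 + B.q a (p (k + 1)) (p' - p (k + 1)) := by
        rw [map_sub, h3, ← q_apply]; ring
      have h6 := (abs_le.1 (hq a (p (k + 1)) (p' - p (k + 1)))).1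
      have h7 : η * ‖p (k + 1)‖ * ‖p' - p (k + 1)‖ ≤ η * Q * ‖p' - p (k + 1)‖ := by
        gcongr; exact hQ _
      rw [h5]; linarith [hρ a]
  -- The path differs from its limiting line by at most the remaining time multiplied by the
  -- remaining impulse.
  have hpos : ∀ k, ‖p' - p k - (T - t k) • v'‖ ≤ (T - t k) * (L * S k) := by
    intro k
    have h1 : ∀ j, k ≤ j → ‖p j - p k - (t j - t k) • v'‖ ≤ (t j - t k) * (L * S k) := by
      intro j hj
      induction j, hj using Nat.le_induction with
      | base => simp
      | succ j hj ih =>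
        have e : p (j + 1) - p k - (t (j + 1) - t k) • v' =
            (p j - p k - (t j - t k) • v') + (t (j + 1) - t j) • (v j - v') := by
          rw [hp j]; module
        rw [e]
        refine (norm_add_le _ _).trans ?_
        rw [norm_smul, Real.norm_eq_abs, abs_of_pos (sub_pos.2 (ht j)), ← dist_eq_norm (v j)]
        have h2 : dist (v j) v' ≤ L * S k := by
          -- The sign of `α` is known only if there is a cylinder; without one there are no
          -- impulses.
          rcases isEmpty_or_nonempty ι with hι | ⟨⟨a⟩⟩
          · have hc' : ∀ n, c n = 0 := fun n => by
              rcases hc n with h | ⟨a, -⟩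
              · exact h.1
              · exact (hι.false a).elim
            refine (hvS j).trans (le_of_eq ?_)
            simp [hS, hc']
          · exact (hvS j).trans (mul_le_mul_of_nonneg_left (hSa hj) (mul_nonneg (hα0 a) hQ0))
        have := mul_le_mul_of_nonneg_left h2 (sub_pos.2 (ht j)).le
        nlinarith
    have h2 : Tendsto (fun j => ‖p j - p k - (t j - t k) • v'‖) atTop
        (𝓝 ‖p' - p k - (T - t k) • v'‖) :=
      ((hp'.sub_const _).sub ((hT.sub_const _).smul_const _)).norm
    exact le_of_tendsto_of_tendsto h2 ((hT.sub_const _).mul_const _)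
      ((eventually_ge_atTop k).mono fun j hj => h1 j hj)
  set C : ℝ := η * |L| * ‖v'‖ with hC
  -- In `⟨A_a p_m, v'⟩` insert `p_m = p' - (T - t_m) v' - e`: the first term vanishes because `a` is
  -- grazed in the limit, the second has the favourable sign, and `hpos` controls `e`.
  have hup : ∀ᶠ n in atTop, ∀ k, ip B (v (n + k + 1) - v (n + k)) v' ≤
      C * (T - t n) * S n * c (n + k) := by
    filter_upwards [eventually_forall_ge_atTop.2 hfreq] with n hn k
    have hk := hn (n + k) (Nat.le_add_right _ _)
    rcases hc (n + k) with ⟨h, h', -⟩ | ⟨a, h3, h3', h4, -⟩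
    · rw [h, h']; simp
    · rw [h4, add_sub_cancel_left, map_smul, smul_apply, smul_eq_mul, mul_comm]
      refine mul_le_mul_of_nonneg_right ?_ (hc0 _)
      have h0 := hk a ⟨h3, h3'⟩
      set m := n + k + 1
      have hmn : n ≤ m := by omega
      set e := p' - p m - (T - t m) • v' with he
      have h5 : ip B (B.A a (p m)) v' = - ((T - t m) * B.q a v' v') - B.q a e v' := by
        have : p m = p' - (T - t m) • v' - e := by rw [he]; module
        rw [← q_apply, this]
        simp only [map_sub, map_smul, sub_apply,
          smul_apply, smul_eq_mul, h0]
        simp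
      have h6 : -(B.q a e v') ≤ η * ‖e‖ * ‖v'‖ := (neg_le_abs _).trans (hq a e v')
      have h7 : 0 ≤ (T - t m) * B.q a v' v' :=
        mul_nonneg (sub_nonneg.2 (htT m)) (B.q_nonneg a v')
      have h8 : ‖e‖ ≤ (T - t n) * (|L| * S n) := by
        refine (hpos m).trans (mul_le_mul (sub_le_sub_left (htm hmn) _) ?_ ?_ ?_)
        · exact mul_le_mul (le_abs_self _) (hSa hmn) (hS0 _) (abs_nonneg _)
        · exact mul_nonneg (mul_nonneg (hα0 a) hQ0) (hS0 _)
        · exact sub_nonneg.2 (htT n)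
      have h9 : η * ‖e‖ * ‖v'‖ ≤ η * ((T - t n) * (|L| * S n)) * ‖v'‖ := by gcongr
      rw [h5, hC]; nlinarith
  have hineq : ∀ᶠ n in atTop, (ρ / 2 * S n) ^ 2 ≤
      (‖B.ip‖ * ‖p'‖) ^ 2 * (2 * (C * (T - t n))) * S n ^ 2 := by
    filter_upwards [hup, eventually_forall_ge_atTop.2 hlow] with n h1 h2
    set D := v' - v n with hD
    have h3 : ip B D v' ≤ C * (T - t n) * S n * S n :=
      hasSum_le h1 (((hsum n).mapL (B.ip.flip v'))) ((hcsn n).hasSum.mul_left (C * (T - t n) * S n))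
    have h4 : ρ / 2 * S n ≤ ip B D p' :=
      hasSum_le (fun k => h2 (n + k) (Nat.le_add_right _ _))
        ((hcsn n).hasSum.mul_left (ρ / 2)) ((hsum n).mapL (B.ip.flip p'))
    -- `v'` and `v n` have the same length, so the chord `D` between them satisfies this identity.
    have h5 : ip B D D = 2 * ip B D v' := by
      have e1 : ip B v' v' = ip B (v n) (v n) := by
        rw [hin n]
        refine tendsto_nhds_unique ((B.ip.continuous₂.tendsto (v', v')).comp
          (hv'.prodMk_nhds hv')) ?_
        exact tendsto_const_nhds.congr fun k => (hin k).symm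
      have e2 : v n = v' - D := by rw [hD]; abel
      rw [e2] at e1
      simp only [map_sub, sub_apply] at e1
      rw [B.ip_comm v' D] at e1
      linarith
    have h6 : ip B D p' ≤ ‖B.ip‖ * ‖D‖ * ‖p'‖ := (le_abs_self _).trans (B.ip.le_opNorm₂ _ _)
    calc (ρ / 2 * S n) ^ 2 ≤ (‖B.ip‖ * ‖D‖ * ‖p'‖) ^ 2 := by
          have := hS0 n
          exact pow_le_pow_left₀ (by positivity) (h4.trans h6) 2
      _ = (‖B.ip‖ * ‖p'‖) ^ 2 * ‖D‖ ^ 2 := by ring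
      _ ≤ (‖B.ip‖ * ‖p'‖) ^ 2 * (2 * (C * (T - t n) * S n * S n)) := by
          refine mul_le_mul_of_nonneg_left ?_ (sq_nonneg _)
          linarith [B.norm_sq_le D]
      _ = _ := by ring
  have hsmall : ∀ᶠ n in atTop, (‖B.ip‖ * ‖p'‖) ^ 2 * (2 * (C * (T - t n))) < (ρ / 2) ^ 2 := by
    have : Tendsto (fun n => (‖B.ip‖ * ‖p'‖) ^ 2 * (2 * (C * (T - t n)))) atTop (𝓝 0) := by
      have := ((((tendsto_const_nhds (x := T)).sub hT).const_mul C).const_mul 2).const_mul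
        ((‖B.ip‖ * ‖p'‖) ^ 2)
      simpa using this
    exact this.eventually_lt_const (by positivity)
  obtain ⟨n, hn1, hn2⟩ := (hineq.and hsmall).exists
  have hSn : S n = 0 := by
    by_contra h
    have : 0 < S n ^ 2 := by have := (hS0 n).lt_of_ne' h; positivity
    nlinarith
  have hck : ∀ k, n ≤ k → c k = 0 := fun k hk => by
    have h1 : S k = 0 := le_antisymm (hSn ▸ hSa hk) (hS0 k)
    linarith [hSs k, hS0 (k + 1), hc0 k]
  -- Without impulses all steps have length one, so the gaps tend to `1` as well as to `0`.
  have h1 : ∀ k, n ≤ k → t (k + 1) = t k + 1 := fun k hk => by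
    rcases hc k with ⟨-, -, h⟩ | ⟨a, -, -, -, h⟩
    · exact h
    · exact absurd (hck k hk) h.ne'
  have h2 : Tendsto (fun k => t (k + 1) - t k) atTop (𝓝 (T - T)) :=
    ((tendsto_add_atTop_iff_nat 1).2 hT).sub hT
  have h3 : Tendsto (fun k => t (k + 1) - t k) atTop (𝓝 1) :=
    tendsto_const_nhds.congr' ((eventually_ge_atTop n).mono fun k hk => by
      change 1 = t (k + 1) - t k
      rw [h1 k hk]; ring)
  have := tendsto_nhds_unique h2 h3
  norm_num at this

end NonAccumulation

end CylinderFamily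

/-! ### Lines and bounces -/

section Lines

variable {X : Type} [NormedAddCommGroup X] [NormedSpace ℝ X]

/-- Free motion for the time `t`. -/
def drift (t : ℝ) (Z : X × X) : X × X := (Z.1 + t • Z.2, Z.2)

/-- Time reversal. -/
def rev (Z : X × X) : X × X := (Z.1, -Z.2)

@[simp] theorem drift_drift (s t : ℝ) (Z : X × X) : drift s (drift t Z) = drift (s + t) Z := by
  refine Prod.ext ?_ rfl
  simp only [drift]; module

@[simp] theorem drift_zero (Z : X × X) : drift 0 Z = Z := by simp [drift]

@[simp] theorem rev_rev (Z : X × X) : rev (rev Z) = Z := by simp [rev]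

theorem rev_drift (t : ℝ) (Z : X × X) : rev (drift t Z) = drift (-t) (rev Z) := by
  simp [rev, drift]

@[simp] theorem rev_fst (Z : X × X) : (rev Z).1 = Z.1 := rfl
@[simp] theorem rev_snd (Z : X × X) : (rev Z).2 = -Z.2 := rfl
@[simp] theorem drift_snd (t : ℝ) (Z : X × X) : (drift t Z).2 = Z.2 := rfl

theorem differentiable_drift (t : ℝ) : Differentiable ℝ (drift t : X × X → X × X) := by
  unfold drift; fun_prop

theorem differentiable_rev : Differentiable ℝ (rev : X × X → X × X) := by
  unfold rev; fun_prop

theorem continuous_drift_uncurry : Continuous fun p : ℝ × (X × X) => drift p.1 p.2 := by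
  unfold drift; fun_prop

theorem continuous_rev : Continuous (rev : X × X → X × X) := by
  unfold rev; fun_prop

end Lines

namespace CylinderFamily

variable {ι X : Type} [NormedAddCommGroup X] [NormedSpace ℝ X] (B : CylinderFamily ι X)

theorem q_sq_le (a : ι) (x y : X) : B.q a x y ^ 2 ≤ B.q a x x * B.q a y y := by
  have h : ∀ t : ℝ, 0 ≤ B.q a y y * (t * t) + (2 * B.q a x y) * t + B.q a x x := fun t => by
    have := B.q_nonneg a (x + t • y)
    simp only [map_add, map_smul, add_apply, smul_apply, smul_eq_mul, B.q_comm a y x] at this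
    linarith
  have := discrim_le_zero h
  unfold discrim at this
  linarith

theorem q_line (a : ι) (t : ℝ) (Z : X × X) : B.q a (drift t Z).1 (drift t Z).1 =
    B.q a Z.1 Z.1 + 2 * t * B.q a Z.1 Z.2 + t ^ 2 * B.q a Z.2 Z.2 := by
  simp only [drift, map_add, map_smul, add_apply, smul_apply, smul_eq_mul, B.q_comm a Z.2 Z.1]
  ring

theorem q_line_vel (a : ι) (t : ℝ) (Z : X × X) : B.q a (drift t Z).1 (drift t Z).2 =
    B.q a Z.1 Z.2 + t * B.q a Z.2 Z.2 := by
  simp only [drift, map_add, map_smul, add_apply, smul_apply, smul_eq_mul]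

/-- A quarter of the discriminant of `t ↦ q(x + t v, x + t v) - r²`. -/
noncomputable def disc (a : ι) (Z : X × X) : ℝ :=
  B.q a Z.1 Z.2 ^ 2 - B.q a Z.2 Z.2 * (B.q a Z.1 Z.1 - B.r a ^ 2)

/-- The time at which the line through `Z` enters the cylinder. -/
noncomputable def entry (a : ι) (Z : X × X) : ℝ :=
  (-(B.q a Z.1 Z.2) - √(B.disc a Z)) / B.q a Z.2 Z.2

open Classical in
/-- The line, parametrized by time, after the reflection of the line through `Z` at the cylinder. -/
noncomputable def bounce (a : ι) (Z : X × X) : X × X :=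
  if 0 < B.disc a Z then drift (-(B.entry a Z)) (B.reflect a (drift (B.entry a Z) Z)) else Z

@[simp] theorem disc_drift (a : ι) (t : ℝ) (Z : X × X) : B.disc a (drift t Z) = B.disc a Z := by
  rw [disc, q_line, q_line_vel, disc, drift_snd]; ring

@[simp] theorem disc_rev (a : ι) (Z : X × X) : B.disc a (rev Z) = B.disc a Z := by
  simp [disc]

variable {B} in
theorem q_vel_pos {a : ι} {Z : X × X} (h : 0 < B.disc a Z) : 0 < B.q a Z.2 Z.2 := by
  refine (B.q_nonneg a Z.2).lt_of_ne' fun h0 => ?_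
  have := B.q_sq_le a Z.1 Z.2
  rw [disc, h0] at h
  rw [h0] at this
  linarith

variable {B} in
theorem entry_drift {a : ι} {Z : X × X} (h : 0 < B.disc a Z) (t : ℝ) :
    B.entry a (drift t Z) = B.entry a Z - t := by
  have := q_vel_pos h
  rw [entry, q_line_vel, disc_drift, drift_snd, entry]
  field_simp; ring

variable {B} in
theorem q_entry {a : ι} {Z : X × X} (h : 0 < B.disc a Z) :
    B.q a (drift (B.entry a Z) Z).1 (drift (B.entry a Z) Z).1 = B.r a ^ 2 := by
  have h1 := q_vel_pos h
  have h2 := Real.sq_sqrt h.le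
  rw [q_line, entry]
  field_simp
  rw [show (-(B.q a Z.1 Z.2) - √(B.disc a Z)) ^ 2 = B.q a Z.1 Z.2 ^ 2 +
    2 * B.q a Z.1 Z.2 * √(B.disc a Z) + √(B.disc a Z) ^ 2 by ring, h2, disc]
  ring

variable {B} in
theorem q_entry_vel {a : ι} {Z : X × X} (h : 0 < B.disc a Z) :
    B.q a (drift (B.entry a Z) Z).1 Z.2 = -√(B.disc a Z) := by
  have h1 := q_vel_pos h
  rw [← drift_snd (B.entry a Z) Z, q_line_vel, entry]
  field_simp; ring

variable {B} in
theorem q_entry_vel_neg {a : ι} {Z : X × X} (h : 0 < B.disc a Z) :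
    B.q a (drift (B.entry a Z) Z).1 (drift (B.entry a Z) Z).2 < 0 := by
  rw [drift_snd, q_entry_vel h]; simpa using h

variable {B} in
theorem disc_eq_of_mem {a : ι} {Z : X × X} (h : B.q a Z.1 Z.1 = B.r a ^ 2) :
    B.disc a Z = B.q a Z.1 Z.2 ^ 2 := by
  rw [disc, h]; ring

variable {B} in
theorem disc_pos_of_incoming {a : ι} {Z : X × X} (h : B.q a Z.1 Z.1 = B.r a ^ 2)
    (h' : B.q a Z.1 Z.2 ≠ 0) : 0 < B.disc a Z := by
  rw [disc_eq_of_mem h]; positivity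

variable {B} in
theorem entry_eq_zero {a : ι} {Z : X × X} (h : B.q a Z.1 Z.1 = B.r a ^ 2)
    (h' : B.q a Z.1 Z.2 < 0) : B.entry a Z = 0 := by
  rw [entry, disc_eq_of_mem h, Real.sqrt_sq_eq_abs, abs_of_neg h', sub_self, zero_div]

variable {B} in
theorem bounce_of_incoming {a : ι} {Z : X × X} (h : B.q a Z.1 Z.1 = B.r a ^ 2)
    (h' : B.q a Z.1 Z.2 < 0) : B.bounce a Z = B.reflect a Z := by
  rw [bounce, if_pos (disc_pos_of_incoming h h'.ne), entry_eq_zero h h']; simp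

-- A state stands for the line through it, with a clock. A shift of the clock shifts the entry time,
-- and the two drifts in `bounce` cancel this shift.
@[simp] theorem bounce_drift (a : ι) (t : ℝ) (Z : X × X) :
    B.bounce a (drift t Z) = drift t (B.bounce a Z) := by
  unfold bounce
  rw [disc_drift]
  split_ifs with h
  · rw [entry_drift h]
    simp only [drift_drift, sub_add_cancel]
    congr 1; ring
  · rfl

theorem reflect_rev (a : ι) (Z : X × X) : B.reflect a (rev Z) = rev (B.reflect a Z) := by
  refine Prod.ext rfl ?_
  simp only [reflect_snd, rev_fst, rev_snd, map_neg]
  module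

/-- The reversed outgoing line enters the cylinder at the same point, where `reflect` is an
involution; lines that miss the cylinder are fixed. So a bounce has an inverse of the same
regularity. -/
theorem rev_bounce_rev_bounce (a : ι) (Z : X × X) :
    rev (B.bounce a (rev (B.bounce a Z))) = Z := by
  by_cases h : 0 < B.disc a Z
  · set τ := B.entry a Z
    set W := drift τ Z with hW
    have h1 : B.q a W.1 W.1 = B.r a ^ 2 := q_entry h
    have h2 : B.q a W.1 W.2 < 0 := q_entry_vel_neg h
    have e1 : B.bounce a Z = drift (-τ) (B.reflect a W) := by rw [bounce, if_pos h]
    have e2 : B.bounce a (rev (B.reflect a W)) = rev W := by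
      rw [bounce_of_incoming, reflect_rev, B.reflect_reflect h1]
      · exact h1
      · rw [rev_fst, reflect_fst, rev_snd, map_neg, B.q_reflect h1, neg_neg]; exact h2
    rw [e1, rev_drift, neg_neg, bounce_drift, e2, rev_drift, rev_rev, hW, drift_drift,
      neg_add_cancel, drift_zero]
  · have e : B.bounce a Z = Z := if_neg h
    rw [e, bounce, disc_rev, if_neg h, rev_rev]

/-! ### Words in the bounces and the time reversal -/

/-- A bounce, or the time reversal. -/
noncomputable def letter : Option ι → X × X → X × X
  | none => rev
  | some a => B.bounce a

/-- The composition of letters, the first one applied first. -/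
noncomputable def word : List (Option ι) → X × X → X × X
  | [], Z => Z
  | o :: w, Z => word w (B.letter o Z)

@[simp] theorem word_nil (Z : X × X) : B.word [] Z = Z := rfl
@[simp] theorem word_cons (o : Option ι) (w : List (Option ι)) (Z : X × X) :
    B.word (o :: w) Z = B.word w (B.letter o Z) := rfl

theorem word_append (w w' : List (Option ι)) (Z : X × X) :
    B.word (w ++ w') Z = B.word w' (B.word w Z) := by
  induction w generalizing Z with
  | nil => rfl
  | cons o w ih => simp [ih]

theorem exists_word_drift (w : List (Option ι)) (t : ℝ) :
    ∃ t', ∀ Z, B.word w (drift t Z) = drift t' (B.word w Z) := by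
  induction w generalizing t with
  | nil => exact ⟨t, fun Z => rfl⟩
  | cons o w ih =>
    cases o with
    | none =>
      obtain ⟨t', h⟩ := ih (-t)
      exact ⟨t', fun Z => by simp only [word_cons, letter, rev_drift, h]⟩
    | some a =>
      obtain ⟨t', h⟩ := ih t
      exact ⟨t', fun Z => by simp only [word_cons, letter, bounce_drift, h]⟩

/-- Lines that graze a cylinder, or enter one while they meet the boundary of another. -/
def bad : Set (X × X) :=
  {Z | ∃ a, B.disc a Z = 0 ∨ ∃ b, b ≠ a ∧ 0 < B.disc a Z ∧
    B.q b (drift (B.entry a Z) Z).1 (drift (B.entry a Z) Z).1 = B.r b ^ 2}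

theorem drift_mem_bad {t : ℝ} {Z : X × X} : drift t Z ∈ B.bad ↔ Z ∈ B.bad := by
  simp only [bad, mem_ofPred_eq, disc_drift]
  refine exists_congr fun a => or_congr_right (exists_congr fun b => and_congr_right fun _ =>
    and_congr_right fun h => ?_)
  rw [entry_drift h]; simp

/-- States no successor or predecessor of which is bad. -/
def regular : Set (X × X) := {Z | ∀ w, B.word w Z ∉ B.bad}

variable {B} in
theorem notMem_bad_of_regular {Z : X × X} (h : Z ∈ B.regular) : Z ∉ B.bad := h []

variable {B} in
theorem word_mem_regular {Z : X × X} (h : Z ∈ B.regular) (w : List (Option ι)) :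
    B.word w Z ∈ B.regular := fun w' => by
  rw [← word_append]; exact h _

theorem drift_mem_regular {t : ℝ} {Z : X × X} : drift t Z ∈ B.regular ↔ Z ∈ B.regular := by
  refine forall_congr' fun w => not_congr ?_
  obtain ⟨t', h⟩ := B.exists_word_drift w t
  rw [h, drift_mem_bad]

/-! ### Null sets -/

section Null

variable [FiniteDimensional ℝ X] [MeasurableSpace X] [BorelSpace X] [SecondCountableTopology X]
  (μ : Measure (X × X)) [μ.IsAddHaarMeasure]

theorem continuous_q (a : ι) : Continuous fun z : X × X => B.q a z.1 z.2 := (B.q a).continuous₂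

theorem continuous_disc (a : ι) : Continuous (B.disc a) := by
  have h := B.continuous_q a
  have h1 : Continuous fun Z : X × X => B.q a Z.2 Z.2 := h.comp (continuous_snd.prodMk continuous_snd)
  have h2 : Continuous fun Z : X × X => B.q a Z.1 Z.1 := h.comp (continuous_fst.prodMk continuous_fst)
  unfold disc; fun_prop

theorem continuous_reflect (a : ι) : Continuous (B.reflect a) := by
  have h := B.continuous_q a
  unfold reflect; fun_prop

theorem measurable_entry (a : ι) : Measurable (B.entry a) := by
  have h := (B.continuous_q a).measurable
  have h1 : Measurable fun Z : X × X => B.q a Z.2 Z.2 := h.comp (measurable_snd.prodMk measurable_snd)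
  have h3 := (B.continuous_disc a).measurable
  unfold entry; fun_prop

theorem measurable_bounce (a : ι) : Measurable (B.bounce a) := by
  classical
  unfold bounce
  refine Measurable.ite (measurableSet_lt measurable_const (B.continuous_disc a).measurable) ?_
    measurable_id
  have h1 : Measurable fun Z : X × X => drift (B.entry a Z) Z :=
    continuous_drift_uncurry.measurable.comp ((B.measurable_entry a).prodMk measurable_id)
  exact continuous_drift_uncurry.measurable.comp
    ((B.measurable_entry a).neg.prodMk ((B.continuous_reflect a).measurable.comp h1))

theorem measurable_letter (o : Option ι) : Measurable (B.letter o) := by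
  cases o with
  | none => exact continuous_rev.measurable
  | some a => exact B.measurable_bounce a

theorem measurable_word (w : List (Option ι)) : Measurable (B.word w) := by
  induction w with
  | nil => exact measurable_id
  | cons o w ih => exact ih.comp (B.measurable_letter o)

/-- The square root and the denominator in `entry` are the only obstructions, and both are positive
here. -/
theorem differentiableAt_bounce {a : ι} {Z : X × X} (h : 0 < B.disc a Z) :
    DifferentiableAt ℝ (B.bounce a) Z := by
  have hq0 : Differentiable ℝ fun Z : X × X => B.q a Z.1 Z.2 := by fun_prop
  have hq1 : Differentiable ℝ fun Z : X × X => B.q a Z.2 Z.2 := by fun_prop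
  have hq2 : Differentiable ℝ fun Z : X × X => B.q a Z.1 Z.1 := by fun_prop
  have hd : Differentiable ℝ (B.disc a) := by unfold disc; fun_prop
  have hs : DifferentiableAt ℝ (fun Z => √(B.disc a Z)) Z := (hd Z).sqrt h.ne'
  have he : DifferentiableAt ℝ (B.entry a) Z := by
    have hv := (q_vel_pos h).ne'
    unfold entry
    fun_prop (disch := assumption)
  have hr : Differentiable ℝ (B.reflect a) := by unfold reflect; fun_prop
  have hdr : Differentiable ℝ fun p : ℝ × (X × X) => drift p.1 p.2 := by unfold drift; fun_prop
  have h1 : DifferentiableAt ℝ (fun Z => drift (B.entry a Z) Z) Z :=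
    (hdr (B.entry a Z, Z)).comp (f := fun Z => (B.entry a Z, Z)) Z
      (he.prodMk differentiableAt_id)
  have h2 : DifferentiableAt ℝ (fun Z => B.reflect a (drift (B.entry a Z) Z)) Z :=
    (hr _).comp (f := fun Z => drift (B.entry a Z) Z) Z h1
  have h3 : DifferentiableAt ℝ (fun Z => drift (-(B.entry a Z))
      (B.reflect a (drift (B.entry a Z) Z))) Z :=
    (hdr (-(B.entry a Z), _)).comp
      (f := fun Z => (-(B.entry a Z), B.reflect a (drift (B.entry a Z) Z))) Z (he.neg.prodMk h2)
  refine h3.congr_of_eventuallyEq ?_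
  filter_upwards [(B.continuous_disc a).continuousAt.eventually (lt_mem_nhds h)] with Y hY
  exact if_pos hY

variable {μ} in
-- Where a bounce acts, it is undone by reversal, bounce and reversal, which is differentiable there
-- and so maps null sets to null sets. Elsewhere the bounce is the identity. No Jacobian has to be
-- computed.
theorem measure_letter_preimage_eq_zero (o : Option ι) {N : Set (X × X)} (hN : μ N = 0) :
    μ (B.letter o ⁻¹' N) = 0 := by
  cases o with
  | none =>
    have : (rev : X × X → X × X) ⁻¹' N = rev '' N :=
      (congrFun (image_eq_preimage_of_inverse rev_rev rev_rev) N).symm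
    change μ (rev ⁻¹' N) = 0
    rw [this]
    exact addHaar_image_eq_zero_of_differentiableOn_of_addHaar_eq_zero μ
      differentiable_rev.differentiableOn hN
  | some a =>
    change μ (B.bounce a ⁻¹' N) = 0
    have hsub : B.bounce a ⁻¹' N ⊆ N ∪
        (fun Z => rev (B.bounce a (rev Z))) '' (N ∩ {Z | 0 < B.disc a Z}) := by
      intro Z hZ
      by_cases h : 0 < B.disc a Z
      · refine Or.inr ⟨B.bounce a Z, ⟨hZ, ?_⟩, B.rev_bounce_rev_bounce a Z⟩
        have h1 : B.bounce a Z = drift (-(B.entry a Z)) (B.reflect a (drift (B.entry a Z) Z)) :=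
          if_pos h
        rw [mem_ofPred_eq, h1, disc_drift]
        refine disc_pos_of_incoming (q_entry h) ?_
        rw [reflect_fst, B.q_reflect (q_entry h)]
        exact neg_ne_zero.2 (q_entry_vel_neg h).ne
      · have h1 : B.bounce a Z = Z := if_neg h
        rw [mem_preimage, h1] at hZ
        exact Or.inl hZ
    refine measure_mono_null hsub (measure_union_null hN ?_)
    refine addHaar_image_eq_zero_of_differentiableOn_of_addHaar_eq_zero μ ?_
      (measure_mono_null inter_subset_left hN)
    intro Z hZ
    have h0 : 0 < B.disc a (rev Z) := by rw [disc_rev]; exact hZ.2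
    exact ((differentiable_rev _).comp Z
      ((B.differentiableAt_bounce h0).comp Z (differentiable_rev Z))).differentiableWithinAt

variable {μ} in
theorem measure_word_preimage_eq_zero (w : List (Option ι)) {N : Set (X × X)} (hN : μ N = 0) :
    μ (B.word w ⁻¹' N) = 0 := by
  induction w with
  | nil => exact hN
  | cons o w ih => exact B.measure_letter_preimage_eq_zero o ih

variable {μ} in
theorem measure_drift_preimage_eq_zero (t : ℝ) {N : Set (X × X)} (hN : μ N = 0) :
    μ (drift t ⁻¹' N) = 0 := by
  have : (drift t : X × X → X × X) ⁻¹' N = drift (-t) '' N :=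
    (congrFun (image_eq_preimage_of_inverse (f := drift (-t)) (g := drift t)
      (fun Z => by simp) (fun Z => by simp)) N).symm
  rw [this]
  exact addHaar_image_eq_zero_of_differentiableOn_of_addHaar_eq_zero μ
    (differentiable_drift _).differentiableOn hN

variable {μ} in
-- There are countably many words. With `bad` in the role of `N`, almost every state is regular.
theorem ae_forall_word_notMem [Countable ι] {N : Set (X × X)} (hN : μ N = 0) :
    ∀ᵐ Z ∂μ, ∀ w, B.word w Z ∉ N :=
  ae_all_iff.2 fun w => measure_eq_zero_iff_ae_notMem.1 (B.measure_word_preimage_eq_zero w hN)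

end Null

end CylinderFamily

namespace CylinderFamily

variable {ι X : Type} [NormedAddCommGroup X] [NormedSpace ℝ X] (B : CylinderFamily ι X)

/-! ### Billiard paths -/

/-- `W'` is the state from which the motion goes on after the arrival at `W`. -/
def Passes (W W' : X × X) : Prop :=
  ((∀ a, B.r a ^ 2 < B.q a W.1 W.1) ∧ W' = W) ∨
    ∃ a, B.q a W.1 W.1 = B.r a ^ 2 ∧ B.q a W.1 W.2 < 0 ∧
      (∀ b, b ≠ a → B.r b ^ 2 < B.q b W.1 W.1) ∧ W' = B.reflect a W

/-- Billiard paths, defined for all times, with simple non-grazing collisions. -/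
def IsPath (γ : ℝ → X × X) : Prop :=
  ∀ t : ℝ, ∃ W, B.Passes (γ t) W ∧ ∃ δ > 0, ∀ h ∈ Ioc (0 : ℝ) δ,
    γ (t - h) = drift (-h) (γ t) ∧ γ (t + h) = drift h W

/-- The motion can start freely. -/
def Released (W : X × X) : Prop :=
  ∀ a, B.r a ^ 2 < B.q a W.1 W.1 ∨ B.q a W.1 W.1 = B.r a ^ 2 ∧ 0 < B.q a W.1 W.2

variable {B} in
theorem Passes.fst_eq {W W' : X × X} (h : B.Passes W W') : W'.1 = W.1 := by
  rcases h with ⟨-, rfl⟩ | ⟨a, -, -, -, rfl⟩ <;> rfl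

variable {B} in
theorem Passes.released {W W' : X × X} (h : B.Passes W W') : B.Released W' := by
  rcases h with ⟨h, rfl⟩ | ⟨a, h1, h2, h3, rfl⟩
  · exact fun a => Or.inl (h a)
  · intro b
    by_cases hb : b = a
    · subst hb
      refine Or.inr ⟨h1, ?_⟩
      rw [reflect_fst, B.q_reflect h1]; linarith
    · exact Or.inl (h3 b hb)

variable {B} in
theorem Passes.rev {W W' : X × X} (h : B.Passes W W') : B.Passes (rev W') (rev W) := by
  rcases h with ⟨h, rfl⟩ | ⟨a, h1, h2, h3, rfl⟩
  · exact Or.inl ⟨h, rfl⟩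
  · refine Or.inr ⟨a, h1, ?_, h3, ?_⟩
    · rw [rev_snd, rev_fst, reflect_fst, map_neg, B.q_reflect h1, neg_neg]; exact h2
    · rw [reflect_rev, B.reflect_reflect h1]

variable {B} in
theorem Passes.exists_word {W W' : X × X} (h : B.Passes W W') : ∃ w, W' = B.word w W := by
  rcases h with ⟨-, rfl⟩ | ⟨a, h1, h2, -, rfl⟩
  · exact ⟨[], rfl⟩
  · exact ⟨[some a], (bounce_of_incoming h1 h2).symm⟩

variable {B} in
-- Along a line, `q - r²` is a quadratic polynomial in time. If it is nonpositive at a time `h > 0`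
-- after a released start, then it starts with a negative slope and a positive value, and its
-- smaller root, the entry time, lies in `(0, h]`.
theorem Released.lt_q_of_entry {a : ι} {W : X × X} (hW : B.Released W) (hd : B.disc a W ≠ 0)
    {h : ℝ} (hh : 0 < h) (he : ¬(0 < B.disc a W ∧ 0 < B.entry a W ∧ B.entry a W ≤ h)) :
    B.r a ^ 2 < B.q a (drift h W).1 (drift h W).1 := by
  by_contra! hf
  rw [q_line] at hf
  have ha := (B.q_nonneg a W.2).lt_of_ne' fun h0 => hd (by
    have := B.q_sq_le a W.1 W.2
    rw [h0, mul_zero] at this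
    have : B.q a W.1 W.2 = 0 := pow_eq_zero_iff two_ne_zero |>.1 (le_antisymm this (sq_nonneg _))
    rw [disc, h0, this]; ring)
  have hdisc : B.disc a W = B.q a W.1 W.2 ^ 2 - B.q a W.2 W.2 * (B.q a W.1 W.1 - B.r a ^ 2) := rfl
  set α := B.q a W.2 W.2
  set β := B.q a W.1 W.2
  set c := B.q a W.1 W.1
  have h1 : (α * h + β) ^ 2 ≤ B.disc a W := by nlinarith
  have h2 : 0 < B.disc a W := lt_of_le_of_ne ((sq_nonneg _).trans h1) (Ne.symm hd)
  have h3 := Real.sq_sqrt h2.le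
  have h4 : 0 ≤ √(B.disc a W) := Real.sqrt_nonneg _
  set s := √(B.disc a W)
  have h5 : -s ≤ α * h + β := (abs_le.1 (abs_le_of_sq_le_sq (h3 ▸ h1) h4)).1
  have hβ : β < 0 := by
    by_contra! hβ
    rcases hW a with hc | ⟨hc, hc'⟩
    · nlinarith [mul_nonneg hh.le hβ, mul_nonneg (sq_nonneg h) ha.le]
    · have hc' : 0 < β := hc'
      nlinarith [mul_pos hh hc', mul_nonneg (sq_nonneg h) ha.le]
  have hc : B.r a ^ 2 < c := by
    rcases hW a with hc | ⟨-, hc'⟩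
    · exact hc
    · exact absurd hc' (not_lt.2 hβ.le)
  refine he ⟨h2, div_pos ?_ ha, ?_⟩
  · have : s < -β := by
      refine lt_of_pow_lt_pow_left₀ 2 (by linarith) ?_
      rw [h3, hdisc]; nlinarith
    linarith
  · change (-β - s) / α ≤ h
    rw [div_le_iff₀ ha]; linarith

variable [Fintype ι]

/-- The line `s.2` enters the cylinder after the time `s.1`. -/
def Hits (a : ι) (s : ℝ × (X × X)) : Prop := 0 < B.disc a s.2 ∧ s.1 < B.entry a s.2

open Classical in
/-- The time of the next collision after the time `s.1`, but at most `s.1 + 1`. -/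
noncomputable def nextTime (s : ℝ × (X × X)) : ℝ :=
  ⨅ o : Option ι, o.elim (s.1 + 1) fun a => if B.Hits a s then min (s.1 + 1) (B.entry a s.2) else s.1 + 1

open Classical in
/-- The line along which the motion goes on after `nextTime`. -/
noncomputable def nextLine (s : ℝ × (X × X)) : X × X :=
  s.2 + ∑ a, if B.Hits a s ∧ B.entry a s.2 = B.nextTime s then B.bounce a s.2 - s.2 else 0

variable {B} in
theorem Hits.nextTime_le {a : ι} {s : ℝ × (X × X)} (h : B.Hits a s) :
    B.nextTime s ≤ B.entry a s.2 := by
  refine (ciInf_le (finite_range _).bddBelow (some a)).trans ?_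
  simp [h]

theorem nextTime_eq (s : ℝ × (X × X)) :
    B.nextTime s = s.1 + 1 ∨ ∃ a, B.Hits a s ∧ B.entry a s.2 = B.nextTime s := by
  classical
  obtain ⟨o, ho⟩ := exists_eq_ciInf_of_finite (f := fun o : Option ι => o.elim (s.1 + 1) fun a =>
    if B.Hits a s then min (s.1 + 1) (B.entry a s.2) else s.1 + 1)
  change _ = B.nextTime s at ho
  rcases o with _ | a
  · exact Or.inl ho.symm
  · simp only [Option.elim_some] at ho
    split_ifs at ho with h
    · rcases min_choice (s.1 + 1) (B.entry a s.2) with h' | h'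
      · exact Or.inl (by rw [← ho, h'])
      · exact Or.inr ⟨a, h, by rw [← ho, h']⟩
    · exact Or.inl ho.symm

theorem lt_nextTime (s : ℝ × (X × X)) : s.1 < B.nextTime s := by
  rcases B.nextTime_eq s with h | ⟨a, h, h'⟩
  · rw [h]; linarith
  · rw [← h']; exact h.2

variable {B} in
theorem Released.lt_q_of_lt_nextTime {s : ℝ × (X × X)} (hW : B.Released (drift s.1 s.2))
    (hb : s.2 ∉ B.bad) {a : ι} {h : ℝ} (h1 : s.1 < h) (h2 : B.Hits a s → h < B.entry a s.2) :
    B.r a ^ 2 < B.q a (drift h s.2).1 (drift h s.2).1 := by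
  have hd : B.disc a s.2 ≠ 0 := fun h0 => hb ⟨a, Or.inl h0⟩
  have := hW.lt_q_of_entry (a := a) (h := h - s.1) (by rwa [disc_drift]) (by linarith) ?_
  · simpa using this
  · rintro ⟨h3, h4, h5⟩
    rw [disc_drift] at h3
    rw [entry_drift h3] at h4 h5
    have := h2 ⟨h3, by linarith⟩
    linarith

variable {B} in
-- Outside `bad`, no other cylinder is touched at the moment of an entry, so at most one term of the
-- sum in `nextLine` is nonzero.
theorem Released.step {s : ℝ × (X × X)} (hW : B.Released (drift s.1 s.2)) (hb : s.2 ∉ B.bad) :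
    ((∀ a, B.r a ^ 2 < B.q a (drift (B.nextTime s) s.2).1 (drift (B.nextTime s) s.2).1) ∧
      B.nextLine s = s.2 ∧ B.nextTime s = s.1 + 1) ∨
    ∃ a, B.q a (drift (B.nextTime s) s.2).1 (drift (B.nextTime s) s.2).1 = B.r a ^ 2 ∧
      B.q a (drift (B.nextTime s) s.2).1 (drift (B.nextTime s) s.2).2 < 0 ∧
      (∀ b, b ≠ a →
        B.r b ^ 2 < B.q b (drift (B.nextTime s) s.2).1 (drift (B.nextTime s) s.2).1) ∧
      B.nextLine s = B.bounce a s.2 ∧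
      drift (B.nextTime s) (B.nextLine s) = B.reflect a (drift (B.nextTime s) s.2) := by
  classical
  by_cases hex : ∃ a, B.Hits a s ∧ B.entry a s.2 = B.nextTime s
  · obtain ⟨a, ha, hat⟩ := hex
    have hother : ∀ b, b ≠ a → ¬(B.Hits b s ∧ B.entry b s.2 = B.nextTime s) := by
      rintro b hba ⟨h1, h2⟩
      exact hb ⟨a, Or.inr ⟨b, hba, ha.1, by rw [hat, ← h2]; exact q_entry h1.1⟩⟩
    have hline : B.nextLine s = B.bounce a s.2 := by
      rw [nextLine, Finset.sum_eq_single a (fun b _ hba => if_neg (hother b hba)) (by simp),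
        if_pos ⟨ha, hat⟩]
      abel
    refine Or.inr ⟨a, ?_, ?_, fun b hba => ?_, hline, ?_⟩
    · rw [← hat]; exact q_entry ha.1
    · rw [← hat]; exact q_entry_vel_neg ha.1
    · exact hW.lt_q_of_lt_nextTime hb (B.lt_nextTime s) fun h =>
        lt_of_le_of_ne h.nextTime_le fun h' => hother b hba ⟨h, h'.symm⟩
    · rw [hline, bounce, if_pos ha.1, ← hat]; simp
  · refine Or.inl ⟨fun a => ?_, ?_, (B.nextTime_eq s).resolve_right hex⟩
    · exact hW.lt_q_of_lt_nextTime hb (B.lt_nextTime s) fun h =>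
        lt_of_le_of_ne h.nextTime_le fun h' => hex ⟨a, h, h'.symm⟩
    · rw [nextLine, Finset.sum_eq_zero fun a _ => if_neg fun h => hex ⟨a, h⟩, add_zero]

/-- The times of the collisions of the motion that starts freely at `Z`, and the lines after them. -/
noncomputable def events (Z : X × X) : ℕ → ℝ × (X × X)
  | 0 => (0, Z)
  | n + 1 => (B.nextTime (events Z n), B.nextLine (events Z n))

theorem events_strictMono (Z : X × X) : StrictMono fun n => (B.events Z n).1 :=
  strictMono_nat_of_lt_succ fun n => B.lt_nextTime (B.events Z n)

theorem events_invariant {Z : X × X} (hZ : B.Released Z) (hr : Z ∈ B.regular) (n : ℕ) :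
    B.Released (drift (B.events Z n).1 (B.events Z n).2) ∧ (B.events Z n).2 ∈ B.regular ∧
      ∃ w, (B.events Z n).2 = B.word w Z := by
  induction n with
  | zero => exact ⟨by simpa [events] using hZ, hr, [], rfl⟩
  | succ n ih =>
    obtain ⟨h1, h2, w, hw⟩ := ih
    rcases h1.step (notMem_bad_of_regular h2) with ⟨h3, h4, -⟩ | ⟨a, h3, h4, h5, h6, h7⟩
    · simp only [events]
      rw [h4]
      exact ⟨fun a => Or.inl (h3 a), h2, w, hw⟩
    · simp only [events]
      refine ⟨?_, ?_, w ++ [some a], ?_⟩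
      · exact Passes.released (Or.inr ⟨a, h3, h4, h5, h7⟩)
      · rw [h6]; exact word_mem_regular h2 [some a]
      · rw [h6, word_append, ← hw]; rfl

theorem events_passes {Z : X × X} (hZ : B.Released Z) (hr : Z ∈ B.regular) (n : ℕ) :
    B.Passes (drift (B.events Z (n + 1)).1 (B.events Z n).2)
      (drift (B.events Z (n + 1)).1 (B.events Z (n + 1)).2) := by
  obtain ⟨h1, h2, -⟩ := B.events_invariant hZ hr n
  rcases h1.step (notMem_bad_of_regular h2) with ⟨h3, h4, -⟩ | ⟨a, h3, h4, h5, h6, h7⟩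
  · exact Or.inl ⟨h3, by simp only [events, h4]⟩
  · exact Or.inr ⟨a, h3, h4, h5, h7⟩

theorem events_interior {Z : X × X} (hZ : B.Released Z) (hr : Z ∈ B.regular) (n : ℕ) {u : ℝ}
    (h1 : (B.events Z n).1 < u) (h2 : u < (B.events Z (n + 1)).1) (a : ι) :
    B.r a ^ 2 < B.q a (drift u (B.events Z n).2).1 (drift u (B.events Z n).2).1 := by
  obtain ⟨h3, h4, -⟩ := B.events_invariant hZ hr n
  exact h3.lt_q_of_lt_nextTime (notMem_bad_of_regular h4) h1 fun h => h2.trans_le h.nextTime_le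

/-- The cap of one time unit in `nextTime` keeps the sequence of events infinite when no further
collision follows; capped steps are the collision-free alternative in `tendsto_atTop_of_collisions`.
-/
theorem events_tendsto [CompleteSpace X] {Z : X × X} (hZ : B.Released Z) (hr : Z ∈ B.regular) :
    Tendsto (fun n => (B.events Z n).1) atTop atTop := by
  refine B.tendsto_atTop_of_collisions (p := fun n => (drift (B.events Z n).1 (B.events Z n).2).1)
    (v := fun n => (B.events Z n).2.2) (fun n => B.lt_nextTime _) (fun n => ?_) fun n => ?_
  · rw [(B.events_passes hZ hr n).fst_eq]
    simp only [drift]; module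
  · obtain ⟨h1, h2, -⟩ := B.events_invariant hZ hr n
    have h0 := (B.events_passes hZ hr n).fst_eq
    rw [h0]
    rcases h1.step (notMem_bad_of_regular h2) with ⟨h3, h4, h5⟩ | ⟨a, h3, h4, h5, h6, h7⟩
    · exact Or.inl ⟨by simp only [events, h4], h5⟩
    · exact Or.inr ⟨a, h3, h4, (congrArg Prod.snd h7 :)⟩

open Classical in
/-- The motion that starts freely at `Z`; at collision times, it takes the incoming value. -/
noncomputable def fwd (p : ℝ × (X × X)) : X × X :=
  -- The second alternative only makes the search total where the event times stay bounded; regular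
  -- released starts never need it.
  drift p.1 (B.events p.2 (Nat.find (p := fun n => p.1 ≤ (B.events p.2 (n + 1)).1 ∨
    ∀ m, (B.events p.2 (m + 1)).1 < p.1) (by
      by_cases h : ∀ m, (B.events p.2 (m + 1)).1 < p.1
      · exact ⟨0, Or.inr h⟩
      · push Not at h
        exact h.imp fun n hn => Or.inl hn))).2

open Classical in
/-- The motion that starts freely at `Z`; at collision times, it takes the outgoing value. -/
noncomputable def fwdRight (p : ℝ × (X × X)) : X × X :=
  drift p.1 (B.events p.2 (Nat.find (p := fun n => p.1 < (B.events p.2 (n + 1)).1 ∨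
    ∀ m, (B.events p.2 (m + 1)).1 ≤ p.1) (by
      by_cases h : ∀ m, (B.events p.2 (m + 1)).1 ≤ p.1
      · exact ⟨0, Or.inr h⟩
      · push Not at h
        exact h.imp fun n hn => Or.inl hn))).2

theorem fwd_eq {Z : X × X} {u : ℝ} {n : ℕ} (h1 : n = 0 ∨ (B.events Z n).1 < u)
    (h2 : u ≤ (B.events Z (n + 1)).1) : B.fwd (u, Z) = drift u (B.events Z n).2 := by
  classical
  unfold fwd
  congr 3
  rw [Nat.find_eq_iff]
  refine ⟨Or.inl h2, fun m hm h => ?_⟩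
  rcases h with h | h
  · rcases h1 with h1 | h1
    · omega
    · exact absurd (h.trans ((B.events_strictMono Z).monotone hm)) (not_le.2 h1)
  · exact absurd h2 (not_le.2 (h n))

theorem fwdRight_eq {Z : X × X} {u : ℝ} {n : ℕ} (h1 : n = 0 ∨ (B.events Z n).1 ≤ u)
    (h2 : u < (B.events Z (n + 1)).1) : B.fwdRight (u, Z) = drift u (B.events Z n).2 := by
  classical
  unfold fwdRight
  congr 3
  rw [Nat.find_eq_iff]
  refine ⟨Or.inl h2, fun m hm h => ?_⟩
  rcases h with h | h
  · rcases h1 with h1 | h1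
    · omega
    · exact absurd (h.trans_le ((B.events_strictMono Z).monotone hm)) (not_lt.2 h1)
  · exact absurd h2 (not_lt.2 (h n))

theorem exists_events_between {Z : X × X} (ht : Tendsto (fun n => (B.events Z n).1) atTop atTop)
    {u : ℝ} (hu : 0 < u) : ∃ n, (B.events Z n).1 < u ∧ u ≤ (B.events Z (n + 1)).1 := by
  classical
  obtain ⟨n, hn⟩ := (ht.eventually_ge_atTop u).exists
  have hex : ∃ n, u ≤ (B.events Z n).1 := ⟨n, hn⟩
  have h0 : Nat.find hex ≠ 0 := fun h0 => by
    have := Nat.find_spec hex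
    rw [h0] at this
    exact absurd this (not_le.2 hu)
  obtain ⟨k, hk⟩ := Nat.exists_eq_succ_of_ne_zero h0
  refine ⟨k, not_le.1 (Nat.find_min hex (by omega)), ?_⟩
  have := Nat.find_spec hex
  rwa [hk] at this

theorem exists_events_between' {Z : X × X} (ht : Tendsto (fun n => (B.events Z n).1) atTop atTop)
    {u : ℝ} (hu : 0 ≤ u) : ∃ n, (B.events Z n).1 ≤ u ∧ u < (B.events Z (n + 1)).1 := by
  classical
  obtain ⟨n, hn⟩ := (ht.eventually_gt_atTop u).exists
  have hex : ∃ n, u < (B.events Z n).1 := ⟨n, hn⟩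
  have h0 : Nat.find hex ≠ 0 := fun h0 => by
    have := Nat.find_spec hex
    rw [h0] at this
    exact absurd this (not_lt.2 hu)
  obtain ⟨k, hk⟩ := Nat.exists_eq_succ_of_ne_zero h0
  refine ⟨k, not_lt.1 (Nat.find_min hex (by omega)), ?_⟩
  have := Nat.find_spec hex
  rwa [hk] at this

variable [CompleteSpace X]

/-- Between events one line is followed; at an event time `events_passes` leads to the next line.
The bound `δ < u` keeps both sides within the positive times of `path`. -/
theorem fwd_spec {Z : X × X} (hZ : B.Released Z) (hr : Z ∈ B.regular) {u : ℝ} (hu : 0 < u) :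
    ∃ W, B.Passes (B.fwd (u, Z)) W ∧ ∃ δ > 0, δ < u ∧ ∀ h ∈ Ioc (0 : ℝ) δ,
      B.fwd (u - h, Z) = drift (-h) (B.fwd (u, Z)) ∧ B.fwd (u + h, Z) = drift h W := by
  have ht := B.events_tendsto hZ hr
  have hm := B.events_strictMono Z
  obtain ⟨n, h1, h2⟩ := B.exists_events_between ht hu
  have ht0 : 0 ≤ (B.events Z n).1 := hm.monotone (Nat.zero_le n)
  have e0 := B.fwd_eq (Or.inr h1) h2
  have eL : ∀ h, 0 < h → h < u - (B.events Z n).1 →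
      B.fwd (u - h, Z) = drift (-h) (B.fwd (u, Z)) := fun h h3 h4 => by
    rw [e0, drift_drift, B.fwd_eq (n := n) (Or.inr (by linarith)) (by linarith)]
    congr 1; ring
  rcases h2.lt_or_eq with h2' | h2'
  · refine ⟨B.fwd (u, Z), Or.inl ⟨?_, rfl⟩,
      min ((u - (B.events Z n).1) / 2) ((B.events Z (n + 1)).1 - u),
      lt_min (by linarith) (by linarith), ?_, ?_⟩
    · rw [e0]; exact B.events_interior hZ hr n h1 h2'
    · exact (min_le_left _ _).trans_lt (by linarith)
    · rintro h ⟨h3, h4⟩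
      have h5 := h4.trans (min_le_left _ _)
      have h6 := h4.trans (min_le_right _ _)
      refine ⟨eL h h3 (by linarith), ?_⟩
      rw [e0, drift_drift, B.fwd_eq (n := n) (Or.inr (by linarith)) (by linarith), add_comm]
  · have h7 : (B.events Z (n + 1)).1 < (B.events Z (n + 2)).1 := hm (Nat.lt_succ_self (n + 1))
    refine ⟨drift u (B.events Z (n + 1)).2, ?_,
      min ((u - (B.events Z n).1) / 2) ((B.events Z (n + 2)).1 - u),
      lt_min (by linarith) (by linarith), ?_, ?_⟩
    · rw [e0, h2']; exact B.events_passes hZ hr n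
    · exact (min_le_left _ _).trans_lt (by linarith)
    · rintro h ⟨h3, h4⟩
      have h5 := h4.trans (min_le_left _ _)
      have h6 := h4.trans (min_le_right _ _)
      refine ⟨eL h h3 (by linarith), ?_⟩
      rw [drift_drift, B.fwd_eq (n := n + 1) (Or.inr (by linarith))
        (by change u + h ≤ (B.events Z (n + 2)).1; linarith), add_comm]

/-- This version serves the past: time reversal turns outgoing values into incoming ones, which
`path` has to take. -/
theorem fwdRight_spec {Z : X × X} (hZ : B.Released Z) (hr : Z ∈ B.regular) {u : ℝ} (hu : 0 < u) :
    ∃ W, B.Passes W (B.fwdRight (u, Z)) ∧ ∃ δ > 0, δ < u ∧ ∀ h ∈ Ioc (0 : ℝ) δ,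
      B.fwdRight (u + h, Z) = drift h (B.fwdRight (u, Z)) ∧
        B.fwdRight (u - h, Z) = drift (-h) W := by
  have ht := B.events_tendsto hZ hr
  have hm := B.events_strictMono Z
  obtain ⟨n, h1, h2⟩ := B.exists_events_between' ht hu.le
  have e0 := B.fwdRight_eq (Or.inr h1) h2
  have eR : ∀ h, 0 < h → h < (B.events Z (n + 1)).1 - u →
      B.fwdRight (u + h, Z) = drift h (B.fwdRight (u, Z)) := fun h h3 h4 => by
    rw [e0, drift_drift, B.fwdRight_eq (n := n) (Or.inr (by linarith)) (by linarith), add_comm]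
  rcases h1.lt_or_eq with h1' | h1'
  · have ht0 : 0 ≤ (B.events Z n).1 := hm.monotone (Nat.zero_le n)
    refine ⟨B.fwdRight (u, Z), Or.inl ⟨?_, rfl⟩,
      min ((u - (B.events Z n).1) / 2) (((B.events Z (n + 1)).1 - u) / 2),
      lt_min (by linarith) (by linarith), ?_, ?_⟩
    · rw [e0]; exact B.events_interior hZ hr n h1' h2
    · exact (min_le_left _ _).trans_lt (by linarith)
    · rintro h ⟨h3, h4⟩
      have h5 := h4.trans (min_le_left _ _)
      have h6 := h4.trans (min_le_right _ _)
      refine ⟨eR h h3 (by linarith), ?_⟩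
      rw [e0, drift_drift, B.fwdRight_eq (n := n) (Or.inr (by linarith)) (by linarith)]
      congr 1; ring
  · obtain ⟨k, rfl⟩ : ∃ k, n = k + 1 := Nat.exists_eq_succ_of_ne_zero (by
      rintro rfl; exact hu.ne h1')
    have h7 : (B.events Z k).1 < (B.events Z (k + 1)).1 := hm (Nat.lt_succ_self k)
    have ht0 : 0 ≤ (B.events Z k).1 := hm.monotone (Nat.zero_le k)
    refine ⟨drift u (B.events Z k).2, ?_,
      min ((u - (B.events Z k).1) / 2) (((B.events Z (k + 1 + 1)).1 - u) / 2),
      lt_min (by linarith) (by linarith), ?_, ?_⟩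
    · rw [e0, ← h1']; exact B.events_passes hZ hr k
    · exact (min_le_left _ _).trans_lt (by linarith)
    · rintro h ⟨h3, h4⟩
      have h5 := h4.trans (min_le_left _ _)
      have h6 := h4.trans (min_le_right _ _)
      refine ⟨eR h h3 (by linarith), ?_⟩
      rw [drift_drift, B.fwdRight_eq (n := k) (Or.inr (by linarith)) (by linarith)]
      congr 1; ring

omit [CompleteSpace X] in
theorem fwd_near_zero {Z : X × X} {h : ℝ} (h2 : h ≤ (B.events Z 1).1) :
    B.fwd (h, Z) = drift h Z :=
  B.fwd_eq (n := 0) (Or.inl rfl) h2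

omit [CompleteSpace X] in
theorem fwdRight_near_zero {Z : X × X} {h : ℝ} (h2 : h < (B.events Z 1).1) :
    B.fwdRight (h, Z) = drift h Z :=
  B.fwdRight_eq (n := 0) (Or.inl rfl) h2

open Classical in
/-- The path that arrives at `Z` at the time zero and goes on from `Z'`. -/
noncomputable def path (Z' Z : X × X) (u : ℝ) : X × X :=
  if 0 < u then B.fwd (u, Z') else rev (B.fwdRight (-u, rev Z))

omit [CompleteSpace X] in
theorem path_zero (Z' Z : X × X) : B.path Z' Z 0 = Z := by
  have h : (0 : ℝ) < (B.events (rev Z) 1).1 := B.lt_nextTime (0, rev Z)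
  rw [path, if_neg (lt_irrefl _), neg_zero, B.fwdRight_near_zero h, drift_zero, rev_rev]

theorem isPath_path {Z Z' : X × X} (hr : Z ∈ B.regular) (hp : B.Passes Z Z') :
    B.IsPath (B.path Z' Z) := by
  have hr' : Z' ∈ B.regular := by
    obtain ⟨w, rfl⟩ := hp.exists_word; exact word_mem_regular hr w
  have hrr : rev Z ∈ B.regular := word_mem_regular hr [none]
  have hZ' := hp.released
  have hZr := hp.rev.released
  intro t
  rcases lt_trichotomy t 0 with ht | rfl | ht
  · obtain ⟨W, h1, δ, h2, h3, h4⟩ := B.fwdRight_spec hZr hrr (neg_pos.2 ht)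
    have e : B.path Z' Z t = rev (B.fwdRight (-t, rev Z)) := if_neg (not_lt.2 ht.le)
    refine ⟨rev W, ?_, δ, h2, fun h hh => ⟨?_, ?_⟩⟩
    · rw [e]; exact h1.rev
    · rw [e, path, if_neg (by linarith [hh.1]), ← neg_neg (t - h), neg_neg (t - h),
        show -(t - h) = -t + h by ring, (h4 h hh).1, rev_drift]
    · rw [path, if_neg (by linarith [hh.2]), show -(t + h) = -t - h by ring, (h4 h hh).2, rev_drift,
        neg_neg]
  · have h1 : (0 : ℝ) < (B.events (rev Z) 1).1 := B.lt_nextTime (0, rev Z)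
    have h2 : (0 : ℝ) < (B.events Z' 1).1 := B.lt_nextTime (0, Z')
    refine ⟨Z', by rwa [path_zero], min ((B.events (rev Z) 1).1 / 2) (B.events Z' 1).1,
      lt_min (by linarith) h2, fun h hh => ⟨?_, ?_⟩⟩
    · have := hh.2.trans (min_le_left _ _)
      rw [path_zero, path, if_neg (by linarith [hh.1]), zero_sub, neg_neg,
        B.fwdRight_near_zero (by linarith), rev_drift, rev_rev]
    · rw [zero_add, path, if_pos hh.1, B.fwd_near_zero (hh.2.trans (min_le_right _ _))]
  · obtain ⟨W, h1, δ, h2, h3, h4⟩ := B.fwd_spec hZ' hr' ht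
    have e : B.path Z' Z t = B.fwd (t, Z') := if_pos ht
    refine ⟨W, by rwa [e], δ, h2, fun h hh => ⟨?_, ?_⟩⟩
    · rw [e, path, if_pos (by linarith [hh.2]), (h4 h hh).1]
    · rw [path, if_pos (by linarith [hh.1]), (h4 h hh).2]

/-- Finitely many events precede a given time. Null sets can thus be followed under countably many
fixed maps, although the sequence of collisions depends on the state. -/
theorem exists_path_eq_drift_word {Z Z' : X × X} (hr : Z ∈ B.regular) (hp : B.Passes Z Z') (u : ℝ) :
    ∃ w, B.path Z' Z u = drift u (B.word w Z) := by
  have hr' : Z' ∈ B.regular := by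
    obtain ⟨w, rfl⟩ := hp.exists_word; exact word_mem_regular hr w
  have hrr : rev Z ∈ B.regular := word_mem_regular hr [none]
  by_cases hu : 0 < u
  · obtain ⟨n, h1, h2⟩ := B.exists_events_between (B.events_tendsto hp.released hr') hu
    obtain ⟨-, -, w, hw⟩ := B.events_invariant hp.released hr' n
    obtain ⟨w', hw'⟩ := hp.exists_word
    refine ⟨w' ++ w, ?_⟩
    rw [path, if_pos hu, B.fwd_eq (Or.inr h1) h2, hw, word_append, ← hw']
  · obtain ⟨n, h1, h2⟩ := B.exists_events_between' (u := -u)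
      (B.events_tendsto hp.rev.released hrr) (by linarith)
    obtain ⟨-, -, w, hw⟩ := B.events_invariant hp.rev.released hrr n
    refine ⟨none :: (w ++ [none]), ?_⟩
    rw [path, if_neg hu, B.fwdRight_eq (Or.inr h1) h2, hw, rev_drift, neg_neg, word_cons,
      word_append]
    rfl

/-! ### Measurability -/

section Measurability

variable [FiniteDimensional ℝ X] [MeasurableSpace X] [BorelSpace X] [SecondCountableTopology X]

omit [CompleteSpace X]

theorem measurableSet_hits (a : ι) : MeasurableSet {s : ℝ × (X × X) | B.Hits a s} :=
  (measurableSet_lt measurable_const ((B.continuous_disc a).measurable.comp measurable_snd)).inter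
    (measurableSet_lt measurable_fst ((B.measurable_entry a).comp measurable_snd))

theorem measurable_nextTime : Measurable B.nextTime := by
  classical
  unfold nextTime
  refine Measurable.iInf fun o => ?_
  have h1 : Measurable fun s : ℝ × (X × X) => s.1 + 1 := by fun_prop
  cases o with
  | none => exact h1
  | some a =>
    exact Measurable.ite (B.measurableSet_hits a)
      (h1.min ((B.measurable_entry a).comp measurable_snd)) h1

theorem measurable_nextLine : Measurable B.nextLine := by
  classical
  unfold nextLine
  refine measurable_snd.add (Finset.measurable_fun_sum _ fun a _ => Measurable.ite ?_ ?_ ?_)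
  · exact (B.measurableSet_hits a).inter (measurableSet_eq_fun
      ((B.measurable_entry a).comp measurable_snd) B.measurable_nextTime)
  · exact ((B.measurable_bounce a).comp measurable_snd).sub measurable_snd
  · exact measurable_const

theorem measurable_events (n : ℕ) : Measurable fun Z => B.events Z n := by
  induction n with
  | zero => exact measurable_const.prodMk measurable_id
  | succ n ih => exact (B.measurable_nextTime.comp ih).prodMk (B.measurable_nextLine.comp ih)

theorem measurable_fwd : Measurable B.fwd := by
  classical
  unfold fwd
  refine Measurable.find (f := fun n (p : ℝ × (X × X)) => drift p.1 (B.events p.2 n).2)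
    (p := fun n p => p.1 ≤ (B.events p.2 (n + 1)).1 ∨ ∀ m, (B.events p.2 (m + 1)).1 < p.1)
    (fun n => ?_) (fun n => ?_) _
  · exact continuous_drift_uncurry.measurable.comp (measurable_fst.prodMk
      ((B.measurable_events n).snd.comp measurable_snd))
  · have h : MeasurableSet {p : ℝ × (X × X) | ∀ m, (B.events p.2 (m + 1)).1 < p.1} := by
      rw [ofPred_forall]
      exact MeasurableSet.iInter fun m =>
        measurableSet_lt ((B.measurable_events _).fst.comp measurable_snd) measurable_fst
    exact (measurableSet_le measurable_fst
      ((B.measurable_events _).fst.comp measurable_snd)).union h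

theorem measurable_fwdRight : Measurable B.fwdRight := by
  classical
  unfold fwdRight
  refine Measurable.find (f := fun n (p : ℝ × (X × X)) => drift p.1 (B.events p.2 n).2)
    (p := fun n p => p.1 < (B.events p.2 (n + 1)).1 ∨ ∀ m, (B.events p.2 (m + 1)).1 ≤ p.1)
    (fun n => ?_) (fun n => ?_) _
  · exact continuous_drift_uncurry.measurable.comp (measurable_fst.prodMk
      ((B.measurable_events n).snd.comp measurable_snd))
  · have h : MeasurableSet {p : ℝ × (X × X) | ∀ m, (B.events p.2 (m + 1)).1 ≤ p.1} := by
      rw [ofPred_forall]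
      exact MeasurableSet.iInter fun m =>
        measurableSet_le ((B.measurable_events _).fst.comp measurable_snd) measurable_fst
    exact (measurableSet_lt measurable_fst
      ((B.measurable_events _).fst.comp measurable_snd)).union h

theorem measurable_path : Measurable fun p : ℝ × (X × X) => B.path p.2 p.2 p.1 := by
  classical
  unfold path
  refine Measurable.ite (measurableSet_lt measurable_const measurable_fst) B.measurable_fwd ?_
  exact continuous_rev.measurable.comp (B.measurable_fwdRight.comp
    (measurable_fst.neg.prodMk (continuous_rev.measurable.comp measurable_snd)))

end Measurability

end CylinderFamily

/-! ### Grazing lines, boundaries and double collisions are negligible -/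

theorem finite_setOf_quadratic_eq_zero {a : ℝ} (ha : a ≠ 0) (b c : ℝ) :
    {s : ℝ | a * s ^ 2 + b * s + c = 0}.Finite := by
  by_cases h : ∃ s₀, a * s₀ ^ 2 + b * s₀ + c = 0
  · obtain ⟨s₀, h₀⟩ := h
    refine (Set.toFinite {s₀, -b / a - s₀}).subset fun s hs => ?_
    have hs : a * s ^ 2 + b * s + c = 0 := hs
    have h1 : (s - s₀) * (a * (s + s₀) + b) = 0 := by linear_combination hs - h₀
    rcases mul_eq_zero.1 h1 with h2 | h2
    · exact Or.inl (sub_eq_zero.1 h2)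
    · refine Or.inr ?_
      rw [mem_singleton_iff, eq_sub_iff_add_eq, eq_div_iff ha]; linarith
  · exact Set.finite_empty.subset fun s hs => h ⟨s, hs⟩

/-- Fubini in the direction `e`: a countable set of parameters on almost every line is a null set.
-/
theorem measure_eq_zero_of_lines {E : Type} [NormedAddCommGroup E] [NormedSpace ℝ E]
    [FiniteDimensional ℝ E] [MeasurableSpace E] [BorelSpace E] (μ : Measure E) [μ.IsAddHaarMeasure]
    {S : Set E} (hS : MeasurableSet S) (e : E)
    (h : ∀ᵐ y ∂μ, {s : ℝ | y + s • e ∈ S}.Countable) : μ S = 0 := by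
  have : ProperSpace E := FiniteDimensional.proper_real E
  have := (ae_ae_add_linearMap_mem_iff (LinearMap.toSpanSingleton ℝ E e) (volume : Measure ℝ) μ
    hS.compl).1 (h.mono fun y hy => ?_)
  · exact measure_eq_zero_iff_ae_notMem.2 this
  · have h0 : volume {s : ℝ | y + s • e ∈ S} = 0 := hy.measure_zero _
    exact measure_eq_zero_iff_ae_notMem.1 h0

namespace CylinderFamily

variable {ι X : Type} [NormedAddCommGroup X] [NormedSpace ℝ X] (B : CylinderFamily ι X)

section Null

variable [FiniteDimensional ℝ X] [MeasurableSpace X] [BorelSpace X] [SecondCountableTopology X]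
  (μ : Measure (X × X)) [μ.IsAddHaarMeasure]

theorem measurable_q_comp (a : ι) {Ω : Type} [MeasurableSpace Ω] {f g : Ω → X} (hf : Measurable f)
    (hg : Measurable g) : Measurable fun z => B.q a (f z) (g z) :=
  (B.continuous_q a).measurable.comp (hf.prodMk hg)

/-- In the direction `(e, 0)`, `disc` is quadratic with leading coefficient `q(e, v)² - q(v, v) q(e,
e)`. This coefficient vanishes only on a null set, since in the direction `(0, f)` it is itself
quadratic with leading coefficient `-q(e, e) q(f, f)`. -/
theorem measure_disc_eq_zero {a : ι} {e f : X} (hef : B.q a e f = 0) (he : 0 < B.q a e e)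
    (hf : 0 < B.q a f f) : μ {Z | B.disc a Z = 0} = 0 := by
  have h1 : μ {Z | B.q a e Z.2 ^ 2 - B.q a Z.2 Z.2 * B.q a e e = 0} = 0 := by
    have hm : Measurable fun Z : X × X => B.q a e Z.2 ^ 2 - B.q a Z.2 Z.2 * B.q a e e :=
      ((B.measurable_q_comp a measurable_const measurable_snd).pow_const 2).sub
        ((B.measurable_q_comp a measurable_snd measurable_snd).mul_const _)
    refine measure_eq_zero_of_lines μ (hm (measurableSet_singleton 0)) (0, f)
      (Eventually.of_forall fun Z => ?_)
    refine ((finite_setOf_quadratic_eq_zero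
      (a := -(B.q a e e * B.q a f f)) (by simp [he.ne', hf.ne']) (-(2 * B.q a e e * B.q a Z.2 f))
      (B.q a e Z.2 ^ 2 - B.q a Z.2 Z.2 * B.q a e e)).subset fun s hs => ?_).countable
    simp only [mem_ofPred_eq, Prod.snd_add, Prod.smul_snd, map_add, map_smul,
      add_apply, smul_apply, smul_eq_mul, hef, B.q_comm a f Z.2] at hs ⊢
    rw [← hs]; ring
  have hm : MeasurableSet {Z | B.disc a Z = 0} :=
    (B.continuous_disc a).measurable (measurableSet_singleton 0)
  refine measure_eq_zero_of_lines μ hm (e, 0) ?_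
  filter_upwards [measure_eq_zero_iff_ae_notMem.1 h1] with Z hZ
  refine ((finite_setOf_quadratic_eq_zero hZ
    (2 * B.q a e Z.2 * B.q a Z.1 Z.2 - 2 * B.q a Z.2 Z.2 * B.q a Z.1 e)
    (B.disc a Z)).subset fun s hs => ?_).countable
  simp only [disc, mem_ofPred_eq, Prod.fst_add, Prod.snd_add, Prod.smul_fst, Prod.smul_snd, map_add,
    map_smul, add_apply, smul_apply, smul_eq_mul, B.q_comm a e Z.1, smul_zero, add_zero] at hs ⊢
  rw [← hs]; ring

theorem measure_boundary_eq_zero {a : ι} {e : X} (he : 0 < B.q a e e) :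
    μ {Z | B.q a Z.1 Z.1 = B.r a ^ 2} = 0 := by
  refine measure_eq_zero_of_lines μ (measurableSet_eq_fun
    (B.measurable_q_comp a measurable_fst measurable_fst) measurable_const) (e, 0)
    (Eventually.of_forall fun Z => ?_)
  refine ((finite_setOf_quadratic_eq_zero he.ne' (2 * B.q a Z.1 e)
    (B.q a Z.1 Z.1 - B.r a ^ 2)).subset fun s hs => ?_).countable
  simp only [mem_ofPred_eq, Prod.fst_add, Prod.smul_fst, map_add, map_smul, add_apply, smul_apply,
    smul_eq_mul, B.q_comm a e Z.1] at hs ⊢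
  rw [← hs]; ring

theorem measurableSet_double (a b : ι) : MeasurableSet {Z | 0 < B.disc a Z ∧
    B.q b (drift (B.entry a Z) Z).1 (drift (B.entry a Z) Z).1 = B.r b ^ 2} := by
  have h : Measurable fun Z => (drift (B.entry a Z) Z).1 :=
    (continuous_drift_uncurry.measurable.comp
      ((B.measurable_entry a).prodMk measurable_id)).fst
  exact (measurableSet_lt measurable_const (B.continuous_disc a).measurable).inter
    (measurableSet_eq_fun (B.measurable_q_comp b h h) measurable_const)

/-- Translate the line in a direction `e` that one of the cylinders does not see. If this is `a`,
the entry time is constant, and the position at entry meets the boundary of `b` for at most two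
parameters. If it is `b`, the at most two times on the boundary of `b` are constant, and at each of
them `a` imposes a quadratic equation on the parameter. -/
theorem measure_double_eq_zero {a b : ι} {e : X}
    (he : (B.A a e = 0 ∧ 0 < B.q b e e) ∨ (B.A b e = 0 ∧ 0 < B.q a e e))
    (hb : μ {Z | B.disc b Z = 0} = 0) :
    μ {Z | 0 < B.disc a Z ∧
      B.q b (drift (B.entry a Z) Z).1 (drift (B.entry a Z) Z).1 = B.r b ^ 2} = 0 := by
  refine measure_eq_zero_of_lines μ (B.measurableSet_double a b) (e, 0) ?_
  have hzero : ∀ c, B.A c e = 0 → ∀ y, B.q c e y = 0 := fun c hc y => by rw [q_apply, hc]; simp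
  filter_upwards [measure_eq_zero_iff_ae_notMem.1 hb] with Z hZ
  rcases he with ⟨h1, h2⟩ | ⟨h1, h2⟩
  · have e1 : ∀ s : ℝ, B.disc a (Z + s • (e, 0)) = B.disc a Z := fun s => by
      simp [disc, hzero a h1, B.q_comm a Z.1 e]
    have e2 : ∀ s : ℝ, B.entry a (Z + s • (e, 0)) = B.entry a Z := fun s => by
      rw [entry, entry, e1]
      simp [hzero a h1]
    refine ((finite_setOf_quadratic_eq_zero h2.ne' (2 * B.q b (drift (B.entry a Z) Z).1 e)
      (B.q b (drift (B.entry a Z) Z).1 (drift (B.entry a Z) Z).1 - B.r b ^ 2)).subset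
      fun s hs => ?_).countable
    have hs := hs.2
    rw [e2] at hs
    rw [mem_ofPred_eq, sub_eq_add_neg, ← hs]
    simp only [drift, Prod.fst_add, Prod.snd_add, Prod.smul_fst, Prod.smul_snd, map_add,
      map_smul, add_apply, smul_apply, smul_eq_mul, smul_zero, add_zero, B.q_comm b e Z.1,
      B.q_comm b e Z.2]
    ring
  · have hv : B.q b Z.2 Z.2 ≠ 0 := fun h0 => hZ (by
      have := B.q_sq_le b Z.1 Z.2
      rw [h0, mul_zero] at this
      have : B.q b Z.1 Z.2 = 0 := pow_eq_zero_iff two_ne_zero |>.1 (le_antisymm this (sq_nonneg _))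
      change B.disc b Z = 0
      rw [disc, h0, this]; ring)
    have hfin : {τ : ℝ | B.q b Z.2 Z.2 * τ ^ 2 + 2 * B.q b Z.1 Z.2 * τ +
      (B.q b Z.1 Z.1 - B.r b ^ 2) = 0}.Finite := finite_setOf_quadratic_eq_zero hv _ _
    refine (hfin.countable.biUnion (t := fun τ _ => {s : ℝ | B.q a e e * s ^ 2 +
      2 * B.q a (drift τ Z).1 e * s +
      (B.q a (drift τ Z).1 (drift τ Z).1 - B.r a ^ 2) = 0}) fun τ _ =>
        (finite_setOf_quadratic_eq_zero h2.ne' _ _).countable).mono fun s hs => ?_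
    obtain ⟨hs1, hs2⟩ := hs
    have hs3 := q_entry hs1
    set τ := B.entry a (Z + s • (e, 0))
    refine mem_biUnion (x := τ) ?_ ?_
    · rw [mem_ofPred_eq, sub_eq_add_neg, ← hs2]
      simp only [drift, Prod.fst_add, Prod.snd_add, Prod.smul_fst, Prod.smul_snd, map_add,
        map_smul, add_apply, smul_apply, smul_eq_mul, smul_zero, add_zero, hzero b h1,
        B.q_comm b Z.1 e, B.q_comm b Z.2 e, B.q_comm b Z.2 Z.1]
      ring
    · rw [mem_ofPred_eq, sub_eq_add_neg, ← hs3]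
      simp only [drift, Prod.fst_add, Prod.snd_add, Prod.smul_fst, Prod.smul_snd, map_add,
        map_smul, add_apply, smul_apply, smul_eq_mul, smul_zero, add_zero, B.q_comm a e Z.1,
        B.q_comm a e Z.2]
      ring

/-- The cylinders are in general position. -/
structure Generic : Prop where
  exists_pair : ∀ a, ∃ e f, B.q a e f = 0 ∧ 0 < B.q a e e ∧ 0 < B.q a f f
  exists_kernel : ∀ a b, b ≠ a → ∃ e, (B.A a e = 0 ∧ 0 < B.q b e e) ∨ (B.A b e = 0 ∧ 0 < B.q a e e)

variable {B} in
theorem Generic.measure_bad [Countable ι] (hB : B.Generic) : μ B.bad = 0 := by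
  have h0 : ∀ a, μ {Z | B.disc a Z = 0} = 0 := fun a => by
    obtain ⟨e, f, h1, h2, h3⟩ := hB.exists_pair a
    exact B.measure_disc_eq_zero μ h1 h2 h3
  refine measure_mono_null (t := ⋃ a, ({Z | B.disc a Z = 0} ∪ ⋃ b, ⋃ (_ : b ≠ a),
    {Z | 0 < B.disc a Z ∧
      B.q b (drift (B.entry a Z) Z).1 (drift (B.entry a Z) Z).1 = B.r b ^ 2})) ?_ ?_
  · rintro Z ⟨a, h | ⟨b, hb, h⟩⟩
    · exact mem_iUnion.2 ⟨a, Or.inl h⟩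
    · exact mem_iUnion.2 ⟨a, Or.inr (mem_iUnion₂.2 ⟨b, hb, h⟩)⟩
  · refine measure_iUnion_null fun a => measure_union_null (h0 a) ?_
    refine measure_iUnion_null fun b => measure_iUnion_null fun hb => ?_
    obtain ⟨e, he⟩ := hB.exists_kernel a b hb
    exact B.measure_double_eq_zero μ he (h0 b)

variable {B} in
theorem Generic.ae_mem_regular [Countable ι] (hB : B.Generic) : ∀ᵐ Z ∂μ, Z ∈ B.regular :=
  B.ae_forall_word_notMem (hB.measure_bad μ)

end Null

/-! ### Uniqueness of paths -/

variable {B} in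
theorem Passes.unique {W W₁ W₂ : X × X} (h₁ : B.Passes W W₁) (h₂ : B.Passes W W₂) : W₁ = W₂ := by
  rcases h₁ with ⟨h1, rfl⟩ | ⟨a, h1, h2, h3, rfl⟩ <;>
    rcases h₂ with ⟨h4, rfl⟩ | ⟨b, h4, h5, h6, rfl⟩
  · rfl
  · exact absurd h4 (h1 b).ne'
  · exact absurd h1 (h4 a).ne'
  · by_cases hab : b = a
    · rw [hab]
    · exact absurd h4 (h3 b hab).ne'

variable {B} in
-- Time reversal turns this into `Passes.unique`.
theorem Passes.injective {W₁ W₂ W : X × X} (h₁ : B.Passes W₁ W) (h₂ : B.Passes W₂ W) : W₁ = W₂ := by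
  have := h₁.rev.unique h₂.rev
  simpa using congrArg BBGKY.rev this

variable {B} in
-- The set of times of agreement is open because passages are deterministic, and closed because free
-- motion and passages can be undone; the line is connected.
theorem IsPath.eq_of_eq {γ γ' : ℝ → X × X} (h : B.IsPath γ) (h' : B.IsPath γ') {t₀ : ℝ}
    (h0 : γ t₀ = γ' t₀) : γ = γ' := by
  have hopen : ∀ t, γ t = γ' t → ∀ᶠ u in 𝓝 t, γ u = γ' u := by
    intro t ht
    obtain ⟨W, h1, δ, h2, h3⟩ := h t
    obtain ⟨W', h1', δ', h2', h3'⟩ := h' t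
    have hW : W = W' := h1.unique (ht ▸ h1')
    filter_upwards [Metric.ball_mem_nhds t (lt_min h2 h2')] with u hu
    rw [Metric.mem_ball, Real.dist_eq, lt_min_iff, abs_lt, abs_lt] at hu
    rcases lt_trichotomy u t with hut | rfl | hut
    · have e1 := (h3 (t - u) ⟨by linarith, by linarith [hu.1.1]⟩).1
      have e2 := (h3' (t - u) ⟨by linarith, by linarith [hu.2.1]⟩).1
      rw [sub_sub_cancel] at e1 e2
      rw [e1, e2, ht]
    · exact ht
    · have e1 := (h3 (u - t) ⟨by linarith, by linarith [hu.1.2]⟩).2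
      have e2 := (h3' (u - t) ⟨by linarith, by linarith [hu.2.2]⟩).2
      rw [add_sub_cancel] at e1 e2
      rw [e1, e2, hW]
  have hclosed : ∀ t, (∃ᶠ u in 𝓝 t, γ u = γ' u) → γ t = γ' t := by
    intro t ht
    obtain ⟨W, h1, δ, h2, h3⟩ := h t
    obtain ⟨W', h1', δ', h2', h3'⟩ := h' t
    obtain ⟨u, hu, hu'⟩ := (ht.and_eventually (Metric.ball_mem_nhds t (lt_min h2 h2'))).exists
    change dist u t < min δ δ' at hu'
    rw [Real.dist_eq, lt_min_iff, abs_lt, abs_lt] at hu'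
    rcases lt_trichotomy u t with hut | rfl | hut
    · have e1 := (h3 (t - u) ⟨by linarith, by linarith [hu'.1.1]⟩).1
      have e2 := (h3' (t - u) ⟨by linarith, by linarith [hu'.2.1]⟩).1
      rw [sub_sub_cancel] at e1 e2
      have := congrArg (drift (t - u)) (e1.symm.trans (hu.trans e2))
      simpa using this
    · exact hu
    · have e1 := (h3 (u - t) ⟨by linarith, by linarith [hu'.1.2]⟩).2
      have e2 := (h3' (u - t) ⟨by linarith, by linarith [hu'.2.2]⟩).2
      rw [add_sub_cancel] at e1 e2
      have := congrArg (drift (-(u - t))) (e1.symm.trans (hu.trans e2))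
      simp only [drift_drift, neg_add_cancel, drift_zero] at this
      exact h1.injective (this ▸ h1')
  have hclopen : IsClopen {t | γ t = γ' t} := by
    refine ⟨isClosed_iff_frequently.2 hclosed, isOpen_iff_eventually.2 hopen⟩
  have := hclopen.eq_univ ⟨t₀, h0⟩
  funext t
  exact eq_univ_iff_forall.1 this t

variable {B} in
theorem IsPath.shift {γ : ℝ → X × X} (h : B.IsPath γ) (s : ℝ) : B.IsPath fun t => γ (s + t) := by
  intro t
  obtain ⟨W, h1, δ, h2, h3⟩ := h (s + t)
  refine ⟨W, h1, δ, h2, fun u hu => ?_⟩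
  have := h3 u hu
  rwa [add_sub_assoc, add_assoc] at this

variable {B} in
/-- Paths conserve the kinetic energy. -/
theorem IsPath.ip_eq {γ : ℝ → X × X} (h : B.IsPath γ) (s t : ℝ) :
    B.ip (γ s).2 (γ s).2 = B.ip (γ t).2 (γ t).2 := by
  have hP : ∀ {W W'}, B.Passes W W' → B.ip W'.2 W'.2 = B.ip W.2 W.2 := by
    rintro W W' (⟨-, rfl⟩ | ⟨a, h1, -, -, rfl⟩)
    · rfl
    · exact B.ip_reflect_self h1
  have hloc : IsLocallyConstant fun t => B.ip (γ t).2 (γ t).2 := by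
    rw [IsLocallyConstant.iff_eventually_eq]
    intro t
    obtain ⟨W, h1, δ, h2, h3⟩ := h t
    filter_upwards [Metric.ball_mem_nhds t h2] with u hu
    rw [Metric.mem_ball, Real.dist_eq, abs_lt] at hu
    rcases lt_trichotomy u t with hut | rfl | hut
    · have e1 := (h3 (t - u) ⟨by linarith, by linarith [hu.1]⟩).1
      rw [sub_sub_cancel] at e1
      rw [e1, drift_snd]
    · rfl
    · have e1 := (h3 (u - t) ⟨by linarith, by linarith [hu.2]⟩).2
      rw [add_sub_cancel] at e1
      rw [e1, drift_snd, hP h1]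
  exact hloc.apply_eq_of_preconnectedSpace s t

end CylinderFamily

/-! ### The particle system as a billiard -/

section Pairing

variable {d : ℕ} {κ : Type} [Fintype κ] [LinearOrder κ]

theorem sum_sum_eq_two_mul (f : κ → κ → ℝ) (hs : ∀ i j, f i j = f j i) (h0 : ∀ i, f i i = 0) :
    ∑ i, ∑ j, f i j = 2 * ∑ i, ∑ j, if i < j then f i j else 0 := by
  have h : ∀ i j, f i j = (if i < j then f i j else 0) + if j < i then f j i else 0 := fun i j => by
    rcases lt_trichotomy i j with h | rfl | h
    · simp [h, h.not_gt]
    · simp [h0]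
    · simp [h, h.not_gt, hs i j]
  calc ∑ i, ∑ j, f i j
      = ∑ i, ∑ j, ((if i < j then f i j else 0) + if j < i then f j i else 0) :=
        Finset.sum_congr rfl fun i _ => Finset.sum_congr rfl fun j _ => h i j
    _ = ∑ i, ∑ j, (if i < j then f i j else 0) + ∑ i, ∑ j, if j < i then f j i else 0 := by
        simp only [Finset.sum_add_distrib]
    _ = _ := by rw [Finset.sum_comm (f := fun i j => if j < i then f j i else 0), two_mul]

/-- Summation by parts for the Laplacian of the complete graph. -/
theorem pairing_eq_sum (x v : κ → Space d) :
    pairing x v = ∑ i, inner ℝ (∑ j, (x i - x j)) (v i) := by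
  have h1 := sum_sum_eq_two_mul (fun i j => inner ℝ (x i - x j) (v i - v j))
    (fun i j => by rw [← inner_neg_neg, neg_sub, neg_sub]) (fun i => by simp)
  have h2 : ∑ i, ∑ j, inner ℝ (x i - x j) (v i - v j) =
      2 * ∑ i, inner ℝ (∑ j, (x i - x j)) (v i) := by
    simp only [sum_inner]
    simp only [inner_sub_right, Finset.sum_sub_distrib]
    rw [Finset.sum_comm (f := fun i j => inner ℝ (x i - x j) (v j)), ← Finset.sum_sub_distrib,
      Finset.mul_sum]
    refine Finset.sum_congr rfl fun i _ => ?_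
    rw [← Finset.sum_sub_distrib, Finset.mul_sum]
    refine Finset.sum_congr rfl fun j _ => ?_
    rw [← neg_sub (x i) (x j), inner_neg_left]; ring
  unfold pairing
  linarith

theorem pairing_comm (x v : κ → Space d) : pairing x v = pairing v x :=
  Finset.sum_congr rfl fun i _ => Finset.sum_congr rfl fun j _ => by rw [real_inner_comm]

theorem pairing_smul_left (c : ℝ) (x v : κ → Space d) :
    pairing (fun i => c • x i) v = c * pairing x v := by
  simp only [pairing_eq_sum, ← smul_sub, ← Finset.smul_sum, inner_smul_left, Finset.mul_sum]
  rfl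

end Pairing

/-- The tuples of particles that can collide. -/
abbrev Tuple (M m : ℕ) : Type := {I : Finset (Fin m) // Collidable M I}

section Family

variable {d m M : ℕ} {ε : ℕ → ℝ}

/-- The inner product of configurations. -/
noncomputable def configInner (d m : ℕ) : (Fin m → Space d) →L[ℝ] (Fin m → Space d) →L[ℝ] ℝ :=
  ∑ i, (innerSL ℝ).bilinearComp (ContinuousLinearMap.proj i) (ContinuousLinearMap.proj i)

theorem configInner_apply (x y : Fin m → Space d) :
    configInner d m x y = ∑ i, inner ℝ (x i) (y i) := by
  simp [configInner]

open Classical in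
/-- `(L x)_i = ∑_{j ∈ I} (x_i - x_j)` for `i ∈ I`. -/
noncomputable def tupleLaplacian (I : Finset (Fin m)) : (Fin m → Space d) →L[ℝ] (Fin m → Space d) :=
  ContinuousLinearMap.pi fun i => if i ∈ I then
    ∑ j ∈ I, ((ContinuousLinearMap.proj i : (Fin m → Space d) →L[ℝ] Space d) -
      ContinuousLinearMap.proj j) else 0

theorem tupleLaplacian_of_mem {I : Finset (Fin m)} {i : Fin m} (h : i ∈ I) (x : Fin m → Space d) :
    tupleLaplacian I x i = ∑ j ∈ I, (x i - x j) := by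
  simp [tupleLaplacian, h]

theorem tupleLaplacian_of_notMem {I : Finset (Fin m)} {i : Fin m} (h : i ∉ I)
    (x : Fin m → Space d) : tupleLaplacian I x i = 0 := by
  simp [tupleLaplacian, h]

theorem configInner_tupleLaplacian (I : Finset (Fin m)) (x y : Fin m → Space d) :
    configInner d m (tupleLaplacian I x) y = pairing (fun i : I => x i) (fun i : I => y i) := by
  rw [pairing_eq_sum, configInner_apply,
    Finset.sum_coe_sort I (fun i => inner ℝ (∑ j : I, (x i - x j)) (y i)),
    ← Finset.sum_subset (Finset.subset_univ I)]
  · refine Finset.sum_congr rfl fun i hi => ?_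
    rw [tupleLaplacian_of_mem hi, Finset.sum_coe_sort I fun j => x i - x j]
  · intro i _ hi
    rw [tupleLaplacian_of_notMem hi, inner_zero_left]

/-- The values of `L x` sum to zero over `I`, so the complete graph Laplacian acts on them as
multiplication by `|I|`. This makes a collision of any order a reflection at a cylinder. -/
theorem tupleLaplacian_tupleLaplacian (I : Finset (Fin m)) (x : Fin m → Space d) :
    tupleLaplacian I (tupleLaplacian I x) = (I.card : ℝ) • tupleLaplacian I x := by
  ext1 i
  by_cases hi : i ∈ I
  · have h : ∑ j ∈ I, tupleLaplacian I x j = 0 := by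
      rw [Finset.sum_congr rfl fun j hj => tupleLaplacian_of_mem hj x]
      simp only [Finset.sum_sub_distrib]
      rw [Finset.sum_comm]; simp
    rw [tupleLaplacian_of_mem hi, Finset.sum_sub_distrib, h, sub_zero, Finset.sum_const, Pi.smul_apply,
      Nat.cast_smul_eq_nsmul]
  · rw [tupleLaplacian_of_notMem hi, Pi.smul_apply, tupleLaplacian_of_notMem hi, smul_zero]

/-- The cylinders `{d_I < ε}`. -/
noncomputable def tupleFamily (d m : ℕ) (hε : ∀ k, 2 ≤ k → k ≤ M + 1 → 0 < ε k) :
    CylinderFamily (Tuple M m) (Fin m → Space d) where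
  ip := configInner d m
  ip_comm x y := by
    rw [configInner_apply, configInner_apply]
    exact Finset.sum_congr rfl fun i _ => real_inner_comm _ _
  norm_sq_le x := by
    rw [configInner_apply]
    have h : 0 ≤ ∑ i, inner ℝ (x i) (x i) := Finset.sum_nonneg fun i _ => real_inner_self_nonneg
    rw [← Real.sqrt_le_sqrt_iff h, Real.sqrt_sq (norm_nonneg _),
      pi_norm_le_iff_of_nonneg (Real.sqrt_nonneg _)]
    intro i
    refine Real.le_sqrt_of_sq_le ?_
    rw [← real_inner_self_eq_norm_sq]
    exact Finset.single_le_sum (f := fun i => inner ℝ (x i) (x i))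
      (fun i _ => real_inner_self_nonneg) (Finset.mem_univ i)
  A I := tupleLaplacian I.1
  κ I := I.1.card
  r I := ε I.1.card
  κ_pos I := by have := I.2.1; positivity
  r_pos I := hε _ I.2.1 I.2.2
  A_symm I x y := by
    rw [configInner_tupleLaplacian, pairing_comm, ← configInner_tupleLaplacian, configInner_apply,
      configInner_apply]
    exact Finset.sum_congr rfl fun i _ => real_inner_comm _ _
  A_sq I x := tupleLaplacian_tupleLaplacian _ _

variable (hε : ∀ k, 2 ≤ k → k ≤ M + 1 → 0 < ε k)

theorem tupleFamily_r (I : Tuple M m) : (tupleFamily d m hε).r I = ε I.1.card := rfl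

theorem tupleFamily_q (I : Tuple M m) (x y : Fin m → Space d) :
    (tupleFamily d m hε).q I x y = pairing (fun i : I.1 => x i) (fun i : I.1 => y i) :=
  configInner_tupleLaplacian _ _ _

theorem tupleDist_eq_sqrt (I : Tuple M m) (x : Fin m → Space d) :
    tupleDist x I.1 = √((tupleFamily d m hε).q I x x) := by
  rw [tupleFamily_q, tupleDist, pairing]
  simp only [real_inner_self_eq_norm_sq]

theorem lt_tupleDist_iff (I : Tuple M m) (x : Fin m → Space d) :
    ε I.1.card < tupleDist x I.1 ↔
      (tupleFamily d m hε).r I ^ 2 < (tupleFamily d m hε).q I x x := by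
  rw [tupleDist_eq_sqrt hε, Real.lt_sqrt (hε _ I.2.1 I.2.2).le, tupleFamily_r]

theorem tupleDist_eq_iff (I : Tuple M m) (x : Fin m → Space d) :
    tupleDist x I.1 = ε I.1.card ↔
      (tupleFamily d m hε).q I x x = (tupleFamily d m hε).r I ^ 2 := by
  rw [tupleDist_eq_sqrt hε, tupleFamily_r]
  constructor
  · intro h; rw [← h, Real.sq_sqrt ((tupleFamily d m hε).q_nonneg I x)]
  · intro h; rw [h, Real.sqrt_sq (hε _ I.2.1 I.2.2).le]

theorem le_tupleDist_iff (I : Tuple M m) (x : Fin m → Space d) :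
    ε I.1.card ≤ tupleDist x I.1 ↔
      (tupleFamily d m hε).r I ^ 2 ≤ (tupleFamily d m hε).q I x x := by
  rw [le_iff_lt_or_eq, le_iff_lt_or_eq, lt_tupleDist_iff hε, eq_comm, tupleDist_eq_iff hε, eq_comm]

theorem mem_phaseInterior_iff (Z : Phase d m) : Z ∈ phaseInterior M ε d m ↔
    ∀ I, (tupleFamily d m hε).r I ^ 2 < (tupleFamily d m hε).q I Z.1 Z.1 :=
  ⟨fun h I => (lt_tupleDist_iff hε I Z.1).1 (h I.1 I.2),
    fun h I hI => (lt_tupleDist_iff hε ⟨I, hI⟩ Z.1).2 (h ⟨I, hI⟩)⟩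

theorem mem_phaseSpace_iff (Z : Phase d m) : Z ∈ phaseSpace M ε d m ↔
    ∀ I, (tupleFamily d m hε).r I ^ 2 ≤ (tupleFamily d m hε).q I Z.1 Z.1 :=
  ⟨fun h I => (le_tupleDist_iff hε I Z.1).1 (h I.1 I.2),
    fun h I hI => (le_tupleDist_iff hε ⟨I, hI⟩ Z.1).2 (h ⟨I, hI⟩)⟩

/-- With `κ = |I|` and `r = ε`, the two factors `1/ε` come from the scaled positions, once in the
pairing and once in the direction of the impulse. -/
theorem collide_eq_reflect (I : Tuple M m) (Z : Phase d m) :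
    collide ε I.1 Z = (tupleFamily d m hε).reflect I Z := by
  refine Prod.ext rfl ?_
  ext1 i
  have hpos := hε _ I.2.1 I.2.2
  have hκ := (tupleFamily d m hε).κ_pos I
  change _ = Z.2 i - ((2 / ((I.1.card : ℝ) * ε I.1.card ^ 2) * (tupleFamily d m hε).q I Z.1 Z.2) •
    tupleLaplacian I.1 Z.1) i
  change (0 : ℝ) < (I.1.card : ℝ) at hκ
  by_cases hi : i ∈ I.1
  · simp only [collide, hi, dif_pos, scatter]
    rw [pairing_smul_left, ← tupleFamily_q hε, Pi.smul_apply, tupleLaplacian_of_mem hi,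
      Fintype.card_coe, ← Finset.sum_coe_sort I.1 fun j => Z.1 i - Z.1 j, sub_eq_add_neg]
    congr 1
    rw [← smul_neg, ← Finset.sum_neg_distrib]
    simp only [neg_sub, ← smul_sub, ← Finset.smul_sum, smul_smul]
    congr 1
    field_simp
  · simp only [collide, hi, dif_neg, not_false_iff]
    rw [Pi.smul_apply, tupleLaplacian_of_notMem hi]
    simp

theorem outgoing_iff (Z Z' : Phase d m) :
    Outgoing M ε Z Z' ↔ (tupleFamily d m hε).Passes Z Z' := by
  refine or_congr (and_congr_left fun _ => mem_phaseInterior_iff hε Z) ?_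
  constructor
  · rintro ⟨I, ⟨h1, h2, h3, h4⟩, h5, h6⟩
    refine ⟨⟨I, h2⟩, (tupleDist_eq_iff hε ⟨I, h2⟩ Z.1).1 h3, ?_, fun J hJ => ?_, ?_⟩
    · rw [tupleFamily_q]; exact h5
    · refine lt_of_le_of_ne ((mem_phaseSpace_iff hε Z).1 h1 J) fun h => ?_
      exact h4 J.1 J.2 (fun h' => hJ (Subtype.ext h')) ((tupleDist_eq_iff hε J Z.1).2 h.symm)
    · rw [h6, ← collide_eq_reflect]
  · rintro ⟨I, h1, h2, h3, h4⟩
    refine ⟨I.1, ⟨(mem_phaseSpace_iff hε Z).2 fun J => ?_, I.2, (tupleDist_eq_iff hε I Z.1).2 h1,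
      fun J hJ hJI h => ?_⟩, ?_, ?_⟩
    · by_cases hJ : J = I
      · rw [hJ, h1]
      · exact (h3 J hJ).le
    · exact (h3 ⟨J, hJ⟩ fun h' => hJI (congrArg Subtype.val h')).ne'
        ((tupleDist_eq_iff hε ⟨J, hJ⟩ Z.1).1 h)
    · rw [tupleFamily_q] at h2; exact h2
    · rw [h4, collide_eq_reflect hε]

theorem isTrajectory_iff (γ : ℝ → Phase d m) :
    IsTrajectory M ε γ ↔ (tupleFamily d m hε).IsPath γ :=
  forall_congr' fun _ => exists_congr fun _ => and_congr_left fun _ => outgoing_iff hε _ _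

theorem tupleLaplacian_single_self {I : Finset (Fin m)} {i : Fin m} (hi : i ∈ I) (u : Space d) :
    tupleLaplacian I (Pi.single i u) i = ((I.card : ℝ) - 1) • u := by
  rw [tupleLaplacian_of_mem hi, Finset.sum_sub_distrib, Finset.sum_pi_single' i u I]
  simp [hi, sub_smul, Nat.cast_smul_eq_nsmul]

theorem tupleFamily_q_single {I : Tuple M m} {i : Fin m} (hi : i ∈ I.1) (u w : Space d) :
    (tupleFamily d m hε).q I (Pi.single i u) (Pi.single i w) =
      ((I.1.card : ℝ) - 1) * inner ℝ u w := by
  change configInner d m (tupleLaplacian I.1 _) _ = _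
  rw [configInner_apply, Finset.sum_eq_single i]
  · rw [tupleLaplacian_single_self hi, Pi.single_eq_same, inner_smul_left]; rfl
  · intro j _ hj; rw [Pi.single_eq_of_ne hj, inner_zero_right]
  · simp

theorem tupleLaplacian_single_of_notMem {I : Finset (Fin m)} {i : Fin m} (hi : i ∉ I)
    (u : Space d) : tupleLaplacian I (Pi.single i u) = 0 := by
  ext1 l
  by_cases hl : l ∈ I
  · rw [tupleLaplacian_of_mem hl]
    refine Finset.sum_eq_zero fun j hj => ?_
    rw [Pi.single_eq_of_ne (by rintro rfl; exact hi hl), Pi.single_eq_of_ne (by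
      rintro rfl; exact hi hj), sub_zero]
  · exact tupleLaplacian_of_notMem hl _

/-- One particle of `I`, displaced in two orthogonal directions, provides the pair. A particle that
belongs to exactly one of `I` and `J` is seen by only one of the two cylinders. -/
theorem tupleFamily_generic (hd : 2 ≤ d) : (tupleFamily d m hε).Generic := by
  have hcard : ∀ I : Tuple M m, (0 : ℝ) < (I.1.card : ℝ) - 1 := fun I => by
    have : (2 : ℝ) ≤ I.1.card := by exact_mod_cast I.2.1
    linarith
  set u : Space d := EuclideanSpace.single ⟨0, by omega⟩ 1
  set w : Space d := EuclideanSpace.single ⟨1, by omega⟩ 1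
  have huw : inner ℝ u w = 0 := by simp [u, w, EuclideanSpace.inner_single_left]
  have huu : inner ℝ u u = 1 := by simp [u]
  have hww : inner ℝ w w = 1 := by simp [w]
  constructor
  · intro I
    obtain ⟨i, hi⟩ := Finset.card_pos.1 (by have := I.2.1; omega : 0 < I.1.card)
    refine ⟨Pi.single i u, Pi.single i w, ?_, ?_, ?_⟩
    · rw [tupleFamily_q_single hε hi, huw, mul_zero]
    · rw [tupleFamily_q_single hε hi, huu, mul_one]; exact hcard I
    · rw [tupleFamily_q_single hε hi, hww, mul_one]; exact hcard I
  · intro I J hJI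
    have : ∃ i, (i ∉ I.1 ∧ i ∈ J.1) ∨ (i ∉ J.1 ∧ i ∈ I.1) := by
      by_contra! h
      refine hJI (Subtype.ext (Finset.ext fun i => ⟨fun hi => ?_, fun hi => ?_⟩))
      · by_contra h'; exact (h i).1 h' hi
      · by_contra h'; exact (h i).2 h' hi
    obtain ⟨i, ⟨h1, h2⟩ | ⟨h1, h2⟩⟩ := this
    · refine ⟨Pi.single i u, Or.inl ⟨tupleLaplacian_single_of_notMem h1 u, ?_⟩⟩
      rw [tupleFamily_q_single hε h2, huu, mul_one]; exact hcard J
    · refine ⟨Pi.single i u, Or.inr ⟨tupleLaplacian_single_of_notMem h1 u, ?_⟩⟩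
      rw [tupleFamily_q_single hε h2, huu, mul_one]; exact hcard I

end Family

/-- After a collision the particles separate, so an outgoing state is not an arrival state of
another passage. This reconciles the two alternatives in the definition of `flow`. -/
theorem CylinderFamily.Passes.eq_of_passes {ι X : Type} [NormedAddCommGroup X] [NormedSpace ℝ X]
    {B : CylinderFamily ι X} {Y Z W : X × X} (h₁ : B.Passes Y Z) (h₂ : B.Passes Z W) : Y = Z := by
  rcases h₁ with ⟨-, rfl⟩ | ⟨a, h1, h2, h3, rfl⟩
  · rfl
  · rcases h₂ with ⟨h4, -⟩ | ⟨b, h4, h5, h6, -⟩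
    · exact absurd h1 (h4 a).ne'
    · by_cases hab : b = a
      · subst hab
        rw [B.reflect_fst, B.q_reflect h1] at h5
        linarith
      · exact absurd h4 (h3 b hab).ne'

theorem CylinderFamily.measurableSet_regular {ι X : Type} [NormedAddCommGroup X] [NormedSpace ℝ X]
    [Finite ι] [FiniteDimensional ℝ X] [MeasurableSpace X] [BorelSpace X]
    [SecondCountableTopology X] (B : CylinderFamily ι X) : MeasurableSet B.regular := by
  have hbad : MeasurableSet B.bad := by
    have : B.bad = ⋃ a, ({Z | B.disc a Z = 0} ∪ ⋃ b, ⋃ (_ : b ≠ a), {Z | 0 < B.disc a Z ∧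
        B.q b (drift (B.entry a Z) Z).1 (drift (B.entry a Z) Z).1 = B.r b ^ 2}) := by
      ext Z
      simp only [bad, mem_ofPred_eq, mem_iUnion, mem_union, exists_prop]
    rw [this]
    refine MeasurableSet.iUnion fun a => MeasurableSet.union ?_ ?_
    · exact (B.continuous_disc a).measurable (measurableSet_singleton 0)
    · exact MeasurableSet.iUnion fun b => MeasurableSet.iUnion fun _ => B.measurableSet_double a b
  have : B.regular = ⋂ w, B.word w ⁻¹' B.badᶜ := by
    ext Z
    simp only [regular, mem_ofPred_eq, mem_iInter, mem_preimage, mem_compl_iff]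
  rw [this]
  exact MeasurableSet.iInter fun w => B.measurable_word w hbad.compl

noncomputable instance (M m : ℕ) : Fintype (Tuple M m) := Fintype.ofFinite _

instance (d m : ℕ) : (volume : Measure (Phase d m)).IsAddHaarMeasure :=
  Measure.prod.instIsAddHaarMeasure (volume : Measure (Fin m → Space d))
    (volume : Measure (Fin m → Space d))

/-! ### The interaction flow: conservation laws, measurability and null sets -/

section Flow

variable {d m M : ℕ} {ε : ℕ → ℝ}

/-- A global trajectory arrives at `Z` at the time zero. -/
def HasTraj (M : ℕ) (ε : ℕ → ℝ) (Z : Phase d m) : Prop :=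
  ∃ γ : ℝ → Phase d m, IsTrajectory M ε γ ∧ γ 0 = Z

variable (hε : ∀ k, 2 ≤ k → k ≤ M + 1 → 0 < ε k)
include hε

/-- The trajectory chosen in `flow` may have `γ 0` as its outgoing state, but then the passage is
trivial because `γ 0` is also an arrival state; uniqueness of paths does the rest. -/
theorem flow_apply_zero {γ : ℝ → Phase d m} (h : IsTrajectory M ε γ) (t : ℝ) :
    flow M ε t (γ 0) = γ t := by
  have hex : ∃ γ' : ℝ → Phase d m, IsTrajectory M ε γ' ∧
    (γ' 0 = γ 0 ∨ Outgoing M ε (γ' 0) (γ 0)) := ⟨γ, h, Or.inl rfl⟩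
  rw [flow, dif_pos hex]
  obtain ⟨h1, h2⟩ := hex.choose_spec
  set γ' := hex.choose
  rw [isTrajectory_iff hε] at h1 h
  have h0 : γ' 0 = γ 0 := by
    rcases h2 with h2 | h2
    · exact h2
    · obtain ⟨W, hW, -⟩ := h 0
      exact ((outgoing_iff hε _ _).1 h2).eq_of_passes hW
  rw [h1.eq_of_eq h h0]

theorem IsTrajectory.shift {γ : ℝ → Phase d m} (h : IsTrajectory M ε γ) (s : ℝ) :
    IsTrajectory M ε fun t => γ (s + t) := by
  rw [isTrajectory_iff hε] at h ⊢
  exact h.shift s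

theorem HasTraj.flow_zero {Z : Phase d m} (h : HasTraj M ε Z) : flow M ε 0 Z = Z := by
  obtain ⟨γ, h1, rfl⟩ := h
  exact flow_apply_zero hε h1 0

theorem HasTraj.flow {Z : Phase d m} (h : HasTraj M ε Z) (t : ℝ) : HasTraj M ε (flow M ε t Z) := by
  obtain ⟨γ, h1, rfl⟩ := h
  exact ⟨_, h1.shift hε t, by rw [flow_apply_zero hε h1, add_zero]⟩

theorem HasTraj.flow_flow {Z : Phase d m} (h : HasTraj M ε Z) (s t : ℝ) :
    BBGKY.flow M ε s (BBGKY.flow M ε t Z) = BBGKY.flow M ε (t + s) Z := by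
  obtain ⟨γ, h1, rfl⟩ := h
  have := flow_apply_zero hε (h1.shift hε t) s
  rw [add_zero] at this
  rw [flow_apply_zero hε h1, flow_apply_zero hε h1, this]

theorem HasTraj.mem_phaseSpace {Z : Phase d m} (h : HasTraj M ε Z) : Z ∈ phaseSpace M ε d m := by
  obtain ⟨γ, h1, rfl⟩ := h
  obtain ⟨W, hW | ⟨I, hI, -⟩, -⟩ := h1 0
  · exact fun I hI => (hW.1 I hI).le
  · exact hI.1

theorem HasTraj.kineticEnergy_flow {Z : Phase d m} (h : HasTraj M ε Z) (t : ℝ) :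
    kineticEnergy (BBGKY.flow M ε t Z) = kineticEnergy Z := by
  obtain ⟨γ, h1, rfl⟩ := h
  rw [flow_apply_zero hε h1]
  have := ((isTrajectory_iff hε γ).1 h1).ip_eq t 0
  change configInner d m _ _ = configInner d m _ _ at this
  simp only [configInner_apply, real_inner_self_eq_norm_sq] at this
  rw [kineticEnergy, kineticEnergy, this]

/-- The states at which no collision takes place and whose lines are regular. -/
def regularInterior (d m : ℕ) : Set (Phase d m) :=
  (tupleFamily d m hε).regular ∩ phaseInterior M ε d m

theorem measurableSet_phaseInterior : MeasurableSet (phaseInterior M ε d m) := by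
  have : phaseInterior M ε d m = ⋂ I : Tuple M m, {Z : Phase d m | (tupleFamily d m hε).r I ^ 2 <
      (tupleFamily d m hε).q I Z.1 Z.1} := by
    ext Z
    simp only [mem_phaseInterior_iff hε, mem_iInter, mem_ofPred_eq]
  rw [this]
  exact MeasurableSet.iInter fun I => measurableSet_lt measurable_const
    ((tupleFamily d m hε).measurable_q_comp I measurable_fst measurable_fst)

theorem measurableSet_phaseSpace : MeasurableSet (phaseSpace M ε d m) := by
  have : phaseSpace M ε d m = ⋂ I : Tuple M m, {Z : Phase d m | (tupleFamily d m hε).r I ^ 2 ≤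
      (tupleFamily d m hε).q I Z.1 Z.1} := by
    ext Z
    simp only [mem_phaseSpace_iff hε, mem_iInter, mem_ofPred_eq]
  rw [this]
  exact MeasurableSet.iInter fun I => measurableSet_le measurable_const
    ((tupleFamily d m hε).measurable_q_comp I measurable_fst measurable_fst)

theorem measurableSet_regularInterior : MeasurableSet (regularInterior hε d m) :=
  (tupleFamily d m hε).measurableSet_regular.inter (measurableSet_phaseInterior hε)

theorem ae_mem_regular (hd : 2 ≤ d) : ∀ᵐ Z : Phase d m, Z ∈ (tupleFamily d m hε).regular :=
  (tupleFamily_generic hε hd).ae_mem_regular volume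

theorem ae_mem_regularInterior (hd : 2 ≤ d) :
    ∀ᵐ Z : Phase d m, Z ∈ phaseSpace M ε d m → Z ∈ regularInterior hε d m := by
  have h : ∀ᵐ Z : Phase d m, ∀ I : Tuple M m, (tupleFamily d m hε).q I Z.1 Z.1 ≠
      (tupleFamily d m hε).r I ^ 2 := ae_all_iff.2 fun I => by
    obtain ⟨e, -, -, he, -⟩ := (tupleFamily_generic (m := m) hε hd).exists_pair I
    exact measure_eq_zero_iff_ae_notMem.1
      ((tupleFamily d m hε).measure_boundary_eq_zero volume he)
  filter_upwards [h, ae_mem_regular hε hd] with Z h1 h2 h3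
  refine ⟨h2, (mem_phaseInterior_iff hε Z).2 fun I => ?_⟩
  exact lt_of_le_of_ne ((mem_phaseSpace_iff hε Z).1 h3 I) (h1 I).symm

theorem hasTraj_and_flow_eq {Z Z' : Phase d m} (hr : Z ∈ (tupleFamily d m hε).regular)
    (h : Outgoing M ε Z Z') : HasTraj M ε Z ∧
      ∀ t, flow M ε t Z = (tupleFamily d m hε).path Z' Z t := by
  rw [outgoing_iff hε] at h
  have h1 := (isTrajectory_iff hε _).2 ((tupleFamily d m hε).isPath_path hr h)
  have h2 := (tupleFamily d m hε).path_zero Z' Z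
  refine ⟨⟨_, h1, h2⟩, fun t => ?_⟩
  have := flow_apply_zero hε h1 t
  rwa [h2] at this

theorem hasTraj_of_mem_regularInterior {Z : Phase d m} (h : Z ∈ regularInterior hε d m) :
    HasTraj M ε Z :=
  (hasTraj_and_flow_eq hε h.1 (Or.inl ⟨h.2, rfl⟩)).1

theorem ae_hasTraj (hd : 2 ≤ d) : ∀ᵐ Z : Phase d m, Z ∈ phaseSpace M ε d m → HasTraj M ε Z :=
  (ae_mem_regularInterior hε hd).mono fun _ h h' => hasTraj_of_mem_regularInterior hε (h h')

/-- A measurable version of the flow. -/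
noncomputable def flowMap (d m : ℕ) (p : ℝ × Phase d m) : Phase d m :=
  (tupleFamily d m hε).path p.2 p.2 p.1

theorem measurable_flowMap : Measurable (flowMap hε d m) :=
  (tupleFamily d m hε).measurable_path

theorem flow_eq_flowMap {Z : Phase d m} (h : Z ∈ regularInterior hε d m) (t : ℝ) :
    flow M ε t Z = flowMap hε d m (t, Z) :=
  (hasTraj_and_flow_eq hε h.1 (Or.inl ⟨h.2, rfl⟩)).2 t

/-- `flowMap` goes on from `Z` itself, which is wrong after a collision at time zero; but the past
does not depend on the outgoing state. Adjoined particles lead to exactly such collision states. -/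
theorem flow_eq_flowMap_of_nonpos {Z Z' : Phase d m} (hr : Z ∈ (tupleFamily d m hε).regular)
    (h : Outgoing M ε Z Z') {t : ℝ} (ht : t ≤ 0) : flow M ε t Z = flowMap hε d m (t, Z) := by
  rw [(hasTraj_and_flow_eq hε hr h).2 t, flowMap, CylinderFamily.path, CylinderFamily.path,
    if_neg (not_lt.2 ht), if_neg (not_lt.2 ht)]

theorem exists_flow_eq_drift_word {Z Z' : Phase d m} (hr : Z ∈ (tupleFamily d m hε).regular)
    (h : Outgoing M ε Z Z') (t : ℝ) :
    ∃ w, flow M ε t Z = drift t ((tupleFamily d m hε).word w Z) := by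
  rw [(hasTraj_and_flow_eq hε hr h).2 t]
  exact (tupleFamily d m hε).exists_path_eq_drift_word hr ((outgoing_iff hε _ _).1 h) t

/-- The flow does not map sets of positive measure to null sets. -/
theorem ae_flow_notMem {N : Set (Phase d m)} (hN : volume N = 0) (t : ℝ) :
    ∀ᵐ Z : Phase d m, Z ∈ regularInterior hε d m → flow M ε t Z ∉ N := by
  filter_upwards [(tupleFamily d m hε).ae_forall_word_notMem
    (CylinderFamily.measure_drift_preimage_eq_zero (μ := (volume : Measure (Phase d m))) t hN)] with Z hZ hr
  obtain ⟨w, hw⟩ := exists_flow_eq_drift_word hε hr.1 (Or.inl ⟨hr.2, rfl⟩) t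
  rw [hw]
  exact hZ w

end Flow

/-! ### Hausdorff measure of the boundary of a convex body -/

section Cone

variable {E : Type*} [NormedAddCommGroup E] [NormedSpace ℝ E]

/-- `ρ` is positively homogeneous, Lipschitz, and at least the norm. -/
structure IsGauge (ρ : E → ℝ) (Λ : ℝ) : Prop where
  pos : 0 < Λ
  hom : ∀ (r : ℝ) (y : E), 0 ≤ r → ρ (r • y) = r * ρ y
  lip : ∀ x y, |ρ x - ρ y| ≤ Λ * ‖x - y‖
  norm_le : ∀ y, ‖y‖ ≤ ρ y

variable {ρ : E → ℝ} {Λ : ℝ}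

theorem IsGauge.continuous (h : IsGauge ρ Λ) : Continuous ρ := by
  refine (LipschitzWith.of_dist_le_mul (K := ⟨Λ, h.pos.le⟩) fun x y => ?_).continuous
  rw [Real.dist_eq, dist_eq_norm]
  exact h.lip x y

theorem IsGauge.apply_pos (h : IsGauge ρ Λ) {y : E} (hy : y ≠ 0) : 0 < ρ y :=
  (norm_pos_iff.2 hy).trans_le (h.norm_le y)

theorem IsGauge.apply_zero (h : IsGauge ρ Λ) : ρ 0 = 0 := by
  have := h.hom 0 0 le_rfl
  rwa [zero_smul, zero_mul] at this

variable [MeasurableSpace E] [BorelSpace E] (μ : Measure E)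

/-- The volume of the part of `{ρ ≤ 1}` below a subset of `{ρ = 1}`. -/
noncomputable def coneMeasure (ρ : E → ℝ) : Measure E :=
  (μ.restrict {y | ρ y ≤ 1}).map fun y => (ρ y)⁻¹ • y

variable [FiniteDimensional ℝ E]

theorem IsGauge.measurable_direction (h : IsGauge ρ Λ) : Measurable fun y : E => (ρ y)⁻¹ • y :=
  h.continuous.measurable.inv.smul measurable_id

theorem coneMeasure_apply (h : IsGauge ρ Λ) {S : Set E} (hS : MeasurableSet S) :
    coneMeasure μ ρ S = μ ({y | ρ y ≤ 1} ∩ (fun y => (ρ y)⁻¹ • y) ⁻¹' S) := by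
  rw [coneMeasure, Measure.map_apply h.measurable_direction hS,
    Measure.restrict_apply (h.measurable_direction hS), inter_comm]

variable [μ.IsAddHaarMeasure]

theorem isFiniteMeasure_coneMeasure (h : IsGauge ρ Λ) : IsFiniteMeasure (coneMeasure μ ρ) := by
  refine ⟨?_⟩
  rw [coneMeasure_apply μ h MeasurableSet.univ, preimage_univ, inter_univ]
  refine (measure_mono fun y hy => ?_).trans_lt (measure_closedBall_lt_top (x := (0 : E)) (r := 1))
  rw [mem_closedBall_zero_iff]
  exact (h.norm_le y).trans hy

/-- Radial projection is invariant under dilations, so only the Haar scaling of the volume remains.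
-/
theorem measure_cone_eq (h : IsGauge ρ Λ) {S : Set E} (hS : MeasurableSet S) {r : ℝ} (hr : 0 < r) :
    μ ({y | ρ y ≤ r} ∩ (fun y => (ρ y)⁻¹ • y) ⁻¹' S) =
      ENNReal.ofReal (r ^ Module.finrank ℝ E) * coneMeasure μ ρ S := by
  rw [coneMeasure_apply μ h hS, ← abs_of_pos (pow_pos hr _), ← Measure.addHaar_smul]
  congr 1
  ext y
  rw [mem_smul_set_iff_inv_smul_mem₀ hr.ne']
  have h1 : ρ (r⁻¹ • y) = r⁻¹ * ρ y := h.hom _ _ (inv_nonneg.2 hr.le)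
  have h2 : (r⁻¹ * ρ y)⁻¹ • r⁻¹ • y = (ρ y)⁻¹ • y := by
    rw [smul_smul, mul_inv, inv_inv, mul_comm r, mul_assoc, mul_inv_cancel₀ hr.ne', mul_one]
  simp only [mem_inter_iff, mem_preimage, mem_ofPred_eq]
  rw [h1, h2, inv_mul_le_iff₀ hr, mul_one]

/-- The neighbourhood lies in the shell `|ρ - 1| < Λ δ`, over the points at distance at most `(1 +
Λ) δ` from `S`; by homogeneity this piece of the shell has the stated volume. -/
theorem measure_thickening_le (h : IsGauge ρ Λ) {S : Set E} (hS : ∀ y ∈ S, ρ y = 1) {δ : ℝ}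
    (hδ : 0 < δ) (hΛ : Λ * δ < 1) : μ (Metric.thickening δ S) ≤
      ENNReal.ofReal ((1 + Λ * δ) ^ Module.finrank ℝ E - (1 - Λ * δ) ^ Module.finrank ℝ E) *
        coneMeasure μ ρ (Metric.cthickening ((1 + Λ) * δ) S) := by
  have hΛδ := mul_pos h.pos hδ
  have := isFiniteMeasure_coneMeasure μ h
  set D := (fun y : E => (ρ y)⁻¹ • y) ⁻¹' Metric.cthickening ((1 + Λ) * δ) S
  have hc : MeasurableSet (Metric.cthickening ((1 + Λ) * δ) S) := Metric.isClosed_cthickening.measurableSet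
  have hsub : Metric.thickening δ S ⊆
      ({y | ρ y ≤ 1 + Λ * δ} ∩ D) \ ({y | ρ y ≤ 1 - Λ * δ} ∩ D) := by
    intro y hy
    obtain ⟨x, hx, hyx⟩ := Metric.mem_thickening_iff.1 hy
    have h1 : |ρ y - 1| < Λ * δ := by
      rw [← hS x hx]
      refine (h.lip y x).trans_lt ?_
      rw [← dist_eq_norm]
      exact mul_lt_mul_of_pos_left hyx h.pos
    obtain ⟨h2, h3⟩ := abs_lt.1 h1
    have hpos : 0 < ρ y := by linarith
    have hD : y ∈ D := by
      refine Metric.mem_cthickening_of_dist_le _ x _ _ hx ?_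
      -- Radial projection moves `y` by `|ρ y - 1| ‖y‖ / ρ y`, and `‖y‖ ≤ ρ y`.
      have h4 : dist ((ρ y)⁻¹ • y) y ≤ Λ * δ := by
        have : (ρ y)⁻¹ • y - y = ((ρ y)⁻¹ * (1 - ρ y)) • y := by
          rw [mul_sub, inv_mul_cancel₀ hpos.ne', mul_one, sub_smul, one_smul]
        rw [dist_eq_norm, this, norm_smul, Real.norm_eq_abs, abs_mul, abs_inv, abs_of_pos hpos,
          abs_sub_comm]
        calc (ρ y)⁻¹ * |ρ y - 1| * ‖y‖ ≤ (ρ y)⁻¹ * |ρ y - 1| * ρ y := by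
              gcongr; exact h.norm_le y
          _ = |ρ y - 1| := by field_simp
          _ ≤ Λ * δ := h1.le
      calc dist ((ρ y)⁻¹ • y) x ≤ dist ((ρ y)⁻¹ • y) y + dist y x := dist_triangle _ _ _
        _ ≤ Λ * δ + δ := by gcongr
        _ = (1 + Λ) * δ := by ring
    refine ⟨⟨?_, hD⟩, fun h5 => ?_⟩
    · change ρ y ≤ 1 + Λ * δ
      linarith
    · have : ρ y ≤ 1 - Λ * δ := h5.1
      linarith
  refine (measure_mono hsub).trans ?_
  have hm : ∀ r : ℝ, MeasurableSet ({y | ρ y ≤ r} ∩ D) := fun r =>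
    (measurableSet_le h.continuous.measurable measurable_const).inter (h.measurable_direction hc)
  have hmono : {y | ρ y ≤ 1 - Λ * δ} ∩ D ⊆ {y | ρ y ≤ 1 + Λ * δ} ∩ D := fun y hy =>
    ⟨(show ρ y ≤ 1 - Λ * δ from hy.1).trans (by linarith), hy.2⟩
  rw [measure_sdiff hmono (hm _).nullMeasurableSet, measure_cone_eq μ h hc (by linarith),
    measure_cone_eq μ h hc (by linarith), ENNReal.ofReal_sub _ (pow_nonneg (by linarith) _),
    ENNReal.sub_mul]
  · exact fun _ _ => measure_ne_top _ _
  · rw [measure_cone_eq μ h hc (by linarith)]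
    exact ENNReal.mul_ne_top ENNReal.ofReal_ne_top (measure_ne_top _ _)

omit [NormedSpace ℝ E] [MeasurableSpace E] [BorelSpace E] [FiniteDimensional ℝ E] in
theorem ediam_closedBall_le_ofReal (x : E) (r : ℝ) :
    Metric.ediam (Metric.closedBall x r) ≤ ENNReal.ofReal (2 * r) := by
  refine Metric.ediam_le fun y hy z hz => ?_
  rw [edist_dist]
  refine ENNReal.ofReal_le_ofReal ?_
  have := dist_triangle_right y z x
  rw [Metric.mem_closedBall] at hy hz
  linarith

/-- A maximal `δ`-separated subset of `S` is a `δ`-net, and the balls of radius `δ/2` around it are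
disjoint and contained in the thickening. -/
theorem exists_finset_cover {S : Set E} (hS : IsCompact S) {δ : ℝ} (hδ : 0 < δ) :
    ∃ t : Finset E, S ⊆ ⋃ x : t, Metric.closedBall (x : E) δ ∧
      (t.card : ℝ≥0∞) * (ENNReal.ofReal ((δ / 2) ^ Module.finrank ℝ E) * μ (Metric.ball 0 1)) ≤
        μ (Metric.thickening δ S) := by
  have hδ' : 0 < δ / 2 := by positivity
  set e : NNReal := ⟨δ / 2, hδ'.le⟩
  have he : e ≠ 0 := fun h => hδ'.ne' (congrArg NNReal.toReal h)
  have he2 : ((2 * e : NNReal) : ℝ) = δ := by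
    rw [NNReal.coe_mul]
    change 2 * (δ / 2) = δ
    ring
  have hfin : Metric.packingNumber (2 * e) S ≠ ⊤ := by
    obtain ⟨N, hN1, hN2, hN3⟩ := Metric.exists_finite_isCover_of_isCompact he hS
    have h1 := Metric.packingNumber_two_mul_le_externalCoveringNumber e S
    have h2 := hN3.externalCoveringNumber_le_encard
    exact ((h1.trans h2).trans_lt hN2.encard_lt_top).ne
  obtain ⟨C, hC⟩ : ∃ C, C = Metric.maximalSeparatedSet (2 * e) S := ⟨_, rfl⟩
  have hCS : C ⊆ S := hC ▸ Metric.maximalSeparatedSet_subset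
  have hCf : C.Finite := by
    rw [← Set.encard_lt_top_iff, hC, Metric.encard_maximalSeparatedSet hfin]
    exact hfin.lt_top
  have hcov := hC ▸ Metric.isCover_maximalSeparatedSet hfin
  have hsep : Metric.IsSeparated ((2 * e : NNReal) : ℝ≥0∞) C := hC ▸ Metric.isSeparated_maximalSeparatedSet
  refine ⟨hCf.toFinset, ?_, ?_⟩
  · intro x hx
    have := Metric.isCover_iff_subset_iUnion_closedBall.1 hcov hx
    rw [mem_iUnion₂] at this
    obtain ⟨y, hy, hxy⟩ := this
    rw [he2] at hxy
    exact mem_iUnion.2 ⟨⟨y, hCf.mem_toFinset.2 hy⟩, hxy⟩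
  · have hdisj : (hCf.toFinset : Set E).PairwiseDisjoint fun x => Metric.ball x (δ / 2) := by
      intro x hx y hy hxy
      have h1 : ((2 * e : NNReal) : ℝ≥0∞) < edist x y :=
        hsep (hCf.mem_toFinset.1 hx) (hCf.mem_toFinset.1 hy) hxy
      rw [edist_nndist, ENNReal.coe_lt_coe, ← NNReal.coe_lt_coe, he2, coe_nndist] at h1
      exact Metric.ball_disjoint_ball (by linarith)
    calc _ = ∑ x ∈ hCf.toFinset, μ (Metric.ball x (δ / 2)) := by
          rw [Finset.sum_congr rfl fun x _ => Measure.addHaar_ball_of_pos μ x hδ', Finset.sum_const,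
            nsmul_eq_mul]
      _ = μ (⋃ x ∈ hCf.toFinset, Metric.ball x (δ / 2)) :=
          (measure_biUnion_finset hdisj fun x _ => Metric.isOpen_ball.measurableSet).symm
      _ ≤ _ := measure_mono fun y hy => by
          simp only [mem_iUnion] at hy
          obtain ⟨x, hx, hxy⟩ := hy
          refine Metric.mem_thickening_iff.2 ⟨x, hCS (hCf.mem_toFinset.1 hx), ?_⟩
          exact (Metric.mem_ball.1 hxy).trans (by linarith)

theorem tendsto_pow_sub_pow_div (Λ : ℝ) (n : ℕ) :
    Tendsto (fun k : ℕ => ((1 + Λ * (1 / ((k : ℝ) + 1))) ^ n - (1 - Λ * (1 / ((k : ℝ) + 1))) ^ n) /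
      (1 / ((k : ℝ) + 1))) atTop (𝓝 (2 * n * Λ)) := by
  have hd : HasDerivAt (fun x : ℝ => (1 + Λ * x) ^ n - (1 - Λ * x) ^ n) (2 * n * Λ) 0 := by
    have h1 : HasDerivAt (fun x : ℝ => 1 + Λ * x) Λ 0 := by
      simpa using ((hasDerivAt_id (0 : ℝ)).const_mul Λ).const_add 1
    have h2 : HasDerivAt (fun x : ℝ => 1 - Λ * x) (-Λ) 0 := by
      simpa using ((hasDerivAt_id (0 : ℝ)).const_mul Λ).const_sub 1
    refine ((h1.fun_pow n).fun_sub (h2.fun_pow n)).congr_deriv ?_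
    simp only [mul_zero, add_zero, sub_zero, one_pow, mul_one]
    ring
  have := hd.tendsto_slope_zero.comp (tendsto_nhdsWithin_iff.2
    ⟨tendsto_one_div_add_atTop_nhds_zero_nat (𝕜 := ℝ), Eventually.of_forall fun k => by
      simp only [mem_compl_iff, mem_singleton_iff]; positivity⟩)
  refine this.congr fun k => ?_
  simp only [Function.comp, zero_add, mul_zero, add_zero, sub_zero, one_pow, sub_self, smul_eq_mul]
  rw [div_eq_inv_mul _ (1 / ((k : ℝ) + 1))]

/-- Cover by `m` balls of radius `δ`, where `m (δ/2)^n |B|` is at most the volume of the shell,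
asymptotically `2nΛδ` times the cone measure. Then `m (2δ)^(n-1)` is at most `2^(2n-1) · 2nΛ = 4^n n
Λ` times the cone measure over `|B|`, in the limit. The constant is not sharp; only its exponential
order matters. -/
theorem hausdorffMeasure_le_coneMeasure_of_isCompact (h : IsGauge ρ Λ) {S : Set E}
    (hS : ∀ y ∈ S, ρ y = 1) (hc : IsCompact S) (hn : 1 ≤ Module.finrank ℝ E) :
    μH[((Module.finrank ℝ E - 1 : ℕ) : ℝ)] S ≤
      ENNReal.ofReal (4 ^ Module.finrank ℝ E * Module.finrank ℝ E * Λ) / μ (Metric.ball 0 1) *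
        coneMeasure μ ρ S := by
  have := isFiniteMeasure_coneMeasure μ h
  set n := Module.finrank ℝ E
  have hB0 : μ (Metric.ball (0 : E) 1) ≠ 0 := (Metric.measure_ball_pos μ 0 one_pos).ne'
  have hBt : μ (Metric.ball (0 : E) 1) ≠ ⊤ := measure_ball_lt_top.ne
  set δ : ℕ → ℝ := fun k => 1 / ((k : ℝ) + 1) with hδ
  have hδ0 : ∀ k, 0 < δ k := fun k => by simp only [hδ]; positivity
  have hδlim : Tendsto δ atTop (𝓝 0) := tendsto_one_div_add_atTop_nhds_zero_nat (𝕜 := ℝ)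
  choose t ht1 ht2 using fun k => exists_finset_cover μ hc (hδ0 k)
  have hq := tendsto_pow_sub_pow_div Λ n
  set q : ℕ → ℝ := fun k => ((1 + Λ * δ k) ^ n - (1 - Λ * δ k) ^ n) / δ k with hqdef
  have key := Measure.hausdorffMeasure_le_liminf_sum ((n - 1 : ℕ) : ℝ) S (l := atTop)
    (fun k => ENNReal.ofReal (2 * δ k))
    (by simpa using ENNReal.tendsto_ofReal (hδlim.const_mul 2))
    (fun k (x : t k) => Metric.closedBall (x : E) (δ k))
    (Eventually.of_forall fun k x => ediam_closedBall_le_ofReal _ _)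
    (Eventually.of_forall ht1)
  have hlim : Tendsto (fun k => ENNReal.ofReal (2 ^ (2 * n - 1) * q k) / μ (Metric.ball 0 1) *
      coneMeasure μ ρ (Metric.cthickening ((1 + Λ) * δ k) S)) atTop
      (𝓝 (ENNReal.ofReal (4 ^ n * n * Λ) / μ (Metric.ball 0 1) * coneMeasure μ ρ S)) := by
    have h1 : Tendsto (fun k => coneMeasure μ ρ (Metric.cthickening ((1 + Λ) * δ k) S)) atTop
        (𝓝 (coneMeasure μ ρ S)) := by
      have := (tendsto_measure_cthickening_of_isClosed (μ := coneMeasure μ ρ)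
        ⟨1, one_pos, measure_ne_top _ _⟩ hc.isClosed).comp
          (by simpa using hδlim.const_mul (1 + Λ))
      exact this
    have h2 : Tendsto (fun k => ENNReal.ofReal (2 ^ (2 * n - 1) * q k) / μ (Metric.ball (0 : E) 1)) atTop
        (𝓝 (ENNReal.ofReal (4 ^ n * n * Λ) / μ (Metric.ball 0 1))) := by
      refine ENNReal.Tendsto.div_const (ENNReal.tendsto_ofReal ?_) (Or.inr hB0)
      have h4 : (4 : ℝ) ^ n * n * Λ = 2 ^ (2 * n - 1) * (2 * n * Λ) := by
        have : (4 : ℝ) ^ n = 2 ^ (2 * n - 1) * 2 := by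
          rw [← pow_succ, show 2 * n - 1 + 1 = 2 * n by omega, pow_mul]; norm_num
        rw [this]; ring
      rw [h4]
      exact hq.const_mul _
    exact ENNReal.Tendsto.mul h2 (Or.inr (measure_ne_top _ _)) h1
      (Or.inr (ENNReal.div_ne_top ENNReal.ofReal_ne_top hB0))
  refine key.trans ((liminf_le_liminf ?_).trans_eq hlim.liminf_eq)
  have hev : ∀ᶠ k in atTop, Λ * δ k < 1 := by
    have : Tendsto (fun k => Λ * δ k) atTop (𝓝 0) := by simpa using hδlim.const_mul Λ
    exact this.eventually (gt_mem_nhds one_pos)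
  filter_upwards [hev] with k hk
  have hδk := hδ0 k
  have hthick := (ht2 k).trans (measure_thickening_le μ h hS hδk hk)
  calc ∑ x : t k, Metric.ediam (Metric.closedBall (x : E) (δ k)) ^ (((n - 1 : ℕ) : ℝ))
      ≤ ∑ x : t k, ENNReal.ofReal (2 * δ k) ^ (((n - 1 : ℕ) : ℝ)) := by
        refine Finset.sum_le_sum fun x _ => ENNReal.rpow_le_rpow ?_ (Nat.cast_nonneg _)
        exact ediam_closedBall_le_ofReal _ _
    _ = ((t k).card : ℝ≥0∞) * ENNReal.ofReal ((2 * δ k) ^ (n - 1)) := by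
        rw [Finset.sum_const, nsmul_eq_mul, Finset.card_univ, Fintype.card_coe, ENNReal.rpow_natCast,
          ENNReal.ofReal_pow (by positivity)]
    _ = ((t k).card : ℝ≥0∞) * (ENNReal.ofReal ((δ k / 2) ^ n) * μ (Metric.ball 0 1)) *
          (ENNReal.ofReal (2 ^ (2 * n - 1) / δ k) / μ (Metric.ball 0 1)) := by
        have h1 : (2 * δ k) ^ (n - 1) = (δ k / 2) ^ n * (2 ^ (2 * n - 1) / δ k) := by
          obtain ⟨j, hj⟩ : ∃ j, n = j + 1 := ⟨n - 1, by omega⟩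
          have h2 : ∀ x : ℝ, 0 < x → (2 * x) ^ j = (x / 2) ^ (j + 1) * (2 ^ (j + j + 1) / x) := by
            intro x hx
            rw [mul_pow, div_pow, pow_succ, pow_succ, pow_succ, pow_add]
            field_simp
          rw [hj, show j + 1 - 1 = j by omega, show 2 * (j + 1) - 1 = j + j + 1 by omega]
          exact h2 _ hδk
        rw [h1, ENNReal.ofReal_mul (by positivity)]
        rw [ENNReal.div_eq_inv_mul, mul_assoc, mul_assoc]
        congr 2
        rw [← mul_assoc, ENNReal.mul_inv_cancel hB0 hBt, one_mul]
    _ ≤ ENNReal.ofReal ((1 + Λ * δ k) ^ n - (1 - Λ * δ k) ^ n) *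
        coneMeasure μ ρ (Metric.cthickening ((1 + Λ) * δ k) S) *
          (ENNReal.ofReal (2 ^ (2 * n - 1) / δ k) / μ (Metric.ball 0 1)) := by gcongr
    _ = _ := by
        have h1 : (2 : ℝ) ^ (2 * n - 1) * q k =
            ((1 + Λ * δ k) ^ n - (1 - Λ * δ k) ^ n) * (2 ^ (2 * n - 1) / δ k) := by
          simp only [hqdef]; ring
        rw [h1, ENNReal.ofReal_mul' (by positivity), ENNReal.div_eq_inv_mul, ENNReal.div_eq_inv_mul]
        ring

/-- The compact case shows that the measure is finite, so inner regularity extends the bound to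
measurable sets. -/
theorem hausdorffMeasure_restrict_le_coneMeasure (h : IsGauge ρ Λ) (hn : 1 ≤ Module.finrank ℝ E) :
    (μH[((Module.finrank ℝ E - 1 : ℕ) : ℝ)] : Measure E).restrict {y | ρ y = 1} ≤
      (ENNReal.ofReal (4 ^ Module.finrank ℝ E * Module.finrank ℝ E * Λ) / μ (Metric.ball 0 1)) •
        coneMeasure μ ρ := by
  have hfin := isFiniteMeasure_coneMeasure μ h
  have hB0 : μ (Metric.ball (0 : E) 1) ≠ 0 := (Metric.measure_ball_pos μ 0 one_pos).ne'
  have hcl : IsClosed {y | ρ y = 1} := isClosed_eq h.continuous continuous_const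
  have hK : IsCompact {y | ρ y = 1} :=
    Metric.isCompact_of_isClosed_isBounded hcl ((Metric.isBounded_closedBall (x := (0 : E)) (r := 1)).subset
      fun y hy => by rw [mem_closedBall_zero_iff]; exact (h.norm_le y).trans (le_of_eq hy))
  have hfin2 : IsFiniteMeasure ((μH[((Module.finrank ℝ E - 1 : ℕ) : ℝ)] : Measure E).restrict
      {y | ρ y = 1}) := by
    refine ⟨?_⟩
    rw [Measure.restrict_apply_univ]
    refine (hausdorffMeasure_le_coneMeasure_of_isCompact μ h (fun y hy => hy) hK hn).trans_lt ?_
    exact ENNReal.mul_lt_top (ENNReal.div_lt_top ENNReal.ofReal_ne_top hB0) (measure_lt_top _ _)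
  refine Measure.le_iff.2 fun S hS => ?_
  rw [hS.measure_eq_iSup_isCompact]
  refine iSup₂_le fun L hL => iSup_le fun hLc => ?_
  rw [Measure.restrict_apply hLc.measurableSet, Measure.smul_apply, smul_eq_mul]
  refine (hausdorffMeasure_le_coneMeasure_of_isCompact μ h (fun y hy => hy.2)
    (hLc.inter_right hcl) hn).trans ?_
  gcongr
  exact inter_subset_left.trans hL

end Cone

/-! ### Total mass of the surface measure of the ellipsoid -/

/-- A set lies in a ball with its diameter as radius, so `volume ≤ |B| μH`, and the unit ball has
Hausdorff measure at least one. The sharp isodiametric constant is not needed, only the decay of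
`|B|` in `m`. -/
theorem addHaarScalarFactor_le (m : ℕ) :
    ((volume : Measure (EuclideanSpace ℝ (Fin m))).addHaarScalarFactor μH[(m : ℝ)] : ℝ≥0∞) ≤
      volume (Metric.ball (0 : EuclideanSpace ℝ (Fin m)) 1) := by
  set E := EuclideanSpace ℝ (Fin m)
  set c := (volume : Measure E).addHaarScalarFactor μH[(m : ℝ)]
  have hvol : (volume : Measure E) = c • μH[(m : ℝ)] := Measure.isAddLeftInvariant_eq_smul _ _
  set w := volume (Metric.ball (0 : E) 1)
  have hw0 : w ≠ 0 := (Metric.measure_ball_pos volume 0 one_pos).ne'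
  have hwt : w ≠ ⊤ := measure_ball_lt_top.ne
  have hle : w⁻¹ • (volume : Measure E) ≤ μH[(m : ℝ)] := by
    refine Measure.le_hausdorffMeasure _ _ 1 one_pos fun s hs => ?_
    rw [Measure.smul_apply, smul_eq_mul]
    rcases s.eq_empty_or_nonempty with rfl | ⟨x, hx⟩
    · simp
    have hbd : Bornology.IsBounded s := Metric.isBounded_iff_ediam_ne_top.2 (hs.trans_lt ENNReal.one_lt_top).ne
    have hsub : s ⊆ Metric.closedBall x (Metric.diam s) := fun y hy => Metric.dist_le_diam_of_mem hbd hy hx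
    calc w⁻¹ * volume s ≤ w⁻¹ * (ENNReal.ofReal (Metric.diam s ^ m) * w) := by
          gcongr
          refine (measure_mono hsub).trans_eq ?_
          rw [Measure.addHaar_closedBall _ _ Metric.diam_nonneg, finrank_euclideanSpace_fin]
      _ = ENNReal.ofReal (Metric.diam s) ^ m := by
          rw [mul_comm, mul_assoc, ENNReal.mul_inv_cancel hw0 hwt, mul_one,
            ENNReal.ofReal_pow Metric.diam_nonneg]
      _ = Metric.ediam s ^ (m : ℝ) := by
          rw [ENNReal.rpow_natCast, Metric.diam, ENNReal.ofReal_toReal (hs.trans_lt ENNReal.one_lt_top).ne]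
  have h1 : 1 ≤ μH[(m : ℝ)] (Metric.ball (0 : E) 1) := by
    have := hle (Metric.ball (0 : E) 1)
    rwa [Measure.smul_apply, smul_eq_mul, ENNReal.inv_mul_cancel hw0 hwt] at this
  have h2 : w = c * μH[(m : ℝ)] (Metric.ball (0 : E) 1) := by
    change volume _ = _
    rw [hvol]
    rfl
  rw [h2]
  exact le_mul_of_one_le_right' h1

/-- Chernoff bound: `1 ≤ exp(R (1 - ‖v‖²))` on the unit ball, and for `R = π c²` the Gaussian
integral is `(π/R)^(m/2) = c^(-m)`. -/
theorem exists_volume_ball_le (c : ℝ) (hc : 1 ≤ c) : ∃ B : ℝ, 0 < B ∧ ∀ m : ℕ,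
    volume (Metric.ball (0 : EuclideanSpace ℝ (Fin m)) 1) ≤ ENNReal.ofReal (B / c ^ m) := by
  set R : ℝ := Real.pi * c ^ 2
  have hR : 0 < R := by positivity
  refine ⟨Real.exp R, Real.exp_pos _, fun m => ?_⟩
  have hint := GaussianFourier.integral_rexp_neg_mul_sq_norm (V := EuclideanSpace ℝ (Fin m)) hR
  have hi : Integrable fun v : EuclideanSpace ℝ (Fin m) => Real.exp (-R * ‖v‖ ^ 2) := by
    by_contra h
    rw [integral_undef h] at hint
    have : 0 < (Real.pi / R) ^ ((Module.finrank ℝ (EuclideanSpace ℝ (Fin m)) : ℝ) / 2) :=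
      Real.rpow_pos_of_pos (div_pos Real.pi_pos hR) _
    exact this.ne hint
  have hval : (Real.pi / R) ^ ((Module.finrank ℝ (EuclideanSpace ℝ (Fin m)) : ℝ) / 2) = (c ^ m)⁻¹ := by
    have h1 : Real.pi / R = (c⁻¹) ^ (2 : ℝ) := by
      rw [Real.rpow_two]
      simp only [R]
      field_simp
    rw [finrank_euclideanSpace_fin, h1, ← Real.rpow_mul (by positivity),
      mul_div_cancel₀ _ (two_ne_zero), Real.rpow_natCast, inv_pow]
  calc volume (Metric.ball (0 : EuclideanSpace ℝ (Fin m)) 1)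
      = ∫⁻ _ in Metric.ball (0 : EuclideanSpace ℝ (Fin m)) 1, 1 := by simp
    _ ≤ ∫⁻ v in Metric.ball (0 : EuclideanSpace ℝ (Fin m)) 1,
          ENNReal.ofReal (Real.exp R * Real.exp (-R * ‖v‖ ^ 2)) := by
        refine setLIntegral_mono' Metric.isOpen_ball.measurableSet fun v hv => ?_
        rw [mem_ball_zero_iff] at hv
        rw [ENNReal.one_le_ofReal, ← Real.exp_add]
        refine Real.one_le_exp ?_
        have : ‖v‖ ^ 2 ≤ 1 := pow_le_one₀ (norm_nonneg _) hv.le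
        nlinarith
    _ ≤ ∫⁻ v, ENNReal.ofReal (Real.exp R * Real.exp (-R * ‖v‖ ^ 2)) := setLIntegral_le_lintegral _ _
    _ = ENNReal.ofReal (Real.exp R / c ^ m) := by
        rw [← ofReal_integral_eq_lintegral_ofReal (hi.const_mul _)
          (Eventually.of_forall fun v => by positivity), integral_const_mul, hint, hval]
        rfl

section Gauge

variable {d ℓ : ℕ}

/-- The linear isometry between the norm of the ellipsoid and a Euclidean norm. -/
noncomputable def differences (ω : Impact d ℓ) :
    PiLp 2 fun _ : Fin ℓ ⊕ Fin ℓ × Fin ℓ => Space d :=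
  WithLp.toLp 2 (Sum.elim (fun i => ω i) fun p => if p.1 < p.2 then ω p.1 - ω p.2 else 0)

theorem differences_sub (ω ν : Impact d ℓ) :
    differences (ω - ν) = differences ω - differences ν := by
  ext i : 1
  rcases i with i | p
  · rfl
  · simp only [differences, PiLp.sub_apply, Sum.elim_inr]
    split_ifs
    · abel
    · rw [sub_zero]

theorem differences_smul (r : ℝ) (ω : Impact d ℓ) : differences (r • ω) = r • differences ω := by
  ext i : 1
  rcases i with i | p
  · rfl
  · simp only [differences, PiLp.smul_apply, Sum.elim_inr]
    split_ifs
    · rw [smul_sub]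
    · rw [smul_zero]

theorem inner_differences (ω ν : Impact d ℓ) :
    inner ℝ (differences ω) (differences ν) = crossSection ω ν := by
  rw [PiLp.inner_apply, Fintype.sum_sum_type, Fintype.sum_prod_type, crossSection, pairing]
  congr 1
  refine Finset.sum_congr rfl fun i _ => Finset.sum_congr rfl fun j _ => ?_
  simp only [differences, Sum.elim_inr]
  split_ifs
  · rfl
  · rw [inner_zero_left]

/-- The norm whose unit sphere is the ellipsoid. -/
noncomputable def gauge (ω : Impact d ℓ) : ℝ := ‖differences ω‖

theorem gauge_sq (ω : Impact d ℓ) : gauge ω ^ 2 = crossSection ω ω := by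
  rw [gauge, ← real_inner_self_eq_norm_sq, inner_differences]

theorem crossSection_le (ω ν : Impact d ℓ) : crossSection ω ν ≤ gauge ω * gauge ν := by
  rw [← inner_differences]
  exact real_inner_le_norm _ _

/-- This shows the shape of the ellipsoid: it has half-width `1/√(ℓ+1)` where `∑ ω_i = 0`, and `1`
only in the `d` diagonal directions. -/
theorem crossSection_self_eq (ω : Impact d ℓ) :
    crossSection ω ω = ((ℓ : ℝ) + 1) * ‖ω‖ ^ 2 - ‖∑ i, ω i‖ ^ 2 := by
  have h : ∀ i, ∑ j, (ω i - ω j) = (ℓ : ℝ) • ω i - ∑ j, ω j := fun i => by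
    rw [Finset.sum_sub_distrib, Finset.sum_const, Finset.card_univ, Fintype.card_fin,
      Nat.cast_smul_eq_nsmul]
  have hn : ∑ i, inner ℝ (ω i) (ω i) = ‖ω‖ ^ 2 := by
    rw [← real_inner_self_eq_norm_sq, PiLp.inner_apply]
  rw [crossSection, pairing_eq_sum]
  simp only [h, inner_sub_left, Finset.sum_sub_distrib, real_inner_smul_left]
  rw [← Finset.mul_sum, hn, ← inner_sum, real_inner_self_eq_norm_sq]
  ring

theorem mem_ellipsoid_iff (ω : Impact d ℓ) : ω ∈ ellipsoid d ℓ ↔ gauge ω = 1 := by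
  have h0 : 0 ≤ gauge ω := norm_nonneg _
  rw [← sq_eq_sq₀ h0 zero_le_one, one_pow, gauge_sq]
  change _ = _ ↔ _
  simp only [crossSection, pairing, real_inner_self_eq_norm_sq]

theorem isGauge_gauge (d ℓ : ℕ) : IsGauge (gauge : Impact d ℓ → ℝ) (√((ℓ : ℝ) + 1)) where
  pos := by positivity
  hom r y hr := by rw [gauge, differences_smul, norm_smul, Real.norm_eq_abs, abs_of_nonneg hr, gauge]
  lip x y := by
    refine (abs_norm_sub_norm_le _ _).trans ?_
    rw [← differences_sub]
    refine abs_le_of_sq_le_sq' ?_ (by positivity) |>.2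
    rw [← gauge, gauge_sq, crossSection_self_eq, mul_pow, Real.sq_sqrt (by positivity)]
    exact sub_le_self _ (sq_nonneg _)
  norm_le y := by
    refine abs_le_of_sq_le_sq' ?_ (norm_nonneg _) |>.2
    rw [← gauge, gauge_sq, crossSection, ← real_inner_self_eq_norm_sq, PiLp.inner_apply]
    refine le_add_of_nonneg_right (Finset.sum_nonneg fun i _ => Finset.sum_nonneg fun j _ => ?_)
    split_ifs
    · exact real_inner_self_nonneg
    · exact le_rfl

theorem gauge_le (ω : Impact d ℓ) : gauge ω ≤ √((ℓ : ℝ) + 1) * ‖ω‖ := by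
  have h := (isGauge_gauge d ℓ).lip ω 0
  rw [(isGauge_gauge d ℓ).apply_zero, sub_zero, sub_zero] at h
  exact (le_abs_self _).trans h

theorem finrank_impact (d ℓ : ℕ) : Module.finrank ℝ (Impact d ℓ) = ℓ * d := by
  rw [(WithLp.linearEquiv 2 ℝ (Fin ℓ → Space d)).finrank_eq, Module.finrank_pi_fintype]
  simp

theorem surfaceMeasure_le (hn : 1 ≤ ℓ * d) : surfaceMeasure d ℓ ≤
    (volume (Metric.ball (0 : EuclideanSpace ℝ (Fin (ℓ * d - 1))) 1) *
      (ENNReal.ofReal (4 ^ (ℓ * d) * (ℓ * d : ℕ) * √((ℓ : ℝ) + 1)) /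
        volume (Metric.ball (0 : Impact d ℓ) 1))) • coneMeasure volume (gauge : Impact d ℓ → ℝ) := by
  have h := hausdorffMeasure_restrict_le_coneMeasure (volume : Measure (Impact d ℓ))
    (isGauge_gauge d ℓ) (by rwa [finrank_impact])
  rw [finrank_impact] at h
  have he : ellipsoid d ℓ = {y | gauge y = 1} := by
    ext y
    exact mem_ellipsoid_iff y
  rw [surfaceMeasure, Measure.euclideanHausdorffMeasure_def, he, Measure.restrict_smul, mul_smul]
  refine Measure.le_iff.2 fun S hS => ?_
  rw [Measure.smul_apply, Measure.smul_apply, ENNReal.smul_def, smul_eq_mul, smul_eq_mul]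
  exact mul_le_mul' (addHaarScalarFactor_le _) (h S)

/-- The body is long only along the diagonal, which is parametrized by `ℝ^d`. A `1/(ℓ+1)`-net of at
most `(4(ℓ+1))^d` points of the unit ball there gives a cover by balls of radius `2/√(ℓ+1)`. The
resulting factor `(ℓ+1)^(-ℓd/2)` is the source of the second factorial. -/
theorem volume_gauge_le_one :
    volume {ω : Impact d ℓ | gauge ω ≤ 1} ≤ ENNReal.ofReal ((4 * ((ℓ : ℝ) + 1)) ^ d *
      (2 / √((ℓ : ℝ) + 1)) ^ (ℓ * d)) * volume (Metric.ball (0 : Impact d ℓ) 1) := by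
  have hL : (0 : ℝ) < (ℓ : ℝ) + 1 := by positivity
  set R : ℝ := 2 / √((ℓ : ℝ) + 1)
  have hR : 0 < R := by positivity
  obtain ⟨t, ht1, ht2⟩ := exists_finset_cover (volume : Measure (Space d))
    (isCompact_closedBall (0 : Space d) 1) (δ := 1 / ((ℓ : ℝ) + 1)) (by positivity)
  set w := volume (Metric.ball (0 : Space d) 1)
  have hw0 : w ≠ 0 := (Metric.measure_ball_pos volume 0 one_pos).ne'
  have hwt : w ≠ ⊤ := measure_ball_lt_top.ne
  have hcard : (t.card : ℝ≥0∞) ≤ ENNReal.ofReal ((4 * ((ℓ : ℝ) + 1)) ^ d) := by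
    have h1 : volume (Metric.thickening (1 / ((ℓ : ℝ) + 1)) (Metric.closedBall (0 : Space d) 1)) ≤
        ENNReal.ofReal (2 ^ d) * w := by
      calc _ ≤ volume (Metric.ball (0 : Space d) 2) := by
            refine measure_mono fun y hy => ?_
            obtain ⟨x, hx, hyx⟩ := Metric.mem_thickening_iff.1 hy
            rw [Metric.mem_ball]
            have h2 : 1 / ((ℓ : ℝ) + 1) ≤ 1 := by
              rw [div_le_one hL]; linarith [(Nat.cast_nonneg ℓ : (0 : ℝ) ≤ ℓ)]
            have := dist_triangle y x 0
            rw [Metric.mem_closedBall] at hx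
            linarith
        _ = _ := by rw [Measure.addHaar_ball_of_pos _ _ two_pos, finrank_euclideanSpace_fin]
    have h3 := ht2.trans h1
    rw [finrank_euclideanSpace_fin, ← mul_assoc, ENNReal.mul_le_mul_iff_left hw0 hwt] at h3
    have h4 : (1 / ((ℓ : ℝ) + 1) / 2) ^ d * (4 * ((ℓ : ℝ) + 1)) ^ d = 2 ^ d := by
      rw [← mul_pow]
      congr 1
      field_simp
      norm_num
    have h5 : (0 : ℝ) < (1 / ((ℓ : ℝ) + 1) / 2) ^ d := by positivity
    rw [← h4, ENNReal.ofReal_mul h5.le, mul_comm,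
      ENNReal.mul_le_mul_iff_right (ENNReal.ofReal_pos.2 h5).ne' ENNReal.ofReal_ne_top] at h3
    exact h3
  have hcov : {ω : Impact d ℓ | gauge ω ≤ 1} ⊆
      ⋃ c ∈ t, Metric.closedBall (WithLp.toLp 2 fun _ => c : Impact d ℓ) R := by
    intro ω hω
    have hω' : gauge ω ≤ 1 := hω
    have hg : crossSection ω ω ≤ 1 := by
      rw [← gauge_sq]
      exact pow_le_one₀ (norm_nonneg _) hω'
    rw [crossSection_self_eq] at hg
    set y := ∑ i, ω i with hy
    -- Nearly the mean of the `ω i`; because `(ℓ+1)‖ω‖² ≤ 1 + ‖y‖²`, its diagonal point is within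
    -- `1/√(ℓ+1)` of `ω`.
    set c₀ : Space d := ((ℓ : ℝ) + 1)⁻¹ • y with hc₀
    have hyn : ‖y‖ ^ 2 ≤ ℓ * ‖ω‖ ^ 2 := by
      have h1 : ‖y‖ ≤ ∑ i, ‖ω i‖ := norm_sum_le _ _
      have h2 : (∑ i, ‖ω i‖) ^ 2 ≤ ℓ * ∑ i, ‖ω i‖ ^ 2 := by
        have := sq_sum_le_card_mul_sum_sq (s := Finset.univ) (f := fun i : Fin ℓ => ‖ω i‖)
        simpa using this
      rw [PiLp.norm_sq_eq_of_L2 _ ω]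
      exact (pow_le_pow_left₀ (norm_nonneg _) h1 2).trans h2
    have hωn : ‖ω‖ ^ 2 ≤ 1 := by linarith
    have hc1 : ‖c₀‖ ≤ 1 := by
      rw [hc₀, norm_smul, norm_inv, Real.norm_eq_abs, abs_of_pos hL, inv_mul_le_iff₀ hL, mul_one]
      refine abs_le_of_sq_le_sq' ?_ hL.le |>.2
      nlinarith [(Nat.cast_nonneg ℓ : (0 : ℝ) ≤ ℓ)]
    obtain ⟨⟨c, hct⟩, hc⟩ := mem_iUnion.1 (ht1 (mem_closedBall_zero_iff.2 hc1))
    refine mem_iUnion₂.2 ⟨c, hct, ?_⟩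
    rw [Metric.mem_closedBall] at hc ⊢
    have hs : √((ℓ : ℝ) + 1) ^ 2 = (ℓ : ℝ) + 1 := Real.sq_sqrt hL.le
    have hsp : 0 < √((ℓ : ℝ) + 1) := by positivity
    have h1 : dist ω (WithLp.toLp 2 fun _ => c₀ : Impact d ℓ) ≤ 1 / √((ℓ : ℝ) + 1) := by
      refine abs_le_of_sq_le_sq' ?_ (by positivity) |>.2
      have h2 : dist ω (WithLp.toLp 2 fun _ => c₀ : Impact d ℓ) ^ 2 =
          ‖ω‖ ^ 2 - 2 * inner ℝ y c₀ + ℓ * ‖c₀‖ ^ 2 := by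
        rw [dist_eq_norm, PiLp.norm_sq_eq_of_L2, PiLp.norm_sq_eq_of_L2]
        simp only [PiLp.sub_apply, norm_sub_sq_real]
        rw [Finset.sum_add_distrib, Finset.sum_sub_distrib, ← Finset.mul_sum, ← sum_inner]
        simp
        rfl
      rw [h2, div_pow, one_pow, hs, hc₀, real_inner_smul_right, real_inner_self_eq_norm_sq, norm_smul,
        mul_pow, norm_inv, Real.norm_eq_abs, abs_of_pos hL, le_div_iff₀ hL]
      field_simp
      nlinarith [(Nat.cast_nonneg ℓ : (0 : ℝ) ≤ ℓ), sq_nonneg ‖y‖]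
    have h3 : dist (WithLp.toLp 2 fun _ => c₀ : Impact d ℓ) (WithLp.toLp 2 fun _ => c) ≤
        1 / √((ℓ : ℝ) + 1) := by
      refine abs_le_of_sq_le_sq' ?_ (by positivity) |>.2
      have h4 : dist (WithLp.toLp 2 fun _ => c₀ : Impact d ℓ) (WithLp.toLp 2 fun _ => c) ^ 2 =
          ℓ * dist c₀ c ^ 2 := by
        rw [dist_eq_norm, PiLp.norm_sq_eq_of_L2]
        simp only [PiLp.sub_apply, Finset.sum_const, Finset.card_univ, Fintype.card_fin, nsmul_eq_mul,
          ← dist_eq_norm]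
      rw [h4, div_pow, one_pow, hs]
      calc (ℓ : ℝ) * dist c₀ c ^ 2 ≤ ((ℓ : ℝ) + 1) * (1 / ((ℓ : ℝ) + 1)) ^ 2 := by
            gcongr
            linarith
        _ = 1 / ((ℓ : ℝ) + 1) := by field_simp
    calc dist ω (WithLp.toLp 2 fun _ => c) ≤ _ := dist_triangle _ (WithLp.toLp 2 fun _ => c₀ : Impact d ℓ) _
      _ ≤ 1 / √((ℓ : ℝ) + 1) + 1 / √((ℓ : ℝ) + 1) := add_le_add h1 h3
      _ = R := by simp only [R]; ring
  calc volume {ω : Impact d ℓ | gauge ω ≤ 1}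
      ≤ ∑ c ∈ t, volume (Metric.closedBall (WithLp.toLp 2 fun _ => c : Impact d ℓ) R) :=
        (measure_mono hcov).trans (measure_biUnion_finset_le _ _)
    _ = t.card * (ENNReal.ofReal (R ^ (ℓ * d)) * volume (Metric.ball (0 : Impact d ℓ) 1)) := by
        rw [Finset.sum_congr rfl fun c _ => Measure.addHaar_closedBall volume _ hR.le,
          Finset.sum_const, nsmul_eq_mul, finrank_impact]
    _ ≤ ENNReal.ofReal ((4 * ((ℓ : ℝ) + 1)) ^ d) *
          (ENNReal.ofReal (R ^ (ℓ * d)) * volume (Metric.ball (0 : Impact d ℓ) 1)) := by gcongr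
    _ = _ := by rw [ENNReal.ofReal_mul (by positivity), mul_assoc]

theorem surfaceMeasure_univ_le (hn : 1 ≤ ℓ * d) : surfaceMeasure d ℓ univ ≤
    volume (Metric.ball (0 : EuclideanSpace ℝ (Fin (ℓ * d - 1))) 1) *
      ENNReal.ofReal (4 ^ (ℓ * d) * (ℓ * d : ℕ) * √((ℓ : ℝ) + 1) * ((4 * ((ℓ : ℝ) + 1)) ^ d *
      (2 / √((ℓ : ℝ) + 1)) ^ (ℓ * d))) := by
  have hB0 : volume (Metric.ball (0 : Impact d ℓ) 1) ≠ 0 := (Metric.measure_ball_pos volume 0 one_pos).ne'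
  have hBt : volume (Metric.ball (0 : Impact d ℓ) 1) ≠ ⊤ := measure_ball_lt_top.ne
  refine (surfaceMeasure_le hn univ).trans ?_
  rw [Measure.smul_apply, smul_eq_mul, coneMeasure_apply _ (isGauge_gauge d ℓ) MeasurableSet.univ,
    preimage_univ, inter_univ, mul_assoc]
  gcongr
  calc _ ≤ ENNReal.ofReal (4 ^ (ℓ * d) * (ℓ * d : ℕ) * √((ℓ : ℝ) + 1)) /
        volume (Metric.ball (0 : Impact d ℓ) 1) * (ENNReal.ofReal ((4 * ((ℓ : ℝ) + 1)) ^ d *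
      (2 / √((ℓ : ℝ) + 1)) ^ (ℓ * d)) * volume (Metric.ball (0 : Impact d ℓ) 1)) := by
        gcongr
        exact volume_gauge_le_one
    _ = _ := by
        rw [mul_comm (ENNReal.ofReal ((4 * ((ℓ : ℝ) + 1)) ^ d * _)), ← mul_assoc,
          ENNReal.div_mul_cancel hB0 hBt, ← ENNReal.ofReal_mul (by positivity)]

end Gauge

/-- The mass of the ellipsoid decreases faster than `c^ℓ / ℓ!`. -/
theorem exists_surfaceMeasure_le {d : ℕ} (hd : 2 ≤ d) {c : ℝ} (hc : 1 ≤ c) :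
    ∃ B : ℝ, 0 < B ∧ ∀ ℓ : ℕ, 1 ≤ ℓ →
      surfaceMeasure d ℓ univ ≤ ENNReal.ofReal (B / (c ^ ℓ * (ℓ ! : ℝ))) := by
  -- `b / c` collects the exponential growth of the other factors: `4^d` from the Hausdorff bound,
  -- `2d` for `ℓ d`, `2` for `√(ℓ+1)`, `8^d` for the net and `2^d` for the radii. The unit ball of
  -- dimension `ℓ d - 1` has volume `O(b^(-(ℓ d - 1)))`, which absorbs `b^ℓ`.
  set b : ℝ := c * 8 ^ d * (2 * d) * 2 * 8 ^ d with hb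
  have hd1 : (1 : ℝ) ≤ d := by exact_mod_cast (by omega : 1 ≤ d)
  have hb1 : 1 ≤ b := by
    have h8 : (1 : ℝ) ≤ 8 ^ d := one_le_pow₀ (by norm_num)
    have h2 : 1 ≤ c * 8 ^ d := one_le_mul_of_one_le_of_one_le hc h8
    have h3 : 1 ≤ c * 8 ^ d * (2 * d) := one_le_mul_of_one_le_of_one_le h2 (by linarith)
    exact one_le_mul_of_one_le_of_one_le (by linarith) h8
  obtain ⟨B, hB, hball⟩ := exists_volume_ball_le b hb1
  refine ⟨B * b, by positivity, fun ℓ hℓ => ?_⟩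
  have hn : 1 ≤ ℓ * d := Nat.mul_pos hℓ (by omega)
  refine (surfaceMeasure_univ_le hn).trans ((mul_le_mul' (hball _) le_rfl).trans ?_)
  rw [← ENNReal.ofReal_mul (by positivity)]
  refine ENNReal.ofReal_le_ofReal ?_
  have hℓ1 : (1 : ℝ) ≤ ℓ := by exact_mod_cast hℓ
  have h2ℓ : (ℓ : ℝ) + 1 ≤ 2 ^ ℓ := by exact_mod_cast Nat.lt_two_pow_self
  have hfac : (0 : ℝ) < (ℓ ! : ℝ) := by positivity
  have hsq : √((ℓ : ℝ) + 1) ^ 2 = (ℓ : ℝ) + 1 := Real.sq_sqrt (by positivity)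
  have hsp : 1 ≤ √((ℓ : ℝ) + 1) := Real.one_le_sqrt.2 (by linarith)
  have e1 : ((ℓ * d : ℕ) : ℝ) ≤ (2 * d) ^ ℓ := by
    rw [mul_pow, Nat.cast_mul]
    have : (d : ℝ) ≤ d ^ ℓ := le_self_pow₀ hd1 (by omega)
    gcongr
    linarith
  have e2 : √((ℓ : ℝ) + 1) ≤ 2 ^ ℓ := by
    refine le_trans ?_ h2ℓ
    nlinarith
  have e3 : (4 * ((ℓ : ℝ) + 1)) ^ d ≤ (8 ^ d) ^ ℓ := by
    rw [← pow_mul, mul_comm d, pow_mul]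
    gcongr
    rw [show (8 : ℝ) = 4 * 2 by norm_num, mul_pow]
    have : (4 : ℝ) ≤ 4 ^ ℓ := le_self_pow₀ (by norm_num) (by omega)
    gcongr
  -- Here `2 ≤ d` matters: `√(ℓ+1)^(ℓ d) ≥ (ℓ+1)^ℓ ≥ ℓ!`.
  have e4 : (2 / √((ℓ : ℝ) + 1)) ^ (ℓ * d) ≤ (2 ^ d) ^ ℓ / (ℓ ! : ℝ) := by
    rw [div_pow, ← pow_mul, mul_comm d]
    gcongr
    calc (ℓ ! : ℝ) ≤ (ℓ : ℝ) ^ ℓ := by exact_mod_cast Nat.factorial_le_pow ℓ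
      _ ≤ ((ℓ : ℝ) + 1) ^ ℓ := by gcongr; linarith
      _ = √((ℓ : ℝ) + 1) ^ (ℓ * 2) := by rw [mul_comm ℓ, pow_mul, hsq]
      _ ≤ √((ℓ : ℝ) + 1) ^ (ℓ * d) := pow_le_pow_right₀ hsp (Nat.mul_le_mul_left _ hd)
  have e5 : (4 : ℝ) ^ (ℓ * d) * ((ℓ * d : ℕ) : ℝ) * √((ℓ : ℝ) + 1) * ((4 * ((ℓ : ℝ) + 1)) ^ d *
      (2 / √((ℓ : ℝ) + 1)) ^ (ℓ * d)) ≤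
      (4 ^ d) ^ ℓ * (2 * d) ^ ℓ * 2 ^ ℓ * ((8 ^ d) ^ ℓ * ((2 ^ d) ^ ℓ / (ℓ ! : ℝ))) := by
    rw [mul_comm ℓ d, pow_mul 4, mul_comm d ℓ]
    gcongr
  have e6 : (4 ^ d : ℝ) ^ ℓ * (2 * d) ^ ℓ * 2 ^ ℓ * ((8 ^ d) ^ ℓ * ((2 ^ d) ^ ℓ / (ℓ ! : ℝ))) =
      b ^ ℓ / (c ^ ℓ * (ℓ ! : ℝ)) := by
    have h8 : (8 : ℝ) ^ d = 4 ^ d * 2 ^ d := by rw [← mul_pow]; norm_num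
    have : b = c * (4 ^ d * 2 ^ d) * (2 * d) * 2 * 8 ^ d := by rw [hb, ← h8]
    rw [this]
    simp only [mul_pow]
    have hc0 : c ^ ℓ ≠ 0 := by positivity
    field_simp
  rw [e6] at e5
  have e7 : b ^ ℓ ≤ b * b ^ (ℓ * d - 1) := by
    rw [← pow_succ']
    exact pow_le_pow_right₀ hb1 (by
      have := Nat.mul_le_mul_left ℓ (show 1 ≤ d by omega)
      omega)
  calc _ ≤ B / b ^ (ℓ * d - 1) * (b ^ ℓ / (c ^ ℓ * (ℓ ! : ℝ))) := by gcongr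
    _ ≤ B / b ^ (ℓ * d - 1) * (b * b ^ (ℓ * d - 1) / (c ^ ℓ * (ℓ ! : ℝ))) := by gcongr
    _ = _ := by
        have : b ^ (ℓ * d - 1) ≠ 0 := by positivity
        field_simp

/-! ### Null sets and the surface measure -/

/-- The map is inverted by the two branches `r ↦ a ± √((e²/r² - c)/γ)`, which are differentiable
where the radicand is positive and so preserve null sets. At the vertex `τ = a` the root is
singular. -/
theorem measure_quadratic_preimage_eq_zero {a c γ e : ℝ} (hγ : 0 < γ) (he : e ≠ 0) {R : Set ℝ}
    (hR : volume R = 0) :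
    volume {τ : ℝ | τ ≠ a ∧ 0 < c + γ * (τ - a) ^ 2 ∧ e / √(c + γ * (τ - a) ^ 2) ∈ R} = 0 := by
  set D : Set ℝ := {r | r ≠ 0 ∧ 0 < (e ^ 2 / r ^ 2 - c) / γ}
  set f : ℝ → ℝ := fun r => √((e ^ 2 / r ^ 2 - c) / γ)
  have hf : DifferentiableOn ℝ f (R ∩ D) := fun r hr => by
    have h1 := hr.2.1
    have h2 : DifferentiableAt ℝ (fun r : ℝ => r⁻¹) r := differentiableAt_inv h1
    have h3 : DifferentiableAt ℝ (fun r : ℝ => (e ^ 2 / r ^ 2 - c) / γ) r := by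
      simp only [div_eq_mul_inv, ← inv_pow]
      fun_prop
    exact (h3.sqrt hr.2.2.ne').differentiableWithinAt
  have hnull : volume (R ∩ D) = 0 := measure_mono_null inter_subset_left hR
  have h1 : volume ((fun r => a + f r) '' (R ∩ D)) = 0 :=
    addHaar_image_eq_zero_of_differentiableOn_of_addHaar_eq_zero volume (hf.const_add a) hnull
  have h2 : volume ((fun r => a - f r) '' (R ∩ D)) = 0 :=
    addHaar_image_eq_zero_of_differentiableOn_of_addHaar_eq_zero volume (hf.const_sub a) hnull
  refine measure_mono_null ?_ (measure_union_null h1 h2)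
  rintro τ ⟨hτ, hg, hr⟩
  set g := c + γ * (τ - a) ^ 2 with hgdef
  have hs : 0 < √g := Real.sqrt_pos.2 hg
  have hval : (e ^ 2 / (e / √g) ^ 2 - c) / γ = (τ - a) ^ 2 := by
    rw [div_pow, Real.sq_sqrt hg.le, div_div_eq_mul_div, mul_div_cancel_left₀ _ (pow_ne_zero 2 he), hgdef]
    field_simp
    ring
  have hD : e / √g ∈ R ∩ D := by
    refine ⟨hr, div_ne_zero he hs.ne', ?_⟩
    rw [hval]
    have := sub_ne_zero.2 hτ
    positivity
  have hfv : f (e / √g) = |τ - a| := by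
    simp only [f]
    rw [hval, Real.sqrt_sq_eq_abs]
  rcases le_total 0 (τ - a) with h | h
  · left
    refine ⟨_, hD, ?_⟩
    change a + f _ = τ
    rw [hfv, abs_of_nonneg h]; ring
  · right
    refine ⟨_, hD, ?_⟩
    change a - f _ = τ
    rw [hfv, abs_of_nonpos h]; ring

section Impact

variable {d ℓ : ℕ}

theorem continuous_pairing {κ : Type} [Fintype κ] [LinearOrder κ] :
    Continuous fun p : (κ → Space d) × (κ → Space d) => pairing p.1 p.2 := by
  unfold pairing
  refine continuous_finsetSum _ fun i _ => continuous_finsetSum _ fun j _ => ?_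
  split_ifs
  · fun_prop
  · exact continuous_const

theorem continuous_crossSection :
    Continuous fun p : (Fin ℓ → Space d) × (Fin ℓ → Space d) => crossSection p.1 p.2 := by
  unfold crossSection
  exact (by fun_prop : Continuous fun p : (Fin ℓ → Space d) × (Fin ℓ → Space d) =>
    ∑ i, inner ℝ (p.1 i) (p.2 i)).add continuous_pairing

theorem crossSection_comm (ω ν : Impact d ℓ) : crossSection ω ν = crossSection ν ω := by
  rw [← inner_differences, ← inner_differences, real_inner_comm]

theorem crossSection_sub_smul (z ν : Impact d ℓ) (τ : ℝ) :
    crossSection (z - τ • ν) ν = crossSection z ν - τ * crossSection ν ν := by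
  rw [← inner_differences, ← inner_differences, ← inner_differences, differences_sub,
    differences_smul, inner_sub_left, real_inner_smul_left]

theorem crossSection_smul_left (z ν : Impact d ℓ) (r : ℝ) :
    crossSection (r • z) ν = r * crossSection z ν := by
  rw [← inner_differences, ← inner_differences, differences_smul, real_inner_smul_left]

theorem gauge_sub_smul_sq (z ν : Impact d ℓ) (h : crossSection ν ν ≠ 0) (τ : ℝ) :
    gauge (z - τ • ν) ^ 2 = (crossSection z z - crossSection z ν ^ 2 / crossSection ν ν) +
      crossSection ν ν * (τ - crossSection z ν / crossSection ν ν) ^ 2 := by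
  have h1 : crossSection (WithLp.ofLp (z - τ • ν)) (WithLp.ofLp (z - τ • ν)) =
      crossSection z z - 2 * τ * crossSection z ν + τ ^ 2 * crossSection ν ν := by
    simp only [← inner_differences, differences_sub, differences_smul, inner_sub_left, inner_sub_right,
      real_inner_smul_left, real_inner_smul_right]
    rw [real_inner_comm (differences z) (differences ν)]
    ring
  rw [gauge_sq, h1]
  field_simp
  ring

theorem measurable_gauge : Measurable (gauge : Impact d ℓ → ℝ) :=
  (isGauge_gauge d ℓ).continuous.measurable

theorem measurable_crossSection_left (ν : Impact d ℓ) :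
    Measurable fun ω : Impact d ℓ => crossSection ω ν :=
  (continuous_crossSection.comp
    (Continuous.prodMk (PiLp.continuous_ofLp 2 _) continuous_const)).measurable

theorem isFiniteMeasure_surfaceMeasure (hn : 1 ≤ ℓ * d) : IsFiniteMeasure (surfaceMeasure d ℓ) := by
  refine ⟨(surfaceMeasure_univ_le hn).trans_lt ?_⟩
  exact ENNReal.mul_lt_top measure_ball_lt_top ENNReal.ofReal_lt_top

theorem ae_smul_notMem {E : Type*} [NormedAddCommGroup E] [NormedSpace ℝ E] [FiniteDimensional ℝ E]
    [MeasurableSpace E] [BorelSpace E] {μ : Measure E} [μ.IsAddHaarMeasure] {N : Set E}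
    (hN : μ N = 0) {r : ℝ} (hr : r ≠ 0) : ∀ᵐ z ∂μ, r • z ∉ N := by
  refine measure_eq_zero_iff_ae_notMem.1 ?_
  change μ ((fun z => r • z) ⁻¹' N) = 0
  rw [Measure.addHaar_preimage_smul μ hr, hN, mul_zero]

/-- Where `b(ω, ν) ≠ 0`, the direction `ν` is transversal to the ellipsoid, and `(τ, ω) ↦ e ω + τ ν`
has full rank. Instead of charts, `ω = y / gauge y` with `y` under Lebesgue measure is used; the
surface measure is absolutely continuous with respect to the resulting cone measure. -/
theorem ae_surfaceMeasure_line_notMem (hn : 1 ≤ ℓ * d) {N : Set (Impact d ℓ)} (hN : volume N = 0)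
    (ν : Impact d ℓ) {e : ℝ} (he : e ≠ 0) :
    ∀ᵐ q ∂(volume : Measure ℝ).prod (surfaceMeasure d ℓ),
      crossSection q.2 ν ≠ 0 → e • q.2 + q.1 • ν ∉ N := by
  wlog hNm : MeasurableSet N generalizing N
  · have := this ((measure_toMeasurable N).trans hN) (measurableSet_toMeasurable _ _)
    filter_upwards [this] with q hq h1 h2
    exact hq h1 (subset_toMeasurable _ _ h2)
  have := isFiniteMeasure_surfaceMeasure (d := d) (ℓ := ℓ) hn
  set γ := crossSection ν ν
  have hγ0 : 0 ≤ γ := by change 0 ≤ crossSection ν ν; rw [← gauge_sq]; positivity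
  rcases hγ0.eq_or_lt with hγ | hγ
  · refine Eventually.of_forall fun q h => absurd ?_ h
    have h1 : differences ν = 0 := by
      have : gauge ν ^ 2 = 0 := by rw [gauge_sq]; exact hγ.symm
      exact norm_eq_zero.1 (pow_eq_zero_iff two_ne_zero |>.1 this)
    rw [← inner_differences, h1, inner_zero_right]
  have hb := measurable_crossSection_left ν
  have hρ := measurable_gauge (d := d) (ℓ := ℓ)
  have hg := isGauge_gauge d ℓ
  -- Almost every ray meets `N` in a null set. Below, the factor `r` becomes a function of `τ`, then
  -- `z = y + τ ν` is substituted, and finally `τ` is rescaled.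
  have s0 : ∀ᵐ z : Impact d ℓ, ∀ᵐ r : ℝ, r • z ∉ N := by
    rw [← Measure.ae_ae_comm (p := fun (r : ℝ) (z : Impact d ℓ) => r • z ∉ N)]
    · filter_upwards [measure_eq_zero_iff_ae_notMem.1 (measure_singleton (μ := volume) (0 : ℝ))]
        with r hr
      exact ae_smul_notMem hN hr
    · exact (measurable_fst.smul measurable_snd) hNm.compl
  have s1 : ∀ᵐ z : Impact d ℓ, ∀ᵐ τ : ℝ, crossSection (z - τ • ν) ν ≠ 0 →
      (e / gauge (z - τ • ν)) • z ∉ N := by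
    filter_upwards [s0] with z hz
    -- `gauge (z - τ • ν) ^ 2` is a quadratic polynomial in `τ`, whose vertex is the point where `b`
    -- vanishes.
    have h := measure_quadratic_preimage_eq_zero (a := crossSection z ν / γ)
      (c := crossSection z z - crossSection z ν ^ 2 / γ) hγ he (measure_eq_zero_iff_ae_notMem.2 hz :
        volume {r : ℝ | r • z ∈ N} = 0)
    filter_upwards [measure_eq_zero_iff_ae_notMem.1 h] with τ hτ h1 h2
    have hne : z - τ • ν ≠ 0 := fun h0 => h1 (by
      rw [h0, ← inner_differences, show differences (0 : Impact d ℓ) = 0 from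
        norm_eq_zero.1 hg.apply_zero, inner_zero_left])
    have hpos := hg.apply_pos hne
    refine hτ ⟨fun h3 => h1 ?_, ?_, ?_⟩
    · rw [crossSection_sub_smul, h3]
      change _ - _ / γ * γ = 0
      rw [div_mul_cancel₀ _ hγ.ne', sub_self]
    · rw [← gauge_sub_smul_sq z ν hγ.ne']
      positivity
    · rw [← gauge_sub_smul_sq z ν hγ.ne', Real.sqrt_sq hpos.le]
      exact h2
  have s2 : ∀ᵐ τ : ℝ, ∀ᵐ y : Impact d ℓ, crossSection y ν ≠ 0 →
      (e / gauge y) • (y + τ • ν) ∉ N := by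
    rw [← Measure.ae_ae_comm (p := fun (τ : ℝ) (z : Impact d ℓ) => crossSection (z - τ • ν) ν ≠ 0 →
      (e / gauge (z - τ • ν)) • z ∉ N)] at s1
    · filter_upwards [s1] with τ hτ
      have := (measurePreserving_add_right (volume : Measure (Impact d ℓ)) (τ • ν)).quasiMeasurePreserving.ae hτ
      simpa only [add_sub_cancel_right] using this
    · have h1 : Measurable fun x : ℝ × Impact d ℓ => x.2 - x.1 • ν :=
        measurable_snd.sub (measurable_fst.smul_const ν)
      have h2 : MeasurableSet {x : ℝ × Impact d ℓ | crossSection (x.2 - x.1 • ν) ν ≠ 0} :=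
        (hb.comp h1) (measurableSet_singleton 0).compl
      have h3 : MeasurableSet {x : ℝ × Impact d ℓ | (e / gauge (x.2 - x.1 • ν)) • x.2 ∉ N} :=
        ((measurable_const.div (hρ.comp h1)).smul measurable_snd) hNm.compl
      exact h2.imp h3
  have s3 : ∀ᵐ y : Impact d ℓ, ∀ᵐ τ : ℝ, crossSection y ν ≠ 0 →
      e • (gauge y)⁻¹ • y + τ • ν ∉ N := by
    rw [Measure.ae_ae_comm] at s2
    · filter_upwards [s2] with y hy
      by_cases h0 : crossSection y ν = 0
      · exact Eventually.of_forall fun τ h => absurd h0 h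
      have hne : y ≠ 0 := fun h1 => h0 (by
        rw [h1, ← inner_differences, show differences (0 : Impact d ℓ) = 0 from
          norm_eq_zero.1 hg.apply_zero, inner_zero_left])
      have hpos := hg.apply_pos hne
      have h1 : volume {τ : ℝ | (e / gauge y) • (y + τ • ν) ∈ N} = 0 := by
        refine measure_eq_zero_iff_ae_notMem.2 ?_
        filter_upwards [hy] with τ h using h h0
      filter_upwards [ae_smul_notMem h1 (div_ne_zero hpos.ne' he)] with τ h2 _ h3
      refine h2 ?_
      change (e / gauge y) • (y + ((gauge y / e) • τ) • ν) ∈ N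
      convert h3 using 1
      rw [smul_add, smul_smul, smul_smul, smul_eq_mul, ← mul_assoc]
      congr 2
      field_simp
    · have h2 : MeasurableSet {x : ℝ × Impact d ℓ | crossSection x.2 ν ≠ 0} :=
        (hb.comp measurable_snd) (measurableSet_singleton 0).compl
      have h3 : MeasurableSet {x : ℝ × Impact d ℓ | (e / gauge x.2) • (x.2 + x.1 • ν) ∉ N} :=
        ((measurable_const.div (hρ.comp measurable_snd)).smul
          (measurable_snd.add (measurable_fst.smul_const ν))) hNm.compl
      exact h2.imp h3
  have s4 : ∀ᵐ τ : ℝ, ∀ᵐ y : Impact d ℓ, crossSection y ν ≠ 0 →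
      e • (gauge y)⁻¹ • y + τ • ν ∉ N := by
    rw [Measure.ae_ae_comm]
    · exact s3
    · have h2 : MeasurableSet {x : ℝ × Impact d ℓ | crossSection x.2 ν ≠ 0} :=
        (hb.comp measurable_snd) (measurableSet_singleton 0).compl
      have h3 : MeasurableSet {x : ℝ × Impact d ℓ | e • (gauge x.2)⁻¹ • x.2 + x.1 • ν ∉ N} :=
        (((hρ.comp measurable_snd).inv.smul measurable_snd).const_smul e |>.add
          (measurable_fst.smul_const ν)) hNm.compl
      exact h2.imp h3
  have hm : MeasurableSet {q : ℝ × Impact d ℓ | crossSection q.2 ν ≠ 0 → e • q.2 + q.1 • ν ∉ N} := by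
    have h2 : MeasurableSet {x : ℝ × Impact d ℓ | crossSection x.2 ν ≠ 0} :=
      (hb.comp measurable_snd) (measurableSet_singleton 0).compl
    have h3 : MeasurableSet {x : ℝ × Impact d ℓ | e • x.2 + x.1 • ν ∉ N} :=
      ((measurable_snd.const_smul e).add (measurable_fst.smul_const ν)) hNm.compl
    exact h2.imp h3
  refine (Measure.ae_prod_mem_iff_ae_ae_mem hm).2 ?_
  filter_upwards [s4] with τ hτ
  have hmτ : MeasurableSet {ω : Impact d ℓ | crossSection ω ν ≠ 0 → e • ω + τ • ν ∉ N} :=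
    measurable_prodMk_left hm
  have hκ : ∀ᵐ ω : Impact d ℓ ∂(coneMeasure volume (gauge : Impact d ℓ → ℝ)),
      crossSection ω ν ≠ 0 → e • ω + τ • ν ∉ N := by
    rw [coneMeasure, ae_map_iff hg.measurable_direction.aemeasurable hmτ]
    refine ae_restrict_of_ae ?_
    filter_upwards [hτ] with y hy h
    refine hy fun h0 => h ?_
    rw [crossSection_smul_left, h0, mul_zero]
  exact ((surfaceMeasure_le hn).absolutelyContinuous.trans (Measure.smul_absolutelyContinuous)).ae_le hκ

end Impact

/-! ### Adjoining particles -/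

/-- Only reversals change the sign of time. So a drift after a word can be traded for a drift of the
same length before it, with a sign that depends on the word alone. -/
theorem CylinderFamily.word_drift {ι X : Type} [NormedAddCommGroup X] [NormedSpace ℝ X]
    (B : CylinderFamily ι X) (w : List (Option ι)) :
    ∃ σ : ℝ, (σ = 1 ∨ σ = -1) ∧ ∀ t Z, B.word w (drift (σ * t) Z) = drift t (B.word w Z) := by
  induction w with
  | nil => exact ⟨1, Or.inl rfl, fun t Z => by simp⟩
  | cons o w ih =>
    obtain ⟨σ, hσ, h⟩ := ih
    cases o with
    | none =>
      refine ⟨-σ, by rcases hσ with rfl | rfl <;> simp, fun t Z => ?_⟩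
      change B.word w (rev (drift (-σ * t) Z)) = drift t (B.word w (rev Z))
      rw [rev_drift, ← h, neg_mul, neg_neg]
    | some a =>
      refine ⟨σ, hσ, fun t Z => ?_⟩
      change B.word w (B.bounce a (drift (σ * t) Z)) = drift t (B.word w (B.bounce a Z))
      rw [B.bounce_drift, h]

section Pairing

variable {d : ℕ} {κ κ' : Type} [Fintype κ] [LinearOrder κ] [Fintype κ'] [LinearOrder κ']

theorem pairing_comp_equiv (e : κ ≃ κ') (x v : κ' → Space d) :
    pairing (fun k => x (e k)) (fun k => v (e k)) = pairing x v := by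
  rw [pairing_eq_sum, pairing_eq_sum, ← Equiv.sum_comp e]
  refine Finset.sum_congr rfl fun k _ => ?_
  rw [Equiv.sum_comp e fun j => x (e k) - x j]

theorem scatter_comp_equiv (e : κ ≃ κ') (u v : κ' → Space d) (k : κ) :
    scatter u v (e k) = scatter (fun k => u (e k)) (fun k => v (e k)) k := by
  rw [scatter, scatter, pairing_comp_equiv, Fintype.card_congr e, ← Equiv.sum_comp e]

theorem pairing_smul (c : ℝ) (x v : κ → Space d) : pairing (c • x) v = c * pairing x v :=
  pairing_smul_left c x v

theorem pairing_add_const (c : Space d) (x v : κ → Space d) :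
    pairing (fun k => c + x k) v = pairing x v := by
  simp only [pairing, add_sub_add_left_eq_sub]

theorem scatter_add_const (c : Space d) (u v : κ → Space d) :
    scatter (fun k => c + u k) v = scatter u v := by
  funext k
  simp only [scatter, pairing_add_const, add_sub_add_left_eq_sub]

end Pairing

section Adjoin

variable {d s ℓ : ℕ}

/-- The indices of particle `i` and of the added particles. -/
def clusterIndex (i : Fin s) : Fin (ℓ + 1) ↪ Fin (s + ℓ) where
  toFun := Fin.cons (Fin.castAdd ℓ i) (Fin.natAdd s)
  inj' := by
    refine Fin.cons_injective_iff.2 ⟨?_, Fin.natAdd_injective ℓ s⟩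
    rintro ⟨j, hj⟩
    have := congrArg Fin.val hj
    simp only [Fin.val_natAdd, Fin.val_castAdd] at this
    omega

/-- Particle `i` and the added particles. -/
def cluster (ℓ : ℕ) (i : Fin s) : Finset (Fin (s + ℓ)) := Finset.univ.map (clusterIndex i)

theorem card_cluster (i : Fin s) : (cluster ℓ i).card = ℓ + 1 := by
  rw [cluster, Finset.card_map, Finset.card_univ, Fintype.card_fin]

theorem clusterIndex_mem (i : Fin s) (k : Fin (ℓ + 1)) : clusterIndex i k ∈ cluster ℓ i :=
  Finset.mem_map_of_mem _ (Finset.mem_univ k)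

/-- An enumeration of the cluster. -/
noncomputable def clusterEquiv (i : Fin s) : Fin (ℓ + 1) ≃ cluster ℓ i :=
  Equiv.ofBijective (fun k => ⟨clusterIndex i k, clusterIndex_mem i k⟩)
    ⟨fun k l h => (clusterIndex i).injective (congrArg Subtype.val h), fun ⟨x, hx⟩ => by
      obtain ⟨k, -, rfl⟩ := Finset.mem_map.1 hx
      exact ⟨k, rfl⟩⟩

theorem comp_clusterIndex {α : Type} (i : Fin s) (x : Fin s → α) (y : Fin ℓ → α) :
    (fun k => Fin.append x y (clusterIndex i k)) = Fin.cons (x i) y := by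
  funext k
  refine Fin.cases ?_ (fun j => ?_) k
  · exact Fin.append_left x y i
  · exact Fin.append_right x y j

theorem pairing_cluster (i : Fin s) (x v : Fin (s + ℓ) → Space d) :
    pairing (fun j : cluster ℓ i => x j) (fun j : cluster ℓ i => v j) =
      pairing (fun k => x (clusterIndex i k)) (fun k => v (clusterIndex i k)) :=
  (pairing_comp_equiv (clusterEquiv i) (fun j : cluster ℓ i => x j)
    (fun j : cluster ℓ i => v j)).symm

theorem cons_sub_smul (x : Space d) (e : ℝ) (ω : Fin ℓ → Space d) :
    (Fin.cons x fun j => x - e • ω j : Fin (ℓ + 1) → Space d) =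
      fun k => x + ((-e) • (Fin.cons 0 ω : Fin (ℓ + 1) → Space d)) k := by
  funext k
  refine Fin.cases ?_ (fun j => ?_) k
  · simp
  · simp [sub_eq_add_neg]

/-- The added particles have relative positions `-e ω`. So for `b > 0` the state is incoming if `e =
ε` and outgoing if `e = -ε`. -/
theorem pairing_adjoinPre (e : ℝ) (i : Fin s) (ω v : Fin ℓ → Space d) (Z : Phase d s) :
    pairing (fun j : cluster ℓ i => (adjoinPre e i ω v Z).1 j)
      (fun j : cluster ℓ i => (adjoinPre e i ω v Z).2 j) =
      -(e * crossSection ω fun j => v j - Z.2 i) := by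
  rw [pairing_cluster]
  simp only [adjoinPre]
  rw [comp_clusterIndex, comp_clusterIndex, cons_sub_smul, pairing_add_const, pairing_smul,
    pairing_cons, neg_mul]

theorem pairing_adjoinPre_self (e : ℝ) (i : Fin s) (ω v : Fin ℓ → Space d) (Z : Phase d s) :
    pairing (fun j : cluster ℓ i => (adjoinPre e i ω v Z).1 j)
      (fun j : cluster ℓ i => (adjoinPre e i ω v Z).1 j) = e ^ 2 * crossSection ω ω := by
  rw [pairing_cluster]
  simp only [adjoinPre]
  rw [comp_clusterIndex, cons_sub_smul, pairing_add_const, pairing_smul, pairing_comm,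
    pairing_add_const, pairing_smul, pairing_cons]
  simp only [sub_zero]
  ring

/-- Particles at `x_i + ε ω` are those of `adjoinPre` with `-ε`, an outgoing state for `b > 0`,
which the collisional law turns into an incoming one. The common translation by `x_i` does not
affect the law. -/
theorem adjoinPost_eq_collide {ε : ℕ → ℝ} (hε : 0 < ε (ℓ + 1)) (i : Fin s) (ω v : Fin ℓ → Space d)
    (Z : Phase d s) : adjoinPost (ε (ℓ + 1)) i ω v Z =
      collide ε (cluster ℓ i) (adjoinPre (-ε (ℓ + 1)) i ω v Z) := by
  set e := ε (ℓ + 1)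
  have hfst : (adjoinPost e i ω v Z).1 = (adjoinPre (-e) i ω v Z).1 := by
    simp only [adjoinPost, adjoinPre, neg_smul, sub_neg_eq_add]
  have hscat : ∀ k, scatter (fun j : cluster ℓ i => (ε (cluster ℓ i).card)⁻¹ • (adjoinPre (-e) i ω v Z).1 j)
      (fun j : cluster ℓ i => (adjoinPre (-e) i ω v Z).2 j) (clusterEquiv i k) =
      transformVel ω (Fin.cons (Z.2 i) v) k := fun k => by
    rw [scatter_comp_equiv, card_cluster, transformVel]
    have h1 : (fun k => e⁻¹ • (adjoinPre (-e) i ω v Z).1 (clusterEquiv i k)) =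
        fun k => e⁻¹ • Z.1 i + (Fin.cons 0 ω : Fin (ℓ + 1) → Space d) k := by
      have := comp_clusterIndex i Z.1 fun j => Z.1 i - (-e) • ω j
      funext k
      have h2 := congrFun this k
      rw [cons_sub_smul] at h2
      change e⁻¹ • Fin.append Z.1 (fun j => Z.1 i - (-e) • ω j) (clusterIndex i k) = _
      rw [h2, neg_neg]
      change e⁻¹ • (Z.1 i + e • _) = _
      rw [ smul_add, smul_smul, inv_mul_cancel₀ hε.ne', one_smul]
    have h3 : (fun k => (adjoinPre (-e) i ω v Z).2 (clusterEquiv i k)) = Fin.cons (Z.2 i) v :=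
      comp_clusterIndex i Z.2 v
    rw [h1, h3, scatter_add_const]
  refine Prod.ext hfst ?_
  funext j
  simp only [collide]
  by_cases hj : j ∈ cluster ℓ i
  · obtain ⟨k, -, rfl⟩ := Finset.mem_map.1 hj
    rw [dif_pos hj]
    refine Eq.trans ?_ (hscat k).symm
    refine Fin.cases ?_ (fun l => ?_) k
    · rw [show (clusterIndex i) 0 = Fin.castAdd ℓ i from rfl]
      simp only [adjoinPost, Fin.append_left, Function.update_self]
    · rw [show (clusterIndex i) l.succ = Fin.natAdd s l from rfl]
      simp only [adjoinPost, Fin.append_right]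
  · rw [dif_neg hj]
    refine Fin.addCases (fun k => ?_) (fun k => ?_) j hj
    · intro hk
      have hki : k ≠ i := fun h => hk (by rw [h]; exact clusterIndex_mem i 0)
      simp only [adjoinPost, adjoinPre, Fin.append_left, Function.update_of_ne hki]
    · intro hk
      exact absurd (clusterIndex_mem i k.succ) hk

theorem kineticEnergy_adjoinPre (e : ℝ) (i : Fin s) (ω v : Fin ℓ → Space d) (Z : Phase d s) :
    kineticEnergy (adjoinPre e i ω v Z) = kineticEnergy Z + (1 / 2) * ∑ j, ‖v j‖ ^ 2 := by
  simp only [kineticEnergy, adjoinPre, Fin.sum_univ_add, Fin.append_left, Fin.append_right]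
  ring

/-- The added particles, as a linear function of their relative positions. -/
def adjoinLinear (d ℓ : ℕ) (i : Fin s) :
    (Phase d s × (Fin ℓ → Space d)) × Impact d ℓ →ₗ[ℝ] Phase d (s + ℓ) where
  toFun q := (Fin.append q.1.1.1 fun j => q.1.1.1 i - q.2 j, Fin.append q.1.1.2 q.1.2)
  map_add' p q := by
    refine Prod.ext (funext fun j => ?_) (funext fun j => ?_) <;>
      refine Fin.addCases (fun k => ?_) (fun k => ?_) j <;> simp
    abel
  map_smul' r p := by
    refine Prod.ext (funext fun j => ?_) (funext fun j => ?_) <;>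
      refine Fin.addCases (fun k => ?_) (fun k => ?_) j <;> simp [smul_sub]

theorem adjoinLinear_surjective (i : Fin s) : Function.Surjective (adjoinLinear d ℓ i) := by
  rintro ⟨x, w⟩
  refine ⟨(((fun j => x (Fin.castAdd ℓ j), fun j => w (Fin.castAdd ℓ j)), fun j => w (Fin.natAdd s j)),
    WithLp.toLp 2 fun j => x (Fin.castAdd ℓ i) - x (Fin.natAdd s j)), ?_⟩
  refine Prod.ext (funext fun j => ?_) (funext fun j => ?_) <;>
    refine Fin.addCases (fun k => ?_) (fun k => ?_) j <;> simp [adjoinLinear]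

theorem continuous_adjoinLinear (i : Fin s) : Continuous (adjoinLinear d ℓ i) := by
  have h : ∀ j, Continuous fun q : (Phase d s × (Fin ℓ → Space d)) × Impact d ℓ => q.2 j := fun j =>
    (PiLp.continuous_apply 2 _ j).comp continuous_snd
  refine Continuous.prodMk (continuous_pi fun j => ?_) (continuous_pi fun j => ?_) <;>
    refine Fin.addCases (fun k => ?_) (fun k => ?_) j <;>
    simp only [Fin.append_left, Fin.append_right]
  · fun_prop
  · have := h k
    fun_prop
  · fun_prop
  · fun_prop

/-- Surjective linear maps pull null sets back to null sets; Fubini then fixes the variables in `A ×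
B`. -/
theorem ae_ae_linear_notMem {A B C F : Type*} [NormedAddCommGroup A] [NormedSpace ℝ A]
    [FiniteDimensional ℝ A] [MeasurableSpace A] [BorelSpace A] [NormedAddCommGroup B]
    [NormedSpace ℝ B] [FiniteDimensional ℝ B] [MeasurableSpace B] [BorelSpace B]
    [NormedAddCommGroup C] [NormedSpace ℝ C] [FiniteDimensional ℝ C] [MeasurableSpace C] [BorelSpace C]
    [NormedAddCommGroup F] [NormedSpace ℝ F] [FiniteDimensional ℝ F] [MeasurableSpace F] [BorelSpace F]
    (a : Measure A) (b : Measure B) (c : Measure C) (f : Measure F) [a.IsAddHaarMeasure]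
    [b.IsAddHaarMeasure] [c.IsAddHaarMeasure] [f.IsAddHaarMeasure] (L : (A × B) × C →ₗ[ℝ] F)
    (hL : Function.Surjective L) {N : Set F} (hNm : MeasurableSet N) (hN : f N = 0) :
    ∀ᵐ x ∂a.prod b, ∀ᵐ y ∂c, L (x, y) ∉ N := by
  have : ((a.prod b).prod c).IsAddHaarMeasure := Measure.prod.instIsAddHaarMeasure _ _
  exact Measure.ae_ae_of_ae_prod ((ae_comp_linearMap_mem_iff L ((a.prod b).prod c) f hL
    hNm.compl).2 (measure_eq_zero_iff_ae_notMem.1 hN))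

/-- Seen at time zero, particles adjoined at time `τ` with relative positions `-e ω` have relative
positions `-(e ω + τ ν)`, with `ν` their relative velocities. So `τ` and `ω` enter only through the
points that `ae_surfaceMeasure_line_notMem` treats. -/
theorem drift_adjoinPre (i : Fin s) (e τ : ℝ) (ω : Impact d ℓ) (v : Fin ℓ → Space d) (Z : Phase d s) :
    drift (-τ) (adjoinPre e i ω v (drift τ Z)) =
      adjoinLinear d ℓ i ((Z, v), e • ω + τ • WithLp.toLp 2 fun j => v j - Z.2 i) := by
  refine Prod.ext (funext fun j => ?_) (funext fun j => ?_) <;>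
    refine Fin.addCases (fun k => ?_) (fun k => ?_) j <;> simp [adjoinLinear, adjoinPre, drift]
  module

theorem measurePreserving_drift {X : Type} [NormedAddCommGroup X] [NormedSpace ℝ X]
    [MeasurableSpace X] [BorelSpace X] [SecondCountableTopology X] (μ : Measure X)
    [SFinite μ] [μ.IsAddLeftInvariant] (t : ℝ) :
    MeasurePreserving (drift t : X × X → X × X) (μ.prod μ) (μ.prod μ) := by
  have h := MeasurePreserving.skew_product (MeasurePreserving.id μ) (μc := μ) (μd := μ)
    (g := fun v x => t • v + x)
    ((measurable_fst.const_smul t).add measurable_snd : Measurable fun p : X × X => t • p.1 + p.2)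
    (Eventually.of_forall fun v => map_add_left_eq_self μ (t • v))
  have := (Measure.measurePreserving_swap.comp h).comp (Measure.measurePreserving_swap (μ := μ) (ν := μ))
  convert this using 1
  funext Z
  exact Prod.ext (add_comm _ _) rfl

theorem measurePreserving_shuffle {α β γ δ : Type*} [MeasurableSpace α] [MeasurableSpace β]
    [MeasurableSpace γ] [MeasurableSpace δ] (a : Measure α) (b : Measure β) (c : Measure γ)
    (e : Measure δ) [SFinite a] [SFinite b] [SFinite c] [SFinite e] :
    MeasurePreserving (fun q : (α × β) × (γ × δ) => ((q.1.2, q.2.2), (q.1.1, q.2.1)))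
      ((a.prod b).prod (c.prod e)) ((b.prod e).prod (a.prod c)) := by
  have h1 := measurePreserving_prodAssoc a b (c.prod e)
  have h2 := (MeasurePreserving.id a).prod (measurePreserving_prodAssoc b c e).symm
  have h3 := (MeasurePreserving.id a).prod
    ((Measure.measurePreserving_swap (μ := b) (ν := c)).prod (MeasurePreserving.id e))
  have h4 := (MeasurePreserving.id a).prod (measurePreserving_prodAssoc c b e)
  have h5 := (measurePreserving_prodAssoc a c (b.prod e)).symm
  exact Measure.measurePreserving_swap.comp (h5.comp (h4.comp (h3.comp (h2.comp h1))))

theorem measurable_adjoinPre (e : ℝ) (i : Fin s) :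
    Measurable fun q : Phase d s × (Impact d ℓ × (Fin ℓ → Space d)) =>
      adjoinPre e i q.2.1 q.2.2 q.1 := by
  have h : (fun q : Phase d s × (Impact d ℓ × (Fin ℓ → Space d)) => adjoinPre e i q.2.1 q.2.2 q.1) =
      fun q => adjoinLinear d ℓ i ((q.1, q.2.2), e • q.2.1) := by
    funext q
    rfl
  rw [h]
  exact (continuous_adjoinLinear i).measurable.comp
    ((measurable_fst.prodMk (measurable_snd.comp measurable_snd)).prodMk
      ((measurable_fst.comp measurable_snd).const_smul e))

theorem measurable_relative_crossSection (i : Fin s) :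
    Measurable fun q : Phase d s × (Impact d ℓ × (Fin ℓ → Space d)) =>
      crossSection q.2.1 fun j => q.2.2 j - q.1.2 i := by
  refine (continuous_crossSection.comp (Continuous.prodMk
    ((PiLp.continuous_ofLp 2 _).comp (continuous_fst.comp continuous_snd)) ?_)).measurable
  fun_prop

theorem sFinite_collisionMeasure (hn : 1 ≤ ℓ * d) : SFinite (collisionMeasure d ℓ) := by
  have := isFiniteMeasure_surfaceMeasure (d := d) (ℓ := ℓ) hn
  unfold collisionMeasure
  infer_instance

/-- Combines the linear form of adjoined states with transversality. The factor `σ` will be `1` and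
`-1`, since words can reverse the time. -/
theorem ae_drift_adjoinPre_notMem (hn : 1 ≤ ℓ * d) {N : Set (Phase d (s + ℓ))} (hN : volume N = 0)
    (i : Fin s) {e σ : ℝ} (he : e ≠ 0) (hσ : σ ≠ 0) :
    ∀ᵐ q ∂((volume : Measure ℝ).prod (volume : Measure (Phase d s))).prod (collisionMeasure d ℓ),
      (crossSection q.2.1 fun j => q.2.2 j - q.1.2.2 i) ≠ 0 →
        drift (σ * q.1.1) (adjoinPre e i q.2.1 q.2.2 q.1.2) ∉ N := by
  wlog hNm : MeasurableSet N generalizing N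
  · have := this ((measure_toMeasurable N).trans hN) (measurableSet_toMeasurable _ _)
    filter_upwards [this] with q hq h1 h2
    exact hq h1 (subset_toMeasurable _ _ h2)
  have hfin := isFiniteMeasure_surfaceMeasure (d := d) (ℓ := ℓ) hn
  have hsf := sFinite_collisionMeasure (d := d) (ℓ := ℓ) hn
  have hsp : SFinite ((volume : Measure ℝ).prod (surfaceMeasure d ℓ)) := Measure.prod.instSFinite
  have hlin : ∀ᵐ x : Phase d s × (Fin ℓ → Space d), ∀ᵐ y : Impact d ℓ, adjoinLinear d ℓ i (x, y) ∉ N :=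
    ae_ae_linear_notMem (volume : Measure (Phase d s)) (volume : Measure (Fin ℓ → Space d))
      (volume : Measure (Impact d ℓ)) (volume : Measure (Phase d (s + ℓ))) (adjoinLinear d ℓ i)
      (adjoinLinear_surjective i) hNm hN
  -- The state is first drifted backwards, which makes `drift_adjoinPre` applicable; the
  -- measure-preserving map in `hmp` removes this shift.
  have hτ : ∀ᵐ q ∂((volume : Measure ℝ).prod (volume : Measure (Phase d s))).prod (collisionMeasure d ℓ),
      (crossSection q.2.1 fun j => q.2.2 j - q.1.2.2 i) ≠ 0 →
        drift (σ * q.1.1) (adjoinPre e i q.2.1 q.2.2 (drift (-(σ * q.1.1)) q.1.2)) ∉ N := by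
    refine (measurePreserving_shuffle (volume : Measure ℝ) (volume : Measure (Phase d s))
      (surfaceMeasure d ℓ) (volume : Measure (Fin ℓ → Space d))).quasiMeasurePreserving.ae
      (p := fun x => (crossSection x.2.2 fun j => x.1.2 j - x.1.1.2 i) ≠ 0 →
        drift (σ * x.2.1) (adjoinPre e i x.2.2 x.1.2 (drift (-(σ * x.2.1)) x.1.1)) ∉ N) ?_
    have key : ∀ x : (Phase d s × (Fin ℓ → Space d)) × (ℝ × Impact d ℓ),
        drift (σ * x.2.1) (adjoinPre e i x.2.2 x.1.2 (drift (-(σ * x.2.1)) x.1.1)) =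
        adjoinLinear d ℓ i (x.1, e • x.2.2 + x.2.1 • (-σ) • WithLp.toLp 2 fun j => x.1.2 j - x.1.1.2 i) := by
      intro x
      have := drift_adjoinPre i e (-(σ * x.2.1)) x.2.2 x.1.2 x.1.1
      rw [neg_neg] at this
      rw [this, smul_smul, mul_neg, mul_comm σ]
    simp only [key]
    have hm : MeasurableSet {x : (Phase d s × (Fin ℓ → Space d)) × (ℝ × Impact d ℓ) |
        (crossSection x.2.2 fun j => x.1.2 j - x.1.1.2 i) ≠ 0 → adjoinLinear d ℓ i
          (x.1, e • x.2.2 + x.2.1 • (-σ) • WithLp.toLp 2 fun j => x.1.2 j - x.1.1.2 i) ∉ N} := by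
      have h1 : Measurable fun x : (Phase d s × (Fin ℓ → Space d)) × (ℝ × Impact d ℓ) =>
          (x.1.1, (x.2.2, x.1.2)) := by fun_prop
      have h2 : Measurable fun x : (Phase d s × (Fin ℓ → Space d)) × (ℝ × Impact d ℓ) =>
          (x.1, e • x.2.2 + x.2.1 • (-σ) • (WithLp.toLp 2 fun j => x.1.2 j - x.1.1.2 i : Impact d ℓ)) := by
        refine Continuous.measurable ?_
        have h4 : Continuous fun x : (Phase d s × (Fin ℓ → Space d)) × (ℝ × Impact d ℓ) =>
            (WithLp.toLp 2 fun j => x.1.2 j - x.1.1.2 i : Impact d ℓ) :=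
          (PiLp.continuous_toLp 2 _).comp (by fun_prop)
        fun_prop
      have h3 : MeasurableSet {x : (Phase d s × (Fin ℓ → Space d)) × (ℝ × Impact d ℓ) |
          (crossSection x.2.2 fun j => x.1.2 j - x.1.1.2 i) ≠ 0} :=
        ((measurable_relative_crossSection i).comp h1) (measurableSet_singleton 0).compl
      exact h3.imp (((continuous_adjoinLinear i).measurable.comp h2) hNm.compl)
    refine (Measure.ae_prod_mem_iff_ae_ae_mem hm).2 ?_
    filter_upwards [hlin] with x hx
    set ν : Impact d ℓ := WithLp.toLp 2 fun j => x.2 j - x.1.2 i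
    filter_upwards [ae_surfaceMeasure_line_notMem hn (measure_eq_zero_iff_ae_notMem.2 hx :
      volume {y : Impact d ℓ | adjoinLinear d ℓ i (x, y) ∈ N} = 0) ((-σ) • ν) he] with y hy h
    refine hy ?_
    rw [crossSection_comm, crossSection_smul_left, crossSection_comm]
    exact mul_ne_zero (neg_ne_zero.2 hσ) h
  have hmp : MeasurePreserving (fun q : (ℝ × Phase d s) × (Impact d ℓ × (Fin ℓ → Space d)) =>
      ((q.1.1, drift (σ * q.1.1) q.1.2), q.2))
      (((volume : Measure ℝ).prod (volume : Measure (Phase d s))).prod (collisionMeasure d ℓ))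
      (((volume : Measure ℝ).prod (volume : Measure (Phase d s))).prod (collisionMeasure d ℓ)) := by
    have h1 : MeasurePreserving (fun q : ℝ × Phase d s => (q.1, drift (σ * q.1) q.2))
        ((volume : Measure ℝ).prod (volume : Measure (Phase d s)))
        ((volume : Measure ℝ).prod (volume : Measure (Phase d s))) := by
      refine MeasurePreserving.skew_product (g := fun τ Z => drift (σ * τ) Z) (MeasurePreserving.id _) ?_
        (Eventually.of_forall fun τ => (measurePreserving_drift _ (σ * τ)).map_eq)
      exact continuous_drift_uncurry.measurable.comp ((measurable_fst.const_mul σ).prodMk measurable_snd)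
    exact h1.prod (MeasurePreserving.id (collisionMeasure d ℓ))
  filter_upwards [hmp.quasiMeasurePreserving.ae hτ] with q hq
  simpa only [drift_drift, drift_snd, neg_add_cancel, drift_zero] using hq

end Adjoin

/-! ### Adjoined states under the flow -/

section Adjoined

variable {d s ℓ M : ℕ} {ε : ℕ → ℝ} (hε : ∀ k, 2 ≤ k → k ≤ M + 1 → 0 < ε k)
include hε

/-- The line enters the cylinder of `I` at time zero, so a second collision at this time would make
`Z` bad. -/
theorem outgoing_of_incoming {m : ℕ} {Z : Phase d m} (hr : Z ∈ (tupleFamily d m hε).regular)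
    (hZ : Z ∈ phaseSpace M ε d m) (I : Tuple M m)
    (h1 : (tupleFamily d m hε).q I Z.1 Z.1 = (tupleFamily d m hε).r I ^ 2)
    (h2 : (tupleFamily d m hε).q I Z.1 Z.2 < 0) : Outgoing M ε Z (collide ε I.1 Z) := by
  refine (outgoing_iff hε _ _).2 (Or.inr ⟨I, h1, h2, fun J hJ => ?_, collide_eq_reflect hε I Z⟩)
  refine lt_of_le_of_ne ((mem_phaseSpace_iff hε Z).1 hZ J) fun h => ?_
  refine CylinderFamily.notMem_bad_of_regular hr ⟨I, Or.inr ⟨J, hJ,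
    CylinderFamily.disc_pos_of_incoming h1 h2.ne, ?_⟩⟩
  rw [CylinderFamily.entry_eq_zero h1 h2, drift_zero]
  exact h.symm

theorem kineticEnergy_reflect {m : ℕ} (I : Tuple M m) (Z : Phase d m)
    (h : (tupleFamily d m hε).q I Z.1 Z.1 = (tupleFamily d m hε).r I ^ 2) :
    kineticEnergy ((tupleFamily d m hε).reflect I Z) = kineticEnergy Z := by
  have := (tupleFamily d m hε).ip_reflect_self h
  change configInner d m _ _ = configInner d m _ _ at this
  simp only [configInner_apply, real_inner_self_eq_norm_sq] at this
  rw [kineticEnergy, kineticEnergy, this]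

/-- The colliding particles of an adjoined state. -/
def clusterTuple (hℓ : 1 ≤ ℓ) (hℓM : ℓ ≤ M) (i : Fin s) : Tuple M (s + ℓ) :=
  ⟨cluster ℓ i, by rw [Collidable, card_cluster]; omega⟩

variable (hℓ : 1 ≤ ℓ) (hℓM : ℓ ≤ M)

theorem q_adjoinPre_self (i : Fin s) (ω : Impact d ℓ) (hω : ω ∈ ellipsoid d ℓ) (v : Fin ℓ → Space d)
    (Z : Phase d s) {e : ℝ} (he : e ^ 2 = ε (ℓ + 1) ^ 2) :
    (tupleFamily d (s + ℓ) hε).q (clusterTuple hℓ hℓM i) (adjoinPre e i ω v Z).1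
      (adjoinPre e i ω v Z).1 = (tupleFamily d (s + ℓ) hε).r (clusterTuple hℓ hℓM i) ^ 2 := by
  have h := (mem_ellipsoid_iff ω).1 hω
  rw [tupleFamily_q, tupleFamily_r]
  refine (pairing_adjoinPre_self e i ω v Z).trans ?_
  rw [← gauge_sq, h, one_pow, mul_one, he]
  change _ = ε (cluster ℓ i).card ^ 2
  rw [card_cluster]

theorem adjoinPost_eq_reflect (i : Fin s) (ω v : Fin ℓ → Space d) (Z : Phase d s) :
    adjoinPost (ε (ℓ + 1)) i ω v Z = (tupleFamily d (s + ℓ) hε).reflect (clusterTuple hℓ hℓM i)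
      (adjoinPre (-ε (ℓ + 1)) i ω v Z) := by
  rw [adjoinPost_eq_collide (hε _ (by omega) (by omega))]
  exact collide_eq_reflect hε (clusterTuple hℓ hℓM i) _

include hℓ hℓM in
theorem kineticEnergy_adjoinPost (i : Fin s) (ω : Impact d ℓ) (hω : ω ∈ ellipsoid d ℓ)
    (v : Fin ℓ → Space d) (Z : Phase d s) : kineticEnergy (adjoinPost (ε (ℓ + 1)) i ω v Z) =
      kineticEnergy Z + (1 / 2) * ∑ j, ‖v j‖ ^ 2 := by
  rw [adjoinPost_eq_reflect hε hℓ hℓM, kineticEnergy_reflect, kineticEnergy_adjoinPre]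
  exact q_adjoinPre_self hε hℓ hℓM i ω hω v Z (neg_sq _)

include hℓ hℓM in
/-- Almost every adjoined state in the phase space has a trajectory, and the states from which it
comes avoid a given null set. -/
theorem ae_adjoin (hd : 2 ≤ d) {N : Set (Phase d (s + ℓ))} (hN : volume N = 0) (i : Fin s) :
    ∀ᵐ q ∂((volume : Measure ℝ).prod (volume : Measure (Phase d s))).prod (collisionMeasure d ℓ),
      (0 < crossSection q.2.1 fun j => q.2.2 j - q.1.2.2 i) → ∀ W,
        (W = adjoinPre (ε (ℓ + 1)) i q.2.1 q.2.2 q.1.2 ∨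
          W = adjoinPost (ε (ℓ + 1)) i q.2.1 q.2.2 q.1.2) → W ∈ phaseSpace M ε d (s + ℓ) →
        kineticEnergy W = kineticEnergy q.1.2 + (1 / 2) * ∑ j, ‖q.2.2 j‖ ^ 2 ∧
        HasTraj M ε W ∧ (∀ t ≤ 0, flow M ε t W = flowMap hε d (s + ℓ) (t, W)) ∧
          flow M ε (-q.1.1) W ∉ N := by
  have hn : 1 ≤ ℓ * d := Nat.mul_pos hℓ (by omega)
  have hfin := isFiniteMeasure_surfaceMeasure (d := d) (ℓ := ℓ) hn
  have hsf := sFinite_collisionMeasure (d := d) (ℓ := ℓ) hn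
  have he : 0 < ε (ℓ + 1) := hε _ (by omega) (by omega)
  set B := tupleFamily d (s + ℓ) hε with hB
  set I := clusterTuple hℓ hℓM i
  have hreg : volume (B.regularᶜ : Set (Phase d (s + ℓ))) = 0 := ae_mem_regular hε hd
  -- All states that some word leads into `N`, since the word that describes the flow is not known
  -- beforehand.
  set N' : Set (Phase d (s + ℓ)) := ⋃ w, B.word w ⁻¹' N with hN'
  have hN'0 : volume (N' ∪ B.regularᶜ) = 0 := by
    refine measure_union_null (measure_iUnion_null fun w => ?_) hreg
    exact B.measure_word_preimage_eq_zero w hN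
  have hω : ∀ᵐ q ∂((volume : Measure ℝ).prod (volume : Measure (Phase d s))).prod
      (collisionMeasure d ℓ), q.2.1 ∈ ellipsoid d ℓ := by
    have h1 : ∀ᵐ ω ∂surfaceMeasure d ℓ, ω ∈ ellipsoid d ℓ := by
      refine ae_restrict_mem ?_
      have : ellipsoid d ℓ = {y | gauge y = 1} := by
        ext y
        exact mem_ellipsoid_iff y
      rw [this]
      exact measurableSet_eq_fun measurable_gauge measurable_const
    exact Measure.quasiMeasurePreserving_snd.ae (Measure.quasiMeasurePreserving_fst.ae h1)
  have hall : ∀ e σ : ℝ, e ≠ 0 → σ ≠ 0 → ∀ᵐ q ∂((volume : Measure ℝ).prod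
      (volume : Measure (Phase d s))).prod (collisionMeasure d ℓ),
      (crossSection q.2.1 fun j => q.2.2 j - q.1.2.2 i) ≠ 0 →
        drift (σ * q.1.1) (adjoinPre e i q.2.1 q.2.2 q.1.2) ∉ N' ∪ B.regularᶜ :=
    fun e σ he hσ => ae_drift_adjoinPre_notMem hn hN'0 i he hσ
  have hwords : ∀ e : ℝ, e ≠ 0 → ∀ᵐ q ∂((volume : Measure ℝ).prod
      (volume : Measure (Phase d s))).prod (collisionMeasure d ℓ),
      (crossSection q.2.1 fun j => q.2.2 j - q.1.2.2 i) ≠ 0 →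
        adjoinPre e i q.2.1 q.2.2 q.1.2 ∈ B.regular ∧
        ∀ w, drift (-q.1.1) (B.word w (adjoinPre e i q.2.1 q.2.2 q.1.2)) ∉ N := by
    intro e he
    -- A drift after a word is a drift before it with either sign; regularity follows from one of
    -- them because it is invariant under drifts.
    filter_upwards [hall e 1 he one_ne_zero, hall e (-1) he (by norm_num)] with q h1 h2 h
    have h1' := not_or.1 (h1 h)
    have h2' := not_or.1 (h2 h)
    refine ⟨B.drift_mem_regular.1 (not_not.1 h1'.2), fun w hw => ?_⟩
    obtain ⟨σ, hσ, hσw⟩ := B.word_drift w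
    rw [← hσw] at hw
    rcases hσ with rfl | rfl
    · refine h2'.1 (mem_iUnion.2 ⟨w, ?_⟩)
      rwa [one_mul, ← neg_one_mul] at hw
    · refine h1'.1 (mem_iUnion.2 ⟨w, ?_⟩)
      rwa [neg_one_mul, neg_neg, ← one_mul q.1.1] at hw
  filter_upwards [hω, hwords _ he.ne', hwords _ (neg_ne_zero.2 he.ne')] with q hqω h1 h2 hb W hW hWD
  obtain ⟨h1r, h1w⟩ := h1 hb.ne'
  obtain ⟨h2r, h2w⟩ := h2 hb.ne'
  have key : ∃ (P : Phase d (s + ℓ)) (w : List (Option (Tuple M (s + ℓ)))),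
      P ∈ B.regular ∧ (∀ w, drift (-q.1.1) (B.word w P) ∉ N) ∧ W = B.word w P ∧
      B.q I W.1 W.1 = B.r I ^ 2 ∧ B.q I W.1 W.2 < 0 := by
    rcases hW with rfl | rfl
    · refine ⟨_, [], h1r, h1w, rfl, q_adjoinPre_self hε hℓ hℓM i _ hqω _ _ rfl, ?_⟩
      rw [tupleFamily_q]
      refine (pairing_adjoinPre _ i _ _ _).trans_lt ?_
      have := mul_pos he hb
      linarith
    · set Q := adjoinPre (-ε (ℓ + 1)) i q.2.1 q.2.2 q.1.2
      have hq1 : B.q I Q.1 Q.1 = B.r I ^ 2 := q_adjoinPre_self hε hℓ hℓM i _ hqω _ _ (neg_sq _)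
      have hq2 : 0 < B.q I Q.1 Q.2 := by
        rw [tupleFamily_q]
        refine lt_of_lt_of_eq ?_ (pairing_adjoinPre _ i _ _ _).symm
        have := mul_pos he hb
        linarith
      have hrev : B.q I (rev Q).1 (rev Q).2 < 0 := by
        rw [rev_fst, rev_snd, map_neg]
        linarith
      -- `Q` is outgoing: reversal, bounce and reversal undo the collision and give the incoming
      -- state `adjoinPost`.
      refine ⟨Q, [none, some I, none], h2r, h2w, ?_, ?_, ?_⟩
      · change _ = rev (B.bounce I (rev Q))
        rw [CylinderFamily.bounce_of_incoming (Z := rev Q) hq1 hrev, B.reflect_rev, rev_rev]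
        exact adjoinPost_eq_reflect hε hℓ hℓM i _ _ _
      · rw [adjoinPost_eq_reflect hε hℓ hℓM]
        exact hq1
      · rw [adjoinPost_eq_reflect hε hℓ hℓM]
        change B.q I Q.1 (B.reflect I Q).2 < 0
        rw [B.q_reflect hq1]
        linarith
  obtain ⟨P, w, hPr, hPw, hWP, hq1, hq2⟩ := key
  have hWr : W ∈ B.regular := hWP ▸ CylinderFamily.word_mem_regular hPr w
  have hout := outgoing_of_incoming hε hWr hWD I hq1 hq2
  refine ⟨?_, (hasTraj_and_flow_eq hε hWr hout).1, fun t ht => flow_eq_flowMap_of_nonpos hε hWr hout ht, ?_⟩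
  · rcases hW with rfl | rfl
    · exact kineticEnergy_adjoinPre _ _ _ _ _
    · exact kineticEnergy_adjoinPost hε hℓ hℓM i _ hqω _ _
  · obtain ⟨w', hw'⟩ := exists_flow_eq_drift_word hε hWr hout (-q.1.1)
    rw [hw', hWP, ← B.word_append]
    exact hPw _

end Adjoined

/-! ### Norms -/

section Norms

variable {d : ℕ}

/-- The weight `e^{-μ s} e^{-β E}`. -/
noncomputable def weight {s : ℕ} (β μ : ℝ) (Z : Phase d s) : ℝ :=
  Real.exp (-(μ * s) - β * kineticEnergy Z)

theorem weight_pos {s : ℕ} (β μ : ℝ) (Z : Phase d s) : 0 < weight β μ Z := Real.exp_pos _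

/-- The pointwise form in which all estimates are made; the exceptional null set may depend on `s`,
and later on `t`. -/
theorem normH_le_iff {β μ c : ℝ} (hc : 0 ≤ c) (G : Hier d) : normH β μ G ≤ ENNReal.ofReal c ↔
    ∀ s, 1 ≤ s → ∀ᵐ Z : Phase d s, |G s Z| ≤ c * weight β μ Z := by
  have h : ∀ s : ℕ, (ENNReal.ofReal (Real.exp (μ * s)) * normS β (G s) ≤ ENNReal.ofReal c ↔
      ∀ᵐ Z : Phase d s, |G s Z| ≤ c * weight β μ Z) := by
    intro s
    have hpos : 0 < Real.exp (μ * s) := Real.exp_pos _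
    have h1 : ENNReal.ofReal (Real.exp (μ * s)) * normS β (G s) ≤ ENNReal.ofReal c ↔
        normS β (G s) ≤ ENNReal.ofReal (c / Real.exp (μ * s)) := by
      rw [ENNReal.ofReal_div_of_pos hpos, ENNReal.le_div_iff_mul_le
        (Or.inl (ENNReal.ofReal_pos.2 hpos).ne') (Or.inl ENNReal.ofReal_ne_top), mul_comm]
    have h2 : ∀ Z : Phase d s, (ENNReal.ofReal (|G s Z| * Real.exp (β * kineticEnergy Z)) ≤
        ENNReal.ofReal (c / Real.exp (μ * s)) ↔ |G s Z| ≤ c * weight β μ Z) := by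
      intro Z
      rw [ENNReal.ofReal_le_ofReal_iff (by positivity), ← le_div_iff₀ (Real.exp_pos _), weight,
        sub_eq_add_neg, Real.exp_add, Real.exp_neg, Real.exp_neg, ← mul_assoc, div_eq_mul_inv,
        div_eq_mul_inv]
    rw [h1, normS]
    constructor
    · intro h3
      filter_upwards [ENNReal.ae_le_essSup
        (fun Z : Phase d s => ENNReal.ofReal (|G s Z| * Real.exp (β * kineticEnergy Z)))] with Z hZ
      exact (h2 Z).1 (hZ.trans h3)
    · intro h3
      exact essSup_le_of_ae_le _ (h3.mono fun Z hZ => (h2 Z).2 hZ)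
  rw [normH, iSup₂_le_iff]
  exact forall₂_congr fun s _ => h s

theorem normH_le_normT {T : ℝ} {β μ : ℝ → ℝ} (G : ℝ → Hier d) {t : ℝ} (ht : t ∈ Icc 0 T) :
    normH (β t) (μ t) (G t) ≤ normT T β μ G :=
  le_iSup₂ (f := fun t (_ : t ∈ Icc 0 T) => normH (β t) (μ t) (G t)) t ht

theorem normT_le_iff {T c : ℝ} (hc : 0 ≤ c) {β μ : ℝ → ℝ} (G : ℝ → Hier d) :
    normT T β μ G ≤ ENNReal.ofReal c ↔
      ∀ t ∈ Icc 0 T, ∀ s, 1 ≤ s → ∀ᵐ Z : Phase d s, |G t s Z| ≤ c * weight (β t) (μ t) Z := by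
  rw [normT, iSup₂_le_iff]
  exact forall₂_congr fun t _ => normH_le_iff hc _

theorem weight_eq_of_kineticEnergy_eq {s : ℕ} {β μ : ℝ} {Z W : Phase d s}
    (h : kineticEnergy Z = kineticEnergy W) : weight β μ Z = weight β μ W := by
  rw [weight, weight, h]

end Norms

/-! ### Values along the trajectories -/

section Along

variable {d m M N : ℕ} {ε : ℕ → ℝ} (hε : ∀ k, 2 ≤ k → k ≤ M + 1 → 0 < ε k)

/-- The values along the trajectories, outside an exceptional set. -/
noncomputable def along (M : ℕ) (ε : ℕ → ℝ) (T : ℝ) (G : ℝ → Hier d) (N₀ : Set (Phase d m)) :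
    ℝ × Phase d m → ℝ :=
  (Icc 0 T ×ˢ (phaseSpace M ε d m \ N₀)).indicator fun p => G p.1 m (flow M ε p.1 p.2)

include hε in
-- Each `G t` is controlled only up to a null set, and uncountably many times have to share one. On
-- a countable grid of times, the values along trajectories agree with measurable functions and
-- satisfy the bound outside a common null set; continuity along trajectories carries both over to
-- all times.
theorem exists_null_measurable_along (hd : 2 ≤ d) (hm : 1 ≤ m) {T : ℝ} (hT : 0 < T) {β μ : ℝ → ℝ}
    (hβ : Continuous β) (hμ : Continuous μ) {G : ℝ → Hier d} (hG : MemXT M ε N T β μ G) {c : ℝ}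
    (hc : 0 ≤ c) (hGc : normT T β μ G ≤ ENNReal.ofReal c) :
    ∃ N₀ : Set (Phase d m), MeasurableSet N₀ ∧ volume N₀ = 0 ∧
      (∀ Z ∈ phaseSpace M ε d m \ N₀, Z ∈ regularInterior hε d m ∧
        ContinuousOn (fun t => G t m (flow M ε t Z)) (Icc 0 T)) ∧
      Measurable (along M ε T G N₀) ∧
      ∀ τ ∈ Icc 0 T, ∀ Z, |along M ε T G N₀ (τ, Z)| ≤ c * weight (β τ) (μ τ) Z := by
  have hGc' := (normT_le_iff hc G).1 hGc
  obtain ⟨time, htime⟩ : ∃ time : ℕ → ℕ → ℝ, ∀ n k, time n k = min ((k : ℝ) / ((n : ℝ) + 1)) T :=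
    ⟨_, fun _ _ => rfl⟩
  have htimeI : ∀ n k, time n k ∈ Icc 0 T := fun n k => by
    rw [htime]
    exact ⟨le_min (by positivity) hT.le, min_le_right _ _⟩
  obtain ⟨g, hg, hgG⟩ : ∃ g : ℕ → ℕ → Phase d m → ℝ, (∀ n k, Measurable (g n k)) ∧
      ∀ n k, ∀ᵐ Z, G (time n k) m Z = g n k Z :=
    ⟨fun n k => ((hG.mem _ (htimeI n k)).measurable m hm).mk _,
      fun n k => ((hG.mem _ (htimeI n k)).measurable m hm).stronglyMeasurable_mk.measurable,
      fun n k => ((hG.mem _ (htimeI n k)).measurable m hm).ae_eq_mk⟩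
  obtain ⟨H, hHg, hH⟩ : ∃ H : ℕ → ℕ → Phase d m → ℝ,
      (∀ n k Z, H n k Z = g n k (flowMap hε d m (time n k, Z))) ∧ ∀ n k, Measurable (H n k) :=
    ⟨fun n k Z => g n k (flowMap hε d m (time n k, Z)), fun _ _ _ => rfl, fun n k =>
      (hg n k).comp ((measurable_flowMap hε).comp measurable_prodMk_left)⟩
  have hae : ∀ᵐ Z : Phase d m, Z ∈ phaseSpace M ε d m → (Z ∈ regularInterior hε d m ∧
      ContinuousOn (fun t => G t m (flow M ε t Z)) (Icc 0 T)) ∧ ∀ n k,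
        G (time n k) m (flow M ε (time n k) Z) = H n k Z ∧
        |H n k Z| ≤ c * weight (β (time n k)) (μ (time n k)) Z := by
    have h1 : ∀ n k, ∀ᵐ Z : Phase d m, Z ∈ regularInterior hε d m →
        G (time n k) m (flow M ε (time n k) Z) = H n k Z ∧
        |H n k Z| ≤ c * weight (β (time n k)) (μ (time n k)) Z := by
      intro n k
      have h2 := hgG n k
      have h3 := hGc' _ (htimeI n k) m hm
      have h4 := ae_flow_notMem hε (measure_eq_zero_iff_ae_notMem.2
        (h2.mono fun Z h h' => h' h) : volume {Z | ¬ (G (time n k) m Z = g n k Z)} = 0) (time n k)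
      have h5 := ae_flow_notMem hε (measure_eq_zero_iff_ae_notMem.2
        (h3.mono fun Z h h' => h' h) :
          volume {Z | ¬ (|G (time n k) m Z| ≤ c * weight (β (time n k)) (μ (time n k)) Z)} = 0) (time n k)
      filter_upwards [h4, h5] with Z h6 h7 hZ
      have h8 := not_not.1 (h6 hZ)
      have h9 := not_not.1 (h7 hZ)
      have h10 : G (time n k) m (flow M ε (time n k) Z) = H n k Z := by
        rw [h8, hHg, flow_eq_flowMap hε hZ]
      refine ⟨h10, ?_⟩
      rw [← h10]
      refine h9.trans_eq ?_
      rw [weight_eq_of_kineticEnergy_eq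
        ((hasTraj_of_mem_regularInterior hε hZ).kineticEnergy_flow hε _)]
    filter_upwards [ae_mem_regularInterior hε hd, hG.continuous_along m hm,
      ae_all_iff.2 fun n => ae_all_iff.2 fun k => h1 n k] with Z h2 h3 h4 hZ
    exact ⟨⟨h2 hZ, h3 hZ⟩, fun n k => h4 n k (h2 hZ)⟩
  obtain ⟨N₀, hN₀, hN₀m, hN₀0⟩ := exists_measurable_superset_of_null hae
  have hgood : ∀ Z ∈ phaseSpace M ε d m \ N₀, _ := fun Z hZ =>
    not_not.1 (fun h => hZ.2 (hN₀ h)) hZ.1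
  set K := along M ε T G N₀ with hK
  set S : Set (ℝ × Phase d m) := Icc 0 T ×ˢ (phaseSpace M ε d m \ N₀)
  have hS : MeasurableSet S := measurableSet_Icc.prod ((measurableSet_phaseSpace hε).diff hN₀m)
  set idx : ℕ → ℝ → ℕ := fun n τ => ⌊((n : ℝ) + 1) * τ⌋₊
  have htend : ∀ τ ∈ Icc 0 T, Tendsto (fun n => time n (idx n τ)) atTop (𝓝[Icc 0 T] τ) := by
    intro τ hτ
    refine tendsto_nhdsWithin_iff.2 ⟨?_, Eventually.of_forall fun n => htimeI _ _⟩
    have h1 : ∀ n, time n (idx n τ) = (⌊((n : ℝ) + 1) * τ⌋₊ : ℝ) / ((n : ℝ) + 1) := fun n => by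
      rw [htime]
      refine min_eq_left ?_
      rw [div_le_iff₀ (by positivity), mul_comm]
      refine (Nat.floor_le (mul_nonneg (by positivity) hτ.1)).trans ?_
      exact mul_le_mul_of_nonneg_left hτ.2 (by positivity)
    simp only [h1]
    have h2 := (tendsto_nat_floor_mul_div_atTop hτ.1).comp
      (tendsto_atTop_add_const_right atTop (1 : ℝ) tendsto_natCast_atTop_atTop)
    refine h2.congr fun n => ?_
    simp only [Function.comp]
    rw [mul_comm]
  have hlim : ∀ τ ∈ Icc 0 T, ∀ Z ∈ phaseSpace M ε d m \ N₀,
      Tendsto (fun n => H n (idx n τ) Z) atTop (𝓝 (K (τ, Z))) := by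
    intro τ hτ Z hZ
    obtain ⟨⟨-, h1⟩, h2⟩ := hgood Z hZ
    have h3 : K (τ, Z) = G τ m (flow M ε τ Z) := indicator_of_mem (show (τ, Z) ∈ S from ⟨hτ, hZ⟩) _
    rw [h3]
    refine ((h1 τ hτ).tendsto.comp (htend τ hτ)).congr fun n => ?_
    exact (h2 n (idx n τ)).1
  refine ⟨N₀, hN₀m, hN₀0, fun Z hZ => (hgood Z hZ).1, ?_, ?_⟩
  · refine measurable_of_tendsto_metrizable (f := fun n => S.indicator fun p => H n (idx n p.1) p.2)
      (fun n => Measurable.indicator ?_ hS) (tendsto_pi_nhds.2 fun p => ?_)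
    · have h1 : Measurable fun x : ℕ × Phase d m => H n x.1 x.2 :=
        measurable_from_prod_countable_right fun k => hH n k
      have h2 : Measurable fun p : ℝ × Phase d m => (idx n p.1, p.2) :=
        (Nat.measurable_floor.comp (measurable_fst.const_mul _)).prodMk measurable_snd
      exact Measurable.comp (g := fun x : ℕ × Phase d m => H n x.1 x.2) h1 h2
    · by_cases hp : p ∈ S
      · simp only [indicator_of_mem hp]
        exact hlim p.1 hp.1 p.2 hp.2
      · simp only [indicator_of_notMem hp]
        have : along M ε T G N₀ p = 0 := indicator_of_notMem hp _
        rw [this]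
        exact tendsto_const_nhds
  · intro τ hτ Z
    by_cases hZ : Z ∈ phaseSpace M ε d m \ N₀
    · have h1 := hlim τ hτ Z hZ
      have h2 : Tendsto (fun n => c * weight (β (time n (idx n τ))) (μ (time n (idx n τ))) Z) atTop
          (𝓝 (c * weight (β τ) (μ τ) Z)) := by
        have h3 : Continuous fun t => c * weight (β t) (μ t) Z := by unfold weight; fun_prop
        exact (h3.tendsto τ).comp ((htend τ hτ).mono_right nhdsWithin_le_nhds)
      exact le_of_tendsto_of_tendsto' h1.abs h2 fun n => ((hgood Z hZ).2 n _).2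
    · have : along M ε T G N₀ (τ, Z) = 0 := indicator_of_notMem (fun h => hZ h.2) _
      rw [this, abs_zero]
      exact mul_nonneg hc (weight_pos _ _ _).le

end Along

/-! ### Bounds for the collision integrals -/

section Bounds

variable {d ℓ : ℕ}

/-- The mass of the ellipsoid. -/
noncomputable def surfaceMass (d ℓ : ℕ) : ℝ := (surfaceMeasure d ℓ).real univ

theorem integrable_exp_neg_mul_norm_sq {V : Type*} [NormedAddCommGroup V] [InnerProductSpace ℝ V]
    [FiniteDimensional ℝ V] [MeasurableSpace V] [BorelSpace V] {δ : ℝ} (hδ : 0 < δ) :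
    Integrable fun v : V => Real.exp (-δ * ‖v‖ ^ 2) := by
  by_contra h
  have hint := GaussianFourier.integral_rexp_neg_mul_sq_norm (V := V) hδ
  rw [integral_undef h] at hint
  exact (Real.rpow_pos_of_pos (div_pos Real.pi_pos hδ) _).ne hint

theorem exp_neg_mul_sum {δ : ℝ} (v : Fin ℓ → Space d) :
    Real.exp (-δ * ∑ j, ‖v j‖ ^ 2) = ∏ j, Real.exp (-δ * ‖v j‖ ^ 2) := by
  rw [← Real.exp_sum, Finset.mul_sum]

theorem integrable_exp_neg_mul_sum {δ : ℝ} (hδ : 0 < δ) :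
    Integrable fun v : Fin ℓ → Space d => Real.exp (-δ * ∑ j, ‖v j‖ ^ 2) := by
  simp only [exp_neg_mul_sum]
  exact Integrable.fintype_prod (f := fun _ v => Real.exp (-δ * ‖v‖ ^ 2))
    fun _ => integrable_exp_neg_mul_norm_sq hδ

theorem integral_exp_neg_mul_sum {δ : ℝ} (hδ : 0 < δ) :
    ∫ v : Fin ℓ → Space d, Real.exp (-δ * ∑ j, ‖v j‖ ^ 2) = ((Real.pi / δ) ^ ((d : ℝ) / 2)) ^ ℓ := by
  simp only [exp_neg_mul_sum]
  rw [integral_fintype_prod_volume_eq_pow (fun v : Space d => Real.exp (-δ * ‖v‖ ^ 2)),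
    GaussianFourier.integral_rexp_neg_mul_sq_norm hδ, finrank_euclideanSpace_fin, Fintype.card_fin]

/-- Cauchy–Schwarz for the inner product of the ellipsoid; `√(ℓ+1)` compares `gauge` with the
Euclidean norm. -/
theorem max_crossSection_le {ω : Impact d ℓ} (hω : ω ∈ ellipsoid d ℓ) (v : Fin ℓ → Space d)
    (w : Space d) : max (crossSection ω fun j => v j - w) 0 ≤
      √((ℓ : ℝ) + 1) * (√(∑ j, ‖v j‖ ^ 2) + √ℓ * ‖w‖) := by
  refine max_le ?_ (by positivity)
  have h1 := crossSection_le ω (WithLp.toLp 2 fun j => v j - w)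
  rw [(mem_ellipsoid_iff ω).1 hω, one_mul] at h1
  refine h1.trans ((gauge_le _).trans ?_)
  gcongr
  have h2 : (WithLp.toLp 2 fun j => v j - w : Impact d ℓ) = WithLp.toLp 2 v - WithLp.toLp 2 fun _ => w := rfl
  have h3 : ‖(WithLp.toLp 2 fun _ => w : Impact d ℓ)‖ = √ℓ * ‖w‖ := by
    rw [PiLp.norm_eq_of_L2]
    simp only [Finset.sum_const, Finset.card_univ, Fintype.card_fin, nsmul_eq_mul]
    rw [Real.sqrt_mul (Nat.cast_nonneg _), Real.sqrt_sq (norm_nonneg _)]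
  rw [h2]
  refine (norm_sub_le _ _).trans ?_
  rw [h3, PiLp.norm_eq_of_L2]

/-- As `β/2 ≥ 2δ`, the Gaussian contains two factors `exp(-δ S)`: one absorbs the speeds through `√S
exp(-δ S) ≤ 1/√δ`, the other one is left for the integration. -/
theorem max_crossSection_mul_exp_le {ω : Impact d ℓ} (hω : ω ∈ ellipsoid d ℓ) (v : Fin ℓ → Space d)
    (w : Space d) {β δ : ℝ} (hδ : 0 < δ) (hβ : 4 * δ ≤ β) :
    max (crossSection ω fun j => v j - w) 0 * Real.exp (-(β * ((1 / 2) * ∑ j, ‖v j‖ ^ 2))) ≤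
      √((ℓ : ℝ) + 1) * ((√δ)⁻¹ + √ℓ * ‖w‖) * Real.exp (-δ * ∑ j, ‖v j‖ ^ 2) := by
  set S := ∑ j, ‖v j‖ ^ 2
  have hS : 0 ≤ S := Finset.sum_nonneg fun j _ => sq_nonneg _
  have h1 : Real.exp (-(β * ((1 / 2) * S))) ≤ Real.exp (-δ * S) * Real.exp (-δ * S) := by
    rw [← Real.exp_add]
    refine Real.exp_le_exp.2 ?_
    nlinarith
  have h2 : √S * Real.exp (-δ * S) ≤ (√δ)⁻¹ := by
    have hd : 0 < √δ := Real.sqrt_pos.2 hδ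
    rw [neg_mul, Real.exp_neg, ← div_eq_mul_inv, div_le_iff₀ (Real.exp_pos _), ← div_eq_inv_mul,
      le_div_iff₀ hd]
    have h3 := Real.add_one_le_exp (δ * S)
    have h4 : (√S * √δ) ^ 2 = δ * S := by
      rw [mul_pow, Real.sq_sqrt hS, Real.sq_sqrt hδ.le, mul_comm]
    nlinarith [sq_nonneg (√S * √δ - 1)]
  have h5 : Real.exp (-δ * S) ≤ 1 := Real.exp_le_one_iff.2 (by nlinarith)
  calc _ ≤ √((ℓ : ℝ) + 1) * (√S + √ℓ * ‖w‖) * (Real.exp (-δ * S) * Real.exp (-δ * S)) := by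
        gcongr
        exact max_crossSection_le hω v w
    _ = √((ℓ : ℝ) + 1) * (√S * Real.exp (-δ * S) + √ℓ * ‖w‖ * Real.exp (-δ * S)) *
          Real.exp (-δ * S) := by ring
    _ ≤ √((ℓ : ℝ) + 1) * ((√δ)⁻¹ + √ℓ * ‖w‖ * 1) * Real.exp (-δ * S) := by gcongr
    _ = _ := by rw [mul_one]

theorem measurableSet_ellipsoid : MeasurableSet (ellipsoid d ℓ) := by
  have : ellipsoid d ℓ = {y | gauge y = 1} := by
    ext y
    exact mem_ellipsoid_iff y
  rw [this]
  exact measurableSet_eq_fun measurable_gauge measurable_const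

theorem integrable_and_abs_integral_le (hn : 1 ≤ ℓ * d) {β δ A : ℝ} (hδ : 0 < δ) (hβ : 4 * δ ≤ β)
    (hA : 0 ≤ A) (w : Space d) {f : Impact d ℓ × (Fin ℓ → Space d) → ℝ}
    (hf : AEStronglyMeasurable f (collisionMeasure d ℓ))
    (hle : ∀ᵐ p ∂collisionMeasure d ℓ, |f p| ≤ max (crossSection p.1 fun j => p.2 j - w) 0 *
      (A * Real.exp (-(β * ((1 / 2) * ∑ j, ‖p.2 j‖ ^ 2))))) :
    Integrable f (collisionMeasure d ℓ) ∧ |∫ p, f p ∂collisionMeasure d ℓ| ≤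
      A * (surfaceMass d ℓ * (√((ℓ : ℝ) + 1) * ((√δ)⁻¹ + √ℓ * ‖w‖) *
        ((Real.pi / δ) ^ ((d : ℝ) / 2)) ^ ℓ)) := by
  have hfin := isFiniteMeasure_surfaceMeasure (d := d) (ℓ := ℓ) hn
  have hsf := sFinite_collisionMeasure (d := d) (ℓ := ℓ) hn
  set g : Impact d ℓ × (Fin ℓ → Space d) → ℝ := fun p =>
    A * (√((ℓ : ℝ) + 1) * ((√δ)⁻¹ + √ℓ * ‖w‖)) * Real.exp (-δ * ∑ j, ‖p.2 j‖ ^ 2) with hg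
  have hi : Integrable (fun p : Impact d ℓ × (Fin ℓ → Space d) =>
      (1 : ℝ) * Real.exp (-δ * ∑ j, ‖p.2 j‖ ^ 2)) (collisionMeasure d ℓ) :=
    Integrable.mul_prod (f := fun _ : Impact d ℓ => (1 : ℝ)) (integrable_const 1)
      (integrable_exp_neg_mul_sum hδ)
  simp only [one_mul] at hi
  have hgi : Integrable g (collisionMeasure d ℓ) := hi.const_mul _
  have hω : ∀ᵐ p ∂collisionMeasure d ℓ, p.1 ∈ ellipsoid d ℓ :=
    Measure.quasiMeasurePreserving_fst.ae (ae_restrict_mem measurableSet_ellipsoid)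
  have hfg : ∀ᵐ p ∂collisionMeasure d ℓ, ‖f p‖ ≤ g p := by
    filter_upwards [hle, hω] with p h1 h2
    refine h1.trans ?_
    have := mul_le_mul_of_nonneg_left (max_crossSection_mul_exp_le h2 p.2 w hδ hβ) hA
    simp only [hg]
    linarith
  refine ⟨hgi.mono' hf hfg, (norm_integral_le_of_norm_le hgi hfg).trans_eq ?_⟩
  have h3 := integral_prod_mul (μ := surfaceMeasure d ℓ) (ν := (volume : Measure (Fin ℓ → Space d)))
    (fun _ => (1 : ℝ)) fun v => Real.exp (-δ * ∑ j, ‖v j‖ ^ 2)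
  simp only [one_mul] at h3
  rw [hg, integral_const_mul, collisionMeasure, h3, integral_exp_neg_mul_sum hδ, integral_const,
    smul_eq_mul, mul_one, surfaceMass]
  ring

end Bounds

/-! ### Collision operators of represented functions -/

/-- `K` describes the values of `G` along the trajectories, up to null sets, and satisfies the bound
of the weighted spaces. -/
structure Represents (M : ℕ) (ε : ℕ → ℝ) {d m : ℕ} (T : ℝ) (β μ : ℝ → ℝ) (c : ℝ)
    (G : ℝ → Phase d m → ℝ) (K : ℝ × Phase d m → ℝ) : Prop where
  measurable : Measurable K
  eq : ∀ᵐ Z : Phase d m, Z ∈ phaseSpace M ε d m → ∀ τ ∈ Icc 0 T, G τ (flow M ε τ Z) = K (τ, Z)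
  bound : ∀ τ ∈ Icc 0 T, ∀ Z, |K (τ, Z)| ≤ c * weight (β τ) (μ τ) Z
  zero_outside : ∀ τ ∈ Icc 0 T, ∀ Z ∉ phaseSpace M ε d m, G τ Z = 0

theorem MemXT.exists_represents {d m M N : ℕ} {ε : ℕ → ℝ} (hε : ∀ k, 2 ≤ k → k ≤ M + 1 → 0 < ε k)
    (hd : 2 ≤ d) (hm : 1 ≤ m) {T : ℝ} (hT : 0 < T) {β μ : ℝ → ℝ}
    (hβ : Continuous β) (hμ : Continuous μ) {G : ℝ → Hier d} (hG : MemXT M ε N T β μ G) {c : ℝ}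
    (hc : 0 ≤ c) (hGc : normT T β μ G ≤ ENNReal.ofReal c) :
    ∃ K, Represents M ε T β μ c (fun τ => G τ m) K := by
  obtain ⟨N₀, -, h2, -, h4, h5⟩ := exists_null_measurable_along hε hd hm hT hβ hμ hG hc hGc
  refine ⟨_, h4, ?_, h5, fun τ hτ Z hZ => hG.zero_outside τ hτ m hm Z hZ⟩
  filter_upwards [measure_eq_zero_iff_ae_notMem.1 h2] with Z hZ hZD τ hτ
  exact (indicator_of_mem (M := ℝ) (show (τ, Z) ∈ Icc 0 T ×ˢ (phaseSpace M ε d m \ N₀) from ⟨hτ, hZD, hZ⟩)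
    fun p : ℝ × Phase d m => G p.1 m (flow M ε p.1 p.2)).symm

section Operator

variable {d s ℓ M : ℕ} {ε : ℕ → ℝ} (hε : ∀ k, 2 ≤ k → k ≤ M + 1 → 0 < ε k)

theorem continuous_finAppend {X E : Type*} [TopologicalSpace X] [TopologicalSpace E] {m n : ℕ}
    {a : X → Fin m → E} {b : X → Fin n → E} (ha : Continuous a) (hb : Continuous b) :
    Continuous fun x => Fin.append (a x) (b x) := by
  refine continuous_pi fun j => Fin.addCases (fun k => ?_) (fun k => ?_) j
  · simp only [Fin.append_left]
    exact (continuous_apply k).comp ha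
  · simp only [Fin.append_right]
    exact (continuous_apply k).comp hb

theorem continuous_scatter {X κ : Type} [TopologicalSpace X] [Fintype κ] [LinearOrder κ]
    {u v : X → κ → Space d} (hu : Continuous u) (hv : Continuous v) :
    Continuous fun x => scatter (u x) (v x) := by
  have hp' := hu.prodMk hv
  have hp : Continuous fun x => pairing (u x) (v x) := by
    have := (continuous_pairing (d := d) (κ := κ)).comp hp'
    exact this
  have hv' : ∀ k, Continuous fun x => v x k := fun k => (continuous_apply k).comp hv
  have hu' : ∀ k, Continuous fun x => u x k := fun k => (continuous_apply k).comp hu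
  refine continuous_pi fun k => ?_
  refine (hv' k).add ((continuous_const.mul hp).smul ?_)
  exact continuous_finsetSum _ fun j _ => (hu' j).sub (hu' k)

theorem continuous_adjoinPost (c : ℝ) (i : Fin s) :
    Continuous fun q : Phase d s × (Impact d ℓ × (Fin ℓ → Space d)) =>
      adjoinPost c i q.2.1 q.2.2 q.1 := by
  have h1 : Continuous fun q : Phase d s × (Impact d ℓ × (Fin ℓ → Space d)) =>
      (q.2.1 : Fin ℓ → Space d) := (PiLp.continuous_ofLp 2 _).comp (continuous_fst.comp continuous_snd)
  have hw : Continuous fun q : Phase d s × (Impact d ℓ × (Fin ℓ → Space d)) =>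
      transformVel (q.2.1 : Fin ℓ → Space d) (Fin.cons (q.1.2 i) q.2.2) := by
    refine continuous_scatter ?_ ?_
    · exact Continuous.finCons (A := fun _ => Space d) continuous_const h1
    · exact Continuous.finCons (A := fun _ => Space d)
        ((continuous_apply i).comp (continuous_snd.comp continuous_fst))
        (continuous_snd.comp continuous_snd)
  have hx : Continuous fun q : Phase d s × (Impact d ℓ × (Fin ℓ → Space d)) => q.1.1 :=
    continuous_fst.comp continuous_fst
  have hv : Continuous fun q : Phase d s × (Impact d ℓ × (Fin ℓ → Space d)) => q.1.2 :=
    continuous_snd.comp continuous_fst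
  refine (continuous_finAppend hx (continuous_pi fun j => ?_)).prodMk
    (continuous_finAppend (hv.update i ((continuous_apply 0).comp hw)) (continuous_pi fun j => ?_))
  · exact ((continuous_apply i).comp hx).add (((continuous_apply j).comp h1).const_smul c)
  · exact (continuous_apply j.succ).comp hw

/-- The pairs of a state with added particles. -/
def IsAdjoining (ε : ℕ → ℝ) (i : Fin s)
    (S : Phase d s × (Impact d ℓ × (Fin ℓ → Space d)) → Phase d (s + ℓ)) : Prop :=
  Measurable S ∧ ∀ q, S q = adjoinPre (ε (ℓ + 1)) i q.2.1 q.2.2 q.1 ∨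
    S q = adjoinPost (ε (ℓ + 1)) i q.2.1 q.2.2 q.1

include hε

/-- Adjoined states lie on the collision surface, so `G τ` is read off at time zero, `G τ W = K (τ,
Ψ^{-τ} W)`; by `ae_adjoin`, `Ψ^{-τ} W` avoids the exceptional set of `K`. The bound follows because
`W` has the energy of the state and of the added particles together. -/
theorem exists_measurable_integrand (hd : 2 ≤ d) (hℓ : 1 ≤ ℓ) (hℓM : ℓ ≤ M) {T : ℝ} {β μ : ℝ → ℝ}
    {c : ℝ} (hc : 0 ≤ c) {G : ℝ → Phase d (s + ℓ) → ℝ} {K : ℝ × Phase d (s + ℓ) → ℝ}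
    (hG : Represents M ε T β μ c G K) {i : Fin s}
    {S : Phase d s × (Impact d ℓ × (Fin ℓ → Space d)) → Phase d (s + ℓ)} (hS : IsAdjoining ε i S) :
    ∃ h : (ℝ × Phase d s) × (Impact d ℓ × (Fin ℓ → Space d)) → ℝ, Measurable h ∧
      ∀ᵐ q ∂((volume : Measure ℝ).prod (volume : Measure (Phase d s))).prod (collisionMeasure d ℓ),
        q.1.1 ∈ Icc 0 T →
        max (crossSection q.2.1 fun j => q.2.2 j - q.1.2.2 i) 0 * G q.1.1 (S (q.1.2, q.2)) = h q ∧
        |h q| ≤ max (crossSection q.2.1 fun j => q.2.2 j - q.1.2.2 i) 0 *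
          (c * Real.exp (-(μ q.1.1 * ℓ)) * weight (β q.1.1) (μ q.1.1) q.1.2 *
            Real.exp (-(β q.1.1 * ((1 / 2) * ∑ j, ‖q.2.2 j‖ ^ 2)))) := by
  have hflow : Measurable fun q : (ℝ × Phase d s) × (Impact d ℓ × (Fin ℓ → Space d)) =>
      S (q.1.2, q.2) := hS.1.comp ((measurable_snd.comp measurable_fst).prodMk measurable_snd)
  have hb : Measurable fun q : (ℝ × Phase d s) × (Impact d ℓ × (Fin ℓ → Space d)) =>
      max (crossSection q.2.1 fun j => q.2.2 j - q.1.2.2 i) 0 :=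
    ((measurable_relative_crossSection i).comp
      ((measurable_snd.comp measurable_fst).prodMk measurable_snd)).max measurable_const
  have hτ : Measurable fun q : (ℝ × Phase d s) × (Impact d ℓ × (Fin ℓ → Space d)) => q.1.1 :=
    measurable_fst.comp measurable_fst
  refine ⟨fun q => max (crossSection q.2.1 fun j => q.2.2 j - q.1.2.2 i) 0 *
    ((fun q : (ℝ × Phase d s) × (Impact d ℓ × (Fin ℓ → Space d)) => S (q.1.2, q.2)) ⁻¹'
      phaseSpace M ε d (s + ℓ)).indicator
      (fun q => K (q.1.1, flowMap hε d (s + ℓ) (-q.1.1, S (q.1.2, q.2)))) q, ?_, ?_⟩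
  · refine hb.mul (Measurable.indicator ?_ (hflow (measurableSet_phaseSpace hε)))
    exact hG.measurable.comp (hτ.prodMk ((measurable_flowMap hε).comp (hτ.neg.prodMk hflow)))
  · have hnull : volume {Z : Phase d (s + ℓ) | ¬ (Z ∈ phaseSpace M ε d (s + ℓ) → ∀ τ ∈ Icc 0 T,
        G τ (flow M ε τ Z) = K (τ, Z))} = 0 := hG.eq
    filter_upwards [ae_adjoin hε hℓ hℓM hd hnull i] with q hq hqτ
    have hrhs : 0 ≤ max (crossSection q.2.1 fun j => q.2.2 j - q.1.2.2 i) 0 *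
          (c * Real.exp (-(μ q.1.1 * ℓ)) * weight (β q.1.1) (μ q.1.1) q.1.2 *
            Real.exp (-(β q.1.1 * ((1 / 2) * ∑ j, ‖q.2.2 j‖ ^ 2)))) := by
      have := (weight_pos (β q.1.1) (μ q.1.1) q.1.2).le
      positivity
    rcases le_or_gt (crossSection q.2.1 fun j => q.2.2 j - q.1.2.2 i) 0 with h0 | h0
    · simp only [max_eq_right h0, zero_mul, abs_zero, le_refl, and_self]
    set W := S (q.1.2, q.2) with hW
    by_cases hWD : W ∈ phaseSpace M ε d (s + ℓ)
    · obtain ⟨hE, htr, hmap, hgood⟩ := hq h0 W (hS.2 (q.1.2, q.2)) hWD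
      have h1 := not_not.1 hgood ((htr.flow hε _).mem_phaseSpace hε) q.1.1 hqτ
      rw [htr.flow_flow hε, neg_add_cancel, htr.flow_zero hε] at h1
      have h2 : (-q.1.1) ≤ 0 := neg_nonpos.2 hqτ.1
      have hind : ((fun q : (ℝ × Phase d s) × (Impact d ℓ × (Fin ℓ → Space d)) => S (q.1.2, q.2)) ⁻¹'
          phaseSpace M ε d (s + ℓ)).indicator
          (fun q => K (q.1.1, flowMap hε d (s + ℓ) (-q.1.1, S (q.1.2, q.2)))) q =
          K (q.1.1, flow M ε (-q.1.1) W) := by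
        rw [hmap _ h2]
        exact indicator_of_mem (f := fun q : (ℝ × Phase d s) × (Impact d ℓ × (Fin ℓ → Space d)) =>
          K (q.1.1, flowMap hε d (s + ℓ) (-q.1.1, S (q.1.2, q.2)))) (by exact hWD)
      rw [hind, h1]
      refine ⟨rfl, ?_⟩
      rw [abs_mul, abs_of_nonneg (le_max_right _ _)]
      refine mul_le_mul_of_nonneg_left ?_ (le_max_right _ _)
      refine (hG.bound _ hqτ _).trans_eq ?_
      rw [weight_eq_of_kineticEnergy_eq (htr.kineticEnergy_flow hε _), weight, weight, hE, mul_assoc,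
        mul_assoc, ← Real.exp_add, ← Real.exp_add]
      congr 2
      push_cast
      ring
    · have hind : ((fun q : (ℝ × Phase d s) × (Impact d ℓ × (Fin ℓ → Space d)) => S (q.1.2, q.2)) ⁻¹'
          phaseSpace M ε d (s + ℓ)).indicator
          (fun q => K (q.1.1, flowMap hε d (s + ℓ) (-q.1.1, S (q.1.2, q.2)))) q = 0 :=
        indicator_of_notMem (f := fun q : (ℝ × Phase d s) × (Impact d ℓ × (Fin ℓ → Space d)) =>
          K (q.1.1, flowMap hε d (s + ℓ) (-q.1.1, S (q.1.2, q.2)))) (by exact hWD)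
      rw [hind, hG.zero_outside _ hqτ _ hWD, mul_zero, abs_zero]
      exact ⟨rfl, hrhs⟩

end Operator

/-! ### Size and measurability of the collision operators -/

section Operator

variable {d s ℓ M N : ℕ} {ε : ℕ → ℝ} (hε : ∀ k, 2 ≤ k → k ≤ M + 1 → 0 < ε k)

/-- The growth of the collision operators in the number of particles and in the energy. -/
noncomputable def growth (Z : Phase d s) : ℝ := s + √(s * kineticEnergy Z)

/-- The constant in the bound for the collision operators. -/
noncomputable def collisionConst (d ℓ : ℕ) (K δ : ℝ) : ℝ :=
  K ^ ℓ / ℓ ! * (2 * (surfaceMass d ℓ * (√((ℓ : ℝ) + 1) * ((√δ)⁻¹ + √(2 * ℓ)) *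
    ((Real.pi / δ) ^ ((d : ℝ) / 2)) ^ ℓ)))

theorem kineticEnergy_nonneg (Z : Phase d s) : 0 ≤ kineticEnergy Z :=
  mul_nonneg (by norm_num) (Finset.sum_nonneg fun _ _ => sq_nonneg _)

theorem measurable_kineticEnergy : Measurable (kineticEnergy : Phase d s → ℝ) := by
  unfold kineticEnergy
  exact (by fun_prop : Continuous fun Z : Phase d s => (1 / 2 : ℝ) * ∑ i, ‖Z.2 i‖ ^ 2).measurable

theorem growth_nonneg (Z : Phase d s) : 0 ≤ growth Z := by
  unfold growth
  positivity

theorem measurable_growth : Measurable (growth : Phase d s → ℝ) :=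
  measurable_const.add (measurable_kineticEnergy.const_mul _).sqrt

theorem collisionConst_nonneg {K δ : ℝ} (hK : 0 ≤ K) (hδ : 0 < δ) : 0 ≤ collisionConst d ℓ K δ := by
  unfold collisionConst surfaceMass
  positivity

theorem sum_norm_le (Z : Phase d s) : ∑ i, ‖Z.2 i‖ ≤ √2 * √(s * kineticEnergy Z) := by
  rw [← Real.sqrt_mul (by norm_num)]
  refine Real.le_sqrt_of_sq_le ?_
  have h := Finset.sum_mul_sq_le_sq_mul_sq Finset.univ (fun _ : Fin s => (1 : ℝ)) fun i => ‖Z.2 i‖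
  simp only [one_mul, one_pow, Finset.sum_const, Finset.card_univ, Fintype.card_fin, nsmul_eq_mul,
    mul_one] at h
  refine h.trans_eq ?_
  rw [kineticEnergy]
  ring

theorem sum_add_mul_norm_le {δ : ℝ} (hδ : 0 < δ) (Z : Phase d s) :
    ∑ i, ((√δ)⁻¹ + √ℓ * ‖Z.2 i‖) ≤ ((√δ)⁻¹ + √(2 * ℓ)) * growth Z := by
  have h := mul_le_mul_of_nonneg_left (sum_norm_le Z) (Real.sqrt_nonneg (ℓ : ℝ))
  have h1 : √(2 * (ℓ : ℝ)) = √2 * √ℓ := Real.sqrt_mul (by norm_num) _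
  have h2 : 0 ≤ (√δ)⁻¹ := by positivity
  rw [Finset.sum_add_distrib, ← Finset.mul_sum, Finset.sum_const, Finset.card_univ, Fintype.card_fin,
    nsmul_eq_mul, growth, h1]
  have h3 : 0 ≤ √2 * √(ℓ : ℝ) * s := by positivity
  have h4 : 0 ≤ (√δ)⁻¹ * √(s * kineticEnergy Z) := by positivity
  nlinarith

/-- `e^(ℓd-1) = (e^(d-1/ℓ))^ℓ`, and the binomial coefficient is at most `N^ℓ/ℓ!`. This is the only
use of the scaling. -/
theorem pow_mul_choose_le (hd : 2 ≤ d) (hℓ : 1 ≤ ℓ) {e K : ℝ} (he : 0 < e)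
    (hK : (N : ℝ) * e ^ ((d : ℝ) - 1 / (ℓ : ℝ)) ≤ K) :
    e ^ (ℓ * d - 1) * ((N - s).choose ℓ : ℝ) ≤ K ^ ℓ / ℓ ! := by
  have h1 : ((N - s).choose ℓ : ℝ) ≤ (N : ℝ) ^ ℓ / ℓ ! := by
    refine (Nat.choose_le_pow_div ℓ (N - s)).trans ?_
    have : ((N - s : ℕ) : ℝ) ≤ N := by exact_mod_cast Nat.sub_le N s
    gcongr
  have h2 : e ^ (ℓ * d - 1) = (e ^ ((d : ℝ) - 1 / (ℓ : ℝ))) ^ ℓ := by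
    rw [← Real.rpow_natCast, ← Real.rpow_mul_natCast he.le]
    congr 1
    have : 1 ≤ ℓ * d := Nat.mul_pos hℓ (by omega)
    have h3 : (ℓ : ℝ) ≠ 0 := by exact_mod_cast (by omega : ℓ ≠ 0)
    push_cast [this]
    field_simp
  calc _ ≤ (e ^ ((d : ℝ) - 1 / (ℓ : ℝ))) ^ ℓ * ((N : ℝ) ^ ℓ / ℓ !) := by
        rw [h2]
        gcongr
    _ = ((N : ℝ) * e ^ ((d : ℝ) - 1 / (ℓ : ℝ))) ^ ℓ / ℓ ! := by
        rw [mul_pow]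
        ring
    _ ≤ K ^ ℓ / ℓ ! := by gcongr

theorem isAdjoining_pre (i : Fin s) : IsAdjoining ε i
    fun q : Phase d s × (Impact d ℓ × (Fin ℓ → Space d)) =>
      adjoinPre (ε (ℓ + 1)) i q.2.1 q.2.2 q.1 :=
  ⟨measurable_adjoinPre _ i, fun _ => Or.inl rfl⟩

theorem isAdjoining_post (i : Fin s) : IsAdjoining ε i
    fun q : Phase d s × (Impact d ℓ × (Fin ℓ → Space d)) =>
      adjoinPost (ε (ℓ + 1)) i q.2.1 q.2.2 q.1 :=
  ⟨(continuous_adjoinPost _ i).measurable, fun _ => Or.inr rfl⟩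

include hε

theorem exists_measurable_collisionOp (hd : 2 ≤ d) (hℓ : 1 ≤ ℓ) (hℓM : ℓ ≤ M) {T : ℝ} {β μ : ℝ → ℝ}
    (hβ : Continuous β) (hμ : Continuous μ) {δ : ℝ} (hδ : 0 < δ) (hβδ : ∀ τ ∈ Icc 0 T, 4 * δ ≤ β τ)
    {K₀ : ℝ} (hK₀ : (N : ℝ) * ε (ℓ + 1) ^ ((d : ℝ) - 1 / (ℓ : ℝ)) ≤ K₀)
    {c : ℝ} (hc : 0 ≤ c) {G : ℝ → Phase d (s + ℓ) → ℝ} {K : ℝ × Phase d (s + ℓ) → ℝ}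
    (hG : Represents M ε T β μ c G K) :
    ∃ h : ℝ × Phase d s → ℝ, Measurable h ∧ (N < s + ℓ → ∀ q, h q = 0) ∧
      (∀ τ ∈ Icc 0 T, ∀ Z, |h (τ, Z)| ≤ c * Real.exp (-(μ τ * ℓ)) * weight (β τ) (μ τ) Z *
        (collisionConst d ℓ K₀ δ * growth Z)) ∧
      ∀ᵐ q ∂(volume : Measure ℝ).prod (volume : Measure (Phase d s)), q.1 ∈ Icc 0 T →
        (∀ i : Fin s, Integrable (gainIntegrand ε ℓ i (G q.1) q.2) (collisionMeasure d ℓ) ∧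
          Integrable (lossIntegrand ε ℓ i (G q.1) q.2) (collisionMeasure d ℓ)) ∧
        collisionOp ε N ℓ s (G q.1) q.2 = h q := by
  have hn : 1 ≤ ℓ * d := Nat.mul_pos hℓ (by omega)
  have hsf := sFinite_collisionMeasure (d := d) (ℓ := ℓ) hn
  have hε' : 0 < ε (ℓ + 1) := hε _ (by omega) (by omega)
  have hK₀' : 0 ≤ K₀ := le_trans (by positivity) hK₀
  choose f hf hfe using fun i : Fin s =>
    exists_measurable_integrand hε hd hℓ hℓM hc hG (isAdjoining_post (ε := ε) (ℓ := ℓ) i)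
  choose g hg hge using fun i : Fin s =>
    exists_measurable_integrand hε hd hℓ hℓM hc hG (isAdjoining_pre (ε := ε) (ℓ := ℓ) i)
  obtain ⟨h₀, hh₀⟩ : ∃ h₀ : ℝ × Phase d s → ℝ, ∀ q, h₀ q =
      ε (ℓ + 1) ^ (ℓ * d - 1) * ((N - s).choose ℓ : ℝ) *
        ∑ i : Fin s, (∫ p, f i (q, p) ∂collisionMeasure d ℓ - ∫ p, g i (q, p) ∂collisionMeasure d ℓ) :=
    ⟨_, fun _ => rfl⟩
  have hh₀m : Measurable h₀ := by
    rw [show h₀ = _ from funext hh₀]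
    refine Measurable.const_mul (Finset.measurable_sum _ fun i _ => Measurable.sub ?_ ?_) _
    · exact ((hf i).stronglyMeasurable.integral_prod_right').measurable
    · exact ((hg i).stronglyMeasurable.integral_prod_right').measurable
  obtain ⟨B, hB⟩ : ∃ B : ℝ × Phase d s → ℝ, ∀ q, B q =
      c * Real.exp (-(μ q.1 * ℓ)) * weight (β q.1) (μ q.1) q.2 *
        (collisionConst d ℓ K₀ δ * growth q.2) := ⟨_, fun _ => rfl⟩
  have hBm : Measurable B := by
    rw [show B = _ from funext hB]
    have h1 := hβ.measurable
    have h2 := hμ.measurable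
    have h3 := measurable_kineticEnergy (d := d) (s := s)
    have h4 := measurable_growth (d := d) (s := s)
    unfold weight
    fun_prop
  have hB0 : ∀ q, 0 ≤ B q := fun q => by
    rw [hB]
    have := (weight_pos (β q.1) (μ q.1) q.2).le
    have := growth_nonneg q.2
    have := collisionConst_nonneg (d := d) (ℓ := ℓ) hK₀' hδ
    positivity
  -- The cut-off changes nothing almost everywhere, and the bound then holds at every point, so that
  -- it can be used along each single trajectory.
  refine ⟨{q | |h₀ q| ≤ B q}.indicator h₀, ?_, ?_, ?_, ?_⟩
  · exact hh₀m.indicator (measurableSet_le hh₀m.abs hBm)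
  · intro hN q
    refine indicator_apply_eq_zero.2 fun _ => ?_
    rw [hh₀, Nat.choose_eq_zero_of_lt (by omega), Nat.cast_zero, mul_zero, zero_mul]
  · intro τ _ Z
    rw [← hB (τ, Z)]
    by_cases h : (τ, Z) ∈ {q | |h₀ q| ≤ B q}
    · rw [indicator_of_mem h]
      exact h
    · rw [indicator_of_notMem h, abs_zero]
      exact hB0 _
  · filter_upwards [ae_all_iff.2 fun i => Measure.ae_ae_of_ae_prod (hfe i),
      ae_all_iff.2 fun i => Measure.ae_ae_of_ae_prod (hge i)] with q hq1 hq2 hqτ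
    obtain ⟨A, hA⟩ : ∃ A, A = c * Real.exp (-(μ q.1 * ℓ)) * weight (β q.1) (μ q.1) q.2 := ⟨_, rfl⟩
    have hA0 : 0 ≤ A := by
      rw [hA]
      have := (weight_pos (β q.1) (μ q.1) q.2).le
      positivity
    have e1 : ∀ i, gainIntegrand ε ℓ i (G q.1) q.2 =ᵐ[collisionMeasure d ℓ] fun p => f i (q, p) :=
      fun i => (hq1 i).mono fun p hp => (hp hqτ).1
    have e2 : ∀ i, lossIntegrand ε ℓ i (G q.1) q.2 =ᵐ[collisionMeasure d ℓ] fun p => g i (q, p) :=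
      fun i => (hq2 i).mono fun p hp => (hp hqτ).1
    have b1 := fun i => integrable_and_abs_integral_le hn hδ (hβδ _ hqτ) hA0 (q.2.2 i)
      ((hf i).comp measurable_prodMk_left).aestronglyMeasurable
      ((hq1 i).mono fun p hp => (hp hqτ).2.trans_eq (by rw [hA]))
    have b2 := fun i => integrable_and_abs_integral_le hn hδ (hβδ _ hqτ) hA0 (q.2.2 i)
      ((hg i).comp measurable_prodMk_left).aestronglyMeasurable
      ((hq2 i).mono fun p hp => (hp hqτ).2.trans_eq (by rw [hA]))
    have hop : collisionOp ε N ℓ s (G q.1) q.2 = h₀ q := by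
      rw [hh₀, collisionOp]
      congr 1
      exact Finset.sum_congr rfl fun i _ => by rw [integral_congr_ae (e1 i), integral_congr_ae (e2 i)]
    have hle : |h₀ q| ≤ B q := by
      rw [hh₀, hB, ← hA, abs_mul, abs_of_nonneg (by positivity)]
      obtain ⟨D, hD⟩ : ∃ D, D = surfaceMass d ℓ * √((ℓ : ℝ) + 1) *
        ((Real.pi / δ) ^ ((d : ℝ) / 2)) ^ ℓ := ⟨_, rfl⟩
      have hD0 : 0 ≤ D := by
        rw [hD, surfaceMass]
        positivity
      have hsum : |∑ i : Fin s, (∫ p, f i (q, p) ∂collisionMeasure d ℓ -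
          ∫ p, g i (q, p) ∂collisionMeasure d ℓ)| ≤
          2 * A * D * (((√δ)⁻¹ + √(2 * ℓ)) * growth q.2) := by
        refine (Finset.abs_sum_le_sum_abs _ _).trans ?_
        calc _ ≤ ∑ i : Fin s, 2 * A * D * ((√δ)⁻¹ + √ℓ * ‖q.2.2 i‖) := by
              refine Finset.sum_le_sum fun i _ => (abs_sub _ _).trans ?_
              refine (add_le_add (b1 i).2 (b2 i).2).trans_eq ?_
              rw [hD]
              ring
          _ ≤ _ := by
              rw [← Finset.mul_sum]
              exact mul_le_mul_of_nonneg_left (sum_add_mul_norm_le hδ q.2) (by positivity)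
      refine (mul_le_mul (pow_mul_choose_le hd hℓ hε' hK₀) hsum (abs_nonneg _)
        (by positivity)).trans_eq ?_
      rw [collisionConst, hD]
      ring
    refine ⟨fun i => ⟨(b1 i).1.congr (e1 i).symm, (b2 i).1.congr (e2 i).symm⟩, ?_⟩
    rw [hop, indicator_of_mem (by exact hle)]

end Operator

/-! ### Integrals along the trajectories -/

section Kernel

variable {d s M N : ℕ} {ε : ℕ → ℝ} (hε : ∀ k, 2 ≤ k → k ≤ M + 1 → 0 < ε k)

theorem integral_exp_decay {a : ℝ} (ha : 0 < a) (X r t : ℝ) :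
    ∫ τ in r..t, X * Real.exp (-(a * (t - τ) * X)) = (1 - Real.exp (-(a * (t - r) * X))) / a := by
  have hder : ∀ τ ∈ uIcc r t, HasDerivAt (fun τ => Real.exp (-(a * (t - τ) * X)) / a)
      (X * Real.exp (-(a * (t - τ) * X))) τ := fun τ _ => by
    have h1 : HasDerivAt (fun τ => -(a * (t - τ) * X)) (a * X) τ := by
      have := ((((hasDerivAt_id τ).const_sub t).const_mul a).mul_const X).neg
      refine this.congr_deriv ?_
      ring
    refine (h1.exp.div_const a).congr_deriv ?_
    field_simp
  have hc : Continuous fun τ => X * Real.exp (-(a * (t - τ) * X)) := by fun_prop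
  rw [intervalIntegral.integral_eq_sub_of_hasDerivAt hder (hc.intervalIntegrable _ _)]
  simp only [sub_self, mul_zero, zero_mul, neg_zero, Real.exp_zero]
  ring

/-- The decay integrates to at most `1/(aX)`, which compensates the factor `X`; the part with `q`
costs the length of the interval. -/
theorem integrableOn_and_abs_setIntegral_le {a X p q D r t : ℝ} (ha : 0 < a) (hX : 0 ≤ X)
    (hp : 0 ≤ p) (hq : 0 ≤ q) (hD : 0 ≤ D) (hrt : r ≤ t) {f : ℝ → ℝ} (hf : Measurable f)
    (hle : ∀ τ ∈ Icc r t, |f τ| ≤ D * (Real.exp (-(a * (t - τ) * X)) * (p * X + q))) :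
    IntegrableOn f (Icc r t) ∧ ∀ A ⊆ Icc r t, MeasurableSet A →
      |∫ τ in A, f τ| ≤ D * (p / a + q * (t - r)) := by
  obtain ⟨g, hg⟩ : ∃ g : ℝ → ℝ, ∀ τ, g τ = D * (p * (X * Real.exp (-(a * (t - τ) * X))) + q) :=
    ⟨_, fun _ => rfl⟩
  have hgc : Continuous g := by
    rw [show g = _ from funext hg]
    fun_prop
  have hgi : IntegrableOn g (Icc r t) := hgc.continuousOn.integrableOn_Icc
  have hfg : ∀ τ ∈ Icc r t, ‖f τ‖ ≤ g τ := fun τ hτ => by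
    refine (hle τ hτ).trans ?_
    rw [hg]
    refine mul_le_mul_of_nonneg_left ?_ hD
    have h1 : Real.exp (-(a * (t - τ) * X)) ≤ 1 := by
      refine Real.exp_le_one_iff.2 ?_
      have := mul_nonneg (mul_nonneg ha.le (sub_nonneg.2 hτ.2)) hX
      linarith
    have h2 := mul_le_mul_of_nonneg_right h1 hq
    linarith
  have hfi : IntegrableOn f (Icc r t) := Integrable.mono' hgi hf.aestronglyMeasurable
    ((ae_restrict_mem measurableSet_Icc).mono hfg)
  refine ⟨hfi, fun A hA hAm => ?_⟩
  have hgint : ∫ τ in Icc r t, g τ ≤ D * (p / a + q * (t - r)) := by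
    rw [integral_Icc_eq_integral_Ioc, ← intervalIntegral.integral_of_le hrt]
    simp only [hg]
    rw [intervalIntegral.integral_const_mul, intervalIntegral.integral_add
      ((by fun_prop : Continuous fun τ => p * (X * Real.exp (-(a * (t - τ) * X)))).intervalIntegrable _ _)
      (continuous_const.intervalIntegrable _ _), intervalIntegral.integral_const_mul,
      integral_exp_decay ha, intervalIntegral.integral_const, smul_eq_mul]
    refine mul_le_mul_of_nonneg_left ?_ hD
    have h1 : p * ((1 - Real.exp (-(a * (t - r) * X))) / a) ≤ p / a := by
      rw [← mul_div_assoc]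
      gcongr
      have := Real.exp_pos (-(a * (t - r) * X))
      nlinarith
    linarith
  refine le_trans ?_ hgint
  calc |∫ τ in A, f τ| ≤ ∫ τ in A, g τ := by
        rw [← Real.norm_eq_abs]
        refine norm_integral_le_of_norm_le (hgi.mono_set hA) ?_
        exact (ae_restrict_mem hAm).mono fun τ hτ => hfg τ (hA hτ)
    _ ≤ ∫ τ in Icc r t, g τ := by
        refine setIntegral_mono_set hgi ?_ hA.eventuallyLE
        exact (ae_restrict_mem measurableSet_Icc).mono fun τ hτ => (norm_nonneg _).trans (hfg τ hτ)

/-- Both weights have the same slope, so the loss of weight is a decay at a rate proportional to `s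
+ E`. -/
theorem weight_linearWeight (β₀ T b m : ℝ) (τ t : ℝ) (Z : Phase d s) :
    weight (linearWeight β₀ T b τ) (linearWeight β₀ T m τ) Z =
      weight (linearWeight β₀ T b t) (linearWeight β₀ T m t) Z *
        Real.exp (-(β₀ / (2 * T) * (t - τ) * (s + kineticEnergy Z))) := by
  rw [weight, weight, ← Real.exp_add]
  congr 1
  unfold linearWeight
  ring

include hε in
-- At each fixed time the flow avoids null sets for almost every start; `flowMap` supplies the joint
-- measurability for exchanging times and states.
theorem ae_ae_flow (hd : 2 ≤ d) {P : ℝ × Phase d s → Prop}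
    (hP : ∀ᵐ q ∂(volume : Measure ℝ).prod (volume : Measure (Phase d s)), P q) (t : ℝ) :
    ∀ᵐ Z : Phase d s, Z ∈ phaseSpace M ε d s → ∀ᵐ τ : ℝ, P (τ, flow M ε (τ - t) Z) := by
  obtain ⟨S, hSP, hSm, hS0⟩ := exists_measurable_superset_of_null hP
  have h1 := Measure.ae_ae_of_ae_prod (measure_eq_zero_iff_ae_notMem.1 hS0)
  have hF : Measurable fun x : ℝ × Phase d s => (x.1, flowMap hε d s (x.1 - t, x.2)) :=
    measurable_fst.prodMk ((measurable_flowMap hε).comp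
      ((measurable_fst.sub_const t).prodMk measurable_snd))
  have hm : MeasurableSet {x : ℝ × Phase d s |
      (fun (τ : ℝ) Z => Z ∈ regularInterior hε d s → (τ, flowMap hε d s (τ - t, Z)) ∉ S) x.1 x.2} := by
    have h2 : MeasurableSet {x : ℝ × Phase d s | x.2 ∈ regularInterior hε d s} :=
      measurable_snd (measurableSet_regularInterior hε)
    have h3 : MeasurableSet {x : ℝ × Phase d s | (x.1, flowMap hε d s (x.1 - t, x.2)) ∈ S} := hF hSm
    exact h2.imp h3.compl
  have h4 : ∀ᵐ τ : ℝ, ∀ᵐ Z : Phase d s, Z ∈ regularInterior hε d s →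
      (τ, flowMap hε d s (τ - t, Z)) ∉ S := by
    filter_upwards [h1] with τ hτ
    filter_upwards [ae_flow_notMem hε (measure_eq_zero_iff_ae_notMem.2 hτ :
      volume {Z | (τ, Z) ∈ S} = 0) (τ - t)] with Z hZ hZr
    rw [← flow_eq_flowMap hε hZr]
    exact hZ hZr
  filter_upwards [(Measure.ae_ae_comm hm).1 h4, ae_mem_regularInterior hε hd] with Z h5 h6 hZ
  filter_upwards [h5] with τ h7
  have h8 := h7 (h6 hZ)
  rw [← flow_eq_flowMap hε (h6 hZ)] at h8
  by_contra h9
  exact h8 (hSP h9)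

/-- A bound of the form that the collision operators satisfy. -/
def Dominated (β₀ T b m : ℝ) (B : ℝ) (h : ℝ × Phase d s → ℝ) : Prop :=
  ∀ τ ∈ Icc 0 T, ∀ Z, |h (τ, Z)| ≤
    B * weight (linearWeight β₀ T b τ) (linearWeight β₀ T m τ) Z * growth Z

include hε

theorem measurable_comp_flow {h : ℝ × Phase d s → ℝ} (hh : Measurable h) {Z : Phase d s}
    (hZ : Z ∈ regularInterior hε d s) (t : ℝ) : Measurable fun τ => h (τ, flow M ε (τ - t) Z) := by
  simp only [flow_eq_flowMap hε hZ]
  exact hh.comp (measurable_id.prodMk ((measurable_flowMap hε).comp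
    ((measurable_id.sub_const t).prodMk measurable_const)))

/-- The split of `growth` is left open: `p = 2`, `q = 0` gives the a priori bound, and a small `p`
with a large `q` gives continuity in time. -/
theorem Dominated.integrableOn_and_abs_setIntegral_le {β₀ T b m B : ℝ} (hβ₀ : 0 < β₀) (hT : 0 < T)
    (hB : 0 ≤ B) {h : ℝ × Phase d s → ℝ} (hdom : Dominated β₀ T b m B h) (hh : Measurable h)
    {Z : Phase d s} (hZ : Z ∈ regularInterior hε d s) {p q : ℝ} (hp : 0 ≤ p) (hq : 0 ≤ q)
    (hpq : growth Z ≤ p * (s + kineticEnergy Z) + q) {r t : ℝ} (hr : 0 ≤ r) (hrt : r ≤ t) (ht : t ≤ T)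
    (t' : ℝ) :
    IntegrableOn (fun τ => h (τ, flow M ε (τ - t') Z)) (Icc r t) ∧ ∀ A ⊆ Icc r t, MeasurableSet A →
      |∫ τ in A, h (τ, flow M ε (τ - t') Z)| ≤
        B * (p / (β₀ / (2 * T)) + q * (t - r)) *
          weight (linearWeight β₀ T b t) (linearWeight β₀ T m t) Z := by
  have ha : 0 < β₀ / (2 * T) := by positivity
  have hX : 0 ≤ s + kineticEnergy Z := add_nonneg (Nat.cast_nonneg _) (kineticEnergy_nonneg Z)
  have hw := weight_pos (linearWeight β₀ T b t) (linearWeight β₀ T m t) Z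
  have htr := hasTraj_of_mem_regularInterior hε hZ
  have key := BBGKY.integrableOn_and_abs_setIntegral_le (D := B * weight (linearWeight β₀ T b t)
    (linearWeight β₀ T m t) Z) ha hX hp hq (by positivity) hrt (measurable_comp_flow hε hh hZ t')
    fun τ hτ => by
      refine (hdom τ ⟨hr.trans hτ.1, hτ.2.trans ht⟩ _).trans ?_
      have hE := htr.kineticEnergy_flow hε (τ - t')
      rw [weight_eq_of_kineticEnergy_eq hE, weight_linearWeight β₀ T b m τ t, growth, hE, ← growth]
      refine (mul_le_mul_of_nonneg_left hpq (by positivity)).trans_eq ?_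
      ring
  refine ⟨key.1, fun A hA hAm => (key.2 A hA hAm).trans_eq ?_⟩
  ring

end Kernel

theorem growth_le {d s : ℕ} (Z : Phase d s) : growth Z ≤ 2 * (s + kineticEnergy Z) + 0 := by
  have hE := kineticEnergy_nonneg Z
  have hs : (0 : ℝ) ≤ s := Nat.cast_nonneg s
  have h : √(s * kineticEnergy Z) ≤ s + kineticEnergy Z := by
    refine Real.sqrt_le_iff.2 ⟨by positivity, ?_⟩
    nlinarith
  unfold growth
  linarith

/-- Young's inequality for `√(s E)`. The price of a small coefficient of `s + E` falls on `s` alone,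
which is at most `N` where this is used. -/
theorem growth_le_of_pos {d s : ℕ} (Z : Phase d s) {η : ℝ} (hη : 0 < η) :
    growth Z ≤ η * (s + kineticEnergy Z) + s * (1 + 1 / η) := by
  have hE := kineticEnergy_nonneg Z
  have hs : (0 : ℝ) ≤ s := Nat.cast_nonneg s
  have h : √(s * kineticEnergy Z) ≤ η * kineticEnergy Z + s * (1 / η) := by
    refine Real.sqrt_le_iff.2 ⟨by positivity, ?_⟩
    have h1 : η * kineticEnergy Z * (s * (1 / η)) = s * kineticEnergy Z := by field_simp
    nlinarith [sq_nonneg (η * kineticEnergy Z), sq_nonneg (s * (1 / η))]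
  have h2 : 0 ≤ η * s := by positivity
  unfold growth
  linarith

/-! ### The a priori bounds -/

section Constants

/-- The constant in the bound for the collision operators on the whole time interval. -/
noncomputable def dominationConst (d ℓ : ℕ) (K β₀ μ₀ : ℝ) : ℝ :=
  Real.exp (ℓ * (|μ₀| + β₀ / 2)) * collisionConst d ℓ K (β₀ / 8)

theorem dominationConst_nonneg {d ℓ : ℕ} {K β₀ μ₀ : ℝ} (hK : 0 ≤ K) (hβ₀ : 0 < β₀) :
    0 ≤ dominationConst d ℓ K β₀ μ₀ :=
  mul_nonneg (Real.exp_pos _).le (collisionConst_nonneg hK (by positivity))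

/-- One factorial stands in the definition, and the mass of the ellipsoid provides the other. That
mass also decays like `c^(-ℓ)` for any `c`, which absorbs `(2 K J)^ℓ`, with `J` the Gaussian
integral over one velocity. -/
theorem exists_collisionConst_le {d : ℕ} (hd : 2 ≤ d) {K δ : ℝ} (hK : 0 < K) (hδ : 0 < δ) :
    ∃ C > 0, ∀ ℓ, 1 ≤ ℓ → collisionConst d ℓ K δ * ℓ ! * ℓ ! ≤ C := by
  obtain ⟨J, hJ, hJ0⟩ : ∃ J, J = (Real.pi / δ) ^ ((d : ℝ) / 2) ∧ 0 < J :=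
    ⟨_, rfl, Real.rpow_pos_of_pos (by positivity) _⟩
  obtain ⟨B, hB, hle⟩ := exists_surfaceMeasure_le hd (le_max_left 1 (2 * K * J))
  refine ⟨2 * B * ((√δ)⁻¹ + 2), by positivity, fun ℓ hℓ => ?_⟩
  obtain ⟨c, hc, hc0⟩ : ∃ c, c = max 1 (2 * K * J) ∧ 0 < c :=
    ⟨_, rfl, lt_of_lt_of_le one_pos (le_max_left _ _)⟩
  have hfac : (0 : ℝ) < ℓ ! := by positivity
  have h1 : surfaceMass d ℓ ≤ B / (c ^ ℓ * ℓ !) :=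
    ENNReal.toReal_le_of_le_ofReal (by positivity) (hc ▸ hle ℓ hℓ)
  have h2 : √((ℓ : ℝ) + 1) * ((√δ)⁻¹ + √(2 * ℓ)) ≤ ((√δ)⁻¹ + 2) * 2 ^ ℓ := by
    have h3 : (ℓ : ℝ) + 1 ≤ 2 ^ ℓ := by exact_mod_cast Nat.lt_two_pow_self
    have h4 : √((ℓ : ℝ) + 1) * √((ℓ : ℝ) + 1) = ℓ + 1 := Real.mul_self_sqrt (by positivity)
    have h5 : 1 ≤ √((ℓ : ℝ) + 1) := Real.one_le_sqrt.2 (by linarith [Nat.cast_nonneg (α := ℝ) ℓ])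
    have h6 : √(2 * (ℓ : ℝ)) ≤ 2 * √((ℓ : ℝ) + 1) := by
      refine Real.sqrt_le_iff.2 ⟨by positivity, ?_⟩
      nlinarith [Nat.cast_nonneg (α := ℝ) ℓ]
    have h7 : 0 ≤ (√δ)⁻¹ := by positivity
    calc _ ≤ √((ℓ : ℝ) + 1) * ((√δ)⁻¹ * √((ℓ : ℝ) + 1) + 2 * √((ℓ : ℝ) + 1)) := by
          gcongr
          exact le_mul_of_one_le_right h7 h5
      _ = ((√δ)⁻¹ + 2) * (√((ℓ : ℝ) + 1) * √((ℓ : ℝ) + 1)) := by ring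
      _ = ((√δ)⁻¹ + 2) * (ℓ + 1) := by rw [h4]
      _ ≤ _ := by gcongr
  have h8 : (2 * K * J) ^ ℓ ≤ c ^ ℓ := pow_le_pow_left₀ (by positivity) (hc ▸ le_max_right _ _) _
  have h9 : 0 ≤ surfaceMass d ℓ := measureReal_nonneg
  calc collisionConst d ℓ K δ * ℓ ! * ℓ ! = 2 * (K ^ ℓ * J ^ ℓ) * ℓ ! * (surfaceMass d ℓ *
        (√((ℓ : ℝ) + 1) * ((√δ)⁻¹ + √(2 * ℓ)))) := by
        rw [collisionConst, ← hJ]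
        field_simp
    _ ≤ 2 * (K ^ ℓ * J ^ ℓ) * ℓ ! * (B / (c ^ ℓ * ℓ !) * (((√δ)⁻¹ + 2) * 2 ^ ℓ)) := by gcongr
    _ = 2 * B * ((√δ)⁻¹ + 2) * ((2 * K * J) ^ ℓ / c ^ ℓ) := by
        rw [mul_pow, mul_pow]
        field_simp
    _ ≤ 2 * B * ((√δ)⁻¹ + 2) * 1 := by
        gcongr
        exact div_le_one_of_le₀ h8 (by positivity)
    _ = _ := mul_one _

theorem one_le_peak {β₀ : ℝ} (hβ₀ : 0 < β₀) (μ₀ : ℝ) : 1 ≤ peak β₀ μ₀ := by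
  obtain ⟨⟨ℓ, h1, h2⟩, -⟩ := peak_isGreatest hβ₀ μ₀
  have : (1 : ℝ) ≤ ℓ ! := by exact_mod_cast Nat.one_le_iff_ne_zero.2 (Nat.factorial_ne_zero ℓ)
  linarith

/-- Either the exponential is at most `ℓ!`, or `ℓ` contributes an element of `peakSet` that
dominates it. -/
theorem exp_le_peak_mul_factorial {β₀ : ℝ} (hβ₀ : 0 < β₀) (μ₀ : ℝ) {ℓ : ℕ} (hℓ : 1 ≤ ℓ) :
    Real.exp (ℓ * (|μ₀| + β₀ / 2)) ≤ peak β₀ μ₀ * ℓ ! := by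
  have hfac : (1 : ℝ) ≤ ℓ ! := by exact_mod_cast Nat.one_le_iff_ne_zero.2 (Nat.factorial_ne_zero ℓ)
  have hp := one_le_peak hβ₀ μ₀
  rcases le_or_gt (Real.exp (ℓ * (|μ₀| + β₀ / 2))) (ℓ ! : ℝ) with h | h
  · exact h.trans (le_mul_of_one_le_left (by positivity) hp)
  · have h1 : Real.exp (ℓ * (|μ₀| + β₀ / 2)) ≤
        2 ^ ℓ * (ℓ : ℝ) ^ 3 * Real.exp (ℓ * (|μ₀| + β₀ / 2)) := by
      refine le_mul_of_one_le_left (Real.exp_pos _).le ?_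
      have h2 : (1 : ℝ) ≤ 2 ^ ℓ := one_le_pow₀ (by norm_num)
      have h3 : (1 : ℝ) ≤ (ℓ : ℝ) ^ 3 := one_le_pow₀ (by exact_mod_cast hℓ)
      nlinarith
    have h4 := (peak_isGreatest hβ₀ μ₀).2 ⟨ℓ, rfl, h.trans_le h1⟩
    exact (h1.trans h4).trans (le_mul_of_one_le_right (by positivity) hfac)

/-- Of the two factorials in `exists_collisionConst_le`, one is traded for `peak` against the
exponential, and the other remains on the right-hand side. -/
theorem exists_existenceTime {d : ℕ} (hd : 2 ≤ d) {β₀ K : ℝ} (hβ₀ : 0 < β₀) (hK : 0 < K) :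
    ∃ C > 0, ∀ μ₀, 0 < existenceTime C β₀ μ₀ ∧ ∀ ℓ, 1 ≤ ℓ →
      dominationConst d ℓ K β₀ μ₀ * (2 / (β₀ / (2 * existenceTime C β₀ μ₀))) ≤
        1 / (2 * (Real.exp 1 - 1) * ℓ !) := by
  obtain ⟨C', hC', hle⟩ := exists_collisionConst_le hd hK (show 0 < β₀ / 8 by positivity)
  have he : 0 < Real.exp 1 - 1 := by
    have := Real.add_one_lt_exp (one_ne_zero (α := ℝ))
    linarith
  -- With this constant the factor `4T/β₀` from the time integration equals `1/(2 (e - 1) C' peak)`.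
  refine ⟨4 * C' / β₀, by positivity, fun μ₀ => ?_⟩
  have hp := one_le_peak hβ₀ μ₀
  have hp0 : 0 < peak β₀ μ₀ := by linarith
  have hT : 0 < existenceTime (4 * C' / β₀) β₀ μ₀ := by
    unfold existenceTime
    positivity
  refine ⟨hT, fun ℓ hℓ => ?_⟩
  have hfac : (0 : ℝ) < ℓ ! := by positivity
  have ha : 2 / (β₀ / (2 * existenceTime (4 * C' / β₀) β₀ μ₀)) =
      1 / (2 * (Real.exp 1 - 1) * (C' * peak β₀ μ₀)) := by
    unfold existenceTime
    field_simp
    norm_num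
  have h1 : dominationConst d ℓ K β₀ μ₀ * ℓ ! ≤ C' * peak β₀ μ₀ := by
    have h2 := exp_le_peak_mul_factorial hβ₀ μ₀ hℓ
    have h3 := collisionConst_nonneg (d := d) (ℓ := ℓ) hK.le (show 0 < β₀ / 8 by positivity)
    calc _ ≤ peak β₀ μ₀ * ℓ ! * collisionConst d ℓ K (β₀ / 8) * ℓ ! := by
          unfold dominationConst
          gcongr
      _ = peak β₀ μ₀ * (collisionConst d ℓ K (β₀ / 8) * ℓ ! * ℓ !) := by ring
      _ ≤ peak β₀ μ₀ * C' := by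
          gcongr
          exact hle ℓ hℓ
      _ = _ := mul_comm _ _
  rw [ha, mul_one_div, div_le_div_iff₀ (by positivity) (by positivity), one_mul]
  calc _ = 2 * (Real.exp 1 - 1) * (dominationConst d ℓ K β₀ μ₀ * ℓ !) := by ring
    _ ≤ _ := by gcongr

end Constants

/-! ### The a priori bound for each order -/

section Duhamel

variable {d s ℓ M N : ℕ} {ε : ℕ → ℝ} (hε : ∀ k, 2 ≤ k → k ≤ M + 1 → 0 < ε k)

theorem continuous_linearWeight (β₀ T c : ℝ) : Continuous (linearWeight β₀ T c) := by
  unfold linearWeight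
  fun_prop

theorem le_linearWeight {β₀ T c τ : ℝ} (hβ₀ : 0 < β₀) (hT : 0 < T) (hτ : τ ≤ T) :
    c - β₀ / 2 ≤ linearWeight β₀ T c τ := by
  have h : β₀ / (2 * T) * τ ≤ β₀ / (2 * T) * T := by gcongr
  have h1 : β₀ / (2 * T) * T = β₀ / 2 := by field_simp
  unfold linearWeight
  linarith

include hε

/-- On `[0, T]` both weights drop by at most `β₀/2`. So `β ≥ β₀/2 = 4δ` for `δ = β₀/8`, and `-μ ≤
|μ₀| + β₀/2`. -/
theorem exists_dominated_collisionOp (hd : 2 ≤ d) (hℓ : 1 ≤ ℓ) (hℓM : ℓ ≤ M) {T β₀ μ₀ : ℝ}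
    (hβ₀ : 0 < β₀) (hT : 0 < T) {K₀ : ℝ}
    (hK₀ : (N : ℝ) * ε (ℓ + 1) ^ ((d : ℝ) - 1 / (ℓ : ℝ)) ≤ K₀)
    {c : ℝ} (hc : 0 ≤ c) {G : ℝ → Phase d (s + ℓ) → ℝ} {K : ℝ × Phase d (s + ℓ) → ℝ}
    (hG : Represents M ε T (linearWeight β₀ T β₀) (linearWeight β₀ T μ₀) c G K) :
    ∃ h : ℝ × Phase d s → ℝ, Measurable h ∧ (N < s + ℓ → ∀ q, h q = 0) ∧
      Dominated β₀ T β₀ μ₀ (c * dominationConst d ℓ K₀ β₀ μ₀) h ∧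
      ∀ t, ∀ᵐ Z : Phase d s, Z ∈ phaseSpace M ε d s → ∀ᵐ τ : ℝ, τ ∈ Icc 0 T →
        (∀ i : Fin s,
          Integrable (gainIntegrand ε ℓ i (G τ) (flow M ε (τ - t) Z)) (collisionMeasure d ℓ) ∧
          Integrable (lossIntegrand ε ℓ i (G τ) (flow M ε (τ - t) Z)) (collisionMeasure d ℓ)) ∧
        collisionOp ε N ℓ s (G τ) (flow M ε (τ - t) Z) = h (τ, flow M ε (τ - t) Z) := by
  have hK₀' : 0 ≤ K₀ := by
    have := hε (ℓ + 1) (by omega) (by omega)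
    exact le_trans (by positivity) hK₀
  obtain ⟨h, h1, h2, h3, h4⟩ := exists_measurable_collisionOp hε hd hℓ hℓM
    (continuous_linearWeight β₀ T β₀) (continuous_linearWeight β₀ T μ₀)
    (show 0 < β₀ / 8 by positivity) (fun τ hτ => by
      have := le_linearWeight (c := β₀) hβ₀ hT hτ.2
      linarith) hK₀ hc hG
  refine ⟨h, h1, h2, fun τ hτ Z => (h3 τ hτ Z).trans ?_, fun t => ae_ae_flow hε hd h4 t⟩
  have hw := weight_pos (linearWeight β₀ T β₀ τ) (linearWeight β₀ T μ₀ τ) Z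
  have hg := growth_nonneg Z
  have hcc := collisionConst_nonneg (d := d) (ℓ := ℓ) hK₀' (show 0 < β₀ / 8 by positivity)
  have hexp : Real.exp (-(linearWeight β₀ T μ₀ τ * ℓ)) ≤ Real.exp (ℓ * (|μ₀| + β₀ / 2)) := by
    refine Real.exp_le_exp.2 ?_
    have h5 := le_linearWeight (c := μ₀) hβ₀ hT hτ.2
    have h6 := neg_abs_le μ₀
    have h7 : (0 : ℝ) ≤ ℓ := Nat.cast_nonneg ℓ
    nlinarith
  calc _ ≤ c * Real.exp (ℓ * (|μ₀| + β₀ / 2)) *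
        weight (linearWeight β₀ T β₀ τ) (linearWeight β₀ T μ₀ τ) Z *
        (collisionConst d ℓ K₀ (β₀ / 8) * growth Z) := by gcongr
    _ = _ := by
        rw [dominationConst]
        ring

/-- Along almost every trajectory the operator agrees with its measurable version `h` at almost
every time; what remains is an estimate for functions of one real variable. -/
theorem collisionConverges_and_normT_duhamel_le (hd : 2 ≤ d) (hℓ : 1 ≤ ℓ) (hℓM : ℓ ≤ M)
    {T β₀ μ₀ : ℝ} (hβ₀ : 0 < β₀) (hT : 0 < T) {K₀ : ℝ}
    (hK₀ : (N : ℝ) * ε (ℓ + 1) ^ ((d : ℝ) - 1 / (ℓ : ℝ)) ≤ K₀) {κ : ℝ}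
    (hκ : dominationConst d ℓ K₀ β₀ μ₀ * (2 / (β₀ / (2 * T))) ≤ κ) {G : ℝ → Hier d}
    (hG : MemXT M ε N T (linearWeight β₀ T β₀) (linearWeight β₀ T μ₀) G) :
    CollisionConverges M ε N ℓ T G ∧
      ∀ A : ℝ → Set ℝ, (∀ t ∈ Icc 0 T, MeasurableSet (A t) ∧ A t ⊆ Icc 0 t) →
        normT T (linearWeight β₀ T β₀) (linearWeight β₀ T μ₀) (fun t => duhamel M ε N ℓ (A t) t G) ≤
          ENNReal.ofReal κ * normT T (linearWeight β₀ T β₀) (linearWeight β₀ T μ₀) G := by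
  have hK₀' : 0 ≤ K₀ := by
    have := hε (ℓ + 1) (by omega) (by omega)
    exact le_trans (by positivity) hK₀
  have hΛ := dominationConst_nonneg (d := d) (ℓ := ℓ) (μ₀ := μ₀) hK₀' hβ₀
  have hκ0 : 0 ≤ κ := le_trans (by positivity) hκ
  obtain ⟨c, hc, hGc⟩ : ∃ c : ℝ, 0 ≤ c ∧
      normT T (linearWeight β₀ T β₀) (linearWeight β₀ T μ₀) G = ENNReal.ofReal c :=
    ⟨_, ENNReal.toReal_nonneg, (ENNReal.ofReal_toReal hG.norm_lt_top.ne).symm⟩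
  have key : ∀ s, 1 ≤ s → ∃ h : ℝ × Phase d s → ℝ, Measurable h ∧
      Dominated β₀ T β₀ μ₀ (c * dominationConst d ℓ K₀ β₀ μ₀) h ∧
      ∀ t, ∀ᵐ Z : Phase d s, Z ∈ phaseSpace M ε d s → ∀ᵐ τ : ℝ, τ ∈ Icc 0 T →
        (∀ i : Fin s,
          Integrable (gainIntegrand ε ℓ i (G τ (s + ℓ)) (flow M ε (τ - t) Z)) (collisionMeasure d ℓ) ∧
          Integrable (lossIntegrand ε ℓ i (G τ (s + ℓ)) (flow M ε (τ - t) Z)) (collisionMeasure d ℓ)) ∧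
        collisionOp ε N ℓ s (G τ (s + ℓ)) (flow M ε (τ - t) Z) = h (τ, flow M ε (τ - t) Z) := by
    intro s hs
    obtain ⟨K, hK⟩ := hG.exists_represents (m := s + ℓ) hε hd (by omega) hT
      (continuous_linearWeight β₀ T β₀) (continuous_linearWeight β₀ T μ₀) hc hGc.le
    obtain ⟨h, h1, -, h2, h3⟩ := exists_dominated_collisionOp hε hd hℓ hℓM hβ₀ hT hK₀ hc hK
    exact ⟨h, h1, h2, h3⟩
  constructor
  · intro t ht s hs
    obtain ⟨h, h1, h2, h3⟩ := key s hs
    filter_upwards [h3 t, ae_mem_regularInterior hε hd] with Z h4 h5 hZ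
    have h6 : ∀ᵐ τ ∂volume.restrict (Icc 0 t), τ ∈ Icc 0 T →
        (∀ i : Fin s,
          Integrable (gainIntegrand ε ℓ i (G τ (s + ℓ)) (flow M ε (τ - t) Z)) (collisionMeasure d ℓ) ∧
          Integrable (lossIntegrand ε ℓ i (G τ (s + ℓ)) (flow M ε (τ - t) Z)) (collisionMeasure d ℓ)) ∧
        collisionOp ε N ℓ s (G τ (s + ℓ)) (flow M ε (τ - t) Z) = h (τ, flow M ε (τ - t) Z) :=
      ae_restrict_of_ae (h4 hZ)
    have h7 := ae_restrict_mem (μ := (volume : Measure ℝ)) (measurableSet_Icc (a := (0 : ℝ)) (b := t))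
    constructor
    · filter_upwards [h6, h7] with τ h8 h9
      rw [neg_sub]
      exact (h8 ⟨h9.1, h9.2.trans ht.2⟩).1
    · refine ((h2.integrableOn_and_abs_setIntegral_le hε hβ₀ hT (by positivity) h1 (h5 hZ)
        (by norm_num) le_rfl (growth_le Z) le_rfl ht.1 ht.2 t).1).congr ?_
      filter_upwards [h6, h7] with τ h8 h9
      rw [flowOp, indicator_of_mem hZ, neg_sub]
      exact (h8 ⟨h9.1, h9.2.trans ht.2⟩).2.symm
  · intro A hA
    rw [hGc, ← ENNReal.ofReal_mul hκ0]
    refine (normT_le_iff (by positivity) _).2 fun t ht s hs => ?_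
    obtain ⟨h, h1, h2, h3⟩ := key s hs
    filter_upwards [h3 t, ae_mem_regularInterior hε hd] with Z h4 h5
    have hw := (weight_pos (linearWeight β₀ T β₀ t) (linearWeight β₀ T μ₀ t) Z).le
    by_cases hZ : Z ∈ phaseSpace M ε d s
    · have h6 : duhamel M ε N ℓ (A t) t G s Z = ∫ τ in A t, h (τ, flow M ε (τ - t) Z) := by
        refine setIntegral_congr_ae (hA t ht).1 ?_
        filter_upwards [h4 hZ] with τ h8 h9
        have h10 := (hA t ht).2 h9
        rw [flowOp, indicator_of_mem hZ, neg_sub]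
        exact (h8 ⟨h10.1, h10.2.trans ht.2⟩).2
      rw [h6]
      refine ((h2.integrableOn_and_abs_setIntegral_le hε hβ₀ hT (by positivity) h1 (h5 hZ)
        (by norm_num) le_rfl (growth_le Z) le_rfl ht.1 ht.2 t).2 _ (hA t ht).2 (hA t ht).1).trans ?_
      refine mul_le_mul_of_nonneg_right ?_ hw
      calc _ = c * (dominationConst d ℓ K₀ β₀ μ₀ * (2 / (β₀ / (2 * T)))) := by ring
        _ ≤ c * κ := by gcongr
        _ = _ := mul_comm _ _
    · have h6 : duhamel M ε N ℓ (A t) t G s Z = 0 := by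
        simp only [duhamel, flowOp, indicator_of_notMem hZ, integral_zero]
      rw [h6, abs_zero]
      positivity

end Duhamel

/-! ### Hierarchies that are given by their values along the trajectories -/

section Profile

variable {d M N : ℕ} {ε : ℕ → ℝ} (hε : ∀ k, 2 ≤ k → k ≤ M + 1 → 0 < ε k)

/-- The weight at time `t`. -/
noncomputable abbrev timeWeight (β₀ T μ₀ : ℝ) {s : ℕ} (t : ℝ) (Z : Phase d s) : ℝ :=
  weight (linearWeight β₀ T β₀ t) (linearWeight β₀ T μ₀ t) Z

/-- `u` is bounded and continuous in time in the weighted spaces, at every point. -/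
structure Profile (N : ℕ) (β₀ T μ₀ c : ℝ) (u : ∀ s : ℕ, ℝ × Phase d s → ℝ) : Prop where
  measurable : ∀ s, Measurable (u s)
  vanish : ∀ s, N < s → ∀ q, u s q = 0
  bound : ∀ t ∈ Icc 0 T, ∀ s Z, |u s (t, Z)| ≤ c * timeWeight β₀ T μ₀ t Z
  modulus : ∀ η > 0, ∃ ρ > 0, ∀ t t', 0 ≤ t → t ≤ t' → t' ≤ T → t' - t < ρ → ∀ s Z,
    |u s (t', Z) - u s (t, Z)| ≤ η * timeWeight β₀ T μ₀ t' Z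

/-- The hierarchy with values `u` along the trajectories. -/
noncomputable def spread (M : ℕ) (ε : ℕ → ℝ) (u : ∀ s : ℕ, ℝ × Phase d s → ℝ) : ℝ → Hier d :=
  fun t s => flowOp M ε t fun Z => u s (t, Z)

theorem timeWeight_mono {β₀ T μ₀ : ℝ} (hβ₀ : 0 < β₀) (hT : 0 < T) {t t' : ℝ} (h : t ≤ t') {s : ℕ}
    (Z : Phase d s) : timeWeight β₀ T μ₀ t Z ≤ timeWeight β₀ T μ₀ t' Z := by
  unfold timeWeight
  rw [weight_linearWeight β₀ T β₀ μ₀ t t']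
  refine mul_le_of_le_one_right (weight_pos _ _ _).le (Real.exp_le_one_iff.2 (neg_nonpos.2 ?_))
  have h1 := sub_nonneg.2 h
  have h2 := kineticEnergy_nonneg Z
  positivity

variable {β₀ T μ₀ c : ℝ} {u : ∀ s : ℕ, ℝ × Phase d s → ℝ}

theorem Profile.continuousOn (hu : Profile N β₀ T μ₀ c u) (hβ₀ : 0 < β₀) (hT : 0 < T) (s : ℕ)
    (Z : Phase d s) : ContinuousOn (fun t => u s (t, Z)) (Icc 0 T) := by
  rw [Metric.continuousOn_iff]
  intro t₀ ht₀ η hη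
  have hw := weight_pos (linearWeight β₀ T β₀ T) (linearWeight β₀ T μ₀ T) Z
  obtain ⟨ρ, hρ, h⟩ := hu.modulus (η / 2 / timeWeight β₀ T μ₀ T Z) (by positivity)
  have key : ∀ t t', 0 ≤ t → t ≤ t' → t' ≤ T → t' - t < ρ → |u s (t', Z) - u s (t, Z)| < η := by
    intro t t' h1 h2 h3 h4
    refine (h t t' h1 h2 h3 h4 s Z).trans_lt ?_
    refine (mul_le_mul_of_nonneg_left (timeWeight_mono hβ₀ hT h3 Z) (by positivity)).trans_lt ?_
    rw [div_mul_cancel₀ _ hw.ne']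
    linarith
  refine ⟨ρ, hρ, fun t ht htt => ?_⟩
  rw [Real.dist_eq] at htt ⊢
  have := abs_lt.1 htt
  rcases le_total t₀ t with h1 | h1
  · exact key t₀ t ht₀.1 h1 ht.2 (by linarith)
  · rw [abs_sub_comm]
    exact key t t₀ ht.1 h1 ht₀.2 (by linarith)

theorem spread_apply_of_notMem {t : ℝ} {s : ℕ} {Z : Phase d s} (hZ : Z ∉ phaseSpace M ε d s) :
    spread M ε u t s Z = 0 := by
  rw [spread, flowOp, indicator_of_notMem hZ]

theorem spread_apply {t : ℝ} {s : ℕ} {Z : Phase d s} (hZ : Z ∈ phaseSpace M ε d s) :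
    spread M ε u t s Z = u s (t, flow M ε (-t) Z) := by
  rw [spread, flowOp, indicator_of_mem hZ]

include hε

theorem spread_flow {s : ℕ} {Z : Phase d s} (hZ : HasTraj M ε Z) (t : ℝ) :
    spread M ε u t s (flow M ε t Z) = u s (t, Z) := by
  rw [spread_apply ((hZ.flow hε t).mem_phaseSpace hε), hZ.flow_flow hε, add_neg_cancel,
    hZ.flow_zero hε]

theorem Profile.represents (hd : 2 ≤ d) (hu : Profile N β₀ T μ₀ c u) (m : ℕ) :
    Represents M ε T (linearWeight β₀ T β₀) (linearWeight β₀ T μ₀) c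
      (fun τ => spread M ε u τ m) (u m) where
  measurable := hu.measurable m
  eq := (ae_hasTraj hε hd).mono fun _ h hZ τ _ => spread_flow hε (h hZ) τ
  bound := fun τ hτ Z => hu.bound τ hτ m Z
  zero_outside := fun _ _ _ hZ => spread_apply_of_notMem hZ

theorem Profile.abs_spread_le (hd : 2 ≤ d) (hc : 0 ≤ c) (hu : Profile N β₀ T μ₀ c u) {t : ℝ}
    (ht : t ∈ Icc 0 T) (s : ℕ) :
    ∀ᵐ Z : Phase d s, |spread M ε u t s Z| ≤ c * timeWeight β₀ T μ₀ t Z := by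
  filter_upwards [ae_hasTraj hε hd] with Z h
  by_cases hZ : Z ∈ phaseSpace M ε d s
  · rw [spread_apply hZ, timeWeight, ← weight_eq_of_kineticEnergy_eq ((h hZ).kineticEnergy_flow hε (-t))]
    exact hu.bound t ht s _
  · rw [spread_apply_of_notMem hZ, abs_zero]
    exact mul_nonneg hc (weight_pos _ _ _).le

theorem Profile.normT_spread_le (hd : 2 ≤ d) (hc : 0 ≤ c) (hu : Profile N β₀ T μ₀ c u) :
    normT T (linearWeight β₀ T β₀) (linearWeight β₀ T μ₀) (spread M ε u) ≤ ENNReal.ofReal c :=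
  (normT_le_iff hc _).2 fun _ ht s _ => hu.abs_spread_le hε hd hc ht s

/-- Pulled back along the flow, `spread` is `u` itself, so the modulus of `u` is the continuity of
the filtered hierarchy. -/
theorem Profile.memXT (hd : 2 ≤ d) (hβ₀ : 0 < β₀) (hT : 0 < T) (hc : 0 ≤ c)
    (hu : Profile N β₀ T μ₀ c u) :
    MemXT M ε N T (linearWeight β₀ T β₀) (linearWeight β₀ T μ₀) (spread M ε u) where
  mem := fun t ht =>
    { measurable := fun s _ => by
        have h1 : Measurable ((phaseSpace M ε d s).indicator fun Z => u s (t, flowMap hε d s (-t, Z))) :=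
          ((hu.measurable s).comp (measurable_const.prodMk
            ((measurable_flowMap hε).comp measurable_prodMk_left))).indicator (measurableSet_phaseSpace hε)
        refine h1.aestronglyMeasurable.congr ?_
        filter_upwards [ae_mem_regularInterior hε hd] with Z h
        by_cases hZ : Z ∈ phaseSpace M ε d s
        · rw [spread_apply hZ, indicator_of_mem hZ, flow_eq_flowMap hε (h hZ)]
        · rw [spread_apply_of_notMem hZ, indicator_of_notMem hZ]
      support := fun s _ => Eventually.of_forall fun Z hZ => spread_apply_of_notMem hZ
      vanish := fun s hs => Eventually.of_forall fun Z => by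
        by_cases hZ : Z ∈ phaseSpace M ε d s
        · rw [spread_apply hZ, hu.vanish s hs, Pi.zero_apply]
        · rw [spread_apply_of_notMem hZ, Pi.zero_apply]
      norm_lt_top := ((normH_le_normT _ ht).trans (hu.normT_spread_le hε hd hc)).trans_lt
        ENNReal.ofReal_lt_top }
  norm_lt_top := (hu.normT_spread_le hε hd hc).trans_lt ENNReal.ofReal_lt_top
  continuous := fun t₀ ht₀ => by
    refine ENNReal.tendsto_nhds_zero.2 fun η hη => ?_
    obtain ⟨η', hη', hηη⟩ : ∃ η' : ℝ, 0 < η' ∧ ENNReal.ofReal η' ≤ η := by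
      rcases eq_or_ne η ⊤ with rfl | hne
      · exact ⟨1, one_pos, le_top⟩
      · exact ⟨η.toReal, ENNReal.toReal_pos hη.ne' hne, (ENNReal.ofReal_toReal hne).le⟩
    obtain ⟨ρ, hρ, h⟩ := hu.modulus η' hη'
    have hnear : ∀ᶠ t in 𝓝[Icc 0 T] t₀, t ∈ Icc 0 T ∧ |t - t₀| < ρ :=
      (eventually_mem_nhdsWithin).and (mem_nhdsWithin_of_mem_nhds (Metric.ball_mem_nhds t₀ hρ))
    filter_upwards [hnear] with t ht
    refine le_trans ((normH_le_iff hη'.le _).2 fun s hs => ?_) hηη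
    filter_upwards [ae_hasTraj hε hd] with Z hZt
    by_cases hZ : Z ∈ phaseSpace M ε d s
    · have h1 : ∀ t, flowOp M ε (-t) (spread M ε u t s) Z = u s (t, Z) := fun t => by
        rw [flowOp, indicator_of_mem hZ, neg_neg, spread_flow hε (hZt hZ)]
      rw [h1, h1]
      have := abs_lt.1 ht.2
      rcases le_total t₀ t with h2 | h2
      · rw [max_eq_left h2]
        exact h t₀ t ht₀.1 h2 ht.1.2 (by linarith) s Z
      · rw [max_eq_right h2, abs_sub_comm]
        exact h t t₀ ht.1.1 h2 ht₀.2 (by linarith) s Z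
    · simp only [flowOp, indicator_of_notMem hZ, sub_self, abs_zero]
      exact mul_nonneg hη'.le (weight_pos _ _ _).le
  zero_outside := fun _ _ _ _ _ hZ => spread_apply_of_notMem hZ
  continuous_along := fun s _ => (ae_hasTraj hε hd).mono fun Z h hZ => by
    simp only [spread_flow hε (h hZ)]
    exact hu.continuousOn hβ₀ hT s Z

omit hε

theorem summable_of_profile {U : ℕ → ∀ s : ℕ, ℝ × Phase d s → ℝ}
    (hU : ∀ n, Profile N β₀ T μ₀ (c / 2 ^ n) (U n)) {t : ℝ} (ht : t ∈ Icc 0 T) (s : ℕ) (Z : Phase d s) :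
    Summable (fun n => U n s (t, Z)) ∧
      |∑' n, U n s (t, Z)| ≤ 2 * c * timeWeight β₀ T μ₀ t Z := by
  have h1 : HasSum (fun n : ℕ => c / 2 ^ n * timeWeight β₀ T μ₀ t Z)
      (2 * c * timeWeight β₀ T μ₀ t Z) := by
    have h := ((hasSum_geometric_two).mul_left c).mul_right (timeWeight β₀ T μ₀ t Z)
    rw [mul_comm c 2] at h
    refine h.congr_fun fun n => ?_
    rw [one_div, inv_pow, div_eq_mul_inv]
  have h2 : ∀ n, |U n s (t, Z)| ≤ c / 2 ^ n * timeWeight β₀ T μ₀ t Z := fun n => (hU n).bound t ht s Z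
  have h3 := Summable.of_nonneg_of_le (fun n => abs_nonneg _) h2 h1.summable
  have h4 := norm_tsum_le_tsum_norm (f := fun n => U n s (t, Z)) h3
  exact ⟨h3.of_abs, h4.trans ((h3.tsum_le_tsum h2 h1.summable).trans_eq h1.tsum_eq)⟩

theorem Profile.tsum (hβ₀ : 0 < β₀) (hT : 0 < T) {U : ℕ → ∀ s : ℕ, ℝ × Phase d s → ℝ} (hc : 0 ≤ c)
    (hU : ∀ n, Profile N β₀ T μ₀ (c / 2 ^ n) (U n)) :
    Profile N β₀ T μ₀ (2 * c) fun s q => ∑' n, U n s q where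
  measurable := fun s => Measurable.tsum fun n => (hU n).measurable s
  vanish := fun s hs q => by simp only [fun n => (hU n).vanish s hs q, tsum_zero]
  bound := fun t ht s Z => by
    exact (summable_of_profile hU ht s Z).2
  modulus := fun η hη => by
    -- The two tails at `t` and `t'`, each at most `2 (c / 2 ^ k)`, may use up half of `η`. The
    -- other half is shared by `k` terms, with divisor `k + 1` since `k` may be zero.
    obtain ⟨k, hk⟩ : ∃ k : ℕ, 2 * (2 * (c / 2 ^ k)) < η / 2 := by
      have h1 : Tendsto (fun k : ℕ => 2 * (2 * (c / 2 ^ k))) atTop (𝓝 (2 * (2 * 0))) := by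
        refine ((Tendsto.const_mul 2 (Tendsto.const_mul 2 ?_)))
        exact tendsto_const_nhds.div_atTop (tendsto_pow_atTop_atTop_of_one_lt (by norm_num))
      rw [mul_zero, mul_zero] at h1
      exact (h1.eventually (gt_mem_nhds (by positivity))).exists
    choose ρ hρ hmod using fun n => (hU n).modulus (η / 2 / (k + 1)) (by positivity)
    obtain ⟨ρ₀, hρ₀, hle⟩ : ∃ ρ₀ > 0, ∀ n ∈ Finset.range k, ρ₀ ≤ ρ n := by
      refine ⟨(Finset.range (k + 1)).inf' ⟨0, by simp⟩ ρ, ?_, fun n hn => Finset.inf'_le _ ?_⟩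
      · exact (Finset.lt_inf'_iff _).2 fun n _ => hρ n
      · exact Finset.mem_range.2 ((Finset.mem_range.1 hn).trans (Nat.lt_succ_self k))
    refine ⟨ρ₀, hρ₀, fun t t' h1 h2 h3 h4 s Z => ?_⟩
    have ht : t ∈ Icc 0 T := ⟨h1, h2.trans h3⟩
    have ht' : t' ∈ Icc 0 T := ⟨h1.trans h2, h3⟩
    have hw := (weight_pos (linearWeight β₀ T β₀ t') (linearWeight β₀ T μ₀ t') Z).le
    have hshift : ∀ n, Profile N β₀ T μ₀ (c / 2 ^ k / 2 ^ n) (U (n + k)) := fun n => by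
      have := hU (n + k)
      rwa [pow_add, mul_comm, ← div_div] at this
    have tail : ∀ τ ∈ Icc 0 T, τ ≤ t' → |∑' n, U (n + k) s (τ, Z)| ≤
        2 * (c / 2 ^ k) * timeWeight β₀ T μ₀ t' Z := fun τ hτ hτt => by
      have h5 := summable_of_profile hshift hτ s Z
      refine h5.2.trans ?_
      exact mul_le_mul_of_nonneg_left (timeWeight_mono hβ₀ hT hτt Z) (by positivity)
    have split : ∀ τ ∈ Icc 0 T, ∑' n, U n s (τ, Z) =
        ∑ n ∈ Finset.range k, U n s (τ, Z) + ∑' n, U (n + k) s (τ, Z) := fun τ hτ =>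
      ((summable_of_profile hU hτ s Z).1.sum_add_tsum_nat_add k).symm
    rw [split t ht, split t' ht', add_sub_add_comm, ← Finset.sum_sub_distrib]
    have head : |∑ n ∈ Finset.range k, (U n s (t', Z) - U n s (t, Z))| ≤
        η / 2 * timeWeight β₀ T μ₀ t' Z := by
      refine (Finset.abs_sum_le_sum_abs _ _).trans ?_
      calc _ ≤ ∑ n ∈ Finset.range k, η / 2 / (k + 1) * timeWeight β₀ T μ₀ t' Z :=
            Finset.sum_le_sum fun n hn => hmod n t t' h1 h2 h3 (h4.trans_le (hle n hn)) s Z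
        _ = (k / (k + 1)) * (η / 2 * timeWeight β₀ T μ₀ t' Z) := by
            rw [Finset.sum_const, Finset.card_range, nsmul_eq_mul]
            ring
        _ ≤ _ := by
            refine mul_le_of_le_one_left (by positivity) (div_le_one_of_le₀ (by linarith) (by positivity))
    have h6 := tail t ht h2
    have h7 := tail t' ht' le_rfl
    have h8 := mul_le_mul_of_nonneg_right hk.le hw
    refine (abs_add_le _ _).trans ((add_le_add head (abs_sub _ _)).trans ?_)
    unfold timeWeight at *
    linarith

end Profile

/-! ### The collision term of the hierarchy -/

section Linear

variable {d M N : ℕ} {ε : ℕ → ℝ} {T : ℝ}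

theorem normH_sub_le (β μ : ℝ) (G G' : Hier d) :
    normH β μ (fun s Z => G s Z - G' s Z) ≤ normH β μ G + normH β μ G' := by
  rcases eq_or_ne (normH β μ G) ⊤ with h | h
  · rw [h, top_add]
    exact le_top
  rcases eq_or_ne (normH β μ G') ⊤ with h' | h'
  · rw [h', add_top]
    exact le_top
  have h1 := (normH_le_iff ENNReal.toReal_nonneg G).1 (ENNReal.ofReal_toReal h).ge
  have h2 := (normH_le_iff ENNReal.toReal_nonneg G').1 (ENNReal.ofReal_toReal h').ge
  rw [← ENNReal.ofReal_toReal h, ← ENNReal.ofReal_toReal h',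
    ← ENNReal.ofReal_add ENNReal.toReal_nonneg ENNReal.toReal_nonneg]
  refine (normH_le_iff (by positivity) _).2 fun s hs => ?_
  filter_upwards [h1 s hs, h2 s hs] with Z h3 h4
  refine (abs_sub _ _).trans ((add_le_add h3 h4).trans_eq ?_)
  ring

theorem normT_sub_le (β μ : ℝ → ℝ) (G G' : ℝ → Hier d) :
    normT T β μ (fun t s Z => G t s Z - G' t s Z) ≤ normT T β μ G + normT T β μ G' :=
  iSup₂_le fun _ ht => (normH_sub_le _ _ _ _).trans
    (add_le_add (normH_le_normT G ht) (normH_le_normT G' ht))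

theorem flowOp_sub {s : ℕ} (t : ℝ) (f g : Phase d s → ℝ) (Z : Phase d s) :
    flowOp M ε t (fun W => f W - g W) Z = flowOp M ε t f Z - flowOp M ε t g Z := by
  by_cases hZ : Z ∈ phaseSpace M ε d s
  · simp only [flowOp, indicator_of_mem hZ]
  · simp only [flowOp, indicator_of_notMem hZ, sub_self]

theorem MemXT.sub {β μ : ℝ → ℝ} {G G' : ℝ → Hier d} (hG : MemXT M ε N T β μ G)
    (hG' : MemXT M ε N T β μ G') : MemXT M ε N T β μ fun t s Z => G t s Z - G' t s Z where
  mem := fun t ht =>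
    { measurable := fun s hs => ((hG.mem t ht).measurable s hs).sub ((hG'.mem t ht).measurable s hs)
      support := fun s hs => by
        filter_upwards [(hG.mem t ht).support s hs, (hG'.mem t ht).support s hs] with Z h1 h2 hZ
        rw [h1 hZ, h2 hZ, sub_zero]
      vanish := fun s hs => by
        filter_upwards [(hG.mem t ht).vanish s hs, (hG'.mem t ht).vanish s hs] with Z h1 h2
        rw [h1, h2, Pi.zero_apply, sub_zero]
      norm_lt_top := (normH_sub_le _ _ _ _).trans_lt
        (ENNReal.add_lt_top.2 ⟨(hG.mem t ht).norm_lt_top, (hG'.mem t ht).norm_lt_top⟩) }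
  norm_lt_top := (normT_sub_le _ _ _ _).trans_lt (ENNReal.add_lt_top.2 ⟨hG.norm_lt_top, hG'.norm_lt_top⟩)
  continuous := fun t₀ ht₀ => by
    have h := (hG.continuous t₀ ht₀).add (hG'.continuous t₀ ht₀)
    rw [add_zero] at h
    refine tendsto_of_tendsto_of_tendsto_of_le_of_le tendsto_const_nhds h (fun _ => bot_le) fun t => ?_
    refine le_trans (le_of_eq ?_) (normH_sub_le _ _ _ _)
    congr 1
    funext s Z
    rw [flowOp_sub, flowOp_sub]
    ring
  zero_outside := fun t ht s hs Z hZ => by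
    rw [hG.zero_outside t ht s hs Z hZ, hG'.zero_outside t ht s hs Z hZ, sub_zero]
  continuous_along := fun s hs => by
    filter_upwards [hG.continuous_along s hs, hG'.continuous_along s hs] with Z h1 h2 hZ
    exact (h1 hZ).sub (h2 hZ)

/-- The component of `∫_0^t 𝒯^{t-τ} 𝒞_N G(τ) dτ`. -/
noncomputable def collisionTerm (M : ℕ) (ε : ℕ → ℝ) (N : ℕ) (t : ℝ) (G : ℝ → Hier d) : Hier d :=
  fun s Z => ∫ τ in Icc 0 t, flowOp M ε (t - τ)
    (fun Z' => ∑ ℓ ∈ Finset.Icc 1 M, collisionOp ε N ℓ s (G τ (s + ℓ)) Z') Z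

theorem flowOp_sum {s : ℕ} {ι : Type*} (I : Finset ι) (t : ℝ) (f : ι → Phase d s → ℝ) (Z : Phase d s) :
    flowOp M ε t (fun W => ∑ i ∈ I, f i W) Z = ∑ i ∈ I, flowOp M ε t (f i) Z := by
  by_cases hZ : Z ∈ phaseSpace M ε d s
  · simp only [flowOp, indicator_of_mem hZ]
  · simp only [flowOp, indicator_of_notMem hZ, Finset.sum_const_zero]

theorem collisionTerm_eq_sum {G : ℝ → Hier d}
    (hG : ∀ ℓ ∈ Finset.Icc 1 M, CollisionConverges M ε N ℓ T G) {t : ℝ} (ht : t ∈ Icc 0 T) {s : ℕ}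
    (hs : 1 ≤ s) : ∀ᵐ Z : Phase d s, collisionTerm M ε N t G s Z =
      ∑ ℓ ∈ Finset.Icc 1 M, duhamel M ε N ℓ (Icc 0 t) t G s Z := by
  filter_upwards [(ae_ball_iff (Finset.countable_toSet (Finset.Icc 1 M))).2 fun ℓ hℓ =>
    hG ℓ hℓ t ht s hs] with Z h
  by_cases hZ : Z ∈ phaseSpace M ε d s
  · simp only [collisionTerm, flowOp_sum, duhamel]
    exact integral_finsetSum _ fun ℓ hℓ => (h ℓ hℓ hZ).2
  · simp only [collisionTerm, duhamel, flowOp, indicator_of_notMem hZ, integral_zero,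
      Finset.sum_const_zero]

theorem collisionOp_sub {ℓ s : ℕ} {f g h : Phase d (s + ℓ) → ℝ} {Z : Phase d s}
    (hh : ∀ W, h W = f W - g W)
    (hf : ∀ i : Fin s, Integrable (gainIntegrand ε ℓ i f Z) (collisionMeasure d ℓ) ∧
      Integrable (lossIntegrand ε ℓ i f Z) (collisionMeasure d ℓ))
    (hg : ∀ i : Fin s, Integrable (gainIntegrand ε ℓ i g Z) (collisionMeasure d ℓ) ∧
      Integrable (lossIntegrand ε ℓ i g Z) (collisionMeasure d ℓ)) :
    collisionOp ε N ℓ s h Z = collisionOp ε N ℓ s f Z - collisionOp ε N ℓ s g Z := by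
  have e1 : ∀ i, ∫ p, gainIntegrand ε ℓ i h Z p ∂collisionMeasure d ℓ =
      ∫ p, gainIntegrand ε ℓ i f Z p ∂collisionMeasure d ℓ -
        ∫ p, gainIntegrand ε ℓ i g Z p ∂collisionMeasure d ℓ := fun i => by
    rw [← integral_sub (hf i).1 (hg i).1]
    refine integral_congr_ae (Eventually.of_forall fun p => ?_)
    simp only [gainIntegrand, hh, mul_sub]
  have e2 : ∀ i, ∫ p, lossIntegrand ε ℓ i h Z p ∂collisionMeasure d ℓ =
      ∫ p, lossIntegrand ε ℓ i f Z p ∂collisionMeasure d ℓ -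
        ∫ p, lossIntegrand ε ℓ i g Z p ∂collisionMeasure d ℓ := fun i => by
    rw [← integral_sub (hf i).2 (hg i).2]
    refine integral_congr_ae (Eventually.of_forall fun p => ?_)
    simp only [lossIntegrand, hh, mul_sub]
  rw [collisionOp, collisionOp, collisionOp, ← mul_sub, ← Finset.sum_sub_distrib]
  congr 1
  refine Finset.sum_congr rfl fun i _ => ?_
  rw [e1, e2]
  ring

/-- Linearity holds only where all integrals converge absolutely, because a divergent integral
counts as zero. -/
theorem collisionTerm_sub {G G' G'' : ℝ → Hier d}
    (hG : ∀ ℓ ∈ Finset.Icc 1 M, CollisionConverges M ε N ℓ T G)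
    (hG' : ∀ ℓ ∈ Finset.Icc 1 M, CollisionConverges M ε N ℓ T G')
    (h'' : ∀ t ∈ Icc 0 T, ∀ s Z, G'' t s Z = G t s Z - G' t s Z) {t : ℝ} (ht : t ∈ Icc 0 T) {s : ℕ}
    (hs : 1 ≤ s) : ∀ᵐ Z : Phase d s, collisionTerm M ε N t G'' s Z =
      collisionTerm M ε N t G s Z - collisionTerm M ε N t G' s Z := by
  filter_upwards [(ae_ball_iff (Finset.countable_toSet (Finset.Icc 1 M))).2 fun ℓ hℓ =>
    hG ℓ hℓ t ht s hs, (ae_ball_iff (Finset.countable_toSet (Finset.Icc 1 M))).2 fun ℓ hℓ =>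
    hG' ℓ hℓ t ht s hs] with Z h h'
  by_cases hZ : Z ∈ phaseSpace M ε d s
  · simp only [collisionTerm, flowOp_sum]
    rw [← integral_sub (integrable_finsetSum _ fun ℓ hℓ => (h ℓ hℓ hZ).2)
      (integrable_finsetSum _ fun ℓ hℓ => (h' ℓ hℓ hZ).2)]
    refine integral_congr_ae ?_
    filter_upwards [(ae_ball_iff (Finset.countable_toSet (Finset.Icc 1 M))).2 fun ℓ hℓ =>
      (h ℓ hℓ hZ).1, (ae_ball_iff (Finset.countable_toSet (Finset.Icc 1 M))).2 fun ℓ hℓ =>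
      (h' ℓ hℓ hZ).1, ae_restrict_mem measurableSet_Icc] with τ h1 h2 hτ
    rw [← Finset.sum_sub_distrib]
    refine Finset.sum_congr rfl fun ℓ hℓ => ?_
    rw [← flowOp_sub]
    simp only [flowOp, indicator_of_mem hZ]
    exact collisionOp_sub (h'' τ ⟨hτ.1, hτ.2.trans ht.2⟩ _) (h1 ℓ hℓ) (h2 ℓ hℓ)
  · simp only [collisionTerm, flowOp, indicator_of_notMem hZ, integral_zero, sub_zero]

end Linear

/-- The exponential series without its first term sums to `e - 1`; hence the factor `e - 1` in the
time of existence. -/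
theorem sum_inv_factorial_le (M : ℕ) :
    ∑ ℓ ∈ Finset.Icc 1 M, 1 / (2 * (Real.exp 1 - 1) * (ℓ ! : ℝ)) ≤ 1 / 2 := by
  have he : 0 < Real.exp 1 - 1 := by
    have := Real.add_one_lt_exp (one_ne_zero (α := ℝ))
    linarith
  have h := Real.sum_le_exp_of_nonneg (zero_le_one (α := ℝ)) (M + 1)
  rw [Finset.range_eq_Ico, Finset.sum_eq_sum_Ico_succ_bot (Nat.succ_pos M)] at h
  simp only [one_pow, Nat.factorial_zero, Nat.cast_one, div_one, zero_add] at h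
  have h1 : ∀ ℓ : ℕ, 1 / (2 * (Real.exp 1 - 1) * (ℓ ! : ℝ)) =
      1 / (2 * (Real.exp 1 - 1)) * (1 / (ℓ ! : ℝ)) := fun ℓ => by rw [one_div_mul_one_div]
  simp only [h1]
  rw [← Finset.mul_sum]
  have h2 : ∑ ℓ ∈ Finset.Icc 1 M, 1 / (ℓ ! : ℝ) ≤ Real.exp 1 - 1 := by
    have : Finset.Icc 1 M = Finset.Ico 1 (M + 1) := rfl
    rw [this]
    linarith
  calc _ ≤ 1 / (2 * (Real.exp 1 - 1)) * (Real.exp 1 - 1) := by gcongr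
    _ = 1 / 2 := by field_simp

/-! ### The collision term halves the norm -/

section Contraction

variable {d M N : ℕ} {ε : ℕ → ℝ} (hε : ∀ k, 2 ≤ k → k ≤ M + 1 → 0 < ε k) (hd : 2 ≤ d)
  {β₀ T μ₀ K₀ : ℝ} (hβ₀ : 0 < β₀) (hT : 0 < T)
  (hK₀ : ∀ ℓ ∈ Finset.Icc 1 M, (N : ℝ) * ε (ℓ + 1) ^ ((d : ℝ) - 1 / (ℓ : ℝ)) ≤ K₀)
  (hΛ : ∀ ℓ, 1 ≤ ℓ → dominationConst d ℓ K₀ β₀ μ₀ * (2 / (β₀ / (2 * T))) ≤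
    1 / (2 * (Real.exp 1 - 1) * ℓ !))

include hε hd hβ₀ hT hK₀ hΛ

theorem collisionConverges {G : ℝ → Hier d}
    (hG : MemXT M ε N T (linearWeight β₀ T β₀) (linearWeight β₀ T μ₀) G) :
    ∀ ℓ ∈ Finset.Icc 1 M, CollisionConverges M ε N ℓ T G := fun ℓ hℓ =>
  (collisionConverges_and_normT_duhamel_le hε hd (Finset.mem_Icc.1 hℓ).1 (Finset.mem_Icc.1 hℓ).2
    hβ₀ hT (hK₀ ℓ hℓ) (hΛ ℓ (Finset.mem_Icc.1 hℓ).1) hG).1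

theorem abs_collisionTerm_le {G : ℝ → Hier d}
    (hG : MemXT M ε N T (linearWeight β₀ T β₀) (linearWeight β₀ T μ₀) G) {c : ℝ} (hc : 0 ≤ c)
    (hGc : normT T (linearWeight β₀ T β₀) (linearWeight β₀ T μ₀) G ≤ ENNReal.ofReal c) {t : ℝ}
    (ht : t ∈ Icc 0 T) {s : ℕ} (hs : 1 ≤ s) :
    ∀ᵐ Z : Phase d s, |collisionTerm M ε N t G s Z| ≤ c / 2 * timeWeight β₀ T μ₀ t Z := by
  have he : 0 < Real.exp 1 - 1 := by
    have := Real.add_one_lt_exp (one_ne_zero (α := ℝ))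
    linarith
  have key : ∀ ℓ ∈ Finset.Icc 1 M, ∀ᵐ Z : Phase d s, |duhamel M ε N ℓ (Icc 0 t) t G s Z| ≤
      1 / (2 * (Real.exp 1 - 1) * ℓ !) * c * timeWeight β₀ T μ₀ t Z := by
    intro ℓ hℓ
    have h1 := (collisionConverges_and_normT_duhamel_le hε hd (Finset.mem_Icc.1 hℓ).1
      (Finset.mem_Icc.1 hℓ).2 hβ₀ hT (hK₀ ℓ hℓ) (hΛ ℓ (Finset.mem_Icc.1 hℓ).1) hG).2
      (fun t => Icc 0 t) fun t _ => ⟨measurableSet_Icc, subset_rfl⟩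
    have h2 := h1.trans (mul_le_mul_right hGc _)
    rw [← ENNReal.ofReal_mul (by positivity)] at h2
    exact (normT_le_iff (by positivity) _).1 h2 t ht s hs
  filter_upwards [collisionTerm_eq_sum (collisionConverges hε hd hβ₀ hT hK₀ hΛ hG) ht hs,
    (ae_ball_iff (Finset.countable_toSet (Finset.Icc 1 M))).2 key] with Z h1 h2
  have hw := (weight_pos (linearWeight β₀ T β₀ t) (linearWeight β₀ T μ₀ t) Z).le
  rw [h1]
  refine (Finset.abs_sum_le_sum_abs _ _).trans ((Finset.sum_le_sum fun ℓ hℓ => h2 ℓ hℓ).trans ?_)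
  rw [← Finset.sum_mul, ← Finset.sum_mul]
  refine mul_le_mul_of_nonneg_right ?_ hw
  calc _ ≤ 1 / 2 * c := by gcongr; exact sum_inv_factorial_le M
    _ = c / 2 := by ring

end Contraction

/-! ### Existence and uniqueness of mild solutions -/

section Image

variable {d s M N : ℕ} {ε : ℕ → ℝ} (hε : ∀ k, 2 ≤ k → k ≤ M + 1 → 0 < ε k)

/-- The integral of `h` along the trajectories. -/
noncomputable def pathIntegral (h : ℝ × Phase d s → ℝ) (q : ℝ × Phase d s) : ℝ :=
  ∫ τ in Icc 0 q.1, (univ ×ˢ regularInterior hε d s).indicator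
    (fun p => h (p.1, flowMap hε d s p)) (τ, q.2)

theorem measurable_pathIntegral {h : ℝ × Phase d s → ℝ} (hh : Measurable h) :
    Measurable (pathIntegral hε h) := by
  have h1 : Measurable ((univ ×ˢ regularInterior hε d s).indicator
      fun p : ℝ × Phase d s => h (p.1, flowMap hε d s p)) :=
    (hh.comp (measurable_fst.prodMk (measurable_flowMap hε))).indicator
      (MeasurableSet.univ.prod (measurableSet_regularInterior hε))
  have h2 : MeasurableSet {x : (ℝ × Phase d s) × ℝ | x.2 ∈ Icc 0 x.1.1} :=
    (measurableSet_le measurable_const measurable_snd).inter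
      (measurableSet_le measurable_snd (measurable_fst.comp measurable_fst))
  have h3 : Measurable ({x : (ℝ × Phase d s) × ℝ | x.2 ∈ Icc 0 x.1.1}.indicator fun x =>
      (univ ×ˢ regularInterior hε d s).indicator
        (fun p : ℝ × Phase d s => h (p.1, flowMap hε d s p)) (x.2, x.1.2)) :=
    (h1.comp (measurable_snd.prodMk (measurable_snd.comp measurable_fst))).indicator h2
  have h4 : pathIntegral hε h = fun q => ∫ τ, ({x : (ℝ × Phase d s) × ℝ | x.2 ∈ Icc 0 x.1.1}.indicator
      fun x => (univ ×ˢ regularInterior hε d s).indicator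
        (fun p : ℝ × Phase d s => h (p.1, flowMap hε d s p)) (x.2, x.1.2)) (q, τ) := by
    funext q
    rw [pathIntegral, ← integral_indicator measurableSet_Icc]
    rfl
  rw [h4]
  exact (h3.stronglyMeasurable.integral_prod_right').measurable

theorem pathIntegral_of_notMem (h : ℝ × Phase d s → ℝ) {Z : Phase d s}
    (hZ : Z ∉ regularInterior hε d s) (t : ℝ) : pathIntegral hε h (t, Z) = 0 := by
  have h1 : ∀ τ, (univ ×ˢ regularInterior hε d s).indicator
      (fun p : ℝ × Phase d s => h (p.1, flowMap hε d s p)) (τ, Z) = 0 := fun τ =>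
    indicator_of_notMem (fun h' => hZ h'.2) _
  simp only [pathIntegral, h1, integral_zero]

theorem pathIntegral_of_mem (h : ℝ × Phase d s → ℝ) {Z : Phase d s}
    (hZ : Z ∈ regularInterior hε d s) (t : ℝ) :
    pathIntegral hε h (t, Z) = ∫ τ in Icc 0 t, h (τ, flow M ε (τ - 0) Z) := by
  have h1 : ∀ τ, (univ ×ˢ regularInterior hε d s).indicator
      (fun p : ℝ × Phase d s => h (p.1, flowMap hε d s p)) (τ, Z) = h (τ, flow M ε (τ - 0) Z) := fun τ => by
    rw [sub_zero, flow_eq_flowMap hε hZ]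
    exact indicator_of_mem (show (τ, Z) ∈ univ ×ˢ regularInterior hε d s from ⟨mem_univ _, hZ⟩)
      (fun p : ℝ × Phase d s => h (p.1, flowMap hε d s p))
  simp only [pathIntegral, h1]

variable {β₀ T μ₀ B : ℝ} (hβ₀ : 0 < β₀) (hT : 0 < T)

include hβ₀ hT

theorem Dominated.abs_pathIntegral_le (hB : 0 ≤ B) {h : ℝ × Phase d s → ℝ}
    (hdom : Dominated β₀ T β₀ μ₀ B h) (hh : Measurable h) {t : ℝ} (ht : t ∈ Icc 0 T) (Z : Phase d s) :
    |pathIntegral hε h (t, Z)| ≤ B * (2 / (β₀ / (2 * T))) * timeWeight β₀ T μ₀ t Z := by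
  have hw := (weight_pos (linearWeight β₀ T β₀ t) (linearWeight β₀ T μ₀ t) Z).le
  by_cases hZ : Z ∈ regularInterior hε d s
  · rw [pathIntegral_of_mem hε h hZ]
    refine ((hdom.integrableOn_and_abs_setIntegral_le hε hβ₀ hT hB hh hZ
      (by norm_num) le_rfl (growth_le Z) le_rfl ht.1 ht.2 0).2 _ subset_rfl measurableSet_Icc).trans_eq ?_
    rw [zero_mul, add_zero]
  · rw [pathIntegral_of_notMem hε h hZ, abs_zero]
    positivity

theorem Dominated.abs_pathIntegral_sub_le (hB : 0 ≤ B) {h : ℝ × Phase d s → ℝ}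
    (hdom : Dominated β₀ T β₀ μ₀ B h) (hh : Measurable h) {η : ℝ} (hη : 0 < η) {t t' : ℝ}
    (h0 : 0 ≤ t) (htt : t ≤ t') (ht' : t' ≤ T) (Z : Phase d s) :
    |pathIntegral hε h (t', Z) - pathIntegral hε h (t, Z)| ≤
      B * (η / (β₀ / (2 * T)) + s * (1 + 1 / η) * (t' - t)) * timeWeight β₀ T μ₀ t' Z := by
  have hw := (weight_pos (linearWeight β₀ T β₀ t') (linearWeight β₀ T μ₀ t') Z).le
  by_cases hZ : Z ∈ regularInterior hε d s
  · have h1 := hdom.integrableOn_and_abs_setIntegral_le hε hβ₀ hT hB hh hZ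
      hη.le (by positivity) (growth_le_of_pos Z hη) h0 htt ht' 0
    have h2 := hdom.integrableOn_and_abs_setIntegral_le hε hβ₀ hT hB hh hZ
      hη.le (by positivity) (growth_le_of_pos Z hη) le_rfl (h0.trans htt) ht' 0
    rw [pathIntegral_of_mem hε h hZ, pathIntegral_of_mem hε h hZ]
    have hdisj : Disjoint (Icc 0 t) (Ioc t t') :=
      Set.disjoint_left.2 fun x hx hx' => not_lt.2 hx.2 hx'.1
    rw [← Icc_union_Ioc_eq_Icc h0 htt, setIntegral_union hdisj measurableSet_Ioc
      (h2.1.mono_set (Icc_subset_Icc_right htt)) (h1.1.mono_set Ioc_subset_Icc_self), add_sub_cancel_left]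
    exact h1.2 _ Ioc_subset_Icc_self measurableSet_Ioc
  · rw [pathIntegral_of_notMem hε h hZ, pathIntegral_of_notMem hε h hZ, sub_zero, abs_zero]
    have := sub_nonneg.2 htt
    positivity

theorem profile_pathIntegral (hB : 0 ≤ B) {c : ℝ} (hBc : B * (2 / (β₀ / (2 * T))) ≤ c)
    {h : ∀ s : ℕ, ℝ × Phase d s → ℝ}
    (hdom : ∀ s, Dominated β₀ T β₀ μ₀ B (h s)) (hh : ∀ s, Measurable (h s))
    (hN : ∀ s, N < s → ∀ q, h s q = 0) : Profile N β₀ T μ₀ c fun s => pathIntegral hε (h s) where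
  measurable := fun s => measurable_pathIntegral hε (hh s)
  vanish := fun s hs q => by
    have h1 : ∀ τ, (univ ×ˢ regularInterior hε d s).indicator
        (fun p : ℝ × Phase d s => h s (p.1, flowMap hε d s p)) (τ, q.2) = 0 := fun τ =>
      indicator_apply_eq_zero.2 fun _ => hN s hs _
    simp only [pathIntegral, h1, integral_zero]
  bound := fun t ht s Z => ((hdom s).abs_pathIntegral_le hε hβ₀ hT hB (hh s) ht Z).trans
    (mul_le_mul_of_nonneg_right hBc (weight_pos _ _ _).le)
  modulus := fun η hη => by
    obtain ⟨a, ha, ha0⟩ : ∃ a, a = β₀ / (2 * T) ∧ 0 < a := ⟨_, rfl, by positivity⟩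
    -- First `θ` makes the part without the factor `t' - t` small, then `t' - t` is taken small. The
    -- modulus is uniform in `s` because only `s ≤ N` contribute.
    obtain ⟨θ, hθ, hθη⟩ : ∃ θ, 0 < θ ∧ B * (θ / a) ≤ η / 2 := by
      refine ⟨a * (η / 2) / (B + 1), by positivity, ?_⟩
      have h1 : B * (a * (η / 2) / (B + 1) / a) = B / (B + 1) * (η / 2) := by field_simp
      rw [h1]
      exact mul_le_of_le_one_left (by positivity) (div_le_one_of_le₀ (by linarith) (by positivity))
    refine ⟨η / 2 / (B * (N * (1 + 1 / θ)) + 1), by positivity, fun t t' h0 htt ht' hlt s Z => ?_⟩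
    have hw := (weight_pos (linearWeight β₀ T β₀ t') (linearWeight β₀ T μ₀ t') Z).le
    rcases lt_or_ge N s with hs | hs
    · have h1 : ∀ t, pathIntegral hε (h s) (t, Z) = 0 := fun t => by
        have h2 : ∀ τ, (univ ×ˢ regularInterior hε d s).indicator
            (fun p : ℝ × Phase d s => h s (p.1, flowMap hε d s p)) (τ, Z) = 0 := fun τ =>
          indicator_apply_eq_zero.2 fun _ => hN s hs _
        simp only [pathIntegral, h2, integral_zero]
      rw [h1, h1, sub_zero, abs_zero]
      positivity
    refine ((hdom s).abs_pathIntegral_sub_le hε hβ₀ hT hB (hh s) hθ h0 htt ht' Z).trans ?_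
    refine mul_le_mul_of_nonneg_right ?_ hw
    have hsub := sub_nonneg.2 htt
    have hsN : (s : ℝ) ≤ N := by exact_mod_cast hs
    rw [lt_div_iff₀ (by positivity)] at hlt
    rw [← ha, mul_add]
    have h3 : B * (s * (1 + 1 / θ) * (t' - t)) ≤ B * (N * (1 + 1 / θ)) * (t' - t) := by
      rw [mul_assoc B]
      gcongr
    linarith

end Image

/-! ### The Neumann series and uniqueness -/

section Existence

variable {d M N : ℕ} {ε : ℕ → ℝ} (hε : ∀ k, 2 ≤ k → k ≤ M + 1 → 0 < ε k) (hd : 2 ≤ d)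
  {β₀ T μ₀ K₀ : ℝ} (hβ₀ : 0 < β₀) (hT : 0 < T)
  (hK₀ : ∀ ℓ ∈ Finset.Icc 1 M, (N : ℝ) * ε (ℓ + 1) ^ ((d : ℝ) - 1 / (ℓ : ℝ)) ≤ K₀)
  (hΛ : ∀ ℓ, 1 ≤ ℓ → dominationConst d ℓ K₀ β₀ μ₀ * (2 / (β₀ / (2 * T))) ≤
    1 / (2 * (Real.exp 1 - 1) * ℓ !))

include hε hd

theorem ae_flow_mem_regularInterior {s : ℕ} (t : ℝ) :
    ∀ᵐ Z : Phase d s, Z ∈ phaseSpace M ε d s →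
      Z ∈ regularInterior hε d s ∧ flow M ε t Z ∈ regularInterior hε d s := by
  have h : volume {Z : Phase d s | ¬ (Z ∈ phaseSpace M ε d s → Z ∈ regularInterior hε d s)} = 0 :=
    ae_mem_regularInterior hε hd
  filter_upwards [ae_mem_regularInterior hε hd, ae_flow_notMem hε h t] with Z h1 h2 hZ
  exact ⟨h1 hZ, not_not.1 (h2 (h1 hZ))
    (((hasTraj_of_mem_regularInterior hε (h1 hZ)).flow hε t).mem_phaseSpace hε)⟩

include hβ₀ hT hK₀ hΛ

/-- Since `Ψ^{τ-t} Z = Ψ^τ (Ψ^{-t} Z)`, the integral at `Z` runs along the trajectory that starts at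
`Ψ^{-t} Z`. So the collision term is again given by its values along trajectories. -/
theorem Profile.exists_image {c : ℝ} (hc : 0 ≤ c) {u : ∀ s : ℕ, ℝ × Phase d s → ℝ}
    (hu : Profile N β₀ T μ₀ c u) : ∃ u', Profile N β₀ T μ₀ (c / 2) u' ∧
      ∀ t ∈ Icc 0 T, ∀ s, ∀ᵐ Z : Phase d s,
        collisionTerm M ε N t (spread M ε u) s Z = spread M ε u' t s Z := by
  have hK₀' : ∀ ℓ ∈ Finset.Icc 1 M, 0 ≤ K₀ := fun ℓ hℓ => by
    have := hε (ℓ + 1) (by have := (Finset.mem_Icc.1 hℓ).1; omega)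
      (by have := (Finset.mem_Icc.1 hℓ).2; omega)
    exact le_trans (by positivity) (hK₀ ℓ hℓ)
  have hex : ∀ ℓ : ℕ, ∀ s : ℕ, ∃ h : ℝ × Phase d s → ℝ, ℓ ∈ Finset.Icc 1 M → Measurable h ∧
      (N < s + ℓ → ∀ q, h q = 0) ∧
      Dominated β₀ T β₀ μ₀ (c * dominationConst d ℓ K₀ β₀ μ₀) h ∧
      ∀ t, ∀ᵐ Z : Phase d s, Z ∈ phaseSpace M ε d s → ∀ᵐ τ : ℝ, τ ∈ Icc 0 T →
        collisionOp ε N ℓ s (spread M ε u τ (s + ℓ)) (flow M ε (τ - t) Z) =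
          h (τ, flow M ε (τ - t) Z) := by
    intro ℓ s
    by_cases hℓ : ℓ ∈ Finset.Icc 1 M
    · obtain ⟨h, h1, h2, h3, h4⟩ := exists_dominated_collisionOp hε hd (Finset.mem_Icc.1 hℓ).1
        (Finset.mem_Icc.1 hℓ).2 hβ₀ hT (hK₀ ℓ hℓ) hc (hu.represents hε hd (s + ℓ))
      exact ⟨h, fun _ => ⟨h1, h2, h3, fun t => (h4 t).mono fun Z h5 hZ =>
        (h5 hZ).mono fun τ h6 hτ => (h6 hτ).2⟩⟩
    · exact ⟨0, fun h => absurd h hℓ⟩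
  choose h hspec using hex
  obtain ⟨B, hB⟩ : ∃ B, B = ∑ ℓ ∈ Finset.Icc 1 M, c * dominationConst d ℓ K₀ β₀ μ₀ := ⟨_, rfl⟩
  have hB0 : 0 ≤ B := hB ▸ Finset.sum_nonneg fun ℓ hℓ =>
    mul_nonneg hc (dominationConst_nonneg (hK₀' ℓ hℓ) hβ₀)
  have hBc : B * (2 / (β₀ / (2 * T))) ≤ c / 2 := by
    rw [hB, ← Finset.mul_sum, mul_assoc, Finset.sum_mul]
    calc _ ≤ c * ∑ ℓ ∈ Finset.Icc 1 M, 1 / (2 * (Real.exp 1 - 1) * (ℓ ! : ℝ)) := by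
          gcongr with ℓ hℓ
          exact hΛ ℓ (Finset.mem_Icc.1 hℓ).1
      _ ≤ c * (1 / 2) := by
          gcongr
          exact sum_inv_factorial_le M
      _ = c / 2 := by ring
  refine ⟨_, profile_pathIntegral (N := N) hε hβ₀ hT hB0 hBc
    (h := fun s q => ∑ ℓ ∈ Finset.Icc 1 M, h ℓ s q) (fun s τ hτ Z => ?_)
    (fun s => Finset.measurable_sum _ fun ℓ hℓ => (hspec ℓ s hℓ).1) (fun s hs q => ?_), ?_⟩
  · refine (Finset.abs_sum_le_sum_abs _ _).trans ?_
    rw [hB, Finset.sum_mul, Finset.sum_mul]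
    exact Finset.sum_le_sum fun ℓ hℓ => (hspec ℓ s hℓ).2.2.1 τ hτ Z
  · exact Finset.sum_eq_zero fun ℓ hℓ => (hspec ℓ s hℓ).2.1 (by omega) q
  · intro t ht s
    filter_upwards [(ae_ball_iff (Finset.countable_toSet (Finset.Icc 1 M))).2 fun ℓ hℓ =>
      (hspec ℓ s hℓ).2.2.2 t, ae_flow_mem_regularInterior hε hd (-t)] with Z h1 h2
    by_cases hZ : Z ∈ phaseSpace M ε d s
    · have htr := hasTraj_of_mem_regularInterior hε (h2 hZ).1
      rw [spread_apply hZ, pathIntegral_of_mem hε _ (h2 hZ).2, collisionTerm]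
      refine integral_congr_ae ?_
      filter_upwards [ae_restrict_of_ae ((ae_ball_iff (Finset.countable_toSet (Finset.Icc 1 M))).2
        fun ℓ hℓ => h1 ℓ hℓ hZ), ae_restrict_mem measurableSet_Icc] with τ h3 hτ
      rw [flowOp, indicator_of_mem hZ, neg_sub, sub_zero, htr.flow_flow hε, neg_add_eq_sub]
      exact Finset.sum_congr rfl fun ℓ hℓ => h3 ℓ hℓ ⟨hτ.1, hτ.2.trans ht.2⟩
    · rw [spread_apply_of_notMem hZ]
      simp only [collisionTerm, flowOp, indicator_of_notMem hZ, integral_zero]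

omit hK₀ hΛ

/-- Along trajectories the transported datum is constant in time. A change of `F₀` on null sets
makes the bound hold everywhere, and the flow does not see this change. -/
theorem exists_profile_initial {F₀ : Hier d} (hF₀ : MemX M ε N β₀ μ₀ F₀) {c : ℝ} (hc : 0 ≤ c)
    (hF₀c : normH β₀ μ₀ F₀ ≤ ENNReal.ofReal c) : ∃ u, Profile N β₀ T μ₀ c u ∧
      ∀ t, ∀ s, 1 ≤ s → ∀ᵐ Z : Phase d s, spread M ε u t s Z = flowOp M ε t (F₀ s) Z := by
  have hex : ∀ s : ℕ, ∃ g : Phase d s → ℝ, Measurable g ∧ (N < s → ∀ Z, g Z = 0) ∧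
      (∀ Z, |g Z| ≤ c * weight β₀ μ₀ Z) ∧ (1 ≤ s → ∀ᵐ Z, F₀ s Z = g Z) := by
    intro s
    rcases Nat.lt_or_ge s 1 with hs | hs
    · refine ⟨fun _ => 0, measurable_const, fun _ _ => rfl, fun Z => ?_, fun h => absurd h (by omega)⟩
      rw [abs_zero]
      exact mul_nonneg hc (weight_pos _ _ _).le
    rcases lt_or_ge N s with hN | hN
    · refine ⟨fun _ => 0, measurable_const, fun _ _ => rfl, fun Z => ?_, fun _ => hF₀.vanish s hN⟩
      rw [abs_zero]
      exact mul_nonneg hc (weight_pos _ _ _).le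
    obtain ⟨g, hg, hFg⟩ : ∃ g : Phase d s → ℝ, Measurable g ∧ F₀ s =ᵐ[volume] g :=
      ⟨_, (hF₀.measurable s hs).stronglyMeasurable_mk.measurable, (hF₀.measurable s hs).ae_eq_mk⟩
    have hwm : Measurable fun Z : Phase d s => c * weight β₀ μ₀ Z := by
      have := measurable_kineticEnergy (d := d) (s := s)
      unfold weight
      fun_prop
    refine ⟨{Z | |g Z| ≤ c * weight β₀ μ₀ Z}.indicator g,
      hg.indicator (measurableSet_le hg.abs hwm), fun h => absurd h (by omega), fun Z => ?_, fun _ => ?_⟩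
    · by_cases hZ : Z ∈ {Z | |g Z| ≤ c * weight β₀ μ₀ Z}
      · rw [indicator_of_mem hZ]
        exact hZ
      · rw [indicator_of_notMem hZ, abs_zero]
        exact mul_nonneg hc (weight_pos _ _ _).le
    · filter_upwards [hFg, (normH_le_iff hc F₀).1 hF₀c s hs] with Z h1 h2
      rw [h1] at h2 ⊢
      exact (indicator_of_mem (by exact h2) _).symm
  choose g hgm hgN hgb hgF using hex
  have h0 : ∀ {s : ℕ} (Z : Phase d s), weight β₀ μ₀ Z = timeWeight β₀ T μ₀ 0 Z := fun Z => by
    simp only [timeWeight, linearWeight, mul_zero, sub_zero]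
  refine ⟨fun s q => g s q.2, ⟨fun s => (hgm s).comp measurable_snd, fun s hs q => hgN s hs _,
    fun t ht s Z => (hgb s Z).trans ?_, fun η hη => ⟨1, one_pos, fun t t' _ _ _ _ s Z => ?_⟩⟩,
    fun t s hs => ?_⟩
  · rw [h0]
    exact mul_le_mul_of_nonneg_left (timeWeight_mono hβ₀ hT ht.1 Z) hc
  · rw [sub_self, abs_zero]
    exact mul_nonneg hη.le (weight_pos _ _ _).le
  · have h1 : volume {Z : Phase d s | ¬ (F₀ s Z = g s Z)} = 0 := hgF s hs
    filter_upwards [ae_mem_regularInterior hε hd, ae_flow_notMem hε h1 (-t)] with Z h2 h3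
    by_cases hZ : Z ∈ phaseSpace M ε d s
    · rw [spread_apply hZ, flowOp, indicator_of_mem hZ]
      exact (not_not.1 (h3 (h2 hZ))).symm
    · rw [spread_apply_of_notMem hZ, flowOp, indicator_of_notMem hZ]

include hK₀ hΛ

/-- The series `∑ U n`, where `U (n + 1)` is the collision term of `U n` and the norms halve at each
step. -/
theorem exists_mildSolution {F₀ : Hier d} (hF₀ : MemX M ε N β₀ μ₀ F₀) :
    ∃ F : ℝ → Hier d,
      IsMildSolution M ε N T (linearWeight β₀ T β₀) (linearWeight β₀ T μ₀) F₀ F ∧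
      normT T (linearWeight β₀ T β₀) (linearWeight β₀ T μ₀) F ≤ 2 * normH β₀ μ₀ F₀ := by
  obtain ⟨c, hc, hF₀c⟩ : ∃ c : ℝ, 0 ≤ c ∧ normH β₀ μ₀ F₀ = ENNReal.ofReal c :=
    ⟨_, ENNReal.toReal_nonneg, (ENNReal.ofReal_toReal hF₀.norm_lt_top.ne).symm⟩
  obtain ⟨u₀, hu₀, hu₀F⟩ := exists_profile_initial (T := T) hε hd hβ₀ hT hF₀ hc hF₀c.le
  -- Stated for all `c` and `u`, with a dummy value outside the hypotheses, so that `next` can be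
  -- iterated.
  have hstep : ∀ (c : ℝ) (u : ∀ s : ℕ, ℝ × Phase d s → ℝ), ∃ u', 0 ≤ c ∧ Profile N β₀ T μ₀ c u →
      Profile N β₀ T μ₀ (c / 2) u' ∧ ∀ t ∈ Icc 0 T, ∀ s, ∀ᵐ Z : Phase d s,
        collisionTerm M ε N t (spread M ε u) s Z = spread M ε u' t s Z := by
    intro c u
    by_cases h : 0 ≤ c ∧ Profile N β₀ T μ₀ c u
    · obtain ⟨u', h'⟩ := h.2.exists_image hε hd hβ₀ hT hK₀ hΛ h.1
      exact ⟨u', fun _ => h'⟩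
    · exact ⟨u, fun h' => absurd h' h⟩
  choose next hnext using hstep
  obtain ⟨U, hU0, hUs⟩ : ∃ U : ℕ → ∀ s : ℕ, ℝ × Phase d s → ℝ, U 0 = u₀ ∧
      ∀ n, U (n + 1) = next (c / 2 ^ n) (U n) :=
    ⟨fun n => Nat.rec u₀ (fun n u => next (c / 2 ^ n) u) n, rfl, fun _ => rfl⟩
  have hUp : ∀ n, Profile N β₀ T μ₀ (c / 2 ^ n) (U n) := by
    intro n
    induction n with
    | zero => rwa [hU0, pow_zero, div_one]
    | succ n ih =>
      rw [hUs, pow_succ, ← div_div]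
      exact (hnext _ _ ⟨by positivity, ih⟩).1
  have hUc : ∀ n, ∀ t ∈ Icc 0 T, ∀ s, ∀ᵐ Z : Phase d s,
      collisionTerm M ε N t (spread M ε (U n)) s Z = spread M ε (U (n + 1)) t s Z := fun n => by
    rw [hUs]
    exact (hnext _ _ ⟨by positivity, hUp n⟩).2
  have hshift : ∀ k n, Profile N β₀ T μ₀ (c / 2 ^ k / 2 ^ n) (U (n + k)) := fun k n => by
    have := hUp (n + k)
    rwa [pow_add, mul_comm, ← div_div] at this
  obtain ⟨R, hR⟩ : ∃ R : ℕ → ∀ s : ℕ, ℝ × Phase d s → ℝ, ∀ k, R k = fun s q => ∑' n, U (n + k) s q :=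
    ⟨_, fun _ => rfl⟩
  have hRp : ∀ k, Profile N β₀ T μ₀ (2 * (c / 2 ^ k)) (R k) := fun k => by
    rw [hR]
    exact Profile.tsum hβ₀ hT (by positivity) (hshift k)
  have hRm := fun k => (hRp k).memXT hε hd hβ₀ hT (by positivity)
  have hRU : ∀ k, ∀ t ∈ Icc 0 T, ∀ s Z, spread M ε (U k) t s Z =
      spread M ε (R k) t s Z - spread M ε (R (k + 1)) t s Z := fun k t ht s Z => by
    have h1 : ∀ W, U k s (t, W) = R k s (t, W) - R (k + 1) s (t, W) := fun W => by
      simp only [hR]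
      rw [(summable_of_profile (hshift k) ht s W).1.tsum_eq_zero_add, zero_add]
      simp only [add_right_comm _ 1 k, add_assoc _ k 1, add_sub_cancel_right]
    simp only [spread, h1]
    exact flowOp_sub _ _ _ _
  -- The operator is not exchanged with the infinite series. By linearity, the collision term of the
  -- remainder `R k` minus `R (k + 1)` does not depend on `k`, and its bound tends to zero.
  have hdiff : ∀ t ∈ Icc 0 T, ∀ s, 1 ≤ s → ∀ᵐ Z : Phase d s,
      collisionTerm M ε N t (spread M ε (R 0)) s Z = spread M ε (R 1) t s Z := by
    intro t ht s hs
    have h1 : ∀ k, ∀ᵐ Z : Phase d s, spread M ε (U (k + 1)) t s Z =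
        collisionTerm M ε N t (spread M ε (R k)) s Z -
          collisionTerm M ε N t (spread M ε (R (k + 1))) s Z := fun k => by
      filter_upwards [hUc k t ht s, collisionTerm_sub (collisionConverges hε hd hβ₀ hT hK₀ hΛ (hRm k))
        (collisionConverges hε hd hβ₀ hT hK₀ hΛ (hRm (k + 1))) (hRU k) ht hs] with Z h2 h3
      rw [← h2, h3]
    have h2 : ∀ k, ∀ᵐ Z : Phase d s, |collisionTerm M ε N t (spread M ε (R k)) s Z| ≤
        2 * (c / 2 ^ k) / 2 * timeWeight β₀ T μ₀ t Z := fun k =>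
      abs_collisionTerm_le hε hd hβ₀ hT hK₀ hΛ (hRm k) (by positivity)
        ((hRp k).normT_spread_le hε hd (by positivity)) ht hs
    have h3 : ∀ k, ∀ᵐ Z : Phase d s, |spread M ε (R (k + 1)) t s Z| ≤
        2 * (c / 2 ^ (k + 1)) * timeWeight β₀ T μ₀ t Z := fun k =>
      (hRp (k + 1)).abs_spread_le hε hd (by positivity) ht s
    filter_upwards [ae_all_iff.2 h1, ae_all_iff.2 h2, ae_all_iff.2 h3] with Z h4 h5 h6
    have h7 : ∀ k, collisionTerm M ε N t (spread M ε (R k)) s Z - spread M ε (R (k + 1)) t s Z =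
        collisionTerm M ε N t (spread M ε (R 0)) s Z - spread M ε (R 1) t s Z := by
      intro k
      induction k with
      | zero => rfl
      | succ k ih =>
        rw [← ih]
        have h8 := h4 k
        rw [hRU (k + 1) t ht s Z] at h8
        linarith
    have h8 : ∀ k, |collisionTerm M ε N t (spread M ε (R 0)) s Z - spread M ε (R 1) t s Z| ≤
        2 * (c / 2 ^ k) * timeWeight β₀ T μ₀ t Z := fun k => by
      rw [← h7 k]
      refine (abs_sub _ _).trans ((add_le_add (h5 k) (h6 k)).trans_eq ?_)
      rw [pow_succ, ← div_div]
      ring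
    have h9 : Tendsto (fun k : ℕ => 2 * (c / 2 ^ k) * timeWeight β₀ T μ₀ t Z) atTop
        (𝓝 (2 * 0 * timeWeight β₀ T μ₀ t Z)) :=
      (Tendsto.const_mul 2 (tendsto_const_nhds.div_atTop
        (tendsto_pow_atTop_atTop_of_one_lt (by norm_num)))).mul_const _
    rw [mul_zero, zero_mul] at h9
    have h10 := ge_of_tendsto' h9 h8
    exact sub_eq_zero.1 (abs_nonpos_iff.1 h10)
  refine ⟨spread M ε (R 0), ⟨hRm 0, fun t ht s hs => ?_⟩, ?_⟩
  · filter_upwards [hdiff t ht s hs, hu₀F t s hs] with Z h1 h2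
    have h3 := hRU 0 t ht s Z
    rw [zero_add, hU0, h2] at h3
    change _ = _ + collisionTerm M ε N t (spread M ε (R 0)) s Z
    rw [h1, h3, sub_add_cancel]
  · refine ((hRp 0).normT_spread_le hε hd (by positivity)).trans_eq ?_
    rw [hF₀c, pow_zero, div_one, ENNReal.ofReal_mul (by norm_num), ENNReal.ofReal_ofNat]

/-- The difference of two solutions is its own collision term, so its norm, which is finite, is at
most half of itself. -/
theorem IsMildSolution.ae_eq {F₀ : Hier d} {F F' : ℝ → Hier d}
    (hF : IsMildSolution M ε N T (linearWeight β₀ T β₀) (linearWeight β₀ T μ₀) F₀ F)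
    (hF' : IsMildSolution M ε N T (linearWeight β₀ T β₀) (linearWeight β₀ T μ₀) F₀ F')
    {t : ℝ} (ht : t ∈ Icc 0 T) {s : ℕ} (hs : 1 ≤ s) : F' t s =ᵐ[volume] F t s := by
  have hD := hF'.mem.sub hF.mem
  obtain ⟨c, hc, hDc⟩ : ∃ c : ℝ, 0 ≤ c ∧ normT T (linearWeight β₀ T β₀) (linearWeight β₀ T μ₀)
      (fun t s Z => F' t s Z - F t s Z) = ENNReal.ofReal c :=
    ⟨_, ENNReal.toReal_nonneg, (ENNReal.ofReal_toReal hD.norm_lt_top.ne).symm⟩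
  have hhalf : normT T (linearWeight β₀ T β₀) (linearWeight β₀ T μ₀)
      (fun t s Z => F' t s Z - F t s Z) ≤ ENNReal.ofReal (c / 2) := by
    refine (normT_le_iff (by positivity) _).2 fun t ht s hs => ?_
    filter_upwards [abs_collisionTerm_le hε hd hβ₀ hT hK₀ hΛ hD hc hDc.le ht hs,
      collisionTerm_sub (collisionConverges hε hd hβ₀ hT hK₀ hΛ hF'.mem)
        (collisionConverges hε hd hβ₀ hT hK₀ hΛ hF.mem) (fun _ _ _ _ => rfl) ht hs,
      hF.eqn t ht s hs, hF'.eqn t ht s hs] with Z h1 h2 h3 h4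
    rw [h2] at h1
    rw [h3, h4, add_sub_add_left_eq_sub]
    exact h1
  have hc0 : c = 0 := by
    rw [hDc] at hhalf
    have := (ENNReal.ofReal_le_ofReal_iff (by positivity)).1 hhalf
    linarith
  filter_upwards [(normT_le_iff hc _).1 hDc.le t ht s hs] with Z h1
  rw [hc0, zero_mul] at h1
  exact sub_eq_zero.1 (abs_nonpos_iff.1 h1)

end Existence

end BBGKY

theorem mainTheorem7 (d : ℕ) (hd : 2 ≤ d) (β₀ : ℝ) (hβ₀ : 0 < β₀) (K : ℝ) (hK : 0 < K) :
    ∃ C : ℝ, 0 < C ∧ ∀ μ₀ T : ℝ, T = existenceTime C β₀ μ₀ →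
      0 < T ∧
      ∀ (M N : ℕ) (ε : ℕ → ℝ), 1 ≤ M → M + 1 ≤ N →
        0 < ε 2 → (∀ k, 2 ≤ k → k ≤ M → ε k < ε (k + 1)) →
        (∀ ℓ ∈ Finset.Icc 1 M, (N : ℝ) * ε (ℓ + 1) ^ ((d : ℝ) - 1 / (ℓ : ℝ)) ≤ K) →
        -- existence, uniqueness and the bound on the solution
        (∀ F₀ : Hier d, MemX M ε N β₀ μ₀ F₀ →
          ∃ F : ℝ → Hier d,
            IsMildSolution M ε N T (linearWeight β₀ T β₀) (linearWeight β₀ T μ₀) F₀ F ∧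
            normT T (linearWeight β₀ T β₀) (linearWeight β₀ T μ₀) F ≤ 2 * normH β₀ μ₀ F₀ ∧
            ∀ F' : ℝ → Hier d,
              IsMildSolution M ε N T (linearWeight β₀ T β₀) (linearWeight β₀ T μ₀) F₀ F' →
              ∀ t ∈ Icc 0 T, ∀ s, 1 ≤ s → F' t s =ᵐ[volume] F t s) ∧
        -- a priori bounds for the collision operators of each order
        (∀ ℓ ∈ Finset.Icc 1 M, ∀ G : ℝ → Hier d,
          MemXT M ε N T (linearWeight β₀ T β₀) (linearWeight β₀ T μ₀) G →
          CollisionConverges M ε N ℓ T G ∧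
          ∀ A : ℝ → Set ℝ, (∀ t ∈ Icc 0 T, MeasurableSet (A t) ∧ A t ⊆ Icc 0 t) →
            normT T (linearWeight β₀ T β₀) (linearWeight β₀ T μ₀)
                (fun t => duhamel M ε N ℓ (A t) t G) ≤
              ENNReal.ofReal (1 / (2 * (Real.exp 1 - 1) * (ℓ ! : ℝ))) *
                normT T (linearWeight β₀ T β₀) (linearWeight β₀ T μ₀) G) := by
  obtain ⟨C, hC, hCT⟩ := exists_existenceTime hd hβ₀ hK
  refine ⟨C, hC, ?_⟩
  rintro μ₀ T rfl
  obtain ⟨hT, hΛ⟩ := hCT μ₀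
  refine ⟨hT, fun M N ε _ _ hε₂ hmono hK₀ => ?_⟩
  have hε : ∀ k, 2 ≤ k → k ≤ M + 1 → 0 < ε k := fun k hk => by
    induction k, hk using Nat.le_induction with
    | base => exact fun _ => hε₂
    | succ k hk ih => exact fun hkM => (ih (by omega)).trans (hmono k hk (by omega))
  refine ⟨fun F₀ hF₀ => ?_, fun ℓ hℓ G hG => ?_⟩
  · obtain ⟨F, hF, hle⟩ := exists_mildSolution hε hd hβ₀ hT hK₀ hΛ hF₀
    exact ⟨F, hF, hle, fun F' hF' t ht s hs => hF.ae_eq hε hd hβ₀ hT hK₀ hΛ hF' ht hs⟩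
  · exact collisionConverges_and_normT_duhamel_le hε hd (Finset.mem_Icc.1 hℓ).1 (Finset.mem_Icc.1 hℓ).2
      hβ₀ hT (hK₀ ℓ hℓ) (hΛ ℓ (Finset.mem_Icc.1 hℓ).1) hG
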